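/- Let $k$ be a field, let $N=\mathbb Z^n$, $M=\operatorname{Hom}(N,\mathbb Z)$, and let $\Delta$ be a (finite, nonempty) fan of strongly convex rational polyhedral cones in $N_{\mathbb R}=N\otimes\mathbb R$, with normal toric variety $X_\Delta$ over $k$. For each ray $i\in\Delta(1)$ let $\mathbf v_i\in N$ be the first lattice point on the ray, $D_i$ the corresponding torus-invariant prime divisor, and write $i\in\sigma$ if the $i$th ray is a ray of the cone $\sigma\in\Delta$. Let $\operatorname{Pic}(X_\Delta)_{\mathbb R}=\operatorname{Pic}(X_\Delta)\otimes\mathbb R$, regarded as a subspace of the real divisor class group $\operatorname{Cl}(X_\Delta)\otimes\mathbb R$, write $\operatorname{pos}(S)$ for the convex cone generated by a set $S$ of classes, and let $$\mathcal G_\Delta=\operatorname{pos}\bigl([D]\in \operatorname{Pic}(X_\Delta) : D\text{ is globally generated}\bigr).$$ Let $D=\sum_{i\in\Delta(1)}a_iD_i$ with $a_i\in\mathbb R$ be a divisor whose class $[D]$ lies in $\operatorname{Pic}(X_\Delta)_{\mathbb R}$. Then the following are equivalent: 1. $[D]\in\mathcal G_\Delta$; 2. $[D]\in\bigcap_{\sigma\in\Delta}\operatorname{pos}([D_i]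 : i\notin\sigma)$; 3. there is a piecewise linear function $\psi\colon N_{\mathbb R}\to\mathbb R$ (linear on each of finitely many polyhedral cones covering $N_{\mathbb R}$) that is convex, i.e. $\psi(\sum_j \mathbf u_j)\le\sum_j\psi(\mathbf u_j)$ for all finite families $(\mathbf u_j)$ in $N_{\mathbb R}$, that is linear on every cone of $\Delta$, and that satisfies $\psi(\mathbf v_i)=a_i$ for all $i\in\Delta(1)$. Suppose in addition that there is a projective toric variety $X_\Sigma$, with $\Sigma$ a fan in $N_{\mathbb R}$, such that $\Delta\subseteq\Sigma$. Then these conditions are also equivalent to 4. $[D]\in\bigcup_{\Sigma} i_\Sigma^*(\operatorname{Nef}(X_\Sigma))$, where the union is over all fans $\Sigma\supseteq\Delta$ in $N_{\mathbb R}$ for which $X_\Sigma$ is projective, $i_\Sigma\colon X_\Delta\to X_\Sigma$ is the inclusion, and $\operatorname{Nef}(X_\Sigma)\subseteq\operatorname{Pic}(X_\Sigma)_{\mathbb R}$ is the cone of classes having nonnegative intersection number with every curve in $X_\Sigma$. If moreover the vectors $\mathbf v_i$, $i\in\Delta(1)$, generate $N_{\mathbb R}$ as a convex cone, then the union in 4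 is equal to the union restricted to those $\Sigma$ with $\Sigma(1)=\Delta(1)$. -/

import Mathlib

noncomputable section

/-! ## Varieties as models

An integral separated scheme of finite type over a field `k`, with function field `K`, is determined
by the set of its local rings inside `K` (points correspond to local rings).  Following Zariski and
Nagata, varieties are represented by this set of local rings.  -/

/-- A set of local subrings of the function field `K`, all of them containing `k`.
The elements are the points of the variety (all scheme-theoretic points, including the generic
point `K` itself); the point is identified with its local ring. -/
structure Model (k K : Type*) [Field k] [Field K] [Algebra k K] where
  points : Set (LocalSubring K)
  algebraMap_mem : ∀ R ∈ points, ∀ a : k, algebraMap k K a ∈ R.toSubring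

/-- The order of vanishing of `f` along a discrete valuation ring `R` with fraction field `F`:
`f = u * π ^ m` with `u` a unit of `R` and `π` a uniformizer has order `m`. (`0` for `f = 0`.) -/
def ordAlong {F : Type*} [Field F] (R : Subring F) (f : F) : ℤ := by
  classical
  exact if h : ∃ m : ℤ, ∃ π : R, Irreducible π ∧ ∃ u : Rˣ, f = ((u : R) : F) * (π : F) ^ m
    then h.choose else 0

namespace Model

variable {k K : Type*} [Field k] [Field K] [Algebra k K]

/-- The variety covered by the affine varieties `Spec A`, for `A` in a set of subalgebras of `K`:
its local rings are the localizations of these algebras at their prime ideals. -/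
def ofCharts (S : Set (Subalgebra k K)) : Model k K where
  points := {R | ∃ A ∈ S, ∃ (P : Ideal A.toSubring) (_ : P.IsPrime),
    R = LocalSubring.ofPrime A.toSubring P}
  algebraMap_mem := by
    rintro R ⟨A, -, P, hP, rfl⟩ a
    exact LocalSubring.le_ofPrime A.toSubring P (A.algebraMap_mem a)

/-- `X` is projective over `k`: for some homogeneous coordinates `f₀, …, f_m` it is the variety
covered by the affine pieces `Spec k[f₀/fᵢ, …, f_m/fᵢ]` (coordinates which vanish identically
on `X` may be left out). -/
def IsProjective (X : Model k K) : Prop :=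
  ∃ (m : ℕ) (f : Fin (m + 1) → K), (∀ i, f i ≠ 0) ∧
    X.points = (ofCharts (Set.range fun i =>
      Algebra.adjoin k (Set.range fun j => f j / f i))).points

/-! ### Weil divisors

Everything below is meant for normal varieties. -/

/-- The prime divisors of (a normal variety) `X`: the points of codimension one, i.e. the points
whose local ring is a discrete valuation ring. -/
def PrimeDivisor (X : Model k K) : Type _ :=
  {P : LocalSubring K // P ∈ X.points ∧ IsDiscreteValuationRing P.toSubring}

/-- Order of vanishing of a rational function along a prime divisor. -/
def PrimeDivisor.ord {X : Model k K} (P : X.PrimeDivisor) (f : K) : ℤ :=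
  ordAlong P.1.toSubring f

/-- The prime divisor `P` passes through the point `x`: the local ring at `x` is contained in the
local ring along `P`. -/
def PrimeDivisor.Through {X : Model k K} (P : X.PrimeDivisor) (x : LocalSubring K) : Prop :=
  x.toSubring ≤ P.1.toSubring

/-- Weil divisors with real coefficients. -/
abbrev RDiv (X : Model k K) : Type _ := X.PrimeDivisor →₀ ℝ

/-- Weil divisors. -/
abbrev ZDiv (X : Model k K) : Type _ := X.PrimeDivisor →₀ ℤ

/-- A Weil divisor as a Weil divisor with real coefficients. -/
def toRDiv {X : Model k K} (D : X.ZDiv) : X.RDiv :=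
  D.mapRange (fun m : ℤ => (m : ℝ)) Int.cast_zero

/-- The coefficients of `div f`. -/
def divFun (X : Model k K) (f : K) : X.PrimeDivisor → ℝ := fun P => (P.ord f : ℝ)

/-- The real principal divisors: real linear combinations of divisors `div f`, `f ∈ K^*`. -/
def principal (X : Model k K) : Submodule ℝ X.RDiv :=
  (Submodule.span ℝ {d : X.PrimeDivisor → ℝ | ∃ f : K, f ≠ 0 ∧ d = X.divFun f}).comap
    (Finsupp.lcoeFun : X.RDiv →ₗ[ℝ] (X.PrimeDivisor → ℝ))

/-- The real divisor class group `Cl(X) ⊗ ℝ`. -/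
abbrev ClR (X : Model k K) : Type _ := X.RDiv ⧸ X.principal

/-- The class `[D]` of a divisor. -/
def cls {X : Model k K} (D : X.RDiv) : X.ClR := X.principal.mkQ D

/-! ### Line bundles -/

/-- `f` is a local equation of `D` at `x`. -/
def IsLocalEquation {X : Model k K} (D : X.ZDiv) (x : LocalSubring K) (f : K) : Prop :=
  f ≠ 0 ∧ ∀ P : X.PrimeDivisor, P.Through x → D P = P.ord f

/-- `D` is a Cartier divisor: it is principal near every point. -/
def IsCartier {X : Model k K} (D : X.ZDiv) : Prop :=
  ∀ x ∈ X.points, ∃ f : K, IsLocalEquation D x f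

/-- The Picard group with real coefficients `Pic(X) ⊗ ℝ`; for a normal variety it is the subspace of
`Cl(X) ⊗ ℝ` spanned by the classes of Cartier divisors. -/
def PicR (X : Model k K) : Submodule ℝ X.ClR :=
  Submodule.span ℝ {α | ∃ D : X.ZDiv, IsCartier D ∧ α = cls (toRDiv D)}

/-- The global sections of the sheaf `O(D)`. -/
def globalSections {X : Model k K} (D : X.ZDiv) : Set K :=
  {f | f = 0 ∨ ∀ P : X.PrimeDivisor, 0 ≤ P.ord f + D P}

/-- The stalk of the sheaf `O(D)` at the point `x`. -/
def stalk {X : Model k K} (D : X.ZDiv) (x : LocalSubring K) : Set K :=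
  {f | f = 0 ∨ ∀ P : X.PrimeDivisor, P.Through x → 0 ≤ P.ord f + D P}

/-- `O(D)` is globally generated: at every point `x` its stalk is generated, as a module over the
local ring at `x`, by global sections. -/
def IsGloballyGenerated {X : Model k K} (D : X.ZDiv) : Prop :=
  ∀ x ∈ X.points, ∀ f ∈ stalk D x, f ∈ Submodule.span x.toSubring (globalSections D)

/-- The cone in `Pic(X) ⊗ ℝ` generated by the classes of globally generated Cartier divisors. -/
def ggCone (X : Model k K) : PointedCone ℝ X.ClR :=
  PointedCone.hull ℝ {α | ∃ D : X.ZDiv, IsCartier D ∧ IsGloballyGenerated D ∧ α = cls (toRDiv D)}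

/-! ### Curves, intersection numbers and the nef cone -/

/-- The residue field of a point. -/
abbrev residueField {X : Model k K} (x : X.points) : Type _ :=
  IsLocalRing.ResidueField x.1.toSubring

/-- The structure map from `k` to the local ring at a point. -/
def structureMap {X : Model k K} (x : X.points) : k →+* x.1.toSubring :=
  (algebraMap k K).codRestrict x.1.toSubring (X.algebraMap_mem x.1 x.2)

instance {X : Model k K} (x : X.points) : Algebra k (residueField x) :=
  ((IsLocalRing.residue x.1.toSubring).comp (structureMap x)).toAlgebra

/-- The value at the point `x` of a rational function regular at `x` (`0` if it is not regular). -/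
def valueAt {X : Model k K} (x : X.points) (f : K) : residueField x := by
  classical
  exact if h : f ∈ x.1.toSubring then IsLocalRing.residue x.1.toSubring ⟨f, h⟩ else 0

/-- `c` is the generic point of a curve in `X`, i.e. its closure has dimension one. -/
def IsCurve {X : Model k K} (c : X.points) : Prop :=
  Algebra.trdeg k (residueField c) = 1

/-- The closed points of the (complete) normalization of the curve with generic point `c`:
the nontrivial valuation rings of the function field of the curve that contain `k`. -/
structure Place {X : Model k K} (c : X.points) where
  ring : ValuationSubring (residueField c)
  algebraMap_mem : ∀ a : k, algebraMap k (residueField c) a ∈ ring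
  ne_top : ring ≠ ⊤

/-- The degree over `k` of the residue field of a place. -/
def Place.degree {X : Model k K} {c : X.points} (v : Place c) : ℕ :=
  letI : Algebra k (IsLocalRing.ResidueField v.ring) :=
    ((IsLocalRing.residue v.ring).comp
      ((algebraMap k (residueField c)).codRestrict v.ring.toSubring v.algebraMap_mem)).toAlgebra
  Module.finrank k (IsLocalRing.ResidueField v.ring)

/-- `x` is the image in `X` of the point `v` of the normalization of the curve with generic
point `c`: the point `x` lies in the closure of `c`, and `v` dominates the local ring of the curve
at `x`. -/
def Place.IsCenter {X : Model k K} {c : X.points} (v : Place c) (x : LocalSubring K) : Prop :=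
  x ∈ X.points ∧ x.toSubring ≤ c.1.toSubring ∧
    ∀ r : x.toSubring, valueAt c (r : K) ∈ v.ring ∧
      (r ∈ IsLocalRing.maximalIdeal x.toSubring → valueAt c (r : K) ∈ v.ring.nonunits)

/-- `d` is the intersection number of the Cartier divisor `D` with the complete curve with generic
point `c`, i.e. the degree of the pullback of `O(D)` to the normalization of the curve.
For a local equation `g` of `D` at `c`, the divisor `D - div g` does not contain the curve, and it
has local equation `e v / g` near the image of `v` if `e v` is one for `D`; the pullbacks of these
local equations to the normalization define a divisor whose degree is `d`
(it does not depend on the choices of `g` and `e`). -/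
def IsIntersectionNumber {X : Model k K} (D : X.ZDiv) (c : X.points) (d : ℤ) : Prop :=
  ∃ (g : K) (e : Place c → K), IsLocalEquation D c.1 g ∧
    (∀ v : Place c, ∃ x, v.IsCenter x ∧ IsLocalEquation D x (e v)) ∧
    d = ∑ᶠ v : Place c, (v.degree : ℤ) * ordAlong v.ring.toSubring (valueAt c (e v / g))

/-- The nef cone of a complete variety: the classes in `Pic(X) ⊗ ℝ` which have nonnegative
intersection number with all curves. -/
def nefCone (X : Model k K) : Set X.ClR :=
  {α | ∃ (m : ℕ) (r : Fin m → ℝ) (D : Fin m → X.ZDiv), (∀ j, IsCartier (D j)) ∧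
    α = ∑ j, r j • cls (toRDiv (D j)) ∧
    ∀ c : X.points, IsCurve c → ∃ d : Fin m → ℤ,
      (∀ j, IsIntersectionNumber (D j) c (d j)) ∧ 0 ≤ ∑ j, r j * (d j : ℝ)}

/-! ### Pullback to an open subvariety -/

/-- A prime divisor of an open subvariety `Y` of `X` gives (by closure) one of `X`. -/
def PrimeDivisor.incl {Y X : Model k K} (h : Y.points ⊆ X.points) (P : Y.PrimeDivisor) :
    X.PrimeDivisor :=
  ⟨P.1, h P.2.1, P.2.2⟩

lemma PrimeDivisor.incl_injective {Y X : Model k K} (h : Y.points ⊆ X.points) :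
    Function.Injective (PrimeDivisor.incl h) := fun P Q hPQ =>
  Subtype.ext (show (PrimeDivisor.incl h P).1 = (PrimeDivisor.incl h Q).1 by rw [hPQ])

/-- Restriction of divisors to an open subvariety. -/
def restrictDiv {Y X : Model k K} (h : Y.points ⊆ X.points) : X.RDiv →ₗ[ℝ] Y.RDiv :=
  Finsupp.lcomapDomain (PrimeDivisor.incl h) (PrimeDivisor.incl_injective h)

lemma principal_le_comap {Y X : Model k K} (h : Y.points ⊆ X.points) :
    X.principal ≤ Y.principal.comap (restrictDiv h) := by
  intro D hD
  have key : Submodule.span ℝ {d : X.PrimeDivisor → ℝ | ∃ f : K, f ≠ 0 ∧ d = X.divFun f} ≤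
      (Submodule.span ℝ {d : Y.PrimeDivisor → ℝ | ∃ f : K, f ≠ 0 ∧ d = Y.divFun f}).comap
        (LinearMap.funLeft ℝ ℝ (PrimeDivisor.incl h)) := by
    rw [Submodule.span_le]
    rintro _ ⟨f, hf, rfl⟩
    exact Submodule.subset_span ⟨f, hf, rfl⟩
  exact key hD

/-- The pullback `i^*` of divisor classes along the inclusion `i` of an open subvariety. -/
def pullback {Y X : Model k K} (h : Y.points ⊆ X.points) : X.ClR →ₗ[ℝ] Y.ClR :=
  X.principal.mapQ Y.principal (restrictDiv h) (principal_le_comap h)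

end Model

/-! ## Fans in `ℝⁿ`, with lattice `N = ℤⁿ` and dual lattice `M = ℤⁿ` -/

/-- The pairing between `M` and `N_ℝ`. -/
def pairing {n : ℕ} (u : Fin n → ℤ) (v : Fin n → ℝ) : ℝ := ∑ i, (u i : ℝ) * v i

/-- A lattice vector as a vector in `N_ℝ`. -/
def latticeVec {n : ℕ} (v : Fin n → ℤ) : Fin n → ℝ := fun i => (v i : ℝ)

/-- `v` is a primitive lattice vector (the first lattice point on the ray through it). -/
def IsPrimitive {n : ℕ} (v : Fin n → ℤ) : Prop :=
  ∀ (m : ℤ) (w : Fin n → ℤ), v = m • w → IsUnit m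

/-- The ray spanned by a lattice vector. -/
def rayCone {n : ℕ} (v : Fin n → ℤ) : PointedCone ℝ (Fin n → ℝ) :=
  PointedCone.hull ℝ {latticeVec v}

/-- `τ` is a face of the rational cone `σ`: `τ = σ ∩ u^⊥` for some `u ∈ σ^∨ ∩ M`. -/
def IsConeFace {n : ℕ} (τ σ : PointedCone ℝ (Fin n → ℝ)) : Prop :=
  ∃ u : Fin n → ℤ, (∀ v ∈ σ, 0 ≤ pairing u v) ∧ ∀ v, v ∈ τ ↔ v ∈ σ ∧ pairing u v = 0

/-- A fan: a finite nonempty collection of strongly convex rational polyhedral cones, closed under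
taking faces, such that the intersection of any two cones is a face of each. -/
structure Fan (n : ℕ) where
  cones : Set (PointedCone ℝ (Fin n → ℝ))
  finite : cones.Finite
  nonempty : cones.Nonempty
  rational : ∀ σ ∈ cones, ∃ s : Finset (Fin n → ℤ), σ = PointedCone.hull ℝ (latticeVec '' s)
  strongly_convex : ∀ σ ∈ cones, ∀ v ∈ σ, -v ∈ σ → v = 0
  face_mem : ∀ σ ∈ cones, ∀ τ, IsConeFace τ σ → τ ∈ cones
  inter_face : ∀ σ ∈ cones, ∀ τ ∈ cones, IsConeFace (σ ⊓ τ) σ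

namespace Fan

variable {n : ℕ}

/-- The primitive lattice vector `v` generates a ray of the fan. -/
def IsRay (Δ : Fan n) (v : Fin n → ℤ) : Prop := IsPrimitive v ∧ rayCone v ∈ Δ.cones

/-- The index set `Δ(1)` of the rays; a ray is identified with its first lattice point. -/
def Ray (Δ : Fan n) : Type := {v : Fin n → ℤ // Δ.IsRay v}

/-- The first lattice point on the `i`-th ray, in `N_ℝ`. -/
def Ray.vec {Δ : Fan n} (i : Δ.Ray) : Fin n → ℝ := latticeVec i.1

end Fan

/-! ## Toric varieties -/

section Toric

variable (k : Type*) [Field k]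

/-- The function field `k(M)` of the torus with character lattice `M = ℤⁿ`. -/
abbrev ToricField (n : ℕ) : Type _ := FractionRing (AddMonoidAlgebra k (Fin n → ℤ))

/-- The character `χ^u`. -/
def chi {n : ℕ} (u : Fin n → ℤ) : ToricField k n :=
  algebraMap (AddMonoidAlgebra k (Fin n → ℤ)) _ (AddMonoidAlgebra.single u 1)

/-- The coordinate ring `k[σ^∨ ∩ M]` of the affine toric variety `U_σ`. -/
def coneAlgebra {n : ℕ} (σ : PointedCone ℝ (Fin n → ℝ)) : Subalgebra k (ToricField k n) :=
  Algebra.adjoin k {f | ∃ u : Fin n → ℤ, (∀ v ∈ σ, 0 ≤ pairing u v) ∧ f = chi k u}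

/-- The toric variety `X_Δ`, covered by the affine toric varieties `U_σ` for `σ ∈ Δ`. -/
def toricVariety {n : ℕ} (Δ : Fan n) : Model k (ToricField k n) :=
  Model.ofCharts (coneAlgebra k '' Δ.cones)

/-- The ideal of the closed orbit in `U_σ`, generated by the characters `χ^u` for
`u ∈ σ^∨ ∩ M` not in `σ^⊥`. -/
def orbitIdeal {n : ℕ} (σ : PointedCone ℝ (Fin n → ℝ)) : Ideal (coneAlgebra k σ).toSubring :=
  Ideal.span {f | ∃ u : Fin n → ℤ, (∀ v ∈ σ, 0 ≤ pairing u v) ∧ (∃ v ∈ σ, pairing u v ≠ 0) ∧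
    (f : ToricField k n) = chi k u}

/-- `R` is the generic point of the orbit closure `V(σ)`. For the ray `σ` spanned by `v_i` this is
the torus-invariant prime divisor `D_i`. -/
def IsOrbitPoint {n : ℕ} (σ : PointedCone ℝ (Fin n → ℝ)) (R : LocalSubring (ToricField k n)) :
    Prop :=
  ∃ _ : (orbitIdeal k σ).IsPrime,
    R = LocalSubring.ofPrime (coneAlgebra k σ).toSubring (orbitIdeal k σ)

variable {k}

lemma IsOrbitPoint.unique {n : ℕ} {σ : PointedCone ℝ (Fin n → ℝ)}
    {R S : LocalSubring (ToricField k n)} (hR : IsOrbitPoint k σ R) (hS : IsOrbitPoint k σ S) :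
    R = S := by
  obtain ⟨_, rfl⟩ := hR
  obtain ⟨_, rfl⟩ := hS
  rfl

variable (k)

open Classical in
/-- The coefficient of `∑ a_i D_i` at the prime divisor `P`: it is `a_i` if `P = D_i`, and `0` if
`P` is not among the divisors `D_i`. -/
def toricCoeff {n : ℕ} (Δ : Fan n) (a : Δ.Ray → ℝ) (P : (toricVariety k Δ).PrimeDivisor) : ℝ :=
  if h : ∃ i : Δ.Ray, IsOrbitPoint k (rayCone i.1) P.1 then a h.choose else 0

lemma toricCoeff_support_finite {n : ℕ} (Δ : Fan n) (a : Δ.Ray → ℝ) :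
    (Function.support (toricCoeff k Δ a)).Finite := by
  have hfin : (⋃ σ ∈ Δ.cones,
      {P : (toricVariety k Δ).PrimeDivisor | IsOrbitPoint k σ P.1}).Finite := by
    refine Δ.finite.biUnion fun σ _ => Set.Subsingleton.finite ?_
    intro P hP Q hQ
    exact Subtype.ext (IsOrbitPoint.unique hP hQ)
  refine hfin.subset fun P hP => ?_
  by_cases h : ∃ i : Δ.Ray, IsOrbitPoint k (rayCone i.1) P.1
  · obtain ⟨i, hi⟩ := h
    exact Set.mem_biUnion i.2.2 hi
  · exact absurd (dif_neg h) hP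

/-- The torus-invariant divisor `∑ a_i D_i` on `X_Δ`. -/
def toricDivisor {n : ℕ} (Δ : Fan n) (a : Δ.Ray → ℝ) : (toricVariety k Δ).RDiv :=
  Finsupp.ofSupportFinite (toricCoeff k Δ a) (toricCoeff_support_finite k Δ a)

open Classical in
/-- The torus-invariant prime divisor `D_i`. -/
def rayDivisor {n : ℕ} (Δ : Fan n) (i : Δ.Ray) : (toricVariety k Δ).RDiv :=
  toricDivisor k Δ (Pi.single i 1)

lemma toricVariety_mono {n : ℕ} {Δ Φ : Fan n} (h : Δ.cones ⊆ Φ.cones) :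
    (toricVariety k Δ).points ⊆ (toricVariety k Φ).points := by
  rintro R ⟨A, ⟨σ, hσ, rfl⟩, P, hP, rfl⟩
  exact ⟨_, ⟨σ, h hσ, rfl⟩, P, hP, rfl⟩

end Toric

/-! ## Convex piecewise linear functions -/

/-- `ψ` is linear on the cone `τ`. -/
def IsLinearOn {n : ℕ} (ψ : (Fin n → ℝ) → ℝ) (τ : PointedCone ℝ (Fin n → ℝ)) : Prop :=
  ∃ l : (Fin n → ℝ) →ₗ[ℝ] ℝ, ∀ v ∈ τ, ψ v = l v

/-- `ψ` is piecewise linear on `N_ℝ`: it is linear on each of finitely many polyhedral cones that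
cover `N_ℝ`. -/
def IsPiecewiseLinear {n : ℕ} (ψ : (Fin n → ℝ) → ℝ) : Prop :=
  ∃ S : Set (PointedCone ℝ (Fin n → ℝ)), S.Finite ∧ (∀ τ ∈ S, τ.FG) ∧ (∀ v, ∃ τ ∈ S, v ∈ τ) ∧
    ∀ τ ∈ S, IsLinearOn ψ τ

/-- `ψ` is convex, in the sense of subadditivity. -/
def IsConvexFun {n : ℕ} (ψ : (Fin n → ℝ) → ℝ) : Prop :=
  ∀ (l : ℕ) (u : Fin l → Fin n → ℝ), ψ (∑ j, u j) ≤ ∑ j, ψ (u j)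

end

/-! All conditions are compared with one finite system of linear conditions, `Fan.IsSupported`: for
every cone `σ` of `Δ` there is a real `m` with `a i + ⟨m, v_i⟩ ≥ 0` for all rays and equality for
the rays of `σ`.

The comparison rests on a description of the class group. The coordinate ring of the torus is a
unique factorization domain, so every divisor becomes invariant after subtracting principal
divisors. `Fan.toricPart` records the resulting coefficients, and by `Fan.cls_eq_iff` two classes
agree exactly when these coefficients differ by a real character. Condition 2 then says that, for
each `σ`, adding the divisor of a real character makes `D` effective and supported off `σ`
(`Fan.isSupported_iff_mem_hull`). For condition 3, `ψ` is the maximum of the linear functions `-m`;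
conversely `-m` is a supporting functional of `ψ` at an interior point of `σ`, supplied by
Hahn-Banach (`Fan.isSupported_iff_exists_convex`). For condition 1, a section generating `O(D)` at
the generic point of the orbit of `σ` becomes a Laurent polynomial after trivializing `O(D)` over
the torus, and one of its exponents is the required `m`. Conversely, `exists_int_decomposition`
turns a real solution of the system into a nonnegative combination of integral solutions, and for
those the characters `χ^m` generate (`Fan.isSupported_iff_mem_ggCone`).

From condition 4 to the system: a projective fan `Φ ⊇ Δ` is complete, and Cartier divisors on it
define piecewise linear functions. At an interior point of a cone, the second difference of such a
function along a lattice direction is, up to a positive factor, the intersection number with a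
rational curve in the orbit of that cone (`Fan.exists_curve_intersection`). Nefness therefore makes
the function locally convex along lattice directions, hence convex
(`Fan.isSupported_of_eventually`), and the resulting inequalities restrict to `Δ`.

From the system to condition 4: the minimal order of the coordinates of the given projective variety
yields a strictly convex function `h` (`IsCoordinates.exists_strictly_supporting`). Extend `a` to a
maximum of linear functions, perturb it to `a + ε h`, and take the normal fan of the polytope `{l |
⟨l, v⟩ ≤ a v + ε h v, v ∈ V}`. It is projective, contains `Δ` and has rays only in `V`. For a
suitable `ε` its combinatorial type recurs for arbitrarily small perturbations, so the unperturbed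
data remain linear on its cones (`exists_projective_fan`) and are nef there
(`Fan.IsSupported.mem_nefCone`). Taking for `V` the rays of the given fan proves the implication;
taking the rays of `Δ`, when these span, gives the last assertion. -/

noncomputable section

open scoped BigOperators

/-! ## Linear inequalities -/

/-- Farkas' lemma for finitely many linear functionals. -/
theorem farkas_functional {E : Type*} [AddCommGroup E] [Module ℝ E] :
    ∀ (m : ℕ) (a : Fin m → E →ₗ[ℝ] ℝ) (c : E →ₗ[ℝ] ℝ),
      (∀ x, (∀ i, 0 ≤ a i x) → 0 ≤ c x) → ∃ r : Fin m → ℝ, (∀ i, 0 ≤ r i) ∧ c = ∑ i, r i • a i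
  | 0, a, c, h => by
    refine ⟨fun _ => 0, fun i => i.elim0, ?_⟩
    ext x
    have h1 := h x (fun i => i.elim0)
    have h2 := h (-x) (fun i => i.elim0)
    simp only [map_neg] at h2
    simp
    linarith
  | m + 1, a, c, h => by
    by_cases h0 : ∀ x, (∀ i : Fin m, 0 ≤ a i.castSucc x) → 0 ≤ c x
    · obtain ⟨r, hr, hc⟩ := farkas_functional m (fun i => a i.castSucc) c h0
      refine ⟨Fin.snoc r 0, fun i => ?_, ?_⟩
      · refine Fin.lastCases ?_ (fun j => ?_) i
        · simp
        · simpa using hr j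
      · rw [Fin.sum_univ_castSucc]
        simpa using hc
    · push Not at h0
      obtain ⟨x₀, hx, hcx⟩ := h0
      set l := a (Fin.last m) with hl
      have hlx : l x₀ < 0 := by
        by_contra hcon
        push Not at hcon
        refine absurd (h x₀ fun i => ?_) (not_le.2 hcx)
        refine Fin.lastCases ?_ (fun j => ?_) i
        · exact hcon
        · exact hx j
      -- With this `t`, the map `x ↦ x + t * l x • x₀` is the projection onto `ker l` along `x₀`.
      -- Induction applies to the remaining functionals composed with it.
      set t : ℝ := -(l x₀)⁻¹ with ht
      have ht0 : 0 < t := by rw [ht]; simpa using hlx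
      have htl : t * l x₀ = -1 := by rw [ht]; field_simp [hlx.ne]
      obtain ⟨r, hr, hc⟩ := farkas_functional m (fun i => a i.castSucc + (t * a i.castSucc x₀) • l)
        (c + (t * c x₀) • l) (fun x hxi => by
          have key := h (x + (t * l x) • x₀) (fun i => by
            refine Fin.lastCases ?_ (fun j => ?_) i
            · simp only [← hl, map_add, map_smul, smul_eq_mul]
              have e : l x + t * l x * l x₀ = l x * (1 + t * l x₀) := by ring
              rw [e, htl]
              simp
            · have := hxi j
              simp only [LinearMap.add_apply, LinearMap.smul_apply, smul_eq_mul] at this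
              simp only [map_add, map_smul, smul_eq_mul]
              nlinarith)
          simp only [map_add, map_smul, smul_eq_mul] at key
          simp only [LinearMap.add_apply, LinearMap.smul_apply, smul_eq_mul]
          nlinarith)
      -- The coefficient of `l` collects the correction terms of the projection. It is nonnegative
      -- because `a i x₀ ≥ 0` and `c x₀ < 0`.
      refine ⟨Fin.snoc r (t * (∑ i, r i * a i.castSucc x₀ - c x₀)), fun i => ?_, ?_⟩
      · refine Fin.lastCases ?_ (fun j => ?_) i
        · rw [Fin.snoc_last]
          refine mul_nonneg ht0.le ?_
          have : 0 ≤ ∑ i, r i * a i.castSucc x₀ :=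
            Finset.sum_nonneg fun i _ => mul_nonneg (hr i) (hx i)
          linarith
        · simpa using hr j
      · rw [Fin.sum_univ_castSucc]
        ext x
        have := LinearMap.congr_fun hc x
        simp only [LinearMap.add_apply, LinearMap.smul_apply, smul_eq_mul, LinearMap.coe_sum,
          Finset.sum_apply, mul_add, Finset.sum_add_distrib] at this
        simp only [LinearMap.add_apply, LinearMap.smul_apply, smul_eq_mul, LinearMap.coe_sum,
          Finset.sum_apply, Fin.snoc_castSucc, Fin.snoc_last, ← hl]
        have e : ∑ i : Fin m, r i * (t * a i.castSucc x₀ * l x) =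
            t * (∑ i, r i * a i.castSucc x₀) * l x := by
          rw [Finset.mul_sum, Finset.sum_mul]
          exact Finset.sum_congr rfl fun i _ => by ring
        rw [e] at this
        linarith

theorem farkas_functional_fintype {E J : Type*} [AddCommGroup E] [Module ℝ E] [Fintype J]
    (a : J → E →ₗ[ℝ] ℝ) (c : E →ₗ[ℝ] ℝ) (h : ∀ x, (∀ i, 0 ≤ a i x) → 0 ≤ c x) :
    ∃ r : J → ℝ, (∀ i, 0 ≤ r i) ∧ c = ∑ i, r i • a i := by
  let e := Fintype.equivFin J
  obtain ⟨r, hr, hc⟩ := farkas_functional _ (fun i => a (e.symm i)) c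
    (fun x hx => h x fun i => by simpa using hx (e i))
  refine ⟨fun j => r (e j), fun j => hr _, ?_⟩
  rw [hc, ← e.sum_comp]
  simp

/-- A vector on which every functional nonnegative on `g` is nonnegative is a nonnegative
combination of the `g j`. -/
theorem farkas_vector {J ι : Type*} [Fintype J] [Fintype ι] (g : J → ι → ℝ) (x : ι → ℝ)
    (h : ∀ y : ι → ℝ, (∀ j, 0 ≤ ∑ i, y i * g j i) → 0 ≤ ∑ i, y i * x i) :
    ∃ r : J → ℝ, (∀ j, 0 ≤ r j) ∧ x = ∑ j, r j • g j := by
  classical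
  let ev : (ι → ℝ) → ((ι → ℝ) →ₗ[ℝ] ℝ) := fun v =>
    { toFun := fun y => ∑ i, y i * v i
      map_add' := fun y z => by simp [add_mul, Finset.sum_add_distrib]
      map_smul' := fun c y => by simp [Finset.mul_sum, mul_assoc] }
  obtain ⟨r, hr, hc⟩ := farkas_functional_fintype (fun j => ev (g j)) (ev x) h
  refine ⟨r, hr, ?_⟩
  ext i
  have := LinearMap.congr_fun hc (Pi.single i 1)
  simpa [ev, Pi.single_apply] using this

/-! ## Polyhedral cones are finitely generated -/

section DoubleDescription

variable {E : Type*} [AddCommGroup E] [Module ℝ E]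

/-- One step of the double description method: keep the generators on the nonnegative side and, for
each pair on strictly opposite sides, add the positive combination lying on the hyperplane `a = 0`.
-/
theorem fg_inf_halfspace (C : PointedCone ℝ E) (hC : C.FG) (a : E →ₗ[ℝ] ℝ) :
    ∃ D : PointedCone ℝ E, D.FG ∧ ∀ x, x ∈ D ↔ x ∈ C ∧ 0 ≤ a x := by
  classical
  obtain ⟨G, rfl⟩ := hC
  let G' : Set E := {g | g ∈ G ∧ 0 ≤ a g} ∪
    (fun p : E × E => a p.1 • p.2 - a p.2 • p.1) '' {p | p.1 ∈ G ∧ p.2 ∈ G ∧ 0 < a p.1 ∧ a p.2 < 0}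
  have hfin : G'.Finite := by
    refine Set.Finite.union (G.finite_toSet.subset fun g hg => hg.1) (Set.Finite.image _ ?_)
    exact (G.finite_toSet.prod G.finite_toSet).subset fun p hp => ⟨hp.1, hp.2.1⟩
  let D : PointedCone ℝ E := PointedCone.hull ℝ G'
  have hDC : ∀ x ∈ D, x ∈ PointedCone.hull ℝ (G : Set E) ∧ 0 ≤ a x := by
    intro x hx
    have : D ≤ PointedCone.hull ℝ (G : Set E) ⊓ (PointedCone.positive ℝ ℝ).comap a := by
      refine Submodule.span_le.2 ?_
      rintro _ (⟨hg, h0⟩ | ⟨⟨g, h⟩, ⟨hg, hh, h1, h2⟩, rfl⟩)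
      · exact ⟨Submodule.subset_span hg, h0⟩
      · refine ⟨?_, ?_⟩
        · have e : a g • h - a h • g = a g • h + (-a h) • g := by
            rw [neg_smul, sub_eq_add_neg]
          simp only [e]
          exact add_mem (PointedCone.smul_mem _ h1.le (Submodule.subset_span hh))
            (PointedCone.smul_mem _ (by linarith) (Submodule.subset_span hg))
        · change 0 ≤ a (a g • h - a h • g)
          simp [mul_comm]
    exact this hx
  -- The point where the ray from `y` towards a negative generator `h` meets the hyperplane stays in
  -- `D`; the expression is linear in `y`, so generators suffice.
  have hex : ∀ h ∈ G, a h < 0 → ∀ y ∈ D, a y • h - a h • y ∈ D := by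
    intro h hh hah y hy
    induction hy using Submodule.span_induction with
    | mem g hg =>
      rcases hg with ⟨hg, h0⟩ | ⟨⟨g1, g2⟩, ⟨hg, hg2, h1, h2⟩, rfl⟩
      · rcases h0.eq_or_lt with h0 | h0
        · rw [← h0, zero_smul, zero_sub, ← neg_smul]
          exact PointedCone.smul_mem _ (by linarith) (Submodule.subset_span (Or.inl ⟨hg, h0.le⟩))
        · exact Submodule.subset_span (Or.inr ⟨(g, h), ⟨hg, hh, h0, hah⟩, rfl⟩)
      · have e0 : a (a g1 • g2 - a g2 • g1) = 0 := by simp [mul_comm]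
        simp only [e0, zero_smul, zero_sub, ← neg_smul]
        exact PointedCone.smul_mem _ (by linarith)
          (Submodule.subset_span (Or.inr ⟨(g1, g2), ⟨hg, hg2, h1, h2⟩, rfl⟩))
    | zero => simp
    | add x y _ _ hx hy =>
      have e : a (x + y) • h - a h • (x + y) = (a x • h - a h • x) + (a y • h - a h • y) := by
        rw [map_add, add_smul, smul_add]; abel
      rw [e]; exact add_mem hx hy
    | smul c x _ hx =>
      have e : a (c • x) • h - a h • (c • x) = (c : ℝ) • (a x • h - a h • x) := by
        rw [show c • x = (c : ℝ) • x from rfl, map_smul, smul_sub, smul_smul, smul_smul, smul_smul,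
          smul_eq_mul, mul_comm (a h)]
      rw [e]; exact PointedCone.smul_mem _ c.2 hx
  -- Negative generators can be added one at a time: `a` only decreases along the way, so if it is
  -- nonnegative at the end it is nonnegative at every partial sum.
  have hadd : ∀ q ∈ PointedCone.hull ℝ {g | g ∈ G ∧ a g < 0}, a q ≤ 0 ∧
      ∀ y ∈ D, 0 ≤ a (y + q) → y + q ∈ D := by
    intro q hq
    induction hq using Submodule.span_induction with
    | mem h hh =>
      refine ⟨hh.2.le, fun y hy h0 => ?_⟩
      have h2 := hh.2
      rw [map_add] at h0
      have hy0 : 0 < a y := by linarith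
      have e : y + h = ((a y + a h) * (a y)⁻¹) • y + (a y)⁻¹ • (a y • h - a h • y) := by
        rw [smul_sub, smul_smul, smul_smul, inv_mul_cancel₀ hy0.ne', add_mul,
          mul_inv_cancel₀ hy0.ne', add_smul, one_smul, one_smul, mul_comm (a h)]
        abel
      rw [e]
      exact add_mem (PointedCone.smul_mem _ (mul_nonneg h0 (inv_nonneg.2 hy0.le)) hy)
        (PointedCone.smul_mem _ (inv_nonneg.2 hy0.le) (hex h hh.1 hh.2 y hy))
    | zero => exact ⟨by simp, fun y hy _ => by simpa using hy⟩
    | add q₁ q₂ _ _ h₁ h₂ =>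
      refine ⟨by rw [map_add]; linarith [h₁.1, h₂.1], fun y hy h0 => ?_⟩
      have : y + q₁ ∈ D := h₁.2 y hy (by
        have := h₂.1
        simp only [map_add] at h0 ⊢
        linarith)
      rw [← add_assoc]
      exact h₂.2 _ this (by rwa [add_assoc])
    | smul c q _ h =>
      have e : c • q = (c : ℝ) • q := rfl
      refine ⟨by rw [e, map_smul, smul_eq_mul]; exact mul_nonpos_of_nonneg_of_nonpos c.2 h.1,
        fun y hy h0 => ?_⟩
      rcases c.2.eq_or_lt with hc | hc
      · rw [e, ← hc, zero_smul, add_zero]; exact hy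
      · have e2 : y + c • q = (c : ℝ) • ((c : ℝ)⁻¹ • y + q) := by
          rw [smul_add, smul_smul, mul_inv_cancel₀ hc.ne', one_smul, e]
        rw [e2] at h0 ⊢
        refine PointedCone.smul_mem _ hc.le (h.2 _ (PointedCone.smul_mem _ (by positivity) hy) ?_)
        rw [map_smul, smul_eq_mul] at h0
        exact nonneg_of_mul_nonneg_right h0 hc
  refine ⟨D, ⟨hfin.toFinset, by simp [D]⟩, fun x => ⟨hDC x, fun ⟨hx, h0⟩ => ?_⟩⟩
  have hsplit : PointedCone.hull ℝ (G : Set E) ≤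
      D ⊔ PointedCone.hull ℝ {g | g ∈ G ∧ a g < 0} := by
    refine Submodule.span_le.2 fun g hg => ?_
    rcases le_or_gt 0 (a g) with h | h
    · exact Submodule.mem_sup_left (Submodule.subset_span (Or.inl ⟨hg, h⟩))
    · exact Submodule.mem_sup_right (Submodule.subset_span ⟨hg, h⟩)
  obtain ⟨y, hy, q, hq, rfl⟩ := Submodule.mem_sup.1 (hsplit hx)
  exact (hadd q hq).2 y hy h0

/-- The cone defined by finitely many linear inequalities is finitely generated. -/
theorem exists_fg_of_inequalities [FiniteDimensional ℝ E] {J : Type*} [Fintype J]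
    (a : J → E →ₗ[ℝ] ℝ) : ∃ D : PointedCone ℝ E, D.FG ∧ ∀ x, x ∈ D ↔ ∀ j, 0 ≤ a j x := by
  classical
  have key : ∀ s : Finset J, ∃ D : PointedCone ℝ E, D.FG ∧ ∀ x, x ∈ D ↔ ∀ j ∈ s, 0 ≤ a j x := by
    intro s
    induction s using Finset.induction with
    | empty =>
      refine ⟨⊤, ?_, by simp⟩
      let b := Module.finBasis ℝ E
      refine ⟨Finset.univ.image b ∪ Finset.univ.image (fun i => -b i), ?_⟩
      rw [eq_top_iff]
      rintro x -
      rw [← b.sum_repr x]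
      refine sum_mem fun i _ => ?_
      rcases le_total 0 (b.repr x i) with h | h
      · exact PointedCone.smul_mem _ h (Submodule.subset_span (by simp))
      · have : b.repr x i • b i = (-b.repr x i) • (-b i) := by simp
        rw [this]
        exact PointedCone.smul_mem _ (by linarith) (Submodule.subset_span (by simp))
    | insert j s _ ih =>
      obtain ⟨D, hD, h⟩ := ih
      obtain ⟨D', hD', h'⟩ := fg_inf_halfspace D hD (a j)
      refine ⟨D', hD', fun x => ?_⟩
      rw [h', h, Finset.forall_mem_insert]
      tauto
  obtain ⟨D, hD, h⟩ := key Finset.univ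
  exact ⟨D, hD, fun x => by simp [h]⟩

end DoubleDescription

/-! ## Decomposition into integer vectors -/

/-- Write `x = B β` with `B` rational and the entries of `β` independent over `ℚ`. Forms in `F`
vanishing at `x` vanish on the whole image of `B`, and the others keep their sign near `β`. Surround
`β` by a small box with rational corners and clear denominators at the corners. The index type `Fin
(r + 1)` guarantees at least one summand, which is what uses needing a single integral vector rely
on. -/
theorem exists_int_decomposition {ι : Type*} [Fintype ι] (F : Finset (ι → ℤ)) (x : ι → ℝ) :
    ∃ (r : ℕ) (c : Fin (r + 1) → ℝ) (z : Fin (r + 1) → ι → ℤ), (∀ s, 0 ≤ c s) ∧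
      (∀ i, x i = ∑ s, c s * (z s i : ℝ)) ∧
      ∀ s, ∀ p ∈ F, SignType.sign (∑ i, (p i : ℝ) * (z s i : ℝ)) =
        SignType.sign (∑ i, (p i : ℝ) * x i) := by
  classical
  let V : Submodule ℚ ℝ := Submodule.span ℚ (Set.range x)
  have : FiniteDimensional ℚ V := FiniteDimensional.span_of_finite ℚ (Set.finite_range x)
  let b := Module.finBasis ℚ V
  set d := Module.finrank ℚ V
  let q : ι → Fin d → ℚ := fun i j => b.repr ⟨x i, Submodule.subset_span ⟨i, rfl⟩⟩ j
  let β : Fin d → ℝ := fun j => (b j : ℝ)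
  have hx : ∀ i, x i = ∑ j, (q i j : ℝ) * β j := by
    intro i
    have := congrArg (Subtype.val) (b.sum_repr ⟨x i, Submodule.subset_span ⟨i, rfl⟩⟩)
    simp only [AddSubmonoidClass.coe_finsetSum, SetLike.val_smul] at this
    rw [← this]
    exact Finset.sum_congr rfl fun j _ => by rw [Rat.smul_def]
  let B : (Fin d → ℝ) → ι → ℝ := fun t i => ∑ j, (q i j : ℝ) * t j
  have hBβ : B β = x := funext fun i => (hx i).symm
  let f : (ι → ℤ) → (Fin d → ℝ) → ℝ := fun p t => ∑ i, (p i : ℝ) * B t i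
  have hf : ∀ p t, f p t = ∑ j, ((∑ i, (p i : ℚ) * q i j : ℚ) : ℝ) * t j := by
    intro p t
    simp only [f, B, Finset.mul_sum, Rat.cast_sum, Finset.sum_mul, Rat.cast_mul, Rat.cast_intCast]
    rw [Finset.sum_comm]
    exact Finset.sum_congr rfl fun j _ => Finset.sum_congr rfl fun i _ => by ring
  -- `f p` has rational coefficients and the `β j` are independent over `ℚ`, so a zero at `β` kills
  -- every coefficient.
  have hzero : ∀ p, f p β = 0 → ∀ t, f p t = 0 := by
    intro p hp t
    rw [hf] at hp ⊢
    have h1 : ∑ j, (∑ i, (p i : ℚ) * q i j) • b j = 0 := by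
      apply Subtype.ext
      simp only [AddSubmonoidClass.coe_finsetSum, SetLike.val_smul, ZeroMemClass.coe_zero]
      rw [← hp]
      exact Finset.sum_congr rfl fun j _ => by rw [Rat.smul_def]
    have h2 := Fintype.linearIndependent_iff.1 b.linearIndependent _ h1
    simp [h2]
  have hcont : ∀ p, Continuous (f p) := by
    intro p
    simp only [f, B]
    fun_prop
  let U : Set (Fin d → ℝ) := {t | ∀ p ∈ F, f p β ≠ 0 →
    SignType.sign (f p t) = SignType.sign (f p β)}
  have hU : ∀ᶠ t in nhds β, t ∈ U := by
    refine (Filter.eventually_all_finset F).2 fun p _ => ?_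
    by_cases h0 : f p β = 0
    · exact Filter.Eventually.of_forall fun t h => absurd h0 h
    rcases lt_or_gt_of_ne h0 with h | h
    · filter_upwards [(hcont p).continuousAt.eventually (gt_mem_nhds h)] with t ht _
      rw [sign_neg ht, sign_neg h]
    · filter_upwards [(hcont p).continuousAt.eventually (lt_mem_nhds h)] with t ht _
      rw [sign_pos ht, sign_pos h]
  obtain ⟨ε, hε, hball⟩ := Metric.eventually_nhds_iff_ball.1 hU
  have hlo : ∀ j, ∃ r : ℚ, β j - ε < r ∧ (r : ℝ) < β j := fun j => exists_rat_btwn (by linarith)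
  have hhi : ∀ j, ∃ r : ℚ, β j < r ∧ (r : ℝ) < β j + ε := fun j => exists_rat_btwn (by linarith)
  choose lo hlo using hlo
  choose hi hhi using hhi
  -- The corners of the box around `β`; the convex hull of a product is the product of the convex
  -- hulls.
  let S : Fin d → Set ℝ := fun j => {(lo j : ℝ), (hi j : ℝ)}
  have hβ : β ∈ convexHull ℝ (Set.univ.pi S) := by
    rw [convexHull_pi]
    intro j _
    simp only [S]
    rw [convexHull_pair, segment_eq_Icc ((hlo j).2.trans (hhi j).1).le]
    exact ⟨(hlo j).2.le, (hhi j).1.le⟩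
  obtain ⟨κ, hκ, w, t, hw0, hw1, ht, hsum⟩ := mem_convexHull_iff_exists_fintype.1 hβ
  have hrat : ∀ a : κ, ∃ u : Fin d → ℚ, ∀ j, t a j = u j := by
    intro a
    refine ⟨fun j => if t a j = lo j then lo j else hi j, fun j => ?_⟩
    have := ht a j (Set.mem_univ _)
    simp only [S, Set.mem_insert_iff, Set.mem_singleton_iff] at this
    beta_reduce
    split_ifs with h
    · exact h
    · exact this.resolve_left h
  have htU : ∀ a, t a ∈ U := by
    intro a
    apply hball
    rw [Metric.mem_ball, dist_pi_lt_iff hε]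
    intro j
    have := ht a j (Set.mem_univ _)
    simp only [S, Set.mem_insert_iff, Set.mem_singleton_iff] at this
    rw [Real.dist_eq, abs_lt]
    have h1 := hlo j
    have h2 := hhi j
    rcases this with h | h <;> rw [h] <;> constructor <;> linarith
  choose u hu using hrat
  have hden : ∀ a : κ, ∃ (N : ℕ) (z : ι → ℤ), 0 < N ∧ ∀ i, (N : ℝ) * B (t a) i = z i := by
    intro a
    let v : ι → ℚ := fun i => ∑ j, q i j * u a j
    have hv : ∀ i, B (t a) i = (v i : ℝ) := by
      intro i
      simp [B, v, hu]
    refine ⟨∏ i, (v i).den, fun i => (v i).num * ∏ l ∈ Finset.univ.erase i, ((v l).den : ℤ),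
      Finset.prod_pos fun i _ => (v i).den_pos, fun i => ?_⟩
    rw [hv, ← Finset.mul_prod_erase _ _ (Finset.mem_univ i)]
    have hd : ((v i).den : ℝ) ≠ 0 := by exact_mod_cast (v i).den_ne_zero
    have hq : (v i : ℝ) * (v i).den = (v i).num := by
      exact_mod_cast Rat.mul_den_eq_num (v i)
    push_cast
    rw [← hq]
    ring
  choose N z hN hz using hden
  have hNR : ∀ a, (0 : ℝ) < N a := fun a => by exact_mod_cast hN a
  have hne : Nonempty κ := by
    by_contra h
    rw [not_nonempty_iff] at h
    simp at hw1
  obtain ⟨r, hr⟩ : ∃ r, Fintype.card κ = r + 1 := ⟨Fintype.card κ - 1, by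
    have := Fintype.card_pos (α := κ); omega⟩
  let e : κ ≃ Fin (r + 1) := Fintype.equivFinOfCardEq hr
  have hzB : ∀ a i, (z a i : ℝ) = N a * B (t a) i := fun a i => (hz a i).symm
  refine ⟨r, fun s => w (e.symm s) / N (e.symm s), fun s => z (e.symm s),
    fun s => div_nonneg (hw0 _) (hNR _).le, fun i => ?_, fun s p hp => ?_⟩
  · rw [e.symm.sum_comp (fun a => w a / N a * (z a i : ℝ)), hx, ← hsum]
    simp only [hzB, B, Finset.sum_apply, Pi.smul_apply, smul_eq_mul, Finset.mul_sum]
    rw [Finset.sum_comm]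
    refine Finset.sum_congr rfl fun a _ => Finset.sum_congr rfl fun j _ => ?_
    field_simp [(hNR a).ne']
  · set a := e.symm s
    have e1 : ∑ i, (p i : ℝ) * (z a i : ℝ) = N a * f p (t a) := by
      simp only [hzB, f, Finset.mul_sum]
      exact Finset.sum_congr rfl fun i _ => by ring
    have e2 : ∑ i, (p i : ℝ) * x i = f p β := by simp only [f, hBβ]
    rw [e1, e2, sign_mul, sign_pos (hNR a), one_mul]
    by_cases h0 : f p β = 0
    · rw [h0, hzero p h0]
    · exact htU a p hp h0

end

noncomputable section

open scoped BigOperators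

/-! ## The pairing and lattice points -/

section Pairing

variable {n : ℕ}

/-- The pairing with `u ∈ M` as a linear functional. -/
def pairingLin (u : Fin n → ℤ) : (Fin n → ℝ) →ₗ[ℝ] ℝ where
  toFun := pairing u
  map_add' v w := by simp [pairing, mul_add, Finset.sum_add_distrib]
  map_smul' c v := by simp [pairing, Finset.mul_sum, mul_left_comm]

lemma pairingLin_apply (u : Fin n → ℤ) (v : Fin n → ℝ) : pairingLin u v = pairing u v := rfl

lemma pairing_add_right (u : Fin n → ℤ) (v w : Fin n → ℝ) :
    pairing u (v + w) = pairing u v + pairing u w := (pairingLin u).map_add v w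

lemma pairing_neg_right (u : Fin n → ℤ) (v : Fin n → ℝ) :
    pairing u (-v) = -pairing u v := (pairingLin u).map_neg v

lemma pairing_smul_right (u : Fin n → ℤ) (c : ℝ) (v : Fin n → ℝ) :
    pairing u (c • v) = c * pairing u v := (pairingLin u).map_smul c v

lemma pairing_sum_right {J : Type*} (u : Fin n → ℤ) (s : Finset J) (v : J → Fin n → ℝ) :
    pairing u (∑ j ∈ s, v j) = ∑ j ∈ s, pairing u (v j) := map_sum (pairingLin u) v s

@[simp] lemma pairing_zero_right (u : Fin n → ℤ) : pairing u (0 : Fin n → ℝ) = 0 :=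
  (pairingLin u).map_zero

lemma pairing_add_left (u u' : Fin n → ℤ) (v : Fin n → ℝ) :
    pairing (u + u') v = pairing u v + pairing u' v := by
  simp [pairing, add_mul, Finset.sum_add_distrib]

lemma pairing_neg_left (u : Fin n → ℤ) (v : Fin n → ℝ) :
    pairing (-u) v = -pairing u v := by
  simp [pairing]

lemma pairing_sub_left (u u' : Fin n → ℤ) (v : Fin n → ℝ) :
    pairing (u - u') v = pairing u v - pairing u' v := by
  simp [pairing, sub_mul, Finset.sum_sub_distrib]

@[simp] lemma pairing_zero_left (v : Fin n → ℝ) : pairing (0 : Fin n → ℤ) v = 0 := by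
  simp [pairing]

lemma pairing_nsmul_left (m : ℕ) (u : Fin n → ℤ) (v : Fin n → ℝ) :
    pairing (m • u) v = m * pairing u v := by
  simp [pairing, Finset.mul_sum, mul_assoc]

lemma pairing_sum_left {J : Type*} (s : Finset J) (u : J → Fin n → ℤ) (v : Fin n → ℝ) :
    pairing (∑ j ∈ s, u j) v = ∑ j ∈ s, pairing (u j) v := by
  simp only [pairing, Finset.sum_apply, Int.cast_sum, Finset.sum_mul]
  exact Finset.sum_comm

lemma pairing_latticeVec (u v : Fin n → ℤ) : pairing u (latticeVec v) = ((u ⬝ᵥ v : ℤ) : ℝ) := by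
  simp [pairing, latticeVec, dotProduct]

lemma continuous_pairing (u : Fin n → ℤ) : Continuous (pairing u) := by
  unfold pairing; fun_prop

lemma latticeVec_add (v w : Fin n → ℤ) : latticeVec (v + w) = latticeVec v + latticeVec w := by
  ext; simp [latticeVec]

lemma latticeVec_zsmul (m : ℤ) (v : Fin n → ℤ) : latticeVec (m • v) = (m : ℝ) • latticeVec v := by
  ext; simp [latticeVec]

lemma latticeVec_nsmul (m : ℕ) (v : Fin n → ℤ) : latticeVec (m • v) = (m : ℝ) • latticeVec v := by
  ext; simp [latticeVec]

@[simp] lemma latticeVec_zero : latticeVec (0 : Fin n → ℤ) = 0 := by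
  ext; simp [latticeVec]

lemma latticeVec_neg (v : Fin n → ℤ) : latticeVec (-v) = -latticeVec v := by
  ext; simp [latticeVec]

lemma latticeVec_sum {J : Type*} (s : Finset J) (v : J → Fin n → ℤ) :
    latticeVec (∑ j ∈ s, v j) = ∑ j ∈ s, latticeVec (v j) := by
  ext; simp [latticeVec]

lemma latticeVec_injective : Function.Injective (latticeVec (n := n)) := by
  intro v w h
  ext i
  have := congrFun h i
  simpa [latticeVec] using this

lemma mem_hull_lattice {s : Finset (Fin n → ℤ)} {v : Fin n → ℝ} :
    v ∈ PointedCone.hull ℝ (latticeVec '' (s : Set (Fin n → ℤ))) ↔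
      ∃ c : (Fin n → ℤ) → ℝ, (∀ g, 0 ≤ c g) ∧ v = ∑ g ∈ s, c g • latticeVec g := by
  classical
  constructor
  · intro hv
    induction hv using Submodule.span_induction with
    | mem x hx =>
      obtain ⟨g, hg, rfl⟩ := hx
      refine ⟨Pi.single g 1, fun h => ?_, ?_⟩
      · by_cases e : h = g
        · subst e; simp
        · simp [e]
      · rw [Finset.sum_eq_single g]
        · simp
        · intro h _ hne; simp [hne]
        · intro h; exact absurd hg h
    | zero => exact ⟨0, fun _ => le_rfl, by simp⟩
    | add x y _ _ hx hy =>
      obtain ⟨c, hc, rfl⟩ := hx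
      obtain ⟨d, hd, rfl⟩ := hy
      exact ⟨c + d, fun g => add_nonneg (hc g) (hd g), by
        simp [add_smul, Finset.sum_add_distrib]⟩
    | smul r x _ hx =>
      obtain ⟨c, hc, rfl⟩ := hx
      refine ⟨fun g => r * c g, fun g => mul_nonneg r.2 (hc g), ?_⟩
      rw [show r • (∑ g ∈ s, c g • latticeVec g) = (r : ℝ) • ∑ g ∈ s, c g • latticeVec g from rfl,
        Finset.smul_sum]
      simp [smul_smul]
  · rintro ⟨c, hc, rfl⟩
    exact sum_mem fun g hg => PointedCone.smul_mem _ (hc g) (Submodule.subset_span ⟨g, hg, rfl⟩)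

/-- Farkas' lemma separates by a real functional. By `exists_int_decomposition` that functional is a
nonnegative combination of integral ones with the same signs on `s`, so some integral one already
separates. -/
lemma exists_separating {s : Finset (Fin n → ℤ)} {v : Fin n → ℝ}
    (hv : v ∉ PointedCone.hull ℝ (latticeVec '' (s : Set (Fin n → ℤ)))) :
    ∃ u : Fin n → ℤ, (∀ g ∈ s, 0 ≤ u ⬝ᵥ g) ∧ pairing u v < 0 := by
  by_contra hcon
  push Not at hcon
  apply hv
  obtain ⟨r, hr, e⟩ := farkas_vector (fun g : s => latticeVec g.1) v (fun y hy => by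
    obtain ⟨m, c, z, hc, hx, hs⟩ := exists_int_decomposition s y
    have e1 : ∑ i, y i * v i = ∑ t, c t * pairing (z t) v := by
      simp only [pairing, Finset.mul_sum]
      rw [Finset.sum_comm]
      refine Finset.sum_congr rfl fun i _ => ?_
      rw [hx i, Finset.sum_mul]
      exact Finset.sum_congr rfl fun t _ => by ring
    rw [e1]
    refine Finset.sum_nonneg fun t _ => mul_nonneg (hc t) (hcon _ fun g hg => ?_)
    have h1 := hs t g hg
    have h2 : 0 ≤ ∑ i, (g i : ℝ) * y i := by
      have := hy ⟨g, hg⟩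
      simpa [latticeVec, mul_comm] using this
    have h3 : 0 ≤ ∑ i, (g i : ℝ) * (z t i : ℝ) := by
      rw [← sign_nonneg_iff, h1, sign_nonneg_iff]; exact h2
    have h4 : ∑ i, (g i : ℝ) * (z t i : ℝ) = ((z t ⬝ᵥ g : ℤ) : ℝ) := by
      simp [dotProduct, mul_comm]
    rw [h4] at h3
    exact_mod_cast h3)
  rw [e]
  exact sum_mem fun g _ => PointedCone.smul_mem _ (hr g) (Submodule.subset_span ⟨g.1, g.2, rfl⟩)

/-- An integer functional which is nonnegative where the functionals `a j` are has a positive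
multiple that is a combination of the `a j` with natural coefficients. -/
lemma farkas_int {J : Type*} [Fintype J] (a : J → Fin n → ℤ) (u : Fin n → ℤ)
    (h : ∀ w : Fin n → ℝ, (∀ j, 0 ≤ pairing (a j) w) → 0 ≤ pairing u w) :
    ∃ (q : ℕ) (c : J → ℕ), 0 < q ∧ q • u = ∑ j, c j • a j := by
  classical
  obtain ⟨r, hr, e⟩ := farkas_vector (fun j => latticeVec (a j)) (latticeVec u) (fun y hy => by
    have := h y (fun j => by simpa [pairing, latticeVec, mul_comm] using hy j)
    simpa [pairing, latticeVec, mul_comm] using this)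
  -- The relation `u = ∑ r j • a j` is homogenized by giving `u` the coefficient `1`. The forms in
  -- `F` encode this relation coordinate by coordinate and the signs of the coefficients; an
  -- integral vector with the same signs then has a positive entry at `none`, which becomes `q`.
  let x : Option J → ℝ := fun o => o.elim 1 r
  let F : Finset (Option J → ℤ) :=
    (Finset.univ.image fun i : Fin n => fun o : Option J => o.elim (-(u i)) fun j => a j i) ∪
    (Finset.univ.image fun o : Option J => Pi.single o 1)
  obtain ⟨m, c, z, hc, hx, hs⟩ := exists_int_decomposition F x
  have hpos : ∀ o, SignType.sign ((z 0 o : ℤ) : ℝ) = SignType.sign (x o) := by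
    intro o
    have := hs 0 (Pi.single o 1) (by simp [F])
    simpa [Pi.single_apply] using this
  have hq : 0 < z 0 none := by
    have := hpos none
    simp only [x, Option.elim, sign_one] at this
    rw [sign_eq_one_iff] at this
    exact_mod_cast this
  have hcj : ∀ j, 0 ≤ z 0 (some j) := by
    intro j
    have h1 : (0 : ℝ) ≤ z 0 (some j) := by
      rw [← sign_nonneg_iff, hpos, sign_nonneg_iff]; exact hr j
    exact_mod_cast h1
  refine ⟨(z 0 none).toNat, fun j => (z 0 (some j)).toNat, by omega, ?_⟩
  ext i
  have h1 := hs 0 (fun o : Option J => o.elim (-(u i)) fun j => a j i) (by simp [F])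
  have h2 : ∑ o : Option J, ((o.elim (-(u i)) fun j => a j i : ℤ) : ℝ) * x o = 0 := by
    rw [Fintype.sum_option]
    have := congrFun e i
    simp only [latticeVec, Finset.sum_apply, Pi.smul_apply, smul_eq_mul] at this
    simp only [Option.elim, x]
    push_cast
    rw [this]
    simp [mul_comm]
  rw [h2, sign_zero, sign_eq_zero_iff, Fintype.sum_option] at h1
  have h3 : -(u i) * z 0 none + ∑ j, a j i * z 0 (some j) = 0 := by exact_mod_cast h1
  have h4 : ∀ j, (((z 0 (some j)).toNat : ℕ) : ℤ) = z 0 (some j) :=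
    fun j => Int.toNat_of_nonneg (hcj j)
  simp only [Pi.smul_apply, Finset.sum_apply, ← natCast_zsmul, smul_eq_mul,
    Int.toNat_of_nonneg hq.le, h4]
  have h5 : ∑ j, z 0 (some j) * a j i = ∑ j, a j i * z 0 (some j) :=
    Finset.sum_congr rfl fun j _ => mul_comm _ _
  rw [h5]
  linarith

end Pairing

/-! ## Rational cones -/

section RationalCone

variable {n : ℕ}

/-- A cone generated by finitely many lattice vectors. -/
def IsRational (σ : PointedCone ℝ (Fin n → ℝ)) : Prop :=
  ∃ s : Finset (Fin n → ℤ), σ = PointedCone.hull ℝ (latticeVec '' s)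

/-- The semigroup `σ^∨ ∩ M`. -/
def dualSemigroup (σ : PointedCone ℝ (Fin n → ℝ)) : AddSubmonoid (Fin n → ℤ) where
  carrier := {u | ∀ v ∈ σ, 0 ≤ pairing u v}
  zero_mem' := by simp
  add_mem' hu hv w hw := by rw [pairing_add_left]; exact add_nonneg (hu w hw) (hv w hw)

lemma mem_dualSemigroup {σ : PointedCone ℝ (Fin n → ℝ)} {u : Fin n → ℤ} :
    u ∈ dualSemigroup σ ↔ ∀ v ∈ σ, 0 ≤ pairing u v := Iff.rfl

lemma dualSemigroup_anti {σ τ : PointedCone ℝ (Fin n → ℝ)} (h : τ ≤ σ) :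
    dualSemigroup σ ≤ dualSemigroup τ := fun _ hu v hv => hu v (h hv)

lemma mem_dualSemigroup_hull {s : Set (Fin n → ℤ)} {u : Fin n → ℤ} :
    u ∈ dualSemigroup (PointedCone.hull ℝ (latticeVec '' s)) ↔ ∀ g ∈ s, 0 ≤ u ⬝ᵥ g := by
  constructor
  · intro h g hg
    have := h _ (Submodule.subset_span ⟨g, hg, rfl⟩)
    rw [pairing_latticeVec] at this
    exact_mod_cast this
  · intro h v hv
    have : PointedCone.hull ℝ (latticeVec '' s) ≤
        (PointedCone.positive ℝ ℝ).comap (pairingLin u) := by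
      refine Submodule.span_le.2 ?_
      rintro _ ⟨g, hg, rfl⟩
      change 0 ≤ pairing u (latticeVec g)
      rw [pairing_latticeVec]
      exact_mod_cast h g hg
    exact this hv

/-- Bidual description of a rational cone. -/
lemma IsRational.mem_iff {σ : PointedCone ℝ (Fin n → ℝ)} (hσ : IsRational σ) {v : Fin n → ℝ} :
    v ∈ σ ↔ ∀ u ∈ dualSemigroup σ, 0 ≤ pairing u v := by
  obtain ⟨s, rfl⟩ := hσ
  refine ⟨fun hv u hu => hu v hv, fun h => ?_⟩
  by_contra hv
  obtain ⟨u, hu, hneg⟩ := exists_separating hv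
  exact absurd (h u (mem_dualSemigroup_hull.2 hu)) (not_le.2 hneg)

lemma IsRational.isClosed {σ : PointedCone ℝ (Fin n → ℝ)} (hσ : IsRational σ) :
    IsClosed (σ : Set (Fin n → ℝ)) := by
  have : (σ : Set (Fin n → ℝ)) = ⋂ u ∈ dualSemigroup σ, {v | 0 ≤ pairing u v} := by
    ext v; simp [hσ.mem_iff]
  rw [this]
  exact isClosed_biInter fun u _ => isClosed_le continuous_const (continuous_pairing u)

/-- The semigroup of lattice points of the dual of a rational cone is finitely generated. -/
lemma IsRational.dualSemigroup_fg {σ : PointedCone ℝ (Fin n → ℝ)} (hσ : IsRational σ) :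
    ∃ T : Finset (Fin n → ℤ), AddSubmonoid.closure (T : Set (Fin n → ℤ)) = dualSemigroup σ := by
  classical
  obtain ⟨s, rfl⟩ := hσ
  -- Gordan's argument: `D` is the dual cone. Its real generators are first replaced by finitely
  -- many lattice vectors `Z` of the dual cone.
  obtain ⟨D, ⟨G, rfl⟩, hD⟩ := exists_fg_of_inequalities (fun g : s => pairingLin g.1)
  have hz : ∀ g : G, ∃ (r : ℕ) (c : Fin (r + 1) → ℝ) (z : Fin (r + 1) → Fin n → ℤ),
      (∀ t, 0 ≤ c t) ∧ (∀ i, g.1 i = ∑ t, c t * (z t i : ℝ)) ∧ ∀ t, ∀ p ∈ s,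
        SignType.sign (∑ i, (p i : ℝ) * (z t i : ℝ)) =
        SignType.sign (∑ i, (p i : ℝ) * g.1 i) := fun g => exists_int_decomposition s g.1
  choose r c z hc hx hs using hz
  let Z : Finset (Fin n → ℤ) := Finset.univ.biUnion fun g : G => Finset.univ.image (z g)
  have hZdual : ∀ u ∈ Z, ∀ p ∈ s, 0 ≤ u ⬝ᵥ p := by
    intro u hu p hp
    simp only [Z, Finset.mem_biUnion, Finset.mem_univ, true_and, Finset.mem_image] at hu
    obtain ⟨g, t, rfl⟩ := hu
    have h1 : 0 ≤ pairingLin p g.1 := (hD g.1).1 (Submodule.subset_span g.2) ⟨p, hp⟩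
    have h2 : 0 ≤ ∑ i, (p i : ℝ) * (z g t i : ℝ) := by
      rw [← sign_nonneg_iff, hs g t p hp, sign_nonneg_iff]; exact h1
    have h4 : ∑ i, (p i : ℝ) * (z g t i : ℝ) = ((z g t ⬝ᵥ p : ℤ) : ℝ) := by
      simp [dotProduct, mul_comm]
    rw [h4] at h2
    exact_mod_cast h2
  have hle : (Submodule.span _ (G : Set (Fin n → ℝ)) : PointedCone ℝ (Fin n → ℝ)) ≤
      PointedCone.hull ℝ (latticeVec '' (Z : Set (Fin n → ℤ))) := by
    refine Submodule.span_le.2 fun g hg => ?_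
    have : g = ∑ t, c ⟨g, hg⟩ t • latticeVec (z ⟨g, hg⟩ t) := by
      ext i; simpa [latticeVec] using hx ⟨g, hg⟩ i
    rw [this]
    refine sum_mem fun t _ => PointedCone.smul_mem _ (hc _ t) (Submodule.subset_span ⟨_, ?_, rfl⟩)
    simp only [Z, Finset.coe_biUnion, Set.mem_iUnion]
    exact ⟨⟨g, hg⟩, by simp, by simp⟩
  -- lattice points of the box spanned by `Z`
  let M : ℝ := ∑ z ∈ Z, ‖latticeVec z‖
  have hbox : {u : Fin n → ℤ | ‖latticeVec u‖ ≤ M}.Finite := by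
    have : {u : Fin n → ℤ | ‖latticeVec u‖ ≤ M} ⊆
        Set.univ.pi fun _ => Set.Icc (-⌊M⌋) ⌊M⌋ := by
      intro u hu i _
      have h1 : |(u i : ℝ)| ≤ M := (norm_le_pi_norm (latticeVec u) i).trans hu
      rw [abs_le] at h1
      refine ⟨?_, Int.le_floor.2 h1.2⟩
      rw [neg_le]
      exact Int.le_floor.2 (by push_cast; linarith [h1.1])
    exact (Set.Finite.pi fun _ => Set.finite_Icc _ _).subset this
  let T : Finset (Fin n → ℤ) := Z ∪ hbox.toFinset.filter fun u => ∀ p ∈ s, 0 ≤ u ⬝ᵥ p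
  refine ⟨T, le_antisymm ?_ ?_⟩
  · refine (AddSubmonoid.closure_le).2 fun u hu => ?_
    rw [SetLike.mem_coe, mem_dualSemigroup_hull]
    simp only [T, Finset.coe_union, Set.mem_union, Finset.mem_coe, Finset.mem_filter] at hu
    rcases hu with hu | hu
    · exact hZdual u hu
    · exact hu.2
  · intro u hu
    rw [mem_dualSemigroup_hull] at hu
    have h1 : latticeVec u ∈ (Submodule.span _ (G : Set (Fin n → ℝ)) :
        PointedCone ℝ (Fin n → ℝ)) := by
      rw [hD]
      intro g
      rw [pairingLin_apply, pairing_latticeVec, dotProduct_comm]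
      exact_mod_cast hu g.1 g.2
    obtain ⟨d, hd, he⟩ := mem_hull_lattice.1 (hle h1)
    -- Splitting the coefficients into integral and fractional parts leaves a lattice point of the
    -- dual cone of norm at most `M`.
    let u₀ : Fin n → ℤ := ∑ z ∈ Z, ⌊d z⌋.toNat • z
    have hfl : ∀ z, ((⌊d z⌋.toNat : ℕ) : ℝ) = (⌊d z⌋ : ℝ) := by
      intro z
      exact_mod_cast congrArg (Int.cast : ℤ → ℝ) (Int.toNat_of_nonneg (Int.floor_nonneg.2 (hd z)))
    have hrem : latticeVec (u - u₀) = ∑ z ∈ Z, Int.fract (d z) • latticeVec z := by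
      rw [sub_eq_add_neg, latticeVec_add, latticeVec_neg, he, latticeVec_sum, ← sub_eq_add_neg,
        ← Finset.sum_sub_distrib]
      refine Finset.sum_congr rfl fun z _ => ?_
      rw [latticeVec_nsmul, ← sub_smul, hfl]
      rfl
    have hmem : u - u₀ ∈ T := by
      simp only [T, Finset.mem_union, Finset.mem_filter, Set.Finite.mem_toFinset,
        Set.mem_ofPred_eq]
      refine Or.inr ⟨?_, fun p hp => ?_⟩
      · rw [hrem]
        refine (norm_sum_le _ _).trans (Finset.sum_le_sum fun z _ => ?_)
        rw [norm_smul, Real.norm_of_nonneg (Int.fract_nonneg _)]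
        exact mul_le_of_le_one_left (norm_nonneg _) (Int.fract_lt_one _).le
      · have : (0 : ℝ) ≤ pairing p (latticeVec (u - u₀)) := by
          rw [hrem, pairing_sum_right]
          refine Finset.sum_nonneg fun z hz => ?_
          rw [pairing_smul_right, pairing_latticeVec, dotProduct_comm]
          exact mul_nonneg (Int.fract_nonneg _) (by exact_mod_cast hZdual z hz p hp)
        rw [pairing_latticeVec, dotProduct_comm] at this
        exact_mod_cast this
    have : u = u₀ + (u - u₀) := by abel
    rw [this]
    refine add_mem (sum_mem fun z hz => AddSubmonoid.nsmul_mem _ (AddSubmonoid.subset_closure ?_) _)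
      (AddSubmonoid.subset_closure hmem)
    simp [T, Finset.mem_coe.1 hz]

end RationalCone

end

noncomputable section

open scoped BigOperators

/-! ### Faces, relative interiors and primitive vectors of rational cones -/

section Faces

variable {n : ℕ}

/-- The face of `σ` on which `u` vanishes. -/
def faceCone (σ : PointedCone ℝ (Fin n → ℝ)) (u : Fin n → ℤ) : PointedCone ℝ (Fin n → ℝ) :=
  σ ⊓ PointedCone.ofSubmodule (LinearMap.ker (pairingLin u))

lemma mem_faceCone {σ : PointedCone ℝ (Fin n → ℝ)} {u : Fin n → ℤ} {v : Fin n → ℝ} :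
    v ∈ faceCone σ u ↔ v ∈ σ ∧ pairing u v = 0 := Iff.rfl

lemma isConeFace_faceCone {σ : PointedCone ℝ (Fin n → ℝ)} {u : Fin n → ℤ}
    (hu : u ∈ dualSemigroup σ) : IsConeFace (faceCone σ u) σ := ⟨u, hu, fun _ => mem_faceCone⟩

/-- `w` lies in the relative interior of `σ`: every supporting functional vanishing at `w`
vanishes on `σ`. -/
def IsRelint (σ : PointedCone ℝ (Fin n → ℝ)) (w : Fin n → ℝ) : Prop :=
  w ∈ σ ∧ ∀ u ∈ dualSemigroup σ, pairing u w = 0 → ∀ v ∈ σ, pairing u v = 0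

/-- The sum of the generators works: a nonnegative functional vanishing on the sum vanishes on each
summand. -/
lemma IsRational.exists_relint {σ : PointedCone ℝ (Fin n → ℝ)} (hσ : IsRational σ) :
    ∃ w : Fin n → ℤ, IsRelint σ (latticeVec w) := by
  obtain ⟨s, rfl⟩ := hσ
  refine ⟨∑ g ∈ s, g, ?_, fun u hu h0 v hv => ?_⟩
  · rw [latticeVec_sum]
    exact sum_mem fun g hg => Submodule.subset_span ⟨g, hg, rfl⟩
  · rw [latticeVec_sum, pairing_sum_right, Finset.sum_eq_zero_iff_of_nonneg
      (fun g hg => hu _ (Submodule.subset_span ⟨g, hg, rfl⟩))] at h0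
    obtain ⟨c, hc, rfl⟩ := mem_hull_lattice.1 hv
    rw [pairing_sum_right]
    exact Finset.sum_eq_zero fun g hg => by rw [pairing_smul_right, h0 g hg, mul_zero]

/-- In a set of supporting functionals closed under addition there is one which cuts out the
smallest face. -/
lemma exists_smallest_face {s : Finset (Fin n → ℤ)} (Q : AddSubmonoid (Fin n → ℤ))
    (hQ : ∀ u ∈ Q, ∀ g ∈ s, 0 ≤ u ⬝ᵥ g) :
    ∃ u₀ ∈ Q, ∀ u ∈ Q, ∀ g ∈ s, u₀ ⬝ᵥ g = 0 → u ⬝ᵥ g = 0 := by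
  classical
  let f : (Fin n → ℤ) → ℕ := fun u => (s.filter fun g => u ⬝ᵥ g = 0).card
  obtain ⟨u₀, h₀, hmin⟩ : ∃ u₀ ∈ Q, ∀ u ∈ Q, f u₀ ≤ f u := by
    obtain ⟨_, ⟨u₀, h, rfl⟩, hm⟩ := WellFounded.has_min (wellFounded_lt (α := ℕ))
      (f '' (Q : Set (Fin n → ℤ))) ⟨_, 0, Q.zero_mem, rfl⟩
    exact ⟨u₀, h, fun u hu => not_lt.1 (hm _ ⟨u, hu, rfl⟩)⟩
  refine ⟨u₀, h₀, fun u hu g hg h0 => ?_⟩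
  -- `u₀` kills as few generators as possible, while `u₀ + u` kills only those killed by both.
  -- Minimality makes the two sets equal.
  have hsub : (s.filter fun g => (u₀ + u) ⬝ᵥ g = 0) ⊆ s.filter fun g => u₀ ⬝ᵥ g = 0 := by
    intro h hh
    rw [Finset.mem_filter] at hh ⊢
    refine ⟨hh.1, ?_⟩
    have := hh.2
    rw [add_dotProduct] at this
    linarith [hQ u₀ h₀ h hh.1, hQ u hu h hh.1]
  have heq := Finset.eq_of_subset_of_card_le hsub (hmin _ (Q.add_mem h₀ hu))
  have : g ∈ s.filter fun g => (u₀ + u) ⬝ᵥ g = 0 := by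
    rw [heq, Finset.mem_filter]; exact ⟨hg, h0⟩
  rw [Finset.mem_filter, add_dotProduct, h0, zero_add] at this
  exact this.2

/-- In a nonnegative combination annihilated by `u`, every generator with nonzero coefficient is
annihilated too. -/
lemma faceCone_hull {s : Finset (Fin n → ℤ)} {u : Fin n → ℤ} (hu : ∀ g ∈ s, 0 ≤ u ⬝ᵥ g) :
    faceCone (PointedCone.hull ℝ (latticeVec '' (s : Set (Fin n → ℤ)))) u =
      PointedCone.hull ℝ (latticeVec '' ((s.filter fun g => u ⬝ᵥ g = 0 :
        Finset (Fin n → ℤ)) : Set (Fin n → ℤ))) := by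
  classical
  ext v
  rw [mem_faceCone]
  constructor
  · rintro ⟨hv, h0⟩
    obtain ⟨c, hc, rfl⟩ := mem_hull_lattice.1 hv
    rw [pairing_sum_right, Finset.sum_eq_zero_iff_of_nonneg (fun g hg => by
      rw [pairing_smul_right, pairing_latticeVec]
      exact mul_nonneg (hc g) (by exact_mod_cast hu g hg))] at h0
    refine sum_mem fun g hg => ?_
    by_cases hcg : c g = 0
    · rw [hcg, zero_smul]; exact zero_mem _
    · refine PointedCone.smul_mem _ (hc g) (Submodule.subset_span ⟨g, ?_, rfl⟩)
      have := h0 g hg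
      rw [pairing_smul_right, pairing_latticeVec, mul_eq_zero] at this
      have h1 := this.resolve_left hcg
      simp only [Finset.coe_filter, Set.mem_ofPred_eq]
      exact ⟨hg, by exact_mod_cast h1⟩
  · intro hv
    obtain ⟨c, hc, rfl⟩ := mem_hull_lattice.1 hv
    refine ⟨sum_mem fun g hg => PointedCone.smul_mem _ (hc g)
      (Submodule.subset_span ⟨g, (Finset.mem_filter.1 hg).1, rfl⟩), ?_⟩
    rw [pairing_sum_right]
    refine Finset.sum_eq_zero fun g hg => ?_
    rw [pairing_smul_right, pairing_latticeVec, (Finset.mem_filter.1 hg).2]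
    simp

/-- The dual semigroup of a face is obtained by inverting the functional defining the face. -/
lemma IsRational.exists_add_nsmul_mem {σ : PointedCone ℝ (Fin n → ℝ)} (hσ : IsRational σ)
    {u₀ u : Fin n → ℤ} (h₀ : u₀ ∈ dualSemigroup σ) (hu : u ∈ dualSemigroup (faceCone σ u₀)) :
    ∃ k : ℕ, u + k • u₀ ∈ dualSemigroup σ := by
  obtain ⟨s, rfl⟩ := hσ
  rw [mem_dualSemigroup_hull] at h₀
  -- Generators on the face already pair nonnegatively with `u`. On the others the integer `u₀ ⬝ᵥ g`
  -- is at least `1`, so a multiple exceeding all the deficits suffices.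
  refine ⟨∑ g ∈ s, (-(u ⬝ᵥ g)).toNat, mem_dualSemigroup_hull.2 fun g hg => ?_⟩
  rw [add_dotProduct, smul_dotProduct, nsmul_eq_mul]
  rcases (h₀ g hg).eq_or_lt with h | h
  · rw [← h, mul_zero, add_zero]
    have := hu (latticeVec g) (mem_faceCone.2 ⟨Submodule.subset_span ⟨g, hg, rfl⟩, by
      rw [pairing_latticeVec, ← h]; simp⟩)
    rw [pairing_latticeVec] at this
    exact_mod_cast this
  · have h1 : (-(u ⬝ᵥ g)).toNat ≤ ∑ g ∈ s, (-(u ⬝ᵥ g)).toNat :=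
      Finset.single_le_sum (f := fun g => (-(u ⬝ᵥ g)).toNat) (fun _ _ => Nat.zero_le _) hg
    have h2 : -(u ⬝ᵥ g) ≤ ((∑ g ∈ s, (-(u ⬝ᵥ g)).toNat : ℕ) : ℤ) :=
      (Int.self_le_toNat _).trans (by exact_mod_cast h1)
    nlinarith

/-- Every point of a rational cone lies in the relative interior of a face. -/
lemma IsRational.exists_face_relint {σ : PointedCone ℝ (Fin n → ℝ)} (hσ : IsRational σ)
    {w : Fin n → ℝ} (hw : w ∈ σ) :
    ∃ u ∈ dualSemigroup σ, IsRelint (_root_.faceCone σ u) w := by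
  have hσ' := hσ
  obtain ⟨s, rfl⟩ := hσ'
  let σ := PointedCone.hull ℝ (latticeVec '' (s : Set (Fin n → ℤ)))
  let Q : AddSubmonoid (Fin n → ℤ) := 
    { carrier := {u | u ∈ dualSemigroup σ ∧ pairing u w = 0}
      zero_mem' := ⟨zero_mem _, by simp⟩
      add_mem' := fun {a b} ha hb => ⟨add_mem ha.1 hb.1, by
        rw [pairing_add_left, ha.2, hb.2, add_zero]⟩ }
  obtain ⟨u₀, h₀, hmin⟩ := exists_smallest_face (s := s) Q
    (fun u hu => mem_dualSemigroup_hull.1 hu.1)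
  refine ⟨u₀, h₀.1, mem_faceCone.2 ⟨hw, h₀.2⟩, fun u hu h0 v hv => ?_⟩
  obtain ⟨k, hk⟩ := hσ.exists_add_nsmul_mem h₀.1 hu
  have hkQ : u + k • u₀ ∈ Q := ⟨hk, by
    rw [pairing_add_left, pairing_nsmul_left, h0, h₀.2]; simp⟩
  rw [faceCone_hull (mem_dualSemigroup_hull.1 h₀.1)] at hv
  obtain ⟨c, hc, rfl⟩ := mem_hull_lattice.1 hv
  rw [pairing_sum_right]
  refine Finset.sum_eq_zero fun g hg => ?_
  rw [Finset.mem_filter] at hg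
  have h1 := hmin _ hkQ g hg.1 hg.2
  rw [add_dotProduct, smul_dotProduct, hg.2, smul_zero, add_zero] at h1
  rw [pairing_smul_right, pairing_latticeVec, h1]
  simp

/-- A linear functional with strict signs on the remaining generators of a strongly convex cone. -/
lemma exists_pos_functional (s : Finset (Fin n → ℤ)) (e : Fin n → ℤ)
    (h : ∀ c : (Fin n → ℤ) → ℝ, (∀ g, 0 ≤ c g) → ∀ t : ℝ,
      ∑ g ∈ s, c g • latticeVec g = t • latticeVec e → ∀ g ∈ s, c g = 0) :
    ∃ u : Fin n → ℤ, u ⬝ᵥ e = 0 ∧ ∀ g ∈ s, 0 < u ⬝ᵥ g := by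
  classical
  have hsep : ∀ g₀ ∈ s, ∃ u : Fin n → ℤ, u ⬝ᵥ e = 0 ∧ (∀ g ∈ s, 0 ≤ u ⬝ᵥ g) ∧ 0 < u ⬝ᵥ g₀ := by
    intro g₀ hg₀
    -- Were `-g₀` in the cone generated by `s` and the line through `e`, there would be a forbidden
    -- relation in which `g₀` has coefficient at least `1`. Separating `-g₀` from this cone gives a
    -- functional vanishing on `e` and positive at `g₀`; summing over `g₀` makes it positive on all
    -- of `s`.
    have hnot : latticeVec (-g₀) ∉ PointedCone.hull ℝ
        (latticeVec '' ((s ∪ {e, -e} : Finset (Fin n → ℤ)) : Set (Fin n → ℤ))) := by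
      intro hmem
      have h1 : (PointedCone.hull ℝ (latticeVec '' ((s ∪ {e, -e} : Finset (Fin n → ℤ)) :
          Set (Fin n → ℤ)))) ≤ PointedCone.hull ℝ (latticeVec '' (s : Set (Fin n → ℤ))) ⊔
            PointedCone.ofSubmodule (Submodule.span ℝ {latticeVec e}) := by
        refine Submodule.span_le.2 ?_
        rintro _ ⟨g, hg, rfl⟩
        simp only [Finset.coe_union, Finset.coe_insert, Finset.coe_singleton, Set.mem_union,
          Set.mem_insert_iff, Set.mem_singleton_iff, Finset.mem_coe] at hg
        rcases hg with hg | rfl | rfl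
        · exact Submodule.mem_sup_left (Submodule.subset_span ⟨g, hg, rfl⟩)
        · exact Submodule.mem_sup_right (Submodule.mem_span_singleton_self _)
        · refine Submodule.mem_sup_right ?_
          rw [latticeVec_neg]
          exact Submodule.neg_mem (Submodule.span ℝ {latticeVec e})
            (Submodule.mem_span_singleton_self _)
      obtain ⟨y, hy, z, hz, hyz⟩ := Submodule.mem_sup.1 (h1 hmem)
      obtain ⟨c, hc, rfl⟩ := mem_hull_lattice.1 hy
      obtain ⟨t, rfl⟩ := Submodule.mem_span_singleton.1
        (show z ∈ Submodule.span ℝ {latticeVec e} from hz)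
      have := h (c + Pi.single g₀ 1) (fun g => add_nonneg (hc g) (by
        by_cases e : g = g₀
        · subst e; simp
        · simp [e])) (-t) (by
          simp only [Pi.add_apply, add_smul, Finset.sum_add_distrib]
          have e1 : ∑ x ∈ s, (Pi.single g₀ 1 : (Fin n → ℤ) → ℝ) x • latticeVec x =
              latticeVec g₀ := by
            rw [Finset.sum_eq_single_of_mem g₀ hg₀ (fun b _ hb => by simp [hb])]
            simp
          rw [latticeVec_neg] at hyz
          rw [e1, neg_smul, eq_neg_iff_add_eq_zero, add_right_comm, hyz, neg_add_cancel]) g₀ hg₀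
      simp only [Pi.add_apply, Pi.single_eq_same] at this
      linarith [hc g₀]
    obtain ⟨u, hu, hneg⟩ := exists_separating hnot
    refine ⟨u, ?_, fun g hg => hu g (by simp [hg]), ?_⟩
    · have h1 := hu e (by simp)
      have h2 := hu (-e) (by simp)
      rw [dotProduct_neg] at h2
      linarith
    · rw [pairing_latticeVec, dotProduct_neg] at hneg
      have : -(u ⬝ᵥ g₀) < 0 := by exact_mod_cast hneg
      linarith
  choose! U hU using hsep
  refine ⟨∑ g ∈ s, U g, ?_, fun g hg => ?_⟩
  · rw [sum_dotProduct]
    exact Finset.sum_eq_zero fun g hg => (hU g hg).1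
  · rw [sum_dotProduct]
    exact Finset.sum_pos' (fun i hi => (hU i hi).2.1 g hg) ⟨g, hg, (hU g hg).2.2⟩

lemma exists_primitive (v : Fin n → ℤ) (hv : v ≠ 0) :
    ∃ (m : ℤ) (w : Fin n → ℤ), 0 < m ∧ v = m • w ∧ IsPrimitive w := by
  let d : ℤ := Finset.univ.gcd v
  have hd : d ≠ 0 := by
    intro h
    rw [Finset.gcd_eq_zero_iff] at h
    exact hv (funext fun i => h i (Finset.mem_univ _))
  have hd0 : 0 ≤ d := Int.nonneg_of_normalize_eq_self (Finset.normalize_gcd (s := Finset.univ) (f := v))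
  choose! w hw using fun i => Finset.gcd_dvd (f := v) (Finset.mem_univ i)
  refine ⟨d, w, lt_of_le_of_ne hd0 hd.symm, funext fun i => hw i, ?_⟩
  intro m w' hw'
  have : d * m ∣ d := Finset.dvd_gcd fun i _ => ⟨w' i, by rw [hw i, hw']; simp [d, mul_assoc]⟩
  rw [isUnit_iff_dvd_one]
  have h2 : d * m ∣ d * 1 := by simpa using this
  exact (mul_dvd_mul_iff_left hd).1 h2

/-- Bézout: a generator of the ideal of the coordinates divides `v`, hence is a unit. The character
`χ^u` will be a uniformizer along the divisor attached to `v`. -/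
lemma IsPrimitive.exists_dotProduct_eq_one {v : Fin n → ℤ} (hv : IsPrimitive v) :
    ∃ u : Fin n → ℤ, u ⬝ᵥ v = 1 := by
  let I : Ideal ℤ := Ideal.span (Set.range v)
  obtain ⟨d, hd⟩ := (IsPrincipalIdealRing.principal I).principal
  have hdvd : ∀ i, d ∣ v i := fun i => by
    have : v i ∈ I := Ideal.subset_span ⟨i, rfl⟩
    rw [hd] at this
    exact Ideal.mem_span_singleton.1 this
  choose w hw using hdvd
  have hu : IsUnit d := hv d w (funext hw)
  have h1 : (1 : ℤ) ∈ I := by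
    rw [hd]; exact Ideal.mem_span_singleton.2 hu.dvd
  obtain ⟨c, hc⟩ := (Ideal.mem_span_range_iff_exists_fun).1 h1
  exact ⟨c, by simpa [dotProduct] using hc⟩

lemma IsPrimitive.ne_zero {v : Fin n → ℤ} (hv : IsPrimitive v) : v ≠ 0 := by
  rintro rfl
  obtain ⟨u, hu⟩ := hv.exists_dotProduct_eq_one
  simp at hu

lemma mem_rayCone {v : Fin n → ℤ} {w : Fin n → ℝ} :
    w ∈ rayCone v ↔ ∃ c : ℝ, 0 ≤ c ∧ w = c • latticeVec v := by
  unfold rayCone PointedCone.hull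
  rw [Submodule.mem_span_singleton]
  constructor
  · rintro ⟨c, rfl⟩; exact ⟨c, c.2, rfl⟩
  · rintro ⟨c, hc, rfl⟩; exact ⟨⟨c, hc⟩, rfl⟩

lemma latticeVec_mem_rayCone (v : Fin n → ℤ) : latticeVec v ∈ rayCone v :=
  Submodule.subset_span rfl

lemma rayCone_isRational (v : Fin n → ℤ) : IsRational (rayCone v) := ⟨{v}, by simp [rayCone]⟩

/-- A primitive vector is determined by any positive multiple. -/
lemma IsPrimitive.eq_of_smul {v w : Fin n → ℤ} (hv : IsPrimitive v) (hw : IsPrimitive w) {c : ℝ}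
    (hc : 0 ≤ c) (h : latticeVec w = c • latticeVec v) : v = w := by
  obtain ⟨u, hu⟩ := hv.exists_dotProduct_eq_one
  have h1 : c = ((u ⬝ᵥ w : ℤ) : ℝ) := by
    rw [← pairing_latticeVec, h, pairing_smul_right, pairing_latticeVec, hu]; simp
  rw [h1, ← latticeVec_zsmul] at h
  have h2 := latticeVec_injective h
  have h3 := hw _ _ h2
  have h4 : (0 : ℤ) ≤ u ⬝ᵥ w := by rw [h1] at hc; exact_mod_cast hc
  rcases Int.isUnit_iff.1 h3 with h5 | h5
  · rw [h2, h5, one_smul]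
  · omega

lemma IsPrimitive.eq_of_mem_rayCone {v w : Fin n → ℤ} (hv : IsPrimitive v) (hw : IsPrimitive w)
    (h : latticeVec w ∈ rayCone v) : v = w := by
  obtain ⟨c, hc, h⟩ := mem_rayCone.1 h
  exact hv.eq_of_smul hw hc h

end Faces

/-! ### Rays of a fan as generators of its cones -/

namespace Fan

variable {n : ℕ} (Δ : Fan n)

lemma isRational {σ} (hσ : σ ∈ Δ.cones) : IsRational σ := Δ.rational σ hσ

lemma faceCone_mem {σ} (hσ : σ ∈ Δ.cones) {u : Fin n → ℤ} (hu : u ∈ dualSemigroup σ) :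
    faceCone σ u ∈ Δ.cones := Δ.face_mem σ hσ _ (isConeFace_faceCone hu)

/-- The rays of a cone of a fan generate the cone. -/
lemma exists_rays {σ} (hσ : σ ∈ Δ.cones) : ∃ s : Finset (Fin n → ℤ),
    (∀ g ∈ s, Δ.IsRay g) ∧ σ = PointedCone.hull ℝ (latticeVec '' (s : Set (Fin n → ℤ))) := by
  classical
  obtain ⟨s₀, hs₀⟩ := Δ.rational σ hσ
  -- A generating set of least cardinality is irredundant; each of its members will be shown to span
  -- a face.
  obtain ⟨s, hs, hmin⟩ : ∃ s : Finset (Fin n → ℤ),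
      σ = PointedCone.hull ℝ (latticeVec '' (s : Set (Fin n → ℤ))) ∧
      ∀ t : Finset (Fin n → ℤ), σ = PointedCone.hull ℝ (latticeVec '' (t : Set (Fin n → ℤ))) →
        s.card ≤ t.card := by
    let P := {t : Finset (Fin n → ℤ) |
      σ = PointedCone.hull ℝ (latticeVec '' (t : Set (Fin n → ℤ)))}
    obtain ⟨_, ⟨s, h, rfl⟩, hm⟩ := WellFounded.has_min (wellFounded_lt (α := ℕ))
      (Finset.card '' P) ⟨_, s₀, hs₀, rfl⟩
    exact ⟨s, h, fun u hu => not_lt.1 (hm _ ⟨u, hu, rfl⟩)⟩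
  have hmemσ : ∀ g ∈ s, latticeVec g ∈ σ := fun g hg => by
    rw [hs]; exact Submodule.subset_span ⟨g, hg, rfl⟩
  have hirr : ∀ g ∈ s, latticeVec g ∉
      PointedCone.hull ℝ (latticeVec '' ((s.erase g : Finset _) : Set (Fin n → ℤ))) := by
    intro g hg hmem
    have : σ = PointedCone.hull ℝ (latticeVec '' ((s.erase g : Finset _) : Set (Fin n → ℤ))) := by
      apply le_antisymm
      · rw [hs]
        refine Submodule.span_le.2 ?_
        rintro _ ⟨h, hh, rfl⟩
        by_cases e : h = g
        · subst e; exact hmem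
        · exact Submodule.subset_span ⟨h, Finset.mem_coe.2 (Finset.mem_erase.2 ⟨e, hh⟩), rfl⟩
      · rw [hs]
        exact Submodule.span_mono (Set.image_mono (Finset.coe_subset.2 (Finset.erase_subset _ _)))
    exact absurd (hmin _ this) (not_le.2 (Finset.card_erase_lt_of_mem hg))
  have hface : ∀ g ∈ s, rayCone g ∈ Δ.cones := by
    intro g hg
    -- Such a `u` cuts out exactly the ray of `g`. A relation with `t > 0` would make `g` redundant;
    -- one with `t ≤ 0` and a nonzero coefficient would put a nonzero vector and its negative in
    -- `σ`.
    obtain ⟨u, hu0, hu⟩ := exists_pos_functional (s.erase g) g (fun c hc t hsum => by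
      have hin : ∑ h ∈ s.erase g, c h • latticeVec h ∈
          PointedCone.hull ℝ (latticeVec '' ((s.erase g : Finset _) : Set (Fin n → ℤ))) :=
        mem_hull_lattice.2 ⟨c, hc, rfl⟩
      rcases lt_or_ge 0 t with ht | ht
      · exfalso
        rw [hsum] at hin
        have := PointedCone.smul_mem _ (inv_nonneg.2 ht.le) hin
        rw [smul_smul, inv_mul_cancel₀ ht.ne', one_smul] at this
        exact hirr g hg this
      · intro h hh
        by_contra hne
        have hpos : 0 < c h := lt_of_le_of_ne (hc h) (Ne.symm hne)
        have h1 : -(c h • latticeVec h) ∈ σ := by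
          have : -(c h • latticeVec h) =
              ∑ x ∈ (s.erase g).erase h, c x • latticeVec x + (-t) • latticeVec g := by
            rw [← Finset.add_sum_erase _ _ hh] at hsum
            rw [neg_smul, ← hsum]; abel
          rw [this]
          exact add_mem (sum_mem fun x hx => PointedCone.smul_mem _ (hc x)
            (hmemσ x (Finset.mem_of_mem_erase (Finset.mem_of_mem_erase hx))))
            (PointedCone.smul_mem _ (by linarith) (hmemσ g hg))
        have h2 := Δ.strongly_convex σ hσ _
          (PointedCone.smul_mem _ hpos.le (hmemσ h (Finset.mem_of_mem_erase hh))) h1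
        have h3 : latticeVec h = 0 := (smul_eq_zero.1 h2).resolve_left hpos.ne'
        exact hirr h (Finset.mem_of_mem_erase hh) (by rw [h3]; exact zero_mem _))
    have hu' : ∀ h ∈ s, 0 ≤ u ⬝ᵥ h := fun h hh => by
      by_cases e : h = g
      · rw [e, hu0]
      · exact (hu h (Finset.mem_erase.2 ⟨e, hh⟩)).le
    have hud : u ∈ dualSemigroup σ := by rw [hs]; exact mem_dualSemigroup_hull.2 hu'
    have : faceCone σ u = rayCone g := by
      rw [hs, faceCone_hull hu']
      have : s.filter (fun h => u ⬝ᵥ h = 0) = {g} := by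
        ext h
        rw [Finset.mem_filter, Finset.mem_singleton]
        constructor
        · rintro ⟨hh, h0⟩
          by_contra e
          exact (hu h (Finset.mem_erase.2 ⟨e, hh⟩)).ne' h0
        · rintro rfl; exact ⟨hg, hu0⟩
      rw [this]
      simp [rayCone]
    rw [← this]
    exact Δ.faceCone_mem hσ hud
  have hne : ∀ g ∈ s, g ≠ 0 := by
    rintro g hg rfl
    exact hirr 0 hg (by rw [latticeVec_zero]; exact zero_mem _)
  have hp : ∀ g ∈ s, ∃ w : Fin n → ℤ, IsPrimitive w ∧ ∃ m : ℤ, 0 < m ∧ g = m • w := fun g hg => by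
    obtain ⟨m, w, hm, h1, h2⟩ := exists_primitive g (hne g hg)
    exact ⟨w, h2, m, hm, h1⟩
  choose! p hp1 m hm hpm using hp
  have hray : ∀ g ∈ s, rayCone (p g) = rayCone g := by
    intro g hg
    have hm0 : (0 : ℝ) < m g := by exact_mod_cast hm g hg
    have e : latticeVec g = (m g : ℝ) • latticeVec (p g) := by
      rw [← latticeVec_zsmul, ← hpm g hg]
    ext w
    rw [mem_rayCone, mem_rayCone]
    constructor
    · rintro ⟨c, hc, rfl⟩
      refine ⟨c / m g, by positivity, ?_⟩
      rw [e, smul_smul, div_mul_cancel₀ _ hm0.ne']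
    · rintro ⟨c, hc, rfl⟩
      refine ⟨c * m g, by positivity, ?_⟩
      rw [e, smul_smul]
  refine ⟨s.image p, fun g hg => ?_, ?_⟩
  · obtain ⟨g', hg', rfl⟩ := Finset.mem_image.1 hg
    exact ⟨hp1 g' hg', by rw [hray g' hg']; exact hface g' hg'⟩
  · apply le_antisymm
    · rw [hs]
      refine Submodule.span_le.2 ?_
      rintro _ ⟨g, hg, rfl⟩
      have h1 : latticeVec g ∈ rayCone (p g) := by
        rw [hray g hg]; exact latticeVec_mem_rayCone g
      refine Submodule.span_mono ?_ h1
      rintro _ rfl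
      exact ⟨p g, by simpa using ⟨g, hg, rfl⟩, rfl⟩
    · refine Submodule.span_le.2 ?_
      rintro _ ⟨g', hg', rfl⟩
      obtain ⟨g, hg, rfl⟩ := Finset.mem_image.1 (Finset.mem_coe.1 hg')
      have h1 : latticeVec (p g) ∈ rayCone g := by
        rw [← hray g hg]; exact latticeVec_mem_rayCone _
      obtain ⟨c, hc, e⟩ := mem_rayCone.1 h1
      rw [SetLike.mem_coe, e]
      exact PointedCone.smul_mem _ hc (hmemσ g hg)

/-- A functional positive on the nonzero elements of a cone. -/
lemma exists_dual_pos {σ} (hσ : σ ∈ Δ.cones) :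
    ∃ u ∈ dualSemigroup σ, ∀ v ∈ σ, pairing u v = 0 → v = 0 := by
  obtain ⟨s, hs, e⟩ := Δ.exists_rays hσ
  have hmem : ∀ g ∈ s, latticeVec g ∈ σ := fun g hg => by
    rw [e]; exact Submodule.subset_span ⟨g, hg, rfl⟩
  obtain ⟨u, -, hu⟩ := exists_pos_functional s 0 (fun c hc t hsum g hg => by
    classical
    rw [latticeVec_zero, smul_zero, ← Finset.add_sum_erase _ _ hg] at hsum
    by_contra hne
    have h1 : -(c g • latticeVec g) ∈ σ := by
      rw [neg_eq_of_add_eq_zero_right hsum]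
      exact sum_mem fun x hx =>
        PointedCone.smul_mem _ (hc x) (hmem x (Finset.mem_of_mem_erase hx))
    have h2 := Δ.strongly_convex σ hσ _ (PointedCone.smul_mem _ (hc g) (hmem g hg)) h1
    have h3 := (smul_eq_zero.1 h2).resolve_left hne
    exact (hs g hg).1.ne_zero (latticeVec_injective (by rw [h3, latticeVec_zero])))
  refine ⟨u, by rw [e]; exact mem_dualSemigroup_hull.2 fun g hg => (hu g hg).le, fun v hv h0 => ?_⟩
  rw [e] at hv
  have : v ∈ faceCone (PointedCone.hull ℝ (latticeVec '' (s : Set (Fin n → ℤ)))) u := ⟨hv, h0⟩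
  rw [faceCone_hull (fun g hg => (hu g hg).le)] at this
  rw [Finset.filter_eq_empty_iff.2 (fun g hg => (hu g hg).ne')] at this
  simpa using this

lemma bot_mem : ⊥ ∈ Δ.cones := by
  obtain ⟨σ, hσ⟩ := Δ.nonempty
  obtain ⟨u, hu, h⟩ := Δ.exists_dual_pos hσ
  refine Δ.face_mem σ hσ ⊥ ⟨u, hu, fun v => ⟨?_, fun hv => ?_⟩⟩
  · intro hv
    rw [Submodule.mem_bot] at hv
    subst hv
    exact ⟨zero_mem _, by simp⟩
  · exact (Submodule.mem_bot _).2 (h v hv.1 hv.2)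

variable {Δ}

lemma Ray.ext {i j : Δ.Ray} (h : i.1 = j.1) : i = j := Subtype.ext h

instance : Finite Δ.Ray := by
  have : Finite Δ.cones := Δ.finite
  refine Finite.of_injective (fun i : Δ.Ray => (⟨rayCone i.1, i.2.2⟩ : Δ.cones)) ?_
  intro i j h
  have h1 : rayCone i.1 = rayCone j.1 := congrArg Subtype.val h
  exact Ray.ext (i.2.1.eq_of_mem_rayCone j.2.1 (h1 ▸ latticeVec_mem_rayCone j.1))

instance : Fintype Δ.Ray := Fintype.ofFinite _

variable (Δ)

lemma mem_cone_iff {σ} (hσ : σ ∈ Δ.cones) {v : Fin n → ℝ} : v ∈ σ ↔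
    ∃ c : Δ.Ray → ℝ, (∀ i, 0 ≤ c i) ∧ (∀ i, i.vec ∉ σ → c i = 0) ∧ v = ∑ i, c i • i.vec := by
  classical
  constructor
  · intro hv
    obtain ⟨s, hs, e⟩ := Δ.exists_rays hσ
    rw [e] at hv
    obtain ⟨c, hc, rfl⟩ := mem_hull_lattice.1 hv
    refine ⟨fun i => if i.1 ∈ s then c i.1 else 0, fun i => ?_, fun i hi => ?_, ?_⟩
    · beta_reduce; split_ifs
      · exact hc _
      · exact le_rfl
    · refine if_neg fun h => hi ?_
      rw [e]; exact Submodule.subset_span ⟨i.1, h, rfl⟩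
    · simp only [ite_smul, zero_smul]
      rw [← Finset.sum_filter]
      refine Finset.sum_bij' (fun g hg => (⟨g, hs g hg⟩ : Δ.Ray)) (fun i _ => i.1) ?_ ?_ ?_ ?_ ?_
      · intro g hg; exact Finset.mem_filter.2 ⟨Finset.mem_univ _, hg⟩
      · intro i hi; exact (Finset.mem_filter.1 hi).2
      · intro g _; rfl
      · intro i _; rfl
      · intro g _; rfl
  · rintro ⟨c, hc, h0, rfl⟩
    refine sum_mem fun i _ => ?_
    by_cases hi : i.vec ∈ σ
    · exact PointedCone.smul_mem _ (hc i) hi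
    · rw [h0 i hi, zero_smul]; exact zero_mem _

lemma mem_dualSemigroup_iff {σ} (hσ : σ ∈ Δ.cones) {u : Fin n → ℤ} :
    u ∈ dualSemigroup σ ↔ ∀ i : Δ.Ray, i.vec ∈ σ → 0 ≤ u ⬝ᵥ i.1 := by
  constructor
  · intro hu i hi
    have := hu _ hi
    rw [Ray.vec, pairing_latticeVec] at this
    exact_mod_cast this
  · intro h v hv
    obtain ⟨c, hc, h0, rfl⟩ := (Δ.mem_cone_iff hσ).1 hv
    rw [pairing_sum_right]
    refine Finset.sum_nonneg fun i _ => ?_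
    rw [pairing_smul_right]
    by_cases hi : i.vec ∈ σ
    · refine mul_nonneg (hc i) ?_
      rw [Ray.vec, pairing_latticeVec]
      exact_mod_cast h i hi
    · rw [h0 i hi, zero_mul]

lemma exists_relint_cone {σ} (hσ : σ ∈ Δ.cones) {w : Fin n → ℝ} (hw : w ∈ σ) :
    ∃ τ ∈ Δ.cones, τ ≤ σ ∧ IsRelint τ w := by
  obtain ⟨u, hu, h⟩ := (Δ.isRational hσ).exists_face_relint hw
  exact ⟨_, Δ.faceCone_mem hσ hu, inf_le_left, h⟩

end Fan

end

noncomputable section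

open scoped BigOperators

/-! ## Local rings in a field -/

section LocalRings

variable {F : Type*} [Field F]

lemma LocalSubring.mem_ofPrime {A : Subring F} {P : Ideal A} [P.IsPrime] {f : F} :
    f ∈ (LocalSubring.ofPrime A P).toSubring ↔ ∃ a b : A, b ∉ P ∧ f = a / b := by
  constructor
  · intro hf
    obtain ⟨⟨a, s⟩, hx⟩ := IsLocalization.surj P.primeCompl
      (⟨f, hf⟩ : (LocalSubring.ofPrime A P).toSubring)
    have h1 : f * (s : A) = a := congrArg Subtype.val hx
    have hs : ((s : A) : F) ≠ 0 := fun h =>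
      s.2 (by rw [show (s : A) = 0 from Subtype.ext h]; exact P.zero_mem)
    exact ⟨a, s, s.2, by rw [← h1, mul_div_cancel_right₀ _ hs]⟩
  · rintro ⟨a, b, hb, rfl⟩
    have hb0 : (b : F) ≠ 0 := fun h =>
      hb (by rw [show b = 0 from Subtype.ext h]; exact P.zero_mem)
    have hu := IsLocalization.map_units (LocalSubring.ofPrime A P).toSubring
      (⟨b, hb⟩ : P.primeCompl)
    obtain ⟨y, hy⟩ := hu.exists_right_inv
    have h1 : (b : F) * y = 1 := congrArg Subtype.val hy
    rw [div_eq_mul_inv, ← eq_inv_of_mul_eq_one_right h1]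
    exact mul_mem (LocalSubring.le_ofPrime A P a.2) y.2

lemma LocalSubring.mem_maximalIdeal_ofPrime {A : Subring F} {P : Ideal A} [P.IsPrime] (a : A) :
    (⟨a, LocalSubring.le_ofPrime A P a.2⟩ : (LocalSubring.ofPrime A P).toSubring) ∈
      IsLocalRing.maximalIdeal (LocalSubring.ofPrime A P).toSubring ↔ a ∈ P :=
  IsLocalization.AtPrime.to_map_mem_maximal_iff (LocalSubring.ofPrime A P).toSubring P a

lemma Subring.isUnit_iff_inv_mem {R : Subring F} {f : F} (hf : f ∈ R) (h0 : f ≠ 0) :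
    IsUnit (⟨f, hf⟩ : R) ↔ f⁻¹ ∈ R := by
  constructor
  · intro h
    obtain ⟨y, hy⟩ := h.exists_right_inv
    have h1 : f * y = 1 := congrArg Subtype.val hy
    rw [← eq_inv_of_mul_eq_one_right h1]
    exact y.2
  · intro h
    exact IsUnit.of_mul_eq_one (⟨f⁻¹, h⟩ : R) (Subtype.ext (mul_inv_cancel₀ h0))

lemma LocalSubring.inv_mem_ofPrime {A : Subring F} {P : Ideal A} [P.IsPrime] {a : F} (ha : a ∈ A) :
    (⟨a, ha⟩ : A) ∉ P ↔ a ≠ 0 ∧ a⁻¹ ∈ (LocalSubring.ofPrime A P).toSubring := by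
  have h := LocalSubring.mem_maximalIdeal_ofPrime (P := P) (⟨a, ha⟩ : A)
  rw [← h, IsLocalRing.mem_maximalIdeal, mem_nonunits_iff, not_not]
  by_cases h0 : a = 0
  · subst h0
    have : (⟨(0 : F), LocalSubring.le_ofPrime A P ha⟩ : (LocalSubring.ofPrime A P).toSubring) = 0 :=
      rfl
    simp [this]
  · rw [Subring.isUnit_iff_inv_mem _ h0]
    simp [h0]

/-- `π` is a uniformizer of the discrete valuation ring `R` of the field `F`. -/
structure IsUniformizer (R : Subring F) (π : F) : Prop where
  mem : π ∈ R
  inv_notMem : π⁻¹ ∉ R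
  exists_pow : ∀ f : F, f ≠ 0 → ∃ m : ℤ, f * π ^ (-m) ∈ R ∧ (f * π ^ (-m))⁻¹ ∈ R

namespace IsUniformizer

variable {R : Subring F} {π : F} (h : IsUniformizer R π)
include h

lemma ne_zero : π ≠ 0 := by
  rintro rfl
  exact h.inv_notMem (by simp)

lemma zpow_mem {m : ℤ} : π ^ m ∈ R ↔ 0 ≤ m := by
  constructor
  · intro hm
    by_contra hneg
    apply h.inv_notMem
    have : π⁻¹ = π ^ m * π ^ ((-m - 1).toNat) := by
      rw [← zpow_natCast, Int.toNat_of_nonneg (by omega), ← zpow_add₀ h.ne_zero]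
      rw [← zpow_neg_one]; congr 1; ring
    rw [this]
    exact mul_mem hm (pow_mem h.mem _)
  · intro hm
    lift m to ℕ using hm
    rw [zpow_natCast]
    exact pow_mem h.mem _

lemma unique {f : F} {m m' : ℤ} (hm : f * π ^ (-m) ∈ R ∧ (f * π ^ (-m))⁻¹ ∈ R)
    (hm' : f * π ^ (-m') ∈ R ∧ (f * π ^ (-m'))⁻¹ ∈ R) (hf : f ≠ 0) : m = m' := by
  have h1 : π ^ (m' - m) ∈ R := by
    have : π ^ (m' - m) = f * π ^ (-m) * (f * π ^ (-m'))⁻¹ := by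
      rw [mul_inv, ← zpow_neg, neg_neg, zpow_sub₀ h.ne_zero, zpow_neg]
      field_simp
    rw [this]; exact mul_mem hm.1 hm'.2
  have h2 : π ^ (m - m') ∈ R := by
    have : π ^ (m - m') = f * π ^ (-m') * (f * π ^ (-m))⁻¹ := by
      rw [mul_inv, ← zpow_neg, neg_neg, zpow_sub₀ h.ne_zero, zpow_neg]
      field_simp
    rw [this]; exact mul_mem hm'.1 hm.2
  rw [h.zpow_mem] at h1 h2
  omega

lemma irreducible : Irreducible (⟨π, h.mem⟩ : R) := by
  have hunit : ∀ (f : F) (hf : f ∈ R), f ≠ 0 → ∀ m : ℤ,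
      (f * π ^ (-m) ∈ R ∧ (f * π ^ (-m))⁻¹ ∈ R) → 0 ≤ m ∧ (IsUnit (⟨f, hf⟩ : R) ↔ m = 0) := by
    intro f hf h0 m hm
    have e : f = f * π ^ (-m) * π ^ m := by
      rw [mul_assoc, ← zpow_add₀ h.ne_zero]; simp
    have hm0 : π ^ m ∈ R := by
      have : π ^ m = f * (f * π ^ (-m))⁻¹ := by
        rw [mul_inv, zpow_neg, inv_inv]; field_simp
      rw [this]; exact mul_mem hf hm.2
    refine ⟨h.zpow_mem.1 hm0, ?_⟩
    rw [Subring.isUnit_iff_inv_mem hf h0]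
    constructor
    · intro hinv
      have : π ^ (-m) ∈ R := by
        have : π ^ (-m) = f⁻¹ * (f * π ^ (-m)) := by field_simp
        rw [this]; exact mul_mem hinv hm.1
      have := h.zpow_mem.1 this
      have := h.zpow_mem.1 hm0
      omega
    · rintro rfl
      simpa using hm.2
  rw [irreducible_iff]
  constructor
  · rw [Subring.isUnit_iff_inv_mem _ h.ne_zero]; exact h.inv_notMem
  · rintro ⟨a, ha⟩ ⟨b, hb⟩ hab
    have hab' : π = a * b := congrArg Subtype.val hab
    have ha0 : a ≠ 0 := by rintro rfl; exact h.ne_zero (by rw [hab', zero_mul])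
    have hb0 : b ≠ 0 := by rintro rfl; exact h.ne_zero (by rw [hab', mul_zero])
    obtain ⟨m, hm⟩ := h.exists_pow a ha0
    obtain ⟨l, hl⟩ := h.exists_pow b hb0
    obtain ⟨h1, h2⟩ := hunit a ha ha0 m hm
    obtain ⟨h3, h4⟩ := hunit b hb hb0 l hl
    rw [h2, h4]
    have h5 : π * π ^ (-(m + l)) = (a * π ^ (-m)) * (b * π ^ (-l)) := by
      rw [neg_add, zpow_add₀ h.ne_zero]
      nth_rewrite 1 [hab']
      ring
    have : (1 : ℤ) = m + l := h.unique (f := π) ⟨by simp [h.ne_zero], by simp [h.ne_zero]⟩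
      ⟨by rw [h5]; exact mul_mem hm.1 hl.1, by
        rw [h5, mul_inv]; exact mul_mem hm.2 hl.2⟩ h.ne_zero
    omega

lemma isDiscreteValuationRing : IsDiscreteValuationRing R := by
  refine IsDiscreteValuationRing.ofHasUnitMulPowIrreducibleFactorization
    ⟨⟨π, h.mem⟩, h.irreducible, ?_⟩
  rintro ⟨x, hx⟩ hx0
  have hx0' : x ≠ 0 := fun e => hx0 (Subtype.ext e)
  obtain ⟨m, hm⟩ := h.exists_pow x hx0'
  have hm0 : 0 ≤ m := h.zpow_mem.1 (by
    have : π ^ m = x * (x * π ^ (-m))⁻¹ := by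
      rw [mul_inv, zpow_neg, inv_inv]; field_simp
    rw [this]; exact mul_mem hx hm.2)
  refine ⟨m.toNat, ⟨⟨⟨_, hm.1⟩, ⟨_, hm.2⟩, ?_, ?_⟩, ?_⟩⟩
  · exact Subtype.ext (mul_inv_cancel₀ (mul_ne_zero hx0' (zpow_ne_zero _ h.ne_zero)))
  · exact Subtype.ext (inv_mul_cancel₀ (mul_ne_zero hx0' (zpow_ne_zero _ h.ne_zero)))
  · apply Subtype.ext
    change π ^ m.toNat * (x * π ^ (-m)) = x
    rw [← zpow_natCast, Int.toNat_of_nonneg hm0, mul_left_comm, ← zpow_add₀ h.ne_zero]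
    simp

/-- The definition of `ordAlong` chooses an arbitrary irreducible element and unit. Independence of
the choice holds because any two irreducible elements of a discrete valuation ring are associated.
-/
lemma ordAlong_eq {f : F} (hf : f ≠ 0) {m : ℤ}
    (hm : f * π ^ (-m) ∈ R ∧ (f * π ^ (-m))⁻¹ ∈ R) : ordAlong R f = m := by
  have := h.isDiscreteValuationRing
  have hex : ∃ m : ℤ, ∃ π' : R, Irreducible π' ∧ ∃ u : Rˣ, f = ((u : R) : F) * (π' : F) ^ m := by
    refine ⟨m, ⟨π, h.mem⟩, h.irreducible, ⟨⟨_, hm.1⟩, ⟨_, hm.2⟩, ?_, ?_⟩, ?_⟩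
    · exact Subtype.ext (mul_inv_cancel₀ (mul_ne_zero hf (zpow_ne_zero _ h.ne_zero)))
    · exact Subtype.ext (inv_mul_cancel₀ (mul_ne_zero hf (zpow_ne_zero _ h.ne_zero)))
    · change f = f * π ^ (-m) * π ^ m
      rw [mul_assoc, ← zpow_add₀ h.ne_zero]; simp
  have hval : ordAlong R f = hex.choose := by
    unfold ordAlong
    exact dif_pos hex
  rw [hval]
  obtain ⟨π', hπ', u, hu⟩ := hex.choose_spec
  generalize hex.choose = m' at hu ⊢
  refine h.unique ?_ hm hf
  obtain ⟨w, hw⟩ := IsDiscreteValuationRing.associated_of_irreducible R h.irreducible hπ'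
  have hw' : π * ((w : R) : F) = π' := congrArg Subtype.val hw
  have hunit : ∀ (v : Rˣ) (j : ℤ), ((v : R) : F) ^ j ∈ R := by
    intro v j
    have hv : (((v⁻¹ : Rˣ) : R) : F) = ((v : R) : F)⁻¹ :=
      eq_inv_of_mul_eq_one_right (congrArg Subtype.val v.mul_inv)
    rcases le_total 0 j with hj | hj
    · lift j to ℕ using hj
      rw [zpow_natCast]; exact pow_mem (v : R).2 _
    · obtain ⟨l, rfl⟩ : ∃ l : ℕ, j = -(l : ℤ) := ⟨j.natAbs, by omega⟩
      rw [zpow_neg, zpow_natCast, ← inv_pow, ← hv]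
      exact pow_mem (SetLike.coe_mem _) _
  have e : f * π ^ (-m') = ((u : R) : F) ^ (1 : ℤ) * ((w : R) : F) ^ m' := by
    rw [hu, ← hw', mul_zpow, zpow_neg, zpow_one]
    have := zpow_ne_zero m' h.ne_zero
    field_simp
  rw [e, mul_inv, ← zpow_neg, ← zpow_neg]
  exact ⟨mul_mem (hunit _ _) (hunit _ _), mul_mem (hunit _ _) (hunit _ _)⟩

lemma ordAlong_spec {f : F} (hf : f ≠ 0) :
    f * π ^ (-ordAlong R f) ∈ R ∧ (f * π ^ (-ordAlong R f))⁻¹ ∈ R := by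
  obtain ⟨m, hm⟩ := h.exists_pow f hf
  rw [h.ordAlong_eq hf hm]; exact hm

lemma ordAlong_mul {f g : F} (hf : f ≠ 0) (hg : g ≠ 0) :
    ordAlong R (f * g) = ordAlong R f + ordAlong R g := by
  have e : f * g * π ^ (-(ordAlong R f + ordAlong R g)) =
      (f * π ^ (-ordAlong R f)) * (g * π ^ (-ordAlong R g)) := by
    rw [neg_add, zpow_add₀ h.ne_zero]; ring
  refine h.ordAlong_eq (mul_ne_zero hf hg) ?_
  rw [e, mul_inv]
  exact ⟨mul_mem (h.ordAlong_spec hf).1 (h.ordAlong_spec hg).1,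
    mul_mem (h.ordAlong_spec hf).2 (h.ordAlong_spec hg).2⟩

lemma ordAlong_one : ordAlong R (1 : F) = 0 :=
  h.ordAlong_eq one_ne_zero (by simp)

lemma ordAlong_inv {f : F} (hf : f ≠ 0) : ordAlong R f⁻¹ = -ordAlong R f := by
  have := h.ordAlong_mul hf (inv_ne_zero hf)
  rw [mul_inv_cancel₀ hf, h.ordAlong_one] at this
  linarith

lemma ordAlong_div {f g : F} (hf : f ≠ 0) (hg : g ≠ 0) :
    ordAlong R (f / g) = ordAlong R f - ordAlong R g := by
  rw [div_eq_mul_inv, h.ordAlong_mul hf (inv_ne_zero hg), h.ordAlong_inv hg, sub_eq_add_neg]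

lemma ordAlong_nonneg_iff {f : F} (hf : f ≠ 0) : 0 ≤ ordAlong R f ↔ f ∈ R := by
  obtain ⟨h1, h2⟩ := h.ordAlong_spec hf
  rw [← h.zpow_mem]
  constructor
  · intro hp
    have : f = f * π ^ (-ordAlong R f) * π ^ ordAlong R f := by
      rw [mul_assoc, ← zpow_add₀ h.ne_zero]; simp
    rw [this]; exact mul_mem h1 hp
  · intro hp
    have : π ^ ordAlong R f = f * (f * π ^ (-ordAlong R f))⁻¹ := by
      rw [mul_inv, zpow_neg, inv_inv]; field_simp
    rw [this]; exact mul_mem hp h2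

lemma ordAlong_self : ordAlong R π = 1 :=
  h.ordAlong_eq h.ne_zero (by simp [h.ne_zero])

/-- A discrete valuation ring is a maximal proper subring of its field of fractions. -/
lemma eq_of_le {S : Subring F} (hRS : R ≤ S) (hS : ∃ f, f ∉ S) : R = S := by
  refine le_antisymm hRS fun f hf => ?_
  by_contra hfR
  have hf0 : f ≠ 0 := fun e => hfR (by rw [e]; exact zero_mem _)
  obtain ⟨h1, h2⟩ := h.ordAlong_spec hf0
  set m := ordAlong R f
  have hm : m < 0 := by
    rw [← not_le, h.ordAlong_nonneg_iff hf0]; exact hfR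
  have h3 : π ^ m ∈ S := by
    have : π ^ m = f * (f * π ^ (-m))⁻¹ := by
      rw [mul_inv, zpow_neg, inv_inv]; field_simp
    rw [this]; exact mul_mem hf (hRS h2)
  have h4 : π⁻¹ ∈ S := by
    have : π⁻¹ = π ^ m * π ^ ((-m - 1).toNat) := by
      rw [← zpow_natCast, Int.toNat_of_nonneg (by omega), ← zpow_add₀ h.ne_zero]
      rw [← zpow_neg_one]; congr 1; ring
    rw [this]
    exact mul_mem h3 (pow_mem (hRS h.mem) _)
  obtain ⟨g, hg⟩ := hS
  have hg0 : g ≠ 0 := fun e => hg (by rw [e]; exact zero_mem _)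
  obtain ⟨h5, -⟩ := h.ordAlong_spec hg0
  apply hg
  have : g = g * π ^ (-ordAlong R g) * π ^ ordAlong R g := by
    rw [mul_assoc, ← zpow_add₀ h.ne_zero]; simp
  rw [this]
  refine mul_mem (hRS h5) ?_
  rcases le_total 0 (ordAlong R g) with hj | hj
  · exact hRS (h.zpow_mem.2 hj)
  · obtain ⟨l, hl⟩ : ∃ l : ℕ, ordAlong R g = -(l : ℤ) := ⟨(ordAlong R g).natAbs, by omega⟩
    rw [hl, zpow_neg, zpow_natCast, ← inv_pow]
    exact pow_mem h4 _

end IsUniformizer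

/-- A subring which is a discrete valuation ring with field of fractions `F` has a uniformizer. -/
lemma exists_isUniformizer (R : Subring F) [IsDiscreteValuationRing R]
    (hR : ∀ f : F, ∃ a ∈ R, ∃ b ∈ R, b ≠ 0 ∧ f = a / b) : ∃ π, IsUniformizer R π := by
  obtain ⟨π, hπ⟩ := IsDiscreteValuationRing.exists_irreducible R
  have hπ0 : (π : F) ≠ 0 := fun e => hπ.ne_zero (Subtype.ext e)
  have key : ∀ a : F, a ∈ R → a ≠ 0 →
      ∃ m : ℤ, a * (π : F) ^ (-m) ∈ R ∧ (a * (π : F) ^ (-m))⁻¹ ∈ R := by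
    intro a ha ha0
    obtain ⟨m, u, hu⟩ := IsDiscreteValuationRing.eq_unit_mul_pow_irreducible
      (x := (⟨a, ha⟩ : R)) (fun e => ha0 (congrArg Subtype.val e)) hπ
    have hu' : a = ((u : R) : F) * (π : F) ^ m := congrArg Subtype.val hu
    have e : a * (π : F) ^ (-(m : ℤ)) = (u : R) := by
      rw [hu', zpow_neg, zpow_natCast]
      have := pow_ne_zero m hπ0
      field_simp
    refine ⟨m, ?_, ?_⟩
    · rw [e]; exact (u : R).2
    · rw [e, ← eq_inv_of_mul_eq_one_right (show ((u : R) : F) * ((u⁻¹ : Rˣ) : R) = 1 from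
        congrArg Subtype.val u.mul_inv)]
      exact SetLike.coe_mem _
  refine ⟨π, π.2, fun hinv => hπ.not_isUnit ?_, fun f hf => ?_⟩
  · exact (Subring.isUnit_iff_inv_mem π.2 hπ0).2 hinv
  · obtain ⟨a, ha, b, hb, hb0, rfl⟩ := hR f
    have ha0 : a ≠ 0 := by rintro rfl; simp at hf
    obtain ⟨m, h1, h2⟩ := key a ha ha0
    obtain ⟨l, h3, h4⟩ := key b hb hb0
    have e : a / b * (π : F) ^ (-(m - l)) =
        (a * (π : F) ^ (-m)) * (b * (π : F) ^ (-l))⁻¹ := by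
      rw [neg_sub, zpow_sub₀ hπ0, zpow_neg, zpow_neg]
      field_simp
    refine ⟨m - l, ?_, ?_⟩
    · rw [e]; exact mul_mem h1 h4
    · rw [e, mul_inv, inv_inv]; exact mul_mem h2 h3

end LocalRings

end

noncomputable section

open scoped BigOperators Pointwise

/-! ## Laurent polynomials and the function field -/

section Laurent

variable {k : Type*} [Field k] {n : ℕ}

variable (k n) in
/-- The coordinate ring of the torus. -/
abbrev TorusRing : Type _ := AddMonoidAlgebra k (Fin n → ℤ)

/-- Splitting off one variable presents the ring as Laurent polynomials over the ring of one rank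
less, a localization of a polynomial ring over it. -/
instance torusRing_ufd : ∀ n : ℕ, UniqueFactorizationMonoid (TorusRing k n)
  | 0 => by
    have : UniqueFactorizationMonoid k := inferInstance
    exact (AddMonoidAlgebra.uniqueRingEquiv (R := k) (Fin 0 → ℤ)).symm.toMulEquiv
      |>.uniqueFactorizationMonoid this
  | n + 1 => by
    have ih := torusRing_ufd n
    let e₁ : (Fin (n + 1) → ℤ) ≃+ (Fin n → ℤ) × ℤ :=
      { toFun := fun u => (fun i => u i.succ, u 0)
        invFun := fun p => Fin.cons p.2 p.1
        left_inv := fun u => by ext i; refine Fin.cases ?_ (fun j => ?_) i <;> simp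
        right_inv := fun p => by ext <;> simp
        map_add' := fun u v => rfl }
    let e₂ : (Fin (n + 1) → ℤ) ≃+ ℤ × (Fin n → ℤ) := e₁.trans AddEquiv.prodComm
    let f : TorusRing k (n + 1) ≃ₐ[k] AddMonoidAlgebra (TorusRing k n) ℤ :=
      (AddMonoidAlgebra.domCongr k k e₂).trans (AddMonoidAlgebra.curryAlgEquiv k)
    have : UniqueFactorizationMonoid (LaurentPolynomial (TorusRing k n)) :=
      UniqueFactorizationMonoid.of_isLocalization
        (Submonoid.powers (Polynomial.X : Polynomial (TorusRing k n))) _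
    exact f.symm.toMulEquiv.uniqueFactorizationMonoid this

lemma supp_mul {p q : TorusRing k n} {u : Fin n → ℤ} (hu : u ∈ (p * q).coeff.support) :
    ∃ a ∈ p.coeff.support, ∃ b ∈ q.coeff.support, a + b = u := by
  classical
  exact Finset.mem_add.1 (AddMonoidAlgebra.support_coeff_mul_subset p q hu)

lemma supp_nonempty {p : TorusRing k n} (hp : p ≠ 0) : p.coeff.support.Nonempty :=
  Finsupp.support_nonempty_iff.2 fun h => hp (AddMonoidAlgebra.coeff_eq_zero.1 h)

/-- The order of a Laurent polynomial with respect to the monomial valuation given by `w`. -/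
def monOrd (w : Fin n → ℤ) (p : TorusRing k n) : ℤ :=
  sInf ((fun u => u ⬝ᵥ w) '' (p.coeff.support : Set (Fin n → ℤ)))

lemma monOrd_exists (w : Fin n → ℤ) {p : TorusRing k n} (hp : p ≠ 0) :
    ∃ u ∈ p.coeff.support, u ⬝ᵥ w = monOrd w p := by
  obtain ⟨u, hu⟩ := supp_nonempty hp
  have hfin : ((fun u => u ⬝ᵥ w) '' (p.coeff.support : Set (Fin n → ℤ))).Finite :=
    (Finset.finite_toSet _).image _
  exact Int.csInf_mem (s := (fun u => u ⬝ᵥ w) '' (p.coeff.support : Set (Fin n → ℤ)))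
    ⟨_, u, hu, rfl⟩ hfin.bddBelow

lemma monOrd_le (w : Fin n → ℤ) {p : TorusRing k n} {u : Fin n → ℤ} (hu : u ∈ p.coeff.support) :
    monOrd w p ≤ u ⬝ᵥ w := by
  have hfin : ((fun u => u ⬝ᵥ w) '' (p.coeff.support : Set (Fin n → ℤ))).Finite :=
    (Finset.finite_toSet _).image _
  exact csInf_le hfin.bddBelow ⟨u, hu, rfl⟩

lemma monOrd_eq {w : Fin n → ℤ} {p : TorusRing k n} {m : ℤ}
    (h1 : ∃ u ∈ p.coeff.support, u ⬝ᵥ w = m) (h2 : ∀ u ∈ p.coeff.support, m ≤ u ⬝ᵥ w) :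
    monOrd w p = m := by
  obtain ⟨u, hu, rfl⟩ := h1
  have hp : p ≠ 0 := by rintro rfl; simp at hu
  obtain ⟨u', hu', e⟩ := monOrd_exists w hp
  exact le_antisymm (monOrd_le w hu) (e ▸ h2 u' hu')

lemma monOrd_single (w u : Fin n → ℤ) {c : k} (hc : c ≠ 0) :
    monOrd w (AddMonoidAlgebra.single u c) = u ⬝ᵥ w := by
  have : (AddMonoidAlgebra.single u c).coeff.support = {u} := by
    rw [AddMonoidAlgebra.coeff_single, Finsupp.support_single _ hc]
  exact monOrd_eq ⟨u, by rw [this]; exact Finset.mem_singleton_self u, rfl⟩ (fun v hv => by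
    rw [this, Finset.mem_singleton] at hv; rw [hv])

/-- The product of the initial forms is nonzero because the ring is a domain, and all other
contributions to `p * q` have strictly larger order, so nothing cancels it. -/
lemma monOrd_mul (w : Fin n → ℤ) {p q : TorusRing k n} (hp : p ≠ 0) (hq : q ≠ 0) :
    monOrd w (p * q) = monOrd w p + monOrd w q := by
  classical
  let ini : TorusRing k n → TorusRing k n := fun p =>
    .ofCoeff (p.coeff.filter fun u => u ⬝ᵥ w = monOrd w p)
  have hini : ∀ p : TorusRing k n, p ≠ 0 → ini p ≠ 0 := by
    intro p hp h0
    obtain ⟨u, hu, e⟩ := monOrd_exists w hp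
    have h1 : (ini p).coeff u = p.coeff u := Finsupp.filter_apply_pos _ _ e
    rw [h0] at h1
    exact (Finsupp.mem_support_iff.1 hu) (by rw [← h1]; rfl)
  have hsupp : ∀ p : TorusRing k n, ∀ u ∈ (ini p).coeff.support, u ⬝ᵥ w = monOrd w p := by
    intro p u hu
    have : u ∈ (p.coeff.filter fun u => u ⬝ᵥ w = monOrd w p).support := hu
    rw [Finsupp.support_filter, Finset.mem_filter] at this
    exact this.2
  have hrest : ∀ p : TorusRing k n, ∀ u ∈ (p - ini p).coeff.support, monOrd w p < u ⬝ᵥ w := by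
    intro p u hu
    rw [Finsupp.mem_support_iff] at hu
    have e : (p - ini p).coeff u = p.coeff u - (ini p).coeff u := rfl
    by_cases h : u ⬝ᵥ w = monOrd w p
    · have : (ini p).coeff u = p.coeff u := Finsupp.filter_apply_pos _ _ h
      rw [e, this, sub_self] at hu
      exact absurd rfl hu
    · have : (ini p).coeff u = 0 := Finsupp.filter_apply_neg _ _ h
      rw [e, this, sub_zero] at hu
      exact lt_of_le_of_ne (monOrd_le w (Finsupp.mem_support_iff.2 hu)) (Ne.symm h)
  refine monOrd_eq ?_ ?_
  · obtain ⟨u, hu⟩ := supp_nonempty (mul_ne_zero (hini p hp) (hini q hq))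
    obtain ⟨a, ha, b, hb, rfl⟩ := supp_mul hu
    have hab : (a + b) ⬝ᵥ w = monOrd w p + monOrd w q := by
      rw [add_dotProduct, hsupp p a ha, hsupp q b hb]
    refine ⟨a + b, ?_, hab⟩
    have e : p * q = ini p * ini q + ((p - ini p) * q + ini p * (q - ini q)) := by ring
    have h0 : ((p - ini p) * q + ini p * (q - ini q)).coeff (a + b) = 0 := by
      by_contra hne
      have hne' : ((p - ini p) * q).coeff (a + b) + (ini p * (q - ini q)).coeff (a + b) ≠ 0 := hne
      by_cases h1 : ((p - ini p) * q).coeff (a + b) = 0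
      · rw [h1, zero_add] at hne'
        obtain ⟨a', ha', b', hb', e'⟩ := supp_mul (Finsupp.mem_support_iff.2 hne')
        have := hsupp p a' ha'
        have := hrest q b' hb'
        rw [← e', add_dotProduct] at hab
        omega
      · obtain ⟨a', ha', b', hb', e'⟩ := supp_mul (Finsupp.mem_support_iff.2 h1)
        have := hrest p a' ha'
        have := monOrd_le w hb'
        rw [← e', add_dotProduct] at hab
        omega
    rw [Finsupp.mem_support_iff] at hu ⊢
    rw [e]
    change (ini p * ini q).coeff (a + b) + ((p - ini p) * q + ini p * (q - ini q)).coeff (a + b) ≠ 0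
    rw [h0, add_zero]
    exact hu
  · intro u hu
    obtain ⟨a, ha, b, hb, rfl⟩ := supp_mul hu
    rw [add_dotProduct]
    exact add_le_add (monOrd_le w ha) (monOrd_le w hb)

lemma monOrd_add (w : Fin n → ℤ) {p q : TorusRing k n} (hpq : p + q ≠ 0) {m : ℤ}
    (hp : p ≠ 0 → m ≤ monOrd w p) (hq : q ≠ 0 → m ≤ monOrd w q) : m ≤ monOrd w (p + q) := by
  obtain ⟨u, hu, e⟩ := monOrd_exists w hpq
  rw [← e]
  rw [Finsupp.mem_support_iff] at hu
  have hu' : p.coeff u + q.coeff u ≠ 0 := hu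
  by_cases h : p.coeff u = 0
  · rw [h, zero_add] at hu'
    exact (hq (by rintro rfl; exact hu' rfl)).trans (monOrd_le w (Finsupp.mem_support_iff.2 hu'))
  · exact (hp (by rintro rfl; exact h rfl)).trans (monOrd_le w (Finsupp.mem_support_iff.2 h))

/-- The inclusion of the coordinate ring of the torus in the function field. -/
abbrev toField (p : TorusRing k n) : ToricField k n := algebraMap (TorusRing k n) (ToricField k n) p

lemma toField_injective : Function.Injective (toField (k := k) (n := n)) :=
  IsFractionRing.injective _ _

lemma toField_ne_zero {p : TorusRing k n} (hp : p ≠ 0) : toField p ≠ 0 :=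
  fun h => hp (toField_injective (by rw [h, toField, map_zero]))

lemma exists_fraction (f : ToricField k n) :
    ∃ p q : TorusRing k n, q ≠ 0 ∧ f = toField p / toField q := by
  obtain ⟨p, q, hq, e⟩ := IsFractionRing.div_surjective (TorusRing k n) f
  exact ⟨p, q, nonZeroDivisors.ne_zero hq, e.symm⟩

/-- The monomial valuation of the function field given by a lattice vector `w` (`0` for `f = 0`). -/
def monVal (w : Fin n → ℤ) (f : ToricField k n) : ℤ :=
  monOrd w (exists_fraction f).choose - monOrd w (exists_fraction f).choose_spec.choose

/-- Independence of the chosen fraction, from multiplicativity of `monOrd` on the cross-multiplied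
identity. -/
lemma monVal_div (w : Fin n → ℤ) {p q : TorusRing k n} (hp : p ≠ 0) (hq : q ≠ 0) :
    monVal w (toField p / toField q) = monOrd w p - monOrd w q := by
  set f := toField p / toField q with hf
  obtain ⟨hq', e⟩ := (exists_fraction f).choose_spec.choose_spec
  unfold monVal
  set p' := (exists_fraction f).choose
  set q' := (exists_fraction f).choose_spec.choose
  have h1 : toField p * toField q' = toField p' * toField q := by
    rw [hf, div_eq_div_iff (toField_ne_zero hq) (toField_ne_zero hq')] at e
    exact e
  have h2 : p * q' = p' * q := toField_injective (by simpa [toField] using h1)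
  have hp' : p' ≠ 0 := by
    rintro h0
    rw [h0, zero_mul] at h2
    exact (mul_ne_zero hp hq') h2
  have h3 := congrArg (monOrd w) h2
  rw [monOrd_mul w hp hq', monOrd_mul w hp' hq] at h3
  linarith

lemma monVal_toField (w : Fin n → ℤ) {p : TorusRing k n} (hp : p ≠ 0) :
    monVal w (toField p) = monOrd w p := by
  have := monVal_div w hp (one_ne_zero (α := TorusRing k n))
  have h1 : monOrd w (1 : TorusRing k n) = 0 := by
    rw [AddMonoidAlgebra.one_def, monOrd_single w _ one_ne_zero, zero_dotProduct]
  rw [h1, sub_zero] at this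
  rw [← this]
  simp [toField]

lemma exists_fraction' {f : ToricField k n} (hf : f ≠ 0) :
    ∃ p q : TorusRing k n, p ≠ 0 ∧ q ≠ 0 ∧ f = toField p / toField q := by
  obtain ⟨p, q, hq, e⟩ := exists_fraction f
  exact ⟨p, q, by rintro rfl; simp [toField] at e; exact hf e, hq, e⟩

lemma monVal_mul (w : Fin n → ℤ) {f g : ToricField k n} (hf : f ≠ 0) (hg : g ≠ 0) :
    monVal w (f * g) = monVal w f + monVal w g := by
  obtain ⟨p, q, hp, hq, rfl⟩ := exists_fraction' hf
  obtain ⟨p', q', hp', hq', rfl⟩ := exists_fraction' hg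
  have : toField p / toField q * (toField p' / toField q') =
      toField (p * p') / toField (q * q') := by
    simp only [toField, map_mul]; rw [div_mul_div_comm]
  rw [this, monVal_div w (mul_ne_zero hp hp') (mul_ne_zero hq hq'), monVal_div w hp hq,
    monVal_div w hp' hq', monOrd_mul w hp hp', monOrd_mul w hq hq']
  ring

lemma monVal_one (w : Fin n → ℤ) : monVal w (1 : ToricField k n) = 0 := by
  have := monVal_mul w (one_ne_zero (α := ToricField k n)) one_ne_zero
  rw [mul_one] at this
  linarith

lemma monVal_inv (w : Fin n → ℤ) {f : ToricField k n} (hf : f ≠ 0) :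
    monVal w f⁻¹ = -monVal w f := by
  have := monVal_mul w hf (inv_ne_zero hf)
  rw [mul_inv_cancel₀ hf, monVal_one] at this
  linarith

lemma monVal_add (w : Fin n → ℤ) {f g : ToricField k n} (hfg : f + g ≠ 0) {m : ℤ}
    (hf : f ≠ 0 → m ≤ monVal w f) (hg : g ≠ 0 → m ≤ monVal w g) : m ≤ monVal w (f + g) := by
  obtain ⟨p, q, hq, rfl⟩ := exists_fraction f
  obtain ⟨p', q', hq', rfl⟩ := exists_fraction g
  have hq0 := toField_ne_zero hq
  have hq0' := toField_ne_zero hq'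
  have e : toField p / toField q + toField p' / toField q' =
      toField (p * q' + p' * q) / toField (q * q') := by
    simp only [toField, map_mul, map_add] at hq0 hq0' ⊢
    rw [div_add_div _ _ hq0 hq0', mul_comm (algebraMap _ _ q)]
  have hne : p * q' + p' * q ≠ 0 := by
    intro h0
    rw [e, h0] at hfg
    simp [toField] at hfg
  rw [e, monVal_div w hne (mul_ne_zero hq hq'), monOrd_mul w hq hq', le_sub_iff_add_le]
  refine monOrd_add w hne (fun h1 => ?_) (fun h1 => ?_)
  · have hp : p ≠ 0 := left_ne_zero_of_mul h1
    have := hf (div_ne_zero (toField_ne_zero hp) hq0)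
    rw [monVal_div w hp hq] at this
    rw [monOrd_mul w hp hq']
    linarith
  · have hp : p' ≠ 0 := left_ne_zero_of_mul h1
    have := hg (div_ne_zero (toField_ne_zero hp) hq0')
    rw [monVal_div w hp hq'] at this
    rw [monOrd_mul w hp hq]
    linarith

lemma monVal_neg (w : Fin n → ℤ) (f : ToricField k n) : monVal w (-f) = monVal w f := by
  by_cases hf : f = 0
  · rw [hf, neg_zero]
  have h : monVal w (-1 : ToricField k n) = 0 := by
    have := monVal_mul w (neg_ne_zero.2 (one_ne_zero (α := ToricField k n)))
      (neg_ne_zero.2 one_ne_zero)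
    rw [neg_mul_neg, mul_one, monVal_one] at this
    linarith
  rw [← neg_one_mul, monVal_mul w (by simp) hf, h, zero_add]

/-- The valuation ring of a monomial valuation. -/
def monRing (k : Type*) [Field k] {n : ℕ} (w : Fin n → ℤ) : Subring (ToricField k n) where
  carrier := {f | f ≠ 0 → 0 ≤ monVal w f}
  mul_mem' {f g} hf hg hne := by
    rw [monVal_mul w (left_ne_zero_of_mul hne) (right_ne_zero_of_mul hne)]
    exact add_nonneg (hf (left_ne_zero_of_mul hne)) (hg (right_ne_zero_of_mul hne))
  one_mem' _ := (monVal_one w).ge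
  add_mem' {f g} hf hg hne := monVal_add w hne hf hg
  zero_mem' h := absurd rfl h
  neg_mem' {f} hf hne := by rw [monVal_neg]; exact hf (neg_ne_zero.1 hne)

lemma mem_monRing {w : Fin n → ℤ} {f : ToricField k n} :
    f ∈ monRing k w ↔ (f ≠ 0 → 0 ≤ monVal w f) := Iff.rfl

/-! ### Characters and the coordinate rings of affine toric varieties -/

lemma chi_def (u : Fin n → ℤ) : chi k u = toField (AddMonoidAlgebra.single u 1) := rfl

lemma chi_add (u v : Fin n → ℤ) : chi k (u + v) = chi k u * chi k v := by
  rw [chi_def, chi_def, chi_def, toField, toField, toField, ← map_mul,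
    AddMonoidAlgebra.single_mul_single, mul_one]

@[simp] lemma chi_zero : chi k (0 : Fin n → ℤ) = 1 := by
  rw [chi_def, ← AddMonoidAlgebra.one_def, toField, map_one]

lemma chi_ne_zero (u : Fin n → ℤ) : chi k u ≠ 0 :=
  toField_ne_zero (by simp)

lemma chi_neg (u : Fin n → ℤ) : chi k (-u) = (chi k u)⁻¹ := by
  refine eq_inv_of_mul_eq_one_right ?_
  rw [← chi_add, add_neg_cancel, chi_zero]

lemma chi_sub (u v : Fin n → ℤ) : chi k (u - v) = chi k u / chi k v := by
  rw [sub_eq_add_neg, chi_add, chi_neg, div_eq_mul_inv]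

lemma chi_nsmul (m : ℕ) (u : Fin n → ℤ) : chi k (m • u) = chi k u ^ m := by
  induction m with
  | zero => simp
  | succ m ih => rw [succ_nsmul, chi_add, ih, pow_succ]

lemma chi_zsmul (m : ℤ) (u : Fin n → ℤ) : chi k (m • u) = chi k u ^ m := by
  rcases le_total 0 m with h | h
  · lift m to ℕ using h
    rw [natCast_zsmul, chi_nsmul, zpow_natCast]
  · obtain ⟨l, rfl⟩ : ∃ l : ℕ, m = -(l : ℤ) := ⟨m.natAbs, by omega⟩
    rw [neg_smul, chi_neg, natCast_zsmul, chi_nsmul, zpow_neg, zpow_natCast]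

lemma monVal_chi (w u : Fin n → ℤ) : monVal w (chi k u) = u ⬝ᵥ w := by
  rw [chi_def, monVal_toField w (by simp), monOrd_single w u one_ne_zero]

lemma toField_single (u : Fin n → ℤ) (c : k) :
    toField (AddMonoidAlgebra.single u c) = algebraMap k (ToricField k n) c * chi k u := by
  have : AddMonoidAlgebra.single u c =
      algebraMap k (TorusRing k n) c * AddMonoidAlgebra.single u 1 := by
    rw [AddMonoidAlgebra.coe_algebraMap, Function.comp_apply,
      AddMonoidAlgebra.single_mul_single, zero_add, mul_one]
    rfl
  rw [this, toField, map_mul, ← IsScalarTower.algebraMap_apply]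
  rfl

lemma toField_eq_sum (p : TorusRing k n) :
    toField p = ∑ u ∈ p.coeff.support, algebraMap k (ToricField k n) (p.coeff u) * chi k u := by
  conv_lhs => rw [← AddMonoidAlgebra.sum_coeff_single p]
  rw [toField, Finsupp.sum, map_sum]
  exact Finset.sum_congr rfl fun u _ => toField_single u _

lemma mem_coneAlgebra {σ : PointedCone ℝ (Fin n → ℝ)} {f : ToricField k n} :
    f ∈ coneAlgebra k σ ↔
      ∃ p : TorusRing k n, (∀ u ∈ p.coeff.support, u ∈ dualSemigroup σ) ∧ f = toField p := by
  constructor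
  · intro hf
    induction hf using Algebra.adjoin_induction with
    | mem x hx =>
      obtain ⟨u, hu, rfl⟩ := hx
      refine ⟨AddMonoidAlgebra.single u 1, fun v hv => ?_, rfl⟩
      rw [AddMonoidAlgebra.coeff_single, Finsupp.support_single _ one_ne_zero,
        Finset.mem_singleton] at hv
      rw [hv]; exact hu
    | algebraMap c =>
      refine ⟨AddMonoidAlgebra.single 0 c, fun v hv => ?_, by rw [toField_single]; simp⟩
      rw [AddMonoidAlgebra.coeff_single] at hv
      have := Finsupp.support_single_subset hv
      rw [Finset.mem_singleton] at this
      rw [this]; exact zero_mem _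
    | add x y _ _ hx hy =>
      obtain ⟨p, hp, rfl⟩ := hx
      obtain ⟨q, hq, rfl⟩ := hy
      refine ⟨p + q, fun u hu => ?_, by simp [toField]⟩
      classical
      have : u ∈ p.coeff.support ∪ q.coeff.support := Finsupp.support_add hu
      rcases Finset.mem_union.1 this with h | h
      · exact hp u h
      · exact hq u h
    | mul x y _ _ hx hy =>
      obtain ⟨p, hp, rfl⟩ := hx
      obtain ⟨q, hq, rfl⟩ := hy
      refine ⟨p * q, fun u hu => ?_, by simp [toField]⟩
      obtain ⟨a, ha, b, hb, rfl⟩ := supp_mul hu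
      exact add_mem (hp a ha) (hq b hb)
  · rintro ⟨p, hp, rfl⟩
    rw [toField_eq_sum]
    exact sum_mem fun u hu => mul_mem (Subalgebra.algebraMap_mem _ _)
      (Algebra.subset_adjoin ⟨u, hp u hu, rfl⟩)

lemma chi_mem_coneAlgebra {σ : PointedCone ℝ (Fin n → ℝ)} {u : Fin n → ℤ} :
    chi k u ∈ coneAlgebra k σ ↔ u ∈ dualSemigroup σ := by
  refine ⟨fun h => ?_, fun h => Algebra.subset_adjoin ⟨u, h, rfl⟩⟩
  obtain ⟨p, hp, e⟩ := mem_coneAlgebra.1 h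
  rw [← toField_injective e] at hp
  exact hp u (by simp)

lemma coneAlgebra_mono {σ τ : PointedCone ℝ (Fin n → ℝ)} (h : τ ≤ σ) :
    coneAlgebra k σ ≤ coneAlgebra k τ :=
  Algebra.adjoin_mono fun _ ⟨u, hu, e⟩ => ⟨u, dualSemigroup_anti h hu, e⟩

lemma mem_coneAlgebra_bot {f : ToricField k n} :
    f ∈ coneAlgebra k (⊥ : PointedCone ℝ (Fin n → ℝ)) ↔ ∃ p : TorusRing k n, f = toField p := by
  rw [mem_coneAlgebra]
  refine exists_congr fun p => and_iff_right fun u _ v hv => ?_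
  rw [(Submodule.mem_bot _).1 hv]; simp

lemma monVal_nonneg_of_mem {σ : PointedCone ℝ (Fin n → ℝ)} {w : Fin n → ℤ}
    (hw : latticeVec w ∈ σ) {f : ToricField k n} (hf : f ∈ coneAlgebra k σ) : f ∈ monRing k w := by
  intro h0
  obtain ⟨p, hp, rfl⟩ := mem_coneAlgebra.1 hf
  have hp0 : p ≠ 0 := by rintro rfl; simp [toField] at h0
  rw [monVal_toField w hp0]
  obtain ⟨u, hu, e⟩ := monOrd_exists w hp0
  rw [← e]
  have := hp u hu _ hw
  rw [pairing_latticeVec] at this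
  exact_mod_cast this

/-- Testing on characters reduces this to biduality of `σ`. It recovers the lattice points of a cone
from its coordinate ring. -/
lemma coneAlgebra_le_monRing_iff {σ : PointedCone ℝ (Fin n → ℝ)} (hσ : IsRational σ)
    {w : Fin n → ℤ} : (coneAlgebra k σ).toSubring ≤ monRing k w ↔ latticeVec w ∈ σ := by
  refine ⟨fun h => hσ.mem_iff.2 fun u hu => ?_, fun h f hf => monVal_nonneg_of_mem h hf⟩
  have := h (chi_mem_coneAlgebra (k := k).2 hu) (chi_ne_zero u)
  rw [monVal_chi] at this
  rw [pairing_latticeVec]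
  exact_mod_cast this

/-- Every function is a quotient of elements of the coordinate ring of a cone of a fan. -/
lemma Fan.exists_fraction_coneAlgebra (Δ : Fan n) {σ} (hσ : σ ∈ Δ.cones) (f : ToricField k n) :
    ∃ a ∈ coneAlgebra k σ, ∃ b ∈ coneAlgebra k σ, b ≠ 0 ∧ f = a / b := by
  obtain ⟨p, q, hq, rfl⟩ := exists_fraction f
  -- Since `u` is positive on `σ` off the origin, multiplying by a high power of `χ^u` moves any
  -- finite set of exponents into the dual semigroup.
  obtain ⟨u, hu, hpos⟩ := Δ.exists_dual_pos hσ
  have hshift : ∀ p : TorusRing k n, ∃ m : ℕ, ∀ l ≥ m,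
      chi k (l • u) * toField p ∈ coneAlgebra k σ := by
    intro p
    have hex : ∀ v : Fin n → ℤ, ∃ m : ℕ, ∀ l ≥ m, v + l • u ∈ dualSemigroup σ := by
      intro v
      have hbot : v ∈ dualSemigroup (faceCone σ u) := fun x hx => by
        rw [hpos x hx.1 hx.2]; simp
      obtain ⟨m, hm⟩ := (Δ.isRational hσ).exists_add_nsmul_mem hu hbot
      refine ⟨m, fun l hl => ?_⟩
      have : v + l • u = v + m • u + (l - m) • u := by
        rw [add_assoc, ← add_nsmul, Nat.add_sub_cancel' hl]
      rw [this]
      exact add_mem hm (AddSubmonoid.nsmul_mem _ hu _)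
    choose m hm using hex
    refine ⟨p.coeff.support.sup m, fun l hl => ?_⟩
    rw [toField_eq_sum, Finset.mul_sum]
    refine sum_mem fun v hv => ?_
    rw [mul_left_comm, ← chi_add, add_comm]
    exact mul_mem (Subalgebra.algebraMap_mem _ _)
      (chi_mem_coneAlgebra.2 (hm v l ((Finset.le_sup hv).trans hl)))
  obtain ⟨m, hm⟩ := hshift p
  obtain ⟨m', hm'⟩ := hshift q
  refine ⟨_, hm (max m m') (le_max_left _ _), _, hm' (max m m') (le_max_right _ _),
    mul_ne_zero (chi_ne_zero _) (toField_ne_zero hq), ?_⟩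
  rw [mul_div_mul_left _ _ (chi_ne_zero _)]

/-! ### The local rings of the invariant divisors and of the orbits -/

/-- At an interior point `w` a supporting functional is positive unless it vanishes on all of `σ`,
so the generating characters are those of positive `w`-order. Primality of the orbit ideal then
follows from multiplicativity of the valuation. -/
lemma mem_orbitIdeal_iff {σ : PointedCone ℝ (Fin n → ℝ)} {w : Fin n → ℤ}
    (hw : IsRelint σ (latticeVec w)) (f : (coneAlgebra k σ).toSubring) :
    f ∈ orbitIdeal k σ ↔ ((f : ToricField k n) ≠ 0 → 0 < monVal w (f : ToricField k n)) := by
  let I : Ideal (coneAlgebra k σ).toSubring :=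
    { carrier := {f | (f : ToricField k n) ≠ 0 → 0 < monVal w (f : ToricField k n)}
      add_mem' := fun {f g} hf hg hne => Int.lt_iff_add_one_le.2 <| by
        rw [zero_add]
        exact monVal_add w hne (fun h => Int.lt_iff_add_one_le.1 (hf h))
          (fun h => Int.lt_iff_add_one_le.1 (hg h))
      zero_mem' := fun h => absurd rfl h
      smul_mem' := fun f g hg hne => by
        have hne' : (f : ToricField k n) * (g : ToricField k n) ≠ 0 := hne
        change 0 < monVal w ((f : ToricField k n) * (g : ToricField k n))
        rw [monVal_mul w (left_ne_zero_of_mul hne') (right_ne_zero_of_mul hne')]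
        have h1 := monVal_nonneg_of_mem hw.1 f.2 (left_ne_zero_of_mul hne')
        have h2 := hg (right_ne_zero_of_mul hne')
        linarith }
  change f ∈ orbitIdeal k σ ↔ f ∈ I
  constructor
  · intro hf
    refine (Ideal.span_le.2 ?_ : orbitIdeal k σ ≤ I) hf
    rintro g ⟨u, hu, ⟨v, hv, hne⟩, e⟩ -
    rw [e, monVal_chi]
    have h1 := hu _ hw.1
    rw [pairing_latticeVec] at h1
    have h2 : 0 ≤ u ⬝ᵥ w := by exact_mod_cast h1
    refine lt_of_le_of_ne h2 fun h0 => hne (hw.2 u hu ?_ v hv)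
    rw [pairing_latticeVec, ← h0]; simp
  · intro hf
    obtain ⟨p, hp, e⟩ := mem_coneAlgebra.1 f.2
    by_cases h0 : (f : ToricField k n) = 0
    · rw [show f = 0 from Subtype.ext h0]; exact zero_mem _
    have hp0 : p ≠ 0 := by rintro rfl; rw [e] at h0; simp [toField] at h0
    have hpos := hf h0
    rw [e, monVal_toField w hp0] at hpos
    classical
    let t : (Fin n → ℤ) → (coneAlgebra k σ).toSubring := fun u =>
      if h : u ∈ dualSemigroup σ then ⟨chi k u, chi_mem_coneAlgebra.2 h⟩ else 0
    let c : (Fin n → ℤ) → (coneAlgebra k σ).toSubring := fun u =>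
      ⟨algebraMap k _ (p.coeff u), Subalgebra.algebraMap_mem _ _⟩
    have hf' : f = ∑ u ∈ p.coeff.support, c u * t u := by
      apply Subtype.ext
      rw [e, toField_eq_sum]
      simp only [AddSubmonoidClass.coe_finsetSum, Subring.coe_mul]
      refine Finset.sum_congr rfl fun u hu => ?_
      simp only [c, t, dif_pos (hp u hu)]
    rw [hf']
    refine sum_mem fun u hu => Ideal.mul_mem_left _ _ (Ideal.subset_span ?_)
    refine ⟨u, hp u hu, ⟨_, hw.1, ?_⟩, by simp only [t, dif_pos (hp u hu)]⟩
    rw [pairing_latticeVec]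
    have := hpos.trans_le (monOrd_le w hu)
    exact_mod_cast this.ne'

lemma orbitIdeal_isPrime {σ : PointedCone ℝ (Fin n → ℝ)} (hσ : IsRational σ) :
    (orbitIdeal k σ).IsPrime := by
  obtain ⟨w, hw⟩ := hσ.exists_relint
  refine ⟨fun h => ?_, fun {f g} hfg => ?_⟩
  · have := (mem_orbitIdeal_iff (k := k) hw 1).1 (h ▸ Submodule.mem_top) one_ne_zero
    change 0 < monVal w (1 : ToricField k n) at this
    rw [monVal_one] at this
    exact lt_irrefl _ this
  · rw [mem_orbitIdeal_iff hw] at hfg ⊢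
    rw [mem_orbitIdeal_iff hw]
    by_contra hcon
    push Not at hcon
    obtain ⟨⟨hf0, hf⟩, ⟨hg0, hg⟩⟩ := hcon
    have h1 : 0 < monVal w ((f : ToricField k n) * (g : ToricField k n)) := hfg (mul_ne_zero hf0 hg0)
    rw [monVal_mul w hf0 hg0] at h1
    linarith

/-- The local ring of `X_Δ` at the generic point of the orbit of `σ`. -/
def orbitRing (k : Type*) [Field k] {n : ℕ} {σ : PointedCone ℝ (Fin n → ℝ)} (hσ : IsRational σ) :
    LocalSubring (ToricField k n) :=
  haveI := orbitIdeal_isPrime (k := k) hσ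
  LocalSubring.ofPrime (coneAlgebra k σ).toSubring (orbitIdeal k σ)

lemma isOrbitPoint_iff {σ : PointedCone ℝ (Fin n → ℝ)} (hσ : IsRational σ)
    {R : LocalSubring (ToricField k n)} : IsOrbitPoint k σ R ↔ R = orbitRing k hσ :=
  ⟨fun ⟨_, h⟩ => h, fun h => ⟨orbitIdeal_isPrime hσ, h⟩⟩

lemma mem_orbitRing {σ : PointedCone ℝ (Fin n → ℝ)} (hσ : IsRational σ) {w : Fin n → ℤ}
    (hw : IsRelint σ (latticeVec w)) {f : ToricField k n} :
    f ∈ (orbitRing k hσ).toSubring ↔ ∃ a ∈ coneAlgebra k σ, ∃ b ∈ coneAlgebra k σ,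
      b ≠ 0 ∧ monVal w b = 0 ∧ f = a / b := by
  have := orbitIdeal_isPrime (k := k) hσ
  change f ∈ (LocalSubring.ofPrime (coneAlgebra k σ).toSubring (orbitIdeal k σ)).toSubring ↔ _
  rw [LocalSubring.mem_ofPrime]
  constructor
  · rintro ⟨a, b, hb, rfl⟩
    rw [mem_orbitIdeal_iff hw] at hb
    push Not at hb
    exact ⟨a, a.2, b, b.2, hb.1, le_antisymm hb.2 (monVal_nonneg_of_mem hw.1 b.2 hb.1), rfl⟩
  · rintro ⟨a, ha, b, hb, hb0, h0, rfl⟩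
    refine ⟨⟨a, ha⟩, ⟨b, hb⟩, ?_, rfl⟩
    rw [mem_orbitIdeal_iff hw]
    push Not
    exact ⟨hb0, h0.le⟩

lemma monVal_eq_zero_of_unit {w : Fin n → ℤ} {f : ToricField k n} (hf : f ≠ 0)
    (h1 : f ∈ monRing k w) (h2 : f⁻¹ ∈ monRing k w) : monVal w f = 0 := by
  have := h1 hf
  have := h2 (inv_ne_zero hf)
  rw [monVal_inv w hf] at this
  linarith

lemma isRelint_rayCone (v : Fin n → ℤ) : IsRelint (rayCone v) (latticeVec v) := by
  refine ⟨latticeVec_mem_rayCone v, fun u _ h0 x hx => ?_⟩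
  obtain ⟨c, -, rfl⟩ := mem_rayCone.1 hx
  rw [pairing_smul_right, h0, mul_zero]

lemma mem_dualSemigroup_rayCone {u v : Fin n → ℤ} :
    u ∈ dualSemigroup (rayCone v) ↔ 0 ≤ u ⬝ᵥ v := by
  have : rayCone v = PointedCone.hull ℝ (latticeVec '' ({v} : Set (Fin n → ℤ))) := by
    simp [rayCone]
  rw [this, mem_dualSemigroup_hull]
  simp

/-- Multiplying numerator and denominator by a power of `χ^u` with `u ⬝ᵥ v = 1` gives the
denominator order `0` along `v` and keeps both in the coordinate ring of the ray. -/
lemma orbitRing_rayCone {v : Fin n → ℤ} (hv : IsPrimitive v) :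
    (orbitRing k (rayCone_isRational v)).toSubring = monRing k v := by
  ext f
  rw [mem_orbitRing _ (isRelint_rayCone v)]
  constructor
  · rintro ⟨a, ha, b, hb, hb0, h0, rfl⟩ hne
    have ha0 : a ≠ 0 := by rintro rfl; simp at hne
    rw [div_eq_mul_inv, monVal_mul v ha0 (inv_ne_zero hb0), monVal_inv v hb0, h0, neg_zero,
      add_zero]
    exact monVal_nonneg_of_mem (latticeVec_mem_rayCone v) ha ha0
  · intro hf
    by_cases hf0 : f = 0
    · subst hf0
      exact ⟨0, zero_mem _, 1, one_mem _, one_ne_zero, monVal_one _, by simp⟩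
    obtain ⟨p, q, hp, hq, rfl⟩ := exists_fraction' hf0
    obtain ⟨u, hu⟩ := hv.exists_dotProduct_eq_one
    have h1 := hf hf0
    rw [monVal_div v hp hq] at h1
    have hmem : ∀ p : TorusRing k n, p ≠ 0 → monOrd v q ≤ monOrd v p →
        chi k (-(monOrd v q) • u) * toField p ∈ coneAlgebra k (rayCone v) := by
      intro p hp hle
      rw [toField_eq_sum, Finset.mul_sum]
      refine sum_mem fun x hx => ?_
      rw [mul_left_comm, ← chi_add]
      refine mul_mem (Subalgebra.algebraMap_mem _ _) (chi_mem_coneAlgebra.2 ?_)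
      rw [mem_dualSemigroup_rayCone, add_dotProduct, smul_dotProduct, hu]
      have := monOrd_le v hx
      simp only [smul_eq_mul, mul_one]
      linarith
    refine ⟨_, hmem p hp (by linarith), _, hmem q hq le_rfl,
      mul_ne_zero (chi_ne_zero _) (toField_ne_zero hq), ?_, ?_⟩
    · rw [monVal_mul v (chi_ne_zero _) (toField_ne_zero hq), monVal_chi, monVal_toField v hq,
        smul_dotProduct, hu]
      simp
    · rw [mul_div_mul_left _ _ (chi_ne_zero _)]

lemma isUniformizer_monRing {v u : Fin n → ℤ} (hu : u ⬝ᵥ v = 1) :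
    IsUniformizer (monRing k v) (chi k u) := by
  refine ⟨fun _ => ?_, fun h => ?_, fun f hf => ⟨monVal v f, fun _ => ?_, fun _ => ?_⟩⟩
  · rw [monVal_chi, hu]; norm_num
  · have := h (inv_ne_zero (chi_ne_zero u))
    rw [monVal_inv v (chi_ne_zero u), monVal_chi, hu] at this
    norm_num at this
  · rw [← chi_zsmul, monVal_mul v hf (chi_ne_zero _), monVal_chi, smul_dotProduct, hu]
    simp
  · rw [← chi_zsmul, monVal_inv v (mul_ne_zero hf (chi_ne_zero _)),
      monVal_mul v hf (chi_ne_zero _), monVal_chi, smul_dotProduct, hu]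
    simp

lemma ordAlong_monRing {v : Fin n → ℤ} (hv : IsPrimitive v) {f : ToricField k n} (hf : f ≠ 0) :
    ordAlong (monRing k v) f = monVal v f := by
  obtain ⟨u, hu⟩ := hv.exists_dotProduct_eq_one
  refine (isUniformizer_monRing hu).ordAlong_eq hf ⟨fun _ => ?_, fun _ => ?_⟩
  · rw [← chi_zsmul, monVal_mul v hf (chi_ne_zero _), monVal_chi, smul_dotProduct, hu]
    simp
  · rw [← chi_zsmul, monVal_inv v (mul_ne_zero hf (chi_ne_zero _)),
      monVal_mul v hf (chi_ne_zero _), monVal_chi, smul_dotProduct, hu]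
    simp

end Laurent

end

noncomputable section

open scoped BigOperators

/-! ## Points of toric varieties -/

/-- `x` is a localization of the subring `A`. -/
structure IsLocalizationOf {F : Type*} [Field F] (A x : Subring F) : Prop where
  le : A ≤ x
  frac : ∀ f ∈ x, ∃ a ∈ A, ∃ b ∈ A, b ≠ 0 ∧ b⁻¹ ∈ x ∧ f = a / b

lemma LocalSubring.isLocalizationOf_ofPrime {F : Type*} [Field F] (A : Subring F) (P : Ideal A)
    [P.IsPrime] : IsLocalizationOf A (LocalSubring.ofPrime A P).toSubring where
  le := LocalSubring.le_ofPrime A P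
  frac f hf := by
    obtain ⟨a, b, hb, rfl⟩ := LocalSubring.mem_ofPrime.1 hf
    obtain ⟨h0, h1⟩ := (LocalSubring.inv_mem_ofPrime b.2).1 hb
    exact ⟨a, a.2, b, b.2, h0, h1, rfl⟩

lemma IsLocalizationOf.exists_ofPrime {F : Type*} [Field F] {A : Subring F} {R : LocalSubring F}
    (h : IsLocalizationOf A R.toSubring) :
    ∃ (P : Ideal A) (_ : P.IsPrime), R = LocalSubring.ofPrime A P := by
  let P : Ideal A := (IsLocalRing.maximalIdeal R.toSubring).comap (Subring.inclusion h.le)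
  have hP : P.IsPrime := Ideal.comap_isPrime _ _
  have key : ∀ b : A, b ∉ P ↔ (b : F) ≠ 0 ∧ (b : F)⁻¹ ∈ R.toSubring := by
    intro b
    have h1 : b ∉ P ↔ IsUnit (⟨b, h.le b.2⟩ : R.toSubring) := by
      rw [show b ∈ P ↔ (⟨b, h.le b.2⟩ : R.toSubring) ∈ IsLocalRing.maximalIdeal R.toSubring from
        Iff.rfl, IsLocalRing.mem_maximalIdeal, mem_nonunits_iff, not_not]
    rw [h1]
    by_cases h0 : (b : F) = 0
    · have : (⟨b, h.le b.2⟩ : R.toSubring) = 0 := Subtype.ext h0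
      rw [this]; simp [h0]
    · rw [Subring.isUnit_iff_inv_mem _ h0]; simp [h0]
  refine ⟨P, hP, LocalSubring.ext ?_⟩
  ext f
  rw [LocalSubring.mem_ofPrime]
  constructor
  · intro hf
    obtain ⟨a, ha, b, hb, h0, h1, rfl⟩ := h.frac f hf
    exact ⟨⟨a, ha⟩, ⟨b, hb⟩, (key _).2 ⟨h0, h1⟩, rfl⟩
  · rintro ⟨a, b, hb, rfl⟩
    rw [div_eq_mul_inv]
    exact mul_mem (h.le a.2) ((key b).1 hb).2

/-- Lets points be compared across different charts through subrings of `K`, without mentioning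
prime ideals. -/
lemma Model.mem_ofCharts_iff {k K : Type*} [Field k] [Field K] [Algebra k K]
    {S : Set (Subalgebra k K)} {R : LocalSubring K} :
    R ∈ (Model.ofCharts S).points ↔ ∃ A ∈ S, IsLocalizationOf A.toSubring R.toSubring := by
  constructor
  · rintro ⟨A, hA, P, hP, rfl⟩
    exact ⟨A, hA, LocalSubring.isLocalizationOf_ofPrime _ _⟩
  · rintro ⟨A, hA, h⟩
    obtain ⟨P, hP, rfl⟩ := h.exists_ofPrime
    exact ⟨A, hA, P, hP, rfl⟩

section Toric

variable {k : Type*} [Field k] {n : ℕ}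

lemma mem_toricVariety_iff {Δ : Fan n} {x : LocalSubring (ToricField k n)} :
    x ∈ (toricVariety k Δ).points ↔
      ∃ σ ∈ Δ.cones, IsLocalizationOf (coneAlgebra k σ).toSubring x.toSubring := by
  rw [toricVariety, Model.mem_ofCharts_iff, Set.exists_mem_image]

/-- `τ` is the cone whose orbit contains the point `x`. -/
structure IsOrbitCone (τ : PointedCone ℝ (Fin n → ℝ)) (x : LocalSubring (ToricField k n)) :
    Prop extends IsLocalizationOf (coneAlgebra k τ).toSubring x.toSubring where
  chi_neg_mem : ∀ u ∈ dualSemigroup τ, chi k (-u) ∈ x.toSubring → ∀ v ∈ τ, pairing u v = 0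

/-- The characters of `σ^∨` invertible at `x` form a monoid. The member cutting out the smallest
face of `σ` defines `τ`: inverting that single character gives the coordinate ring of `τ`, and no
further character becomes invertible unless it vanishes on `τ`. -/
lemma Fan.exists_isOrbitCone (Δ : Fan n) {x : LocalSubring (ToricField k n)} {σ}
    (hσ : σ ∈ Δ.cones) (h : IsLocalizationOf (coneAlgebra k σ).toSubring x.toSubring) :
    ∃ τ ∈ Δ.cones, τ ≤ σ ∧ IsOrbitCone τ x := by
  obtain ⟨s, hs⟩ := Δ.isRational hσ
  let Q : AddSubmonoid (Fin n → ℤ) :=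
    { carrier := {u | u ∈ dualSemigroup σ ∧ chi k (-u) ∈ x.toSubring}
      zero_mem' := ⟨zero_mem _, by rw [neg_zero, chi_zero]; exact one_mem _⟩
      add_mem' := fun {u v} hu hv => ⟨add_mem hu.1 hv.1, by
        rw [neg_add, chi_add]; exact mul_mem hu.2 hv.2⟩ }
  have hQ : ∀ u ∈ Q, ∀ g ∈ s, 0 ≤ u ⬝ᵥ g := fun u hu => by
    have := hu.1
    rw [hs] at this
    exact mem_dualSemigroup_hull.1 this
  obtain ⟨u₀, hu₀, hmin⟩ := exists_smallest_face Q hQ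
  refine ⟨faceCone σ u₀, Δ.faceCone_mem hσ hu₀.1, inf_le_left, ⟨⟨fun f hf => ?_, fun f hf => ?_⟩,
    fun u hu hux v hv => ?_⟩⟩
  · obtain ⟨p, hp, rfl⟩ := mem_coneAlgebra.1 hf
    rw [toField_eq_sum]
    refine sum_mem fun u hu => mul_mem (h.le (Subalgebra.algebraMap_mem _ _)) ?_
    obtain ⟨m, hm⟩ := (Δ.isRational hσ).exists_add_nsmul_mem hu₀.1 (hp u hu)
    have e : chi k u = chi k (u + m • u₀) * chi k (-u₀) ^ m := by
      rw [← chi_nsmul, ← chi_add]; congr 1; rw [smul_neg]; abel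
    rw [e]
    exact mul_mem (h.le (chi_mem_coneAlgebra.2 hm)) (pow_mem hu₀.2 m)
  · obtain ⟨a, ha, b, hb, h1⟩ := h.frac f hf
    exact ⟨a, coneAlgebra_mono inf_le_left ha, b, coneAlgebra_mono inf_le_left hb, h1⟩
  · obtain ⟨m, hm⟩ := (Δ.isRational hσ).exists_add_nsmul_mem hu₀.1 hu
    have hmQ : u + m • u₀ ∈ Q := ⟨hm, by
      rw [neg_add, ← smul_neg, chi_add, chi_nsmul]; exact mul_mem hux (pow_mem hu₀.2 m)⟩
    have h0 : pairing (u + m • u₀) v = 0 := by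
      have hv' := hv
      rw [hs, faceCone_hull (hQ u₀ hu₀)] at hv'
      obtain ⟨c, -, rfl⟩ := mem_hull_lattice.1 hv'
      rw [pairing_sum_right]
      refine Finset.sum_eq_zero fun g hg => ?_
      rw [Finset.mem_filter] at hg
      rw [pairing_smul_right, pairing_latticeVec, hmin _ hmQ g hg.1 hg.2]
      simp
    have hv0 : pairing u₀ v = 0 := hv.2
    rw [pairing_add_left, pairing_nsmul_left, hv0] at h0
    simpa using h0

lemma Fan.exists_isOrbitCone_of_mem {Δ : Fan n} {x : LocalSubring (ToricField k n)}
    (hx : x ∈ (toricVariety k Δ).points) : ∃ τ ∈ Δ.cones, IsOrbitCone τ x := by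
  obtain ⟨σ, hσ, h⟩ := mem_toricVariety_iff.1 hx
  obtain ⟨τ, hτ, -, hτx⟩ := Δ.exists_isOrbitCone hσ h
  exact ⟨τ, hτ, hτx⟩

lemma isOrbitCone_orbitRing {σ : PointedCone ℝ (Fin n → ℝ)} (hσ : IsRational σ) :
    IsOrbitCone σ (orbitRing k hσ) := by
  obtain ⟨w, hw⟩ := hσ.exists_relint
  have := orbitIdeal_isPrime (k := k) hσ
  refine ⟨LocalSubring.isLocalizationOf_ofPrime _ _, fun u hu hux => hw.2 u hu ?_⟩
  obtain ⟨a, ha, b, hb, hb0, h0, e⟩ := (mem_orbitRing hσ hw).1 hux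
  have ha0 : a ≠ 0 := by rintro rfl; rw [zero_div] at e; exact chi_ne_zero _ e
  have h1 := congrArg (monVal w) e
  rw [div_eq_mul_inv, monVal_mul w ha0 (inv_ne_zero hb0), monVal_inv w hb0, h0, monVal_chi] at h1
  have h2 := monVal_nonneg_of_mem hw.1 ha ha0
  have h3 := hu _ hw.1
  rw [pairing_latticeVec] at h3 ⊢
  have h3' : 0 ≤ u ⬝ᵥ w := by exact_mod_cast h3
  rw [neg_dotProduct] at h1
  have : u ⬝ᵥ w = 0 := by linarith
  exact_mod_cast this

lemma orbitRing_mem {Δ : Fan n} {σ} (hσ : σ ∈ Δ.cones) :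
    orbitRing k (Δ.isRational hσ) ∈ (toricVariety k Δ).points :=
  mem_toricVariety_iff.2 ⟨σ, hσ, (isOrbitCone_orbitRing _).toIsLocalizationOf⟩

/-- An element of the coordinate ring which is invertible at a point of the orbit of `τ` has a
term which is invertible on the orbit. -/
lemma IsOrbitCone.exists_supp {τ : PointedCone ℝ (Fin n → ℝ)} {x : LocalSubring (ToricField k n)}
    (h : IsOrbitCone τ x) {p : TorusRing k n} (hp : ∀ u ∈ p.coeff.support, u ∈ dualSemigroup τ)
    (hp0 : p ≠ 0) (hpx : (toField p)⁻¹ ∈ x.toSubring) :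
    ∃ u ∈ p.coeff.support, ∀ v ∈ τ, pairing u v = 0 := by
  classical
  by_contra! hcon
  have hmem : toField p ∈ x.toSubring := h.le (mem_coneAlgebra.2 ⟨p, hp, rfl⟩)
  have hunit : IsUnit (⟨toField p, hmem⟩ : x.toSubring) :=
    (Subring.isUnit_iff_inv_mem _ (toField_ne_zero hp0)).2 hpx
  let t : (Fin n → ℤ) → x.toSubring := fun u =>
    if h : chi k u ∈ x.toSubring then ⟨chi k u, h⟩ else 0
  have hkx : ∀ c : k, algebraMap k (ToricField k n) c ∈ x.toSubring :=
    fun c => h.le (Subalgebra.algebraMap_mem _ _)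
  let c : (Fin n → ℤ) → x.toSubring := fun u => ⟨algebraMap k _ (p.coeff u), hkx _⟩
  have hchi : ∀ u ∈ p.coeff.support, chi k u ∈ x.toSubring := fun u hu =>
    h.le (chi_mem_coneAlgebra.2 (hp u hu))
  have hf' : (⟨toField p, hmem⟩ : x.toSubring) = ∑ u ∈ p.coeff.support, c u * t u := by
    apply Subtype.ext
    change toField p = _
    rw [toField_eq_sum]
    simp only [AddSubmonoidClass.coe_finsetSum, Subring.coe_mul]
    refine Finset.sum_congr rfl fun u hu => ?_
    simp only [c, t, dif_pos (hchi u hu)]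
  -- If no exponent vanished on `τ`, every term of `p` would lie in the maximal ideal at `x`, and so
  -- would `p`.
  have : (⟨toField p, hmem⟩ : x.toSubring) ∈ IsLocalRing.maximalIdeal x.toSubring := by
    rw [hf']
    refine sum_mem fun u hu => Ideal.mul_mem_left _ _ ?_
    simp only [t, dif_pos (hchi u hu)]
    rw [IsLocalRing.mem_maximalIdeal, mem_nonunits_iff,
      Subring.isUnit_iff_inv_mem _ (chi_ne_zero _), ← chi_neg]
    intro hneg
    obtain ⟨v, hv, hne⟩ := hcon u hu
    exact hne (h.chi_neg_mem u (hp u hu) hneg v hv)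
  exact (IsLocalRing.mem_maximalIdeal _).1 this hunit

/-- For `w` in `τ`, a denominator invertible at `x` has a term orthogonal to `τ`, so its `w`-order
is at most `0` and division preserves nonnegativity. This decides which invariant divisors pass
through `x`. -/
lemma IsOrbitCone.le_monRing_iff {τ : PointedCone ℝ (Fin n → ℝ)} (hτ : IsRational τ)
    {x : LocalSubring (ToricField k n)} (h : IsOrbitCone τ x) {w : Fin n → ℤ} :
    x.toSubring ≤ monRing k w ↔ latticeVec w ∈ τ := by
  refine ⟨fun hle => (coneAlgebra_le_monRing_iff hτ).1 (h.le.trans hle), fun hw f hf => ?_⟩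
  obtain ⟨a, ha, b, hb, hb0, hbx, rfl⟩ := h.frac f hf
  intro hne
  have ha0 : a ≠ 0 := by rintro rfl; simp at hne
  have h1 := monVal_nonneg_of_mem hw ha ha0
  obtain ⟨q, hq, rfl⟩ := mem_coneAlgebra.1 hb
  have hq0 : q ≠ 0 := by rintro rfl; simp [toField] at hb0
  obtain ⟨u, hu, h0⟩ := h.exists_supp hq hq0 hbx
  have h2 := monOrd_le w hu
  have h3 := h0 _ hw
  rw [pairing_latticeVec] at h3
  have h3' : u ⬝ᵥ w = 0 := by exact_mod_cast h3
  rw [div_eq_mul_inv, monVal_mul w ha0 (inv_ne_zero hb0), monVal_inv w hb0, monVal_toField w hq0]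
  linarith

/-! ### Prime divisors -/

/-- The local ring of the torus at a prime element of its coordinate ring. -/
def primeRing (p : TorusRing k n) (hp : Prime p) : Subring (ToricField k n) where
  carrier := {f | ∃ a b : TorusRing k n, ¬ p ∣ b ∧ f = toField a / toField b}
  zero_mem' := ⟨0, 1, hp.not_dvd_one, by simp [toField]⟩
  one_mem' := ⟨1, 1, hp.not_dvd_one, by simp [toField]⟩
  neg_mem' := by
    rintro _ ⟨a, b, hb, rfl⟩
    exact ⟨-a, b, hb, by rw [← neg_div, toField, toField, toField, map_neg]⟩
  mul_mem' := by
    rintro _ _ ⟨a, b, hb, rfl⟩ ⟨a', b', hb', rfl⟩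
    refine ⟨a * a', b * b', fun h => (hp.dvd_or_dvd h).elim hb hb', ?_⟩
    simp only [toField, map_mul, div_mul_div_comm]
  add_mem' := by
    rintro _ _ ⟨a, b, hb, rfl⟩ ⟨a', b', hb', rfl⟩
    refine ⟨a * b' + b * a', b * b', fun h => (hp.dvd_or_dvd h).elim hb hb', ?_⟩
    have h1 : toField b ≠ 0 := toField_ne_zero fun h => hb (h ▸ dvd_zero p)
    have h2 : toField b' ≠ 0 := toField_ne_zero fun h => hb' (h ▸ dvd_zero p)
    simp only [toField, map_mul, map_add] at h1 h2 ⊢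
    rw [div_add_div _ _ h1 h2]

lemma mem_primeRing {p : TorusRing k n} {hp : Prime p} {f : ToricField k n} :
    f ∈ primeRing p hp ↔ ∃ a b : TorusRing k n, ¬ p ∣ b ∧ f = toField a / toField b := Iff.rfl

lemma toField_mem_primeRing {p : TorusRing k n} (hp : Prime p) (a : TorusRing k n) :
    toField a ∈ primeRing p hp := ⟨a, 1, hp.not_dvd_one, by simp [toField]⟩

lemma inv_mem_primeRing {p : TorusRing k n} (hp : Prime p) {b : TorusRing k n} (hb : b ≠ 0) :
    (toField b)⁻¹ ∈ primeRing p hp ↔ ¬ p ∣ b := by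
  constructor
  · rintro ⟨a, c, hc, e⟩ hpb
    have hc0 : toField c ≠ 0 := toField_ne_zero fun h => hc (h ▸ dvd_zero p)
    rw [eq_div_iff hc0, inv_mul_eq_iff_eq_mul₀ (toField_ne_zero hb)] at e
    have : c = b * a := toField_injective (by rw [e, toField, toField, toField, map_mul])
    exact hc (this ▸ dvd_mul_of_dvd_left hpb a)
  · exact fun h => ⟨1, b, h, by simp [toField]⟩

lemma isUniformizer_primeRing {p : TorusRing k n} (hp : Prime p) :
    IsUniformizer (primeRing p hp) (toField p) := by
  have hp0 := toField_ne_zero hp.ne_zero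
  refine ⟨toField_mem_primeRing hp p, fun h => (inv_mem_primeRing hp hp.ne_zero).1 h dvd_rfl,
    fun f hf => ?_⟩
  have dec : ∀ a : TorusRing k n, a ≠ 0 → ∃ m : ℕ, ∃ c, ¬ p ∣ c ∧ a = p ^ m * c := fun a ha => by
    obtain ⟨m, c, hc, e⟩ := (FiniteMultiplicity.of_prime_left hp ha).exists_eq_pow_mul_and_not_dvd
      |> fun ⟨c, e, hc⟩ => (⟨_, c, hc, e⟩ : ∃ m : ℕ, ∃ c, ¬ p ∣ c ∧ a = p ^ m * c)
    exact ⟨m, c, hc, e⟩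
  obtain ⟨a, b, ha, hb, rfl⟩ := exists_fraction' hf
  obtain ⟨m, c, hc, rfl⟩ := dec a ha
  obtain ⟨m', c', hc', rfl⟩ := dec b hb
  have hc0 : toField c ≠ 0 := toField_ne_zero fun h => hc (h ▸ dvd_zero p)
  have hc0' : toField c' ≠ 0 := toField_ne_zero fun h => hc' (h ▸ dvd_zero p)
  have e : toField (p ^ m * c) / toField (p ^ m' * c') * toField p ^ (-((m : ℤ) - m')) =
      toField c / toField c' := by
    simp only [toField, map_mul, map_pow] at hc0 hc0' hp0 ⊢
    rw [neg_sub, zpow_sub₀ hp0, zpow_natCast, zpow_natCast]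
    field_simp
  refine ⟨m - m', ?_, ?_⟩
  · rw [e]; exact ⟨c, c', hc', rfl⟩
  · rw [e, inv_div]; exact ⟨c', c, hc, rfl⟩

/-- The local ring of the torus at a prime element of its coordinate ring, as a local ring. -/
def primePoint (p : TorusRing k n) (hp : Prime p) : LocalSubring (ToricField k n) where
  toSubring := primeRing p hp
  isLocalRing :=
    haveI := (isUniformizer_primeRing hp).isDiscreteValuationRing
    inferInstance

lemma isLocalizationOf_primePoint {p : TorusRing k n} (hp : Prime p) :
    IsLocalizationOf (coneAlgebra k (⊥ : PointedCone ℝ (Fin n → ℝ))).toSubring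
      (primePoint p hp).toSubring where
  le f hf := by
    obtain ⟨q, rfl⟩ := mem_coneAlgebra_bot.1 hf
    exact toField_mem_primeRing hp q
  frac := by
    rintro _ ⟨a, b, hb, rfl⟩
    have hb0 : b ≠ 0 := fun h => hb (h ▸ dvd_zero p)
    exact ⟨_, mem_coneAlgebra_bot.2 ⟨a, rfl⟩, _, mem_coneAlgebra_bot.2 ⟨b, rfl⟩,
      toField_ne_zero hb0, (inv_mem_primeRing hp hb0).2 hb, rfl⟩

variable (k) in
/-- The prime divisor `D_i`. -/
def Fan.primeDiv (Δ : Fan n) (i : Δ.Ray) : (toricVariety k Δ).PrimeDivisor :=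
  ⟨orbitRing k (rayCone_isRational i.1),
    mem_toricVariety_iff.2 ⟨_, i.2.2, (isOrbitCone_orbitRing _).toIsLocalizationOf⟩, by
    obtain ⟨u, hu⟩ := i.2.1.exists_dotProduct_eq_one
    have h := isUniformizer_monRing (k := k) hu
    rw [← orbitRing_rayCone i.2.1] at h
    exact h.isDiscreteValuationRing⟩

/-- The closure in `X_Δ` of a prime divisor of the torus. -/
def Fan.torusDiv (Δ : Fan n) (p : TorusRing k n) (hp : Prime p) :
    (toricVariety k Δ).PrimeDivisor :=
  ⟨primePoint p hp, mem_toricVariety_iff.2 ⟨⊥, Δ.bot_mem, isLocalizationOf_primePoint hp⟩,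
    (isUniformizer_primeRing hp).isDiscreteValuationRing⟩

lemma Fan.primeDiv_toSubring (Δ : Fan n) (i : Δ.Ray) :
    (Δ.primeDiv k i).1.toSubring = monRing k i.1 := orbitRing_rayCone i.2.1

lemma Fan.ord_primeDiv (Δ : Fan n) (i : Δ.Ray) {f : ToricField k n} (hf : f ≠ 0) :
    (Δ.primeDiv k i).ord f = monVal i.1 f := by
  rw [Model.PrimeDivisor.ord, Δ.primeDiv_toSubring, ordAlong_monRing i.2.1 hf]

lemma Fan.ord_torusDiv_self (Δ : Fan n) {p : TorusRing k n} (hp : Prime p) :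
    (Δ.torusDiv p hp).ord (toField p) = 1 := (isUniformizer_primeRing hp).ordAlong_self

lemma Fan.ord_torusDiv_eq_zero (Δ : Fan n) {p : TorusRing k n} (hp : Prime p)
    {q : TorusRing k n} (hq : ¬ p ∣ q) : (Δ.torusDiv p hp).ord (toField q) = 0 := by
  have hq0 : q ≠ 0 := fun h => hq (h ▸ dvd_zero p)
  refine (isUniformizer_primeRing hp).ordAlong_eq (toField_ne_zero hq0) ?_
  simp only [neg_zero, zpow_zero, mul_one]
  exact ⟨toField_mem_primeRing hp q, (inv_mem_primeRing hp hq0).2 hq⟩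

lemma isUnit_single (u : Fin n → ℤ) : IsUnit (AddMonoidAlgebra.single u (1 : k)) := by
  refine IsUnit.of_mul_eq_one (AddMonoidAlgebra.single (-u) 1) ?_
  rw [AddMonoidAlgebra.single_mul_single, add_neg_cancel, mul_one, AddMonoidAlgebra.one_def]

lemma Fan.ord_torusDiv_chi (Δ : Fan n) {p : TorusRing k n} (hp : Prime p) (u : Fin n → ℤ) :
    (Δ.torusDiv p hp).ord (chi k u) = 0 :=
  Δ.ord_torusDiv_eq_zero hp fun h => hp.not_isUnit (isUnit_of_dvd_unit h (isUnit_single u))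

lemma isLocalizationOf_exists_fraction (Δ : Fan n) {x : LocalSubring (ToricField k n)}
    (hx : x ∈ (toricVariety k Δ).points) (f : ToricField k n) :
    ∃ a ∈ x.toSubring, ∃ b ∈ x.toSubring, b ≠ 0 ∧ f = a / b := by
  obtain ⟨σ, hσ, h⟩ := mem_toricVariety_iff.1 hx
  obtain ⟨a, ha, b, hb, h1⟩ := Δ.exists_fraction_coneAlgebra hσ f
  exact ⟨a, h.le ha, b, h.le hb, h1⟩

lemma Fan.exists_isUniformizer_primeDivisor {Δ : Fan n} (P : (toricVariety k Δ).PrimeDivisor) :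
    ∃ π, IsUniformizer P.1.toSubring π :=
  haveI := P.2.2
  exists_isUniformizer _ (isLocalizationOf_exists_fraction Δ P.2.1)

/-- A discrete valuation ring is maximal among proper subrings. If the orbit cone of `P` contains a
ray, the ring at `P` lies in the valuation ring of that ray and equals it. Otherwise `P` meets the
torus, and some prime factor of the numerator of a uniformizer is not invertible at `P`; the ring at
`P` then lies in the localization at that prime. -/
lemma Fan.primeDivisor_cases (Δ : Fan n) (P : (toricVariety k Δ).PrimeDivisor) :
    (∃ i, P = Δ.primeDiv k i) ∨ ∃ p hp, P = Δ.torusDiv p hp := by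
  obtain ⟨π, hπ⟩ := exists_isUniformizer_primeDivisor P
  obtain ⟨τ, hτ, h⟩ := Fan.exists_isOrbitCone_of_mem P.2.1
  by_cases hex : ∃ i : Δ.Ray, i.vec ∈ τ
  · obtain ⟨i, hi⟩ := hex
    refine Or.inl ⟨i, Subtype.ext (LocalSubring.ext ?_)⟩
    rw [Δ.primeDiv_toSubring]
    obtain ⟨u, hu⟩ := i.2.1.exists_dotProduct_eq_one
    exact hπ.eq_of_le ((h.le_monRing_iff (Δ.isRational hτ)).2 hi)
      ⟨_, (isUniformizer_monRing hu).inv_notMem⟩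
  · right
    have hbot : τ = ⊥ := by
      rw [eq_bot_iff]
      intro v hv
      obtain ⟨c, -, h0, rfl⟩ := (Δ.mem_cone_iff hτ).1 hv
      rw [Submodule.mem_bot]
      exact Finset.sum_eq_zero fun i _ => by rw [h0 i fun hi => hex ⟨i, hi⟩, zero_smul]
    subst hbot
    obtain ⟨a, ha, b, hb, hb0, hbx, e⟩ := h.frac π hπ.mem
    obtain ⟨p, rfl⟩ := mem_coneAlgebra_bot.1 ha
    obtain ⟨q, rfl⟩ := mem_coneAlgebra_bot.1 hb
    have hp0 : p ≠ 0 := by rintro rfl; exact hπ.ne_zero (by rw [e]; simp [toField])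
    have hmem : ∀ r : TorusRing k n, toField r ∈ P.1.toSubring := fun r =>
      h.le (mem_coneAlgebra_bot.2 ⟨r, rfl⟩)
    have hpn : (toField p)⁻¹ ∉ P.1.toSubring := fun hp => hπ.inv_notMem (by
      rw [e, inv_div, div_eq_mul_inv]; exact mul_mem (h.le hb) hp)
    have key : ∃ r, Prime r ∧ (toField r)⁻¹ ∉ P.1.toSubring := by
      by_contra! hcon
      clear e ha
      induction p using UniqueFactorizationMonoid.induction_on_prime with
      | h₁ => exact hp0 rfl
      | h₂ p hp =>
        obtain ⟨q, hq⟩ := hp.exists_right_inv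
        have : toField p * toField q = 1 := by rw [toField, toField, ← map_mul, hq, map_one]
        rw [← eq_inv_of_mul_eq_one_right this] at hpn
        exact hpn (hmem q)
      | h₃ a r ha hr ih =>
        have : toField (r * a) = toField r * toField a := map_mul _ _ _
        rw [this, mul_inv] at hpn
        exact ih ha fun hh => hpn (mul_mem (hcon r hr) hh)
    obtain ⟨r, hr, hrn⟩ := key
    refine ⟨r, hr, Subtype.ext (LocalSubring.ext (hπ.eq_of_le (fun f hf => ?_)
      ⟨_, (isUniformizer_primeRing hr).inv_notMem⟩))⟩
    obtain ⟨a, ha, b, hb, hb0, hbx, rfl⟩ := h.frac f hf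
    obtain ⟨a, rfl⟩ := mem_coneAlgebra_bot.1 ha
    obtain ⟨b, rfl⟩ := mem_coneAlgebra_bot.1 hb
    refine ⟨a, b, ?_, rfl⟩
    rintro ⟨c, rfl⟩
    have hrc : toField (r * c) = toField r * toField c := map_mul _ _ _
    have hc0 : toField c ≠ 0 := by rintro h0; rw [hrc, h0, mul_zero] at hb0; exact hb0 rfl
    apply hrn
    have : (toField r)⁻¹ = toField c * (toField (r * c))⁻¹ := by
      rw [hrc, mul_inv, mul_left_comm, mul_inv_cancel₀ hc0, mul_one]
    rw [this]
    exact mul_mem (hmem c) hbx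

lemma Fan.primeDiv_injective (Δ : Fan n) : Function.Injective (Δ.primeDiv k) := by
  intro i j hij
  apply Fan.Ray.ext
  have h : ∀ u : Fin n → ℤ, u ⬝ᵥ i.1 = u ⬝ᵥ j.1 := fun u => by
    rw [← monVal_chi (k := k), ← monVal_chi (k := k), ← Δ.ord_primeDiv i (chi_ne_zero u), hij,
      Δ.ord_primeDiv j (chi_ne_zero u)]
  exact dotProduct_eq _ _ fun u => by rw [dotProduct_comm, h, dotProduct_comm]

lemma Fan.primeDiv_ne_torusDiv (Δ : Fan n) (i : Δ.Ray) {p : TorusRing k n} (hp : Prime p) :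
    Δ.primeDiv k i ≠ Δ.torusDiv p hp := by
  intro h
  obtain ⟨u, hu⟩ := i.2.1.exists_dotProduct_eq_one
  have h1 := Δ.ord_primeDiv i (chi_ne_zero (k := k) u)
  rw [h, Δ.ord_torusDiv_chi, monVal_chi, hu] at h1
  exact zero_ne_one h1

lemma Fan.isOrbitPoint_rayCone_iff (Δ : Fan n) (i : Δ.Ray)
    {P : (toricVariety k Δ).PrimeDivisor} :
    IsOrbitPoint k (rayCone i.1) P.1 ↔ P = Δ.primeDiv k i := by
  rw [isOrbitPoint_iff (rayCone_isRational i.1)]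
  exact ⟨fun h => Subtype.ext h, fun h => h ▸ rfl⟩

@[simp] lemma Fan.toricDivisor_primeDiv (Δ : Fan n) (a : Δ.Ray → ℝ) (i : Δ.Ray) :
    toricDivisor k Δ a (Δ.primeDiv k i) = a i := by
  have h : ∃ j : Δ.Ray, IsOrbitPoint k (rayCone j.1) (Δ.primeDiv k i).1 :=
    ⟨i, (Δ.isOrbitPoint_rayCone_iff i).2 rfl⟩
  change toricCoeff k Δ a _ = _
  rw [toricCoeff, dif_pos h]
  exact congrArg a (Δ.primeDiv_injective ((Δ.isOrbitPoint_rayCone_iff _).1 h.choose_spec)).symm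

@[simp] lemma Fan.toricDivisor_torusDiv (Δ : Fan n) (a : Δ.Ray → ℝ) {p : TorusRing k n}
    (hp : Prime p) : toricDivisor k Δ a (Δ.torusDiv p hp) = 0 := by
  change toricCoeff k Δ a _ = _
  rw [toricCoeff, dif_neg]
  rintro ⟨i, hi⟩
  exact Δ.primeDiv_ne_torusDiv i hp ((Δ.isOrbitPoint_rayCone_iff _).1 hi).symm

lemma Fan.primeDiv_through_iff (Δ : Fan n) (i : Δ.Ray) {τ : PointedCone ℝ (Fin n → ℝ)}
    (hτ : IsRational τ) {x : LocalSubring (ToricField k n)} (h : IsOrbitCone τ x) :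
    (Δ.primeDiv k i).Through x ↔ i.vec ∈ τ := by
  rw [Model.PrimeDivisor.Through, Δ.primeDiv_toSubring, h.le_monRing_iff hτ]
  rfl

lemma Fan.ord_torusDiv_pos (Δ : Fan n) {p : TorusRing k n} (hp : Prime p) {q : TorusRing k n}
    (hq : q ≠ 0) (hpq : p ∣ q) : 0 < (Δ.torusDiv p hp).ord (toField q) := by
  by_contra hle
  have h := isUniformizer_primeRing hp
  have h1 : 0 ≤ ordAlong (primeRing p hp) (toField q)⁻¹ := by
    rw [h.ordAlong_inv (toField_ne_zero hq)]
    change ¬ 0 < ordAlong (primeRing p hp) (toField q) at hle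
    linarith
  exact (inv_mem_primeRing hp hq).1
    ((h.ordAlong_nonneg_iff (inv_ne_zero (toField_ne_zero hq))).1 h1) hpq

/-- A reduced fraction, with the prime divisors of its numerator and denominator. -/
lemma Fan.exists_reduced_fraction (Δ : Fan n) {f : ToricField k n} (hf : f ≠ 0) :
    ∃ a b : TorusRing k n, a ≠ 0 ∧ b ≠ 0 ∧ f = toField a / toField b ∧
      (∀ p hp, p ∣ a → 0 < (Δ.torusDiv p hp).ord f) ∧
      ∀ p hp, p ∣ b → (Δ.torusDiv p hp).ord f < 0 := by
  obtain ⟨a, b, hab, hb0, e⟩ : ∃ a b : TorusRing k n, IsRelPrime a b ∧ b ≠ 0 ∧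
      f = toField a / toField b := by
    obtain ⟨a, b, hab, e⟩ := IsFractionRing.exists_reduced_fraction (A := TorusRing k n) f
    exact ⟨a, b, hab, nonZeroDivisors.ne_zero b.2, by rw [← e, IsFractionRing.mk'_eq_div]⟩
  have ha0 : a ≠ 0 := by rintro rfl; apply hf; rw [e]; simp [toField]
  have key : ∀ p hp, (Δ.torusDiv p hp).ord f =
      (Δ.torusDiv p hp).ord (toField a) - (Δ.torusDiv p hp).ord (toField b) := fun p hp => by
    rw [e]
    exact (isUniformizer_primeRing hp).ordAlong_div (toField_ne_zero ha0) (toField_ne_zero hb0)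
  refine ⟨a, b, ha0, hb0, e, fun p hp hpa => ?_, fun p hp hpb => ?_⟩
  · rw [key, Δ.ord_torusDiv_eq_zero hp fun hpb => hp.not_isUnit (hab hpa hpb), sub_zero]
    exact Δ.ord_torusDiv_pos hp ha0 hpa
  · rw [key, Δ.ord_torusDiv_eq_zero hp fun hpa => hp.not_isUnit (hab hpa hpb), zero_sub]
    exact neg_neg_of_pos (Δ.ord_torusDiv_pos hp hb0 hpb)

/-- If the divisor of a prime `p` avoids `x`, some function regular at `x` has a pole along `p`, so
its denominator, invertible at `x`, is divisible by `p`. The product of these denominators over the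
prime factors of `b` is `q`. -/
lemma Fan.exists_dvd_of_not_through (Δ : Fan n) {τ : PointedCone ℝ (Fin n → ℝ)}
    {x : LocalSubring (ToricField k n)} (hτx : IsOrbitCone τ x) {b : TorusRing k n} (hb0 : b ≠ 0)
    (h : ∀ p hp, p ∣ b → ¬ (Δ.torusDiv p hp).Through x) :
    ∃ q : TorusRing k n, toField q ∈ coneAlgebra k τ ∧ q ≠ 0 ∧ (toField q)⁻¹ ∈ x.toSubring ∧
      b ∣ q := by
  induction b using UniqueFactorizationMonoid.induction_on_prime with
  | h₁ => exact absurd rfl hb0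
  | h₂ b hb =>
    refine ⟨1, ?_, one_ne_zero, ?_, hb.dvd⟩
    · rw [toField, map_one]; exact one_mem _
    · rw [toField, map_one, inv_one]; exact one_mem _
  | h₃ b p hb hp ih =>
    obtain ⟨q, h1, h2, h3, h4⟩ := ih hb fun r hr hrb => h r hr (dvd_mul_of_dvd_right hrb p)
    obtain ⟨g, hg, hgp⟩ := SetLike.not_le_iff_exists.1 (h p hp (dvd_mul_right p b))
    obtain ⟨c, hc, d, hd, hd0, hdx, rfl⟩ := hτx.frac g hg
    obtain ⟨c', -, rfl⟩ := mem_coneAlgebra.1 hc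
    obtain ⟨d', -, rfl⟩ := mem_coneAlgebra.1 hd
    have hd0' : d' ≠ 0 := by rintro rfl; simp [toField] at hd0
    refine ⟨d' * q, ?_, mul_ne_zero hd0' h2, ?_, mul_dvd_mul ?_ h4⟩
    · rw [toField, map_mul]; exact mul_mem hd h1
    · rw [toField, map_mul, mul_inv]; exact mul_mem hdx h3
    · by_contra hpd
      exact hgp ⟨c', d', hpd, rfl⟩

/-- A rational function without poles along the prime divisors through `x` is regular at `x`. -/
lemma Fan.mem_of_ord_nonneg (Δ : Fan n) {x : LocalSubring (ToricField k n)}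
    (hx : x ∈ (toricVariety k Δ).points) {f : ToricField k n} (hf : f ≠ 0)
    (h : ∀ P : (toricVariety k Δ).PrimeDivisor, P.Through x → 0 ≤ P.ord f) : f ∈ x.toSubring := by
  obtain ⟨τ, hτ, hτx⟩ := Fan.exists_isOrbitCone_of_mem hx
  obtain ⟨a, b, ha0, hb0, e, -, hb⟩ := Δ.exists_reduced_fraction hf
  -- The torus primes in the denominator miss `x`, so they can be cleared by an element invertible
  -- at `x`. What remains is a Laurent polynomial, whose exponents are tested on the rays of `τ`.
  obtain ⟨q, hqτ, hq0, hqx, ⟨c, rfl⟩⟩ := Δ.exists_dvd_of_not_through hτx hb0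
    fun p hp hpb ht => (hb p hp hpb).not_ge (h _ ht)
  have hc0 : c ≠ 0 := right_ne_zero_of_mul hq0
  have hfq : f * toField (b * c) = toField (a * c) := by
    have h1 := toField_ne_zero hb0
    rw [e]
    simp only [toField, map_mul] at h1 ⊢
    field_simp
  have hac : toField (a * c) ∈ coneAlgebra k τ := by
    refine mem_coneAlgebra.2 ⟨_, fun u hu => (Δ.mem_dualSemigroup_iff hτ).2 fun i hi => ?_, rfl⟩
    have h1 := h _ ((Δ.primeDiv_through_iff i (Δ.isRational hτ) hτx).2 hi)
    rw [Δ.ord_primeDiv i hf] at h1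
    have h2 := monVal_nonneg_of_mem (w := i.1) hi hqτ (toField_ne_zero hq0)
    have h3 := monOrd_le i.1 hu
    rw [← monVal_toField i.1 (mul_ne_zero ha0 hc0), ← hfq,
      monVal_mul i.1 hf (toField_ne_zero hq0)] at h3
    linarith
  have : f = toField (a * c) * (toField (b * c))⁻¹ := by
    rw [← hfq, mul_inv_cancel_right₀ (toField_ne_zero hq0)]
  rw [this]
  exact mul_mem (hτx.le hac) hqx

lemma Fan.exists_toField_of_ord_nonneg (Δ : Fan n) {f : ToricField k n} (hf : f ≠ 0)
    (h : ∀ p hp, 0 ≤ (Δ.torusDiv p hp).ord f) : ∃ q : TorusRing k n, q ≠ 0 ∧ f = toField q := by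
  obtain ⟨a, b, ha0, hb0, e, -, hb⟩ := Δ.exists_reduced_fraction hf
  have hunit : IsUnit b := by
    by_contra hn
    obtain ⟨p, hp, hpb⟩ := WfDvdMonoid.exists_irreducible_factor hn hb0
    exact (hb p hp.prime hpb).not_ge (h p hp.prime)
  obtain ⟨c, hc⟩ := hunit.exists_right_inv
  have hbc : toField b * toField c = 1 := by rw [toField, toField, ← map_mul, hc, map_one]
  refine ⟨a * c, mul_ne_zero ha0 (by rintro rfl; simp at hc), ?_⟩
  rw [e, div_eq_mul_inv, ← eq_inv_of_mul_eq_one_right hbc]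
  exact (map_mul _ _ _).symm

/-! ### Functions whose divisor is locally invariant -/

lemma IsOrbitCone.monOrd_eq_zero {τ : PointedCone ℝ (Fin n → ℝ)}
    {x : LocalSubring (ToricField k n)} (h : IsOrbitCone τ x) {q : TorusRing k n} (hq0 : q ≠ 0)
    (hq : toField q ∈ coneAlgebra k τ) (hqx : (toField q)⁻¹ ∈ x.toSubring) {v : Fin n → ℤ}
    (hv : latticeVec v ∈ τ) : monOrd v q = 0 := by
  obtain ⟨q', hq', e⟩ := mem_coneAlgebra.1 hq
  obtain rfl := toField_injective e
  obtain ⟨u, hu, h0⟩ := h.exists_supp hq' hq0 hqx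
  have h1 := monVal_nonneg_of_mem hv hq (toField_ne_zero hq0)
  rw [monVal_toField v hq0] at h1
  have h2 := monOrd_le v hu
  have h3 := h0 _ hv
  rw [pairing_latticeVec] at h3
  have h3' : u ⬝ᵥ v = 0 := by exact_mod_cast h3
  linarith

/-- Orders are minima of linear functions. Exponents `u`, `u'` minimal at an interior point `w`
satisfy `u + u' ≥ 0` on `σ` with equality at `w`, hence on all of `σ`; this squeezes both orders to
linear functions. -/
lemma exists_linear_monOrd {σ : PointedCone ℝ (Fin n → ℝ)} (hσ : IsRational σ)
    {p q : TorusRing k n} (hp : p ≠ 0) (hq : q ≠ 0)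
    (h : ∀ v, latticeVec v ∈ σ → monOrd v p + monOrd v q = 0) :
    ∃ m : Fin n → ℤ, ∀ v, latticeVec v ∈ σ → monOrd v p = m ⬝ᵥ v := by
  obtain ⟨w, hw⟩ := hσ.exists_relint
  obtain ⟨u, hu, eu⟩ := monOrd_exists w hp
  obtain ⟨u', hu', eu'⟩ := monOrd_exists w hq
  have hnn : ∀ v, latticeVec v ∈ σ → 0 ≤ (u + u') ⬝ᵥ v := fun v hv => by
    have h1 := monOrd_le v hu
    have h2 := monOrd_le v hu'
    have h3 := h v hv
    rw [add_dotProduct]; linarith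
  have hd : u + u' ∈ dualSemigroup σ := by
    obtain ⟨s, rfl⟩ := hσ
    exact mem_dualSemigroup_hull.2 fun g hg => hnn g (Submodule.subset_span ⟨g, hg, rfl⟩)
  have h0 : pairing (u + u') (latticeVec w) = 0 := by
    rw [pairing_latticeVec, add_dotProduct, eu, eu', h w hw.1]; simp
  refine ⟨u, fun v hv => ?_⟩
  have h1 := hw.2 _ hd h0 _ hv
  rw [pairing_latticeVec] at h1
  have h1' : (u + u') ⬝ᵥ v = 0 := by exact_mod_cast h1
  rw [add_dotProduct] at h1'
  have h2 := monOrd_le v hu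
  have h3 := monOrd_le v hu'
  have h4 := h v hv
  linarith

/-- For a unit and its inverse the orders sum to zero everywhere. Comparing the bounds at `v` and
`-v` forces equality for any pair of exponents. -/
lemma exists_linear_monOrd_of_isUnit {p : TorusRing k n} (hp : IsUnit p) :
    ∃ m : Fin n → ℤ, ∀ v, monOrd v p = m ⬝ᵥ v := by
  obtain ⟨q, hpq⟩ := hp.exists_right_inv
  have hp0 : p ≠ 0 := by rintro rfl; simp at hpq
  have hq0 : q ≠ 0 := by rintro rfl; simp at hpq
  have h : ∀ v, monOrd v p + monOrd v q = 0 := fun v => by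
    rw [← monOrd_mul v hp0 hq0, hpq, ← monVal_toField v one_ne_zero, toField, map_one, monVal_one]
  obtain ⟨u, hu⟩ := supp_nonempty hp0
  obtain ⟨u', hu'⟩ := supp_nonempty hq0
  refine ⟨u, fun v => ?_⟩
  have h1 := monOrd_le v hu
  have h2 := monOrd_le v hu'
  have h1' := monOrd_le (-v) hu
  have h2' := monOrd_le (-v) hu'
  have h3 := h v
  have h3' := h (-v)
  rw [dotProduct_neg] at h1' h2'
  linarith

/-- The primes in numerator and denominator miss `x`, so each divides an element of the coordinate
ring invertible at `x`. Such elements have order `0` on `τ`, and `exists_linear_monOrd` applies. -/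
lemma Fan.exists_linear_of_ord_eq_zero (Δ : Fan n) {τ : PointedCone ℝ (Fin n → ℝ)}
    (hτ : IsRational τ) {x : LocalSubring (ToricField k n)} (hτx : IsOrbitCone τ x)
    {f : ToricField k n} (hf : f ≠ 0)
    (h : ∀ p hp, (Δ.torusDiv p hp).Through x → (Δ.torusDiv p hp).ord f = 0) :
    ∃ m : Fin n → ℤ, ∀ v, latticeVec v ∈ τ → monVal v f = m ⬝ᵥ v := by
  obtain ⟨a, b, ha0, hb0, e, ha, hb⟩ := Δ.exists_reduced_fraction hf
  have key : ∀ a : TorusRing k n, a ≠ 0 → (∀ p hp, p ∣ a → ¬ (Δ.torusDiv p hp).Through x) →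
      ∃ m : Fin n → ℤ, ∀ v, latticeVec v ∈ τ → monOrd v a = m ⬝ᵥ v := by
    intro a ha0 ha
    obtain ⟨q, hqτ, hq0, hqx, ⟨c, rfl⟩⟩ := Δ.exists_dvd_of_not_through hτx ha0 ha
    refine exists_linear_monOrd hτ ha0 (right_ne_zero_of_mul hq0) fun v hv => ?_
    rw [← monOrd_mul v ha0 (right_ne_zero_of_mul hq0), hτx.monOrd_eq_zero hq0 hqτ hqx hv]
  obtain ⟨m, hm⟩ := key a ha0 fun p hp hpa ht => (ha p hp hpa).ne' (h p hp ht)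
  obtain ⟨m', hm'⟩ := key b hb0 fun p hp hpb ht => (hb p hp hpb).ne (h p hp ht)
  refine ⟨m - m', fun v hv => ?_⟩
  rw [e, monVal_div v ha0 hb0, hm v hv, hm' v hv, sub_dotProduct]

lemma Fan.ord_nonneg_of_mem {Δ : Fan n} {x : LocalSubring (ToricField k n)}
    {P : (toricVariety k Δ).PrimeDivisor} (hP : P.Through x) {f : ToricField k n} (hf : f ≠ 0)
    (h : f ∈ x.toSubring) : 0 ≤ P.ord f := by
  obtain ⟨π, hπ⟩ := exists_isUniformizer_primeDivisor P
  exact (hπ.ordAlong_nonneg_iff hf).2 (hP h)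

lemma Fan.ord_mul {Δ : Fan n} (P : (toricVariety k Δ).PrimeDivisor) {f g : ToricField k n}
    (hf : f ≠ 0) (hg : g ≠ 0) : P.ord (f * g) = P.ord f + P.ord g := by
  obtain ⟨π, hπ⟩ := exists_isUniformizer_primeDivisor P
  exact hπ.ordAlong_mul hf hg

lemma Fan.ord_inv {Δ : Fan n} (P : (toricVariety k Δ).PrimeDivisor) {f : ToricField k n}
    (hf : f ≠ 0) : P.ord f⁻¹ = -P.ord f := by
  obtain ⟨π, hπ⟩ := exists_isUniformizer_primeDivisor P
  exact hπ.ordAlong_inv hf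

lemma Fan.ord_one {Δ : Fan n} (P : (toricVariety k Δ).PrimeDivisor) :
    P.ord (1 : ToricField k n) = 0 := by
  obtain ⟨π, hπ⟩ := exists_isUniformizer_primeDivisor P
  exact hπ.ordAlong_one

end Toric

end

noncomputable section

open scoped BigOperators

section ClassGroup

variable {k : Type*} [Field k] {n : ℕ}

/-! ### The class group of a toric variety -/

lemma Fan.torusDiv_eq_of_dvd (Δ : Fan n) {p q : TorusRing k n} (hp : Prime p) (hq : Prime q)
    (h : p ∣ q) : Δ.torusDiv p hp = Δ.torusDiv q hq := by
  have hass : Associated p q := hp.associated_of_dvd hq h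
  refine Subtype.ext (LocalSubring.ext ?_)
  change primeRing p hp = primeRing q hq
  ext f
  simp only [mem_primeRing, hass.dvd_iff_dvd_left]

open Classical in
/-- An equation in the torus of a prime divisor (`1` for the invariant divisors). -/
def Fan.torusEq (Δ : Fan n) (P : (toricVariety k Δ).PrimeDivisor) : TorusRing k n :=
  if h : ∃ p hp, P = Δ.torusDiv p hp then h.choose else 1

lemma Fan.torusEq_primeDiv (Δ : Fan n) (i : Δ.Ray) : Δ.torusEq (Δ.primeDiv k i) = 1 := by
  rw [torusEq, dif_neg]
  rintro ⟨p, hp, e⟩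
  exact Δ.primeDiv_ne_torusDiv i hp e

lemma Fan.torusEq_torusDiv (Δ : Fan n) {p : TorusRing k n} (hp : Prime p) :
    ∃ hq : Prime (Δ.torusEq (Δ.torusDiv p hp)),
      Δ.torusDiv p hp = Δ.torusDiv (Δ.torusEq (Δ.torusDiv p hp)) hq := by
  have h : ∃ q hq, Δ.torusDiv p hp = Δ.torusDiv q hq := ⟨p, hp, rfl⟩
  have e : Δ.torusEq (Δ.torusDiv p hp) = h.choose := by rw [torusEq, dif_pos h]
  generalize Δ.torusEq (Δ.torusDiv p hp) = q at e
  subst e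
  exact h.choose_spec

lemma Fan.torusEq_ne_zero (Δ : Fan n) (P : (toricVariety k Δ).PrimeDivisor) :
    Δ.torusEq P ≠ 0 := by
  obtain ⟨i, rfl⟩ | ⟨p, hp, rfl⟩ := Δ.primeDivisor_cases P
  · rw [torusEq_primeDiv]; exact one_ne_zero
  · exact (Δ.torusEq_torusDiv hp).choose.ne_zero

open Classical in
lemma Fan.ord_torusEq (Δ : Fan n) {p : TorusRing k n} (hp : Prime p)
    (Q : (toricVariety k Δ).PrimeDivisor) :
    (Δ.torusDiv p hp).ord (toField (Δ.torusEq Q)) = if Q = Δ.torusDiv p hp then 1 else 0 := by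
  obtain ⟨i, rfl⟩ | ⟨q, hq, rfl⟩ := Δ.primeDivisor_cases Q
  · rw [if_neg (Δ.primeDiv_ne_torusDiv i hp), torusEq_primeDiv, toField, map_one]
    exact Fan.ord_one _
  · obtain ⟨hq', e⟩ := Δ.torusEq_torusDiv hq
    split_ifs with h
    · rw [← h]
      generalize Δ.torusEq (Δ.torusDiv q hq) = r at hq' e
      rw [e]
      exact Δ.ord_torusDiv_self hq'
    · refine Δ.ord_torusDiv_eq_zero hp fun hd => h ?_
      rw [e]
      exact (Δ.torusDiv_eq_of_dvd hp hq' hd).symm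

/-- The divisor of `f` in the torus, together with the monomial valuations of `f`. -/
lemma Fan.exists_decomposition (Δ : Fan n) {f : ToricField k n} (hf : f ≠ 0) :
    ∃ (z : (toricVariety k Δ).PrimeDivisor →₀ ℤ) (m : Fin n → ℤ),
      (∀ p hp, (Δ.torusDiv p hp).ord f = z (Δ.torusDiv p hp)) ∧
      (∀ i, z (Δ.primeDiv k i) = 0) ∧
      ∀ v, monVal v f = m ⬝ᵥ v + z.sum fun P c => c * monVal v (toField (Δ.torusEq P)) := by
  classical
  have hsum : ∀ (v : Fin n → ℤ) (z z' : (toricVariety k Δ).PrimeDivisor →₀ ℤ),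
      ((z + z').sum fun P c => c * monVal v (toField (Δ.torusEq P))) =
      (z.sum fun P c => c * monVal v (toField (Δ.torusEq P))) +
      z'.sum fun P c => c * monVal v (toField (Δ.torusEq P)) := fun v z z' =>
    Finsupp.sum_add_index' (by simp) (fun _ _ _ => add_mul _ _ _)
  have hsneg : ∀ (v : Fin n → ℤ) (z : (toricVariety k Δ).PrimeDivisor →₀ ℤ),
      ((-z).sum fun P c => c * monVal v (toField (Δ.torusEq P))) =
      -(z.sum fun P c => c * monVal v (toField (Δ.torusEq P))) := fun v z => by
    rw [Finsupp.sum_neg_index (by simp)]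
    simp [Finsupp.sum]
  -- Induction over prime factors. A prime differs from the chosen equation of its divisor by a
  -- unit, and units contribute only to the linear part `m`.
  have key : ∀ a : TorusRing k n, a ≠ 0 → ∃ (z : (toricVariety k Δ).PrimeDivisor →₀ ℤ)
      (m : Fin n → ℤ), (∀ p hp, (Δ.torusDiv p hp).ord (toField a) = z (Δ.torusDiv p hp)) ∧
      (∀ i, z (Δ.primeDiv k i) = 0) ∧
      ∀ v, monVal v (toField a) =
        m ⬝ᵥ v + z.sum fun P c => c * monVal v (toField (Δ.torusEq P)) := by
    intro a ha0
    induction a using UniqueFactorizationMonoid.induction_on_prime with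
    | h₁ => exact absurd rfl ha0
    | h₂ a ha =>
      obtain ⟨m, hm⟩ := exists_linear_monOrd_of_isUnit ha
      refine ⟨0, m, fun p hp => ?_, fun i => rfl, fun v => ?_⟩
      · exact Δ.ord_torusDiv_eq_zero hp fun h => hp.not_isUnit (isUnit_of_dvd_unit h ha)
      · rw [monVal_toField v ha0, hm]; simp
    | h₃ a p ha hp ih =>
      obtain ⟨z, m, h1, h2, h3⟩ := ih ha
      obtain ⟨hq, e⟩ := Δ.torusEq_torusDiv hp
      have hqp : Δ.torusEq (Δ.torusDiv p hp) ∣ p := by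
        by_contra hd
        have h4 := Δ.ord_torusDiv_eq_zero hq hd
        have h5 := Δ.ord_torusDiv_self hp
        rw [e, h4] at h5
        exact zero_ne_one h5
      obtain ⟨c, hc⟩ := hq.associated_of_dvd hp hqp
      obtain ⟨m', hm'⟩ := exists_linear_monOrd_of_isUnit c.isUnit
      have hpa : toField (p * a) = toField p * toField a := map_mul _ _ _
      refine ⟨z + Finsupp.single (Δ.torusDiv p hp) 1, m + m', fun q hq' => ?_, fun i => ?_,
        fun v => ?_⟩
      · rw [hpa, Fan.ord_mul _ (toField_ne_zero hp.ne_zero) (toField_ne_zero ha), h1,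
          Finsupp.add_apply, Finsupp.single_apply, add_comm]
        congr 1
        split_ifs with h
        · rw [← h]; exact Δ.ord_torusDiv_self hp
        · exact Δ.ord_torusDiv_eq_zero hq' fun hd => h (Δ.torusDiv_eq_of_dvd hq' hp hd).symm
      · rw [Finsupp.add_apply, h2, Finsupp.single_apply,
          if_neg (Δ.primeDiv_ne_torusDiv i hp).symm, add_zero]
      · rw [hpa, monVal_mul v (toField_ne_zero hp.ne_zero) (toField_ne_zero ha), h3 v, hsum,
          Finsupp.sum_single_index (zero_mul _), one_mul, add_dotProduct, ← hm',
          monVal_toField v hp.ne_zero, monVal_toField v hq.ne_zero]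
        conv_lhs => rw [← hc, monOrd_mul v hq.ne_zero c.ne_zero]
        ring
  obtain ⟨a, b, ha0, hb0, rfl⟩ := exists_fraction' hf
  obtain ⟨z, m, h1, h2, h3⟩ := key a ha0
  obtain ⟨z', m', h1', h2', h3'⟩ := key b hb0
  have ha := toField_ne_zero ha0
  have hb := toField_ne_zero hb0
  refine ⟨z + -z', m - m', fun p hp => ?_, fun i => ?_, fun v => ?_⟩
  · rw [div_eq_mul_inv, Fan.ord_mul _ ha (inv_ne_zero hb), Fan.ord_inv _ hb, h1, h1']; rfl
  · rw [Finsupp.add_apply, Finsupp.neg_apply, h2, h2']; simp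
  · rw [div_eq_mul_inv, monVal_mul v ha (inv_ne_zero hb), monVal_inv v hb, h3, h3', hsum, hsneg,
      sub_dotProduct]
    ring

variable (k) in
/-- The coefficients of the invariant divisor obtained by subtracting from a divisor `D` the
combination of principal divisors which agrees with `D` in the torus. -/
def Fan.toricPart (Δ : Fan n) : (toricVariety k Δ).RDiv →ₗ[ℝ] (Δ.Ray → ℝ) :=
  LinearMap.pi fun i => Finsupp.lapply (Δ.primeDiv k i) -
    Finsupp.linearCombination ℝ fun P => (monVal i.1 (toField (Δ.torusEq P)) : ℝ)

lemma Fan.toricPart_apply (Δ : Fan n) (d : (toricVariety k Δ).RDiv) (i : Δ.Ray) :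
    Δ.toricPart k d i = d (Δ.primeDiv k i) -
      d.sum fun P c => c * (monVal i.1 (toField (Δ.torusEq P)) : ℝ) := rfl

lemma Fan.torusEq_of_toricDivisor_ne_zero (Δ : Fan n) (a : Δ.Ray → ℝ)
    {P : (toricVariety k Δ).PrimeDivisor} (h : toricDivisor k Δ a P ≠ 0) : Δ.torusEq P = 1 := by
  obtain ⟨i, rfl⟩ | ⟨p, hp, rfl⟩ := Δ.primeDivisor_cases P
  · exact Δ.torusEq_primeDiv i
  · exact absurd (Δ.toricDivisor_torusDiv a hp) h

@[simp] lemma Fan.toricPart_toricDivisor (Δ : Fan n) (a : Δ.Ray → ℝ) :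
    Δ.toricPart k (toricDivisor k Δ a) = a := by
  ext i
  rw [toricPart_apply, toricDivisor_primeDiv, Finsupp.sum, Finset.sum_eq_zero, sub_zero]
  intro P hP
  rw [Δ.torusEq_of_toricDivisor_ne_zero a (Finsupp.mem_support_iff.1 hP), toField, map_one,
    monVal_one, Int.cast_zero, mul_zero]

lemma divFun_chi_torusDiv (Δ : Fan n) {p : TorusRing k n} (hp : Prime p) (u : Fin n → ℤ) :
    (toricVariety k Δ).divFun (chi k u) (Δ.torusDiv p hp) = 0 := by
  rw [Model.divFun, Δ.ord_torusDiv_chi, Int.cast_zero]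

/-- For a single `div f`, `Fan.exists_decomposition` shows that removing the torus components leaves
a linear function on the rays. Principal divisors are defined by a span inside all functions on
prime divisors, so the induction also carries a finitely supported divisor representing each element
of the span. -/
lemma Fan.toricPart_of_principal (Δ : Fan n) {d : (toricVariety k Δ).RDiv}
    (hd : d ∈ (toricVariety k Δ).principal) :
    ∃ m : Fin n → ℝ, ∀ i, Δ.toricPart k d i = m ⬝ᵥ i.vec := by
  have key : ∀ d : (toricVariety k Δ).PrimeDivisor → ℝ,
      d ∈ Submodule.span ℝ {d | ∃ f : ToricField k n, f ≠ 0 ∧ d = (toricVariety k Δ).divFun f} →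
      ∃ D : (toricVariety k Δ).RDiv, ⇑D = d ∧
        ∃ m : Fin n → ℝ, ∀ i, Δ.toricPart k D i = m ⬝ᵥ i.vec := by
    intro d hd
    induction hd using Submodule.span_induction with
    | mem d hd =>
      obtain ⟨f, hf, rfl⟩ := hd
      obtain ⟨z, m, h1, h2, h3⟩ := Δ.exists_decomposition hf
      refine ⟨Model.toRDiv z + toricDivisor k Δ fun i => (monVal i.1 f : ℝ), ?_,
        fun j => (m j : ℝ), fun i => ?_⟩
      · ext P
        obtain ⟨i, rfl⟩ | ⟨p, hp, rfl⟩ := Δ.primeDivisor_cases P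
        · rw [Finsupp.add_apply, toricDivisor_primeDiv, Model.divFun, Δ.ord_primeDiv i hf,
            Model.toRDiv, Finsupp.mapRange_apply, h2]
          simp
        · rw [Finsupp.add_apply, toricDivisor_torusDiv, Model.divFun, h1 p hp, Model.toRDiv,
            Finsupp.mapRange_apply, add_zero]
      · rw [map_add, toricPart_toricDivisor, Pi.add_apply, toricPart_apply, Model.toRDiv,
          Finsupp.mapRange_apply, h2, Finsupp.sum_mapRange_index (by simp)]
        have h4 : ((m ⬝ᵥ i.1 : ℤ) : ℝ) = (fun j => (m j : ℝ)) ⬝ᵥ i.vec := by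
          simp [dotProduct, Fan.Ray.vec, latticeVec]
        rw [← h4, h3 i.1]
        simp [Finsupp.sum]
    | zero => exact ⟨0, rfl, 0, fun i => by simp⟩
    | add x y _ _ hx hy =>
      obtain ⟨D, rfl, m, hm⟩ := hx
      obtain ⟨D', rfl, m', hm'⟩ := hy
      exact ⟨D + D', rfl, m + m', fun i => by
        rw [map_add, Pi.add_apply, hm, hm', add_dotProduct]⟩
    | smul c x _ hx =>
      obtain ⟨D, rfl, m, hm⟩ := hx
      exact ⟨c • D, rfl, c • m, fun i => by
        rw [map_smul, Pi.smul_apply, hm, smul_dotProduct]⟩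
  obtain ⟨D, hD, h⟩ := key _ hd
  rwa [DFunLike.coe_injective hD] at h

/-- The divisors of the chosen torus equations account for the components meeting the torus; what is
left on the invariant divisors is a real combination of the divisors of the coordinate characters.
-/
lemma Fan.principal_of_toricPart (Δ : Fan n) {d : (toricVariety k Δ).RDiv} {m : Fin n → ℝ}
    (h : ∀ i, Δ.toricPart k d i = m ⬝ᵥ i.vec) : d ∈ (toricVariety k Δ).principal := by
  classical
  change ⇑d ∈ Submodule.span ℝ _
  have e : ⇑d = ∑ P ∈ d.support, d P • (toricVariety k Δ).divFun (toField (Δ.torusEq P)) +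
      ∑ j, m j • (toricVariety k Δ).divFun (chi k (Pi.single j 1)) := by
    ext P
    rw [Pi.add_apply, Finset.sum_apply, Finset.sum_apply]
    obtain ⟨i, rfl⟩ | ⟨p, hp, rfl⟩ := Δ.primeDivisor_cases P
    · have h1 := h i
      rw [toricPart_apply, sub_eq_iff_eq_add] at h1
      rw [h1, add_comm]
      congr 1
      · refine Finset.sum_congr rfl fun Q _ => ?_
        rw [Pi.smul_apply, Model.divFun, Δ.ord_primeDiv i (toField_ne_zero (Δ.torusEq_ne_zero Q)),
          smul_eq_mul]
      · refine Finset.sum_congr rfl fun j _ => ?_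
        rw [Pi.smul_apply, Model.divFun, Δ.ord_primeDiv i (chi_ne_zero _), monVal_chi, smul_eq_mul,
          single_one_dotProduct]
        rfl
    · have h1 : ∀ j, (m j • (toricVariety k Δ).divFun (chi k (Pi.single j 1)))
          (Δ.torusDiv p hp) = 0 := fun j => by
        rw [Pi.smul_apply, divFun_chi_torusDiv, smul_zero]
      rw [Finset.sum_eq_zero fun j _ => h1 j, add_zero]
      have h2 : ∀ Q ∈ d.support, (d Q • (toricVariety k Δ).divFun (toField (Δ.torusEq Q)))
          (Δ.torusDiv p hp) = if Q = Δ.torusDiv p hp then d Q else 0 := fun Q _ => by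
        rw [Pi.smul_apply, Model.divFun, Δ.ord_torusEq hp]
        split_ifs <;> simp
      rw [Finset.sum_congr rfl h2, Finset.sum_ite_eq']
      split_ifs with hs
      · rfl
      · exact Finsupp.notMem_support_iff.1 hs
  rw [e]
  exact add_mem
    (sum_mem fun P _ => Submodule.smul_mem _ _ (Submodule.subset_span
      ⟨_, toField_ne_zero (Δ.torusEq_ne_zero P), rfl⟩))
    (sum_mem fun j _ => Submodule.smul_mem _ _ (Submodule.subset_span ⟨_, chi_ne_zero _, rfl⟩))

/-- Two real divisors are linearly equivalent if and only if their invariant parts differ by the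
divisor of a real character. -/
lemma Fan.cls_eq_iff (Δ : Fan n) {d d' : (toricVariety k Δ).RDiv} :
    Model.cls d = Model.cls d' ↔
      ∃ m : Fin n → ℝ, ∀ i, Δ.toricPart k d i = Δ.toricPart k d' i + m ⬝ᵥ i.vec := by
  rw [Model.cls, Model.cls, Submodule.mkQ_apply, Submodule.mkQ_apply, Submodule.Quotient.eq]
  constructor
  · intro h
    obtain ⟨m, hm⟩ := Δ.toricPart_of_principal h
    exact ⟨m, fun i => by rw [← hm, map_sub, Pi.sub_apply]; ring⟩
  · rintro ⟨m, hm⟩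
    exact Δ.principal_of_toricPart (m := m) fun i => by rw [map_sub, Pi.sub_apply, hm]; ring

lemma Fan.toricPart_toRDiv (Δ : Fan n) (D : (toricVariety k Δ).ZDiv) (i : Δ.Ray) :
    Δ.toricPart k (Model.toRDiv D) i = ((D (Δ.primeDiv k i) -
      D.sum fun P c => c * monVal i.1 (toField (Δ.torusEq P)) : ℤ) : ℝ) := by
  rw [toricPart_apply, Model.toRDiv, Finsupp.mapRange_apply, Finsupp.sum_mapRange_index (by simp)]
  simp [Finsupp.sum]

/-- A rational function with the same divisor in the torus as `D`. -/
lemma Fan.exists_torus_equation (Δ : Fan n) (D : (toricVariety k Δ).ZDiv) :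
    ∃ h : ToricField k n, h ≠ 0 ∧ (∀ p hp, (Δ.torusDiv p hp).ord h = D (Δ.torusDiv p hp)) ∧
      ∀ i, Δ.toricPart k (Model.toRDiv D) i = ((D (Δ.primeDiv k i) - monVal i.1 h : ℤ) : ℝ) := by
  classical
  suffices H : ∃ h : ToricField k n, h ≠ 0 ∧
      (∀ p hp, (Δ.torusDiv p hp).ord h = D (Δ.torusDiv p hp)) ∧
      ∀ i : Δ.Ray, monVal i.1 h = D.sum fun P c => c * monVal i.1 (toField (Δ.torusEq P)) by
    obtain ⟨h, h1, h2, h3⟩ := H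
    exact ⟨h, h1, h2, fun i => by rw [toricPart_toRDiv, h3]⟩
  have hz : ∀ (c : ℤ) (f : ToricField k n) (hf : f ≠ 0),
      (∀ P : (toricVariety k Δ).PrimeDivisor, P.ord (f ^ c) = c * P.ord f) ∧
      ∀ v, monVal v (f ^ c) = c * monVal v f := by
    intro c f hf
    induction c using Int.induction_on with
    | zero => exact ⟨fun P => by rw [zpow_zero, Fan.ord_one, zero_mul], fun v => by
        rw [zpow_zero, monVal_one, zero_mul]⟩
    | succ c ih => exact ⟨fun P => by
        rw [zpow_add_one₀ hf, Fan.ord_mul P (zpow_ne_zero _ hf) hf, ih.1]; ring, fun v => by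
        rw [zpow_add_one₀ hf, monVal_mul v (zpow_ne_zero _ hf) hf, ih.2]; ring⟩
    | pred c ih => exact ⟨fun P => by
        rw [zpow_sub_one₀ hf, Fan.ord_mul P (zpow_ne_zero _ hf) (inv_ne_zero hf), ih.1,
          Fan.ord_inv P hf]; ring, fun v => by
        rw [zpow_sub_one₀ hf, monVal_mul v (zpow_ne_zero _ hf) (inv_ne_zero hf), ih.2,
          monVal_inv v hf]; ring⟩
  induction D using Finsupp.induction_linear with
  | zero => exact ⟨1, one_ne_zero, fun p hp => Fan.ord_one _, fun i => by rw [monVal_one]; simp⟩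
  | add D D' hD hD' =>
    obtain ⟨h, h1, h2, h3⟩ := hD
    obtain ⟨h', h1', h2', h3'⟩ := hD'
    refine ⟨h * h', mul_ne_zero h1 h1', fun p hp => ?_, fun i => ?_⟩
    · rw [Fan.ord_mul _ h1 h1', h2, h2']; rfl
    · rw [monVal_mul _ h1 h1', h3, h3', Finsupp.sum_add_index' (by simp)]
      intros; ring
  | single P c =>
    have h0 := toField_ne_zero (Δ.torusEq_ne_zero P)
    refine ⟨toField (Δ.torusEq P) ^ c, zpow_ne_zero _ h0, fun p hp => ?_, fun i => ?_⟩
    · rw [(hz c _ h0).1, Δ.ord_torusEq hp, Finsupp.single_apply]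
      split_ifs <;> simp
    · rw [(hz c _ h0).2, Finsupp.sum_single_index (zero_mul _)]

/-! ### Cartier divisors -/

/-- At the generic point of the orbit of `σ`, the quotient of a torus equation of `D` by a local
equation has order zero along the torus divisors passing through it, so its monomial valuations are
linear on `σ`. -/
lemma Fan.toricPart_of_isCartier (Δ : Fan n) {D : (toricVariety k Δ).ZDiv}
    (hD : Model.IsCartier D) {σ} (hσ : σ ∈ Δ.cones) :
    ∃ m : Fin n → ℤ, ∀ i : Δ.Ray, i.vec ∈ σ →
      Δ.toricPart k (Model.toRDiv D) i + ((m ⬝ᵥ i.1 : ℤ) : ℝ) = 0 := by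
  obtain ⟨h, h0, h1, h2⟩ := Δ.exists_torus_equation D
  obtain ⟨f, hf, hfP⟩ := hD _ (orbitRing_mem hσ)
  have hτ := isOrbitCone_orbitRing (k := k) (Δ.isRational hσ)
  obtain ⟨m, hm⟩ := Δ.exists_linear_of_ord_eq_zero (Δ.isRational hσ) hτ
    (f := h * f⁻¹) (mul_ne_zero h0 (inv_ne_zero hf)) fun p hp ht => by
      rw [Fan.ord_mul _ h0 (inv_ne_zero hf), Fan.ord_inv _ hf, h1, hfP _ ht, add_neg_cancel]
  refine ⟨m, fun i hi => ?_⟩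
  have h3 := hfP _ ((Δ.primeDiv_through_iff i (Δ.isRational hσ) hτ).2 hi)
  rw [Δ.ord_primeDiv i hf] at h3
  rw [h2, ← hm i.1 hi, monVal_mul _ h0 (inv_ne_zero hf), monVal_inv _ hf, h3]
  push_cast
  ring

lemma dotProduct_vec {Δ : Fan n} (m : Fin n → ℤ) (i : Δ.Ray) :
    (fun j => (m j : ℝ)) ⬝ᵥ i.vec = ((m ⬝ᵥ i.1 : ℤ) : ℝ) := by
  simp [dotProduct, Fan.Ray.vec, latticeVec]

/-- The coefficients `a` are given on every cone of `Δ` by a linear function. -/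
def Fan.IsLocallyLinear (Δ : Fan n) (a : Δ.Ray → ℝ) : Prop :=
  ∀ σ ∈ Δ.cones, ∃ m : Fin n → ℝ, ∀ i : Δ.Ray, i.vec ∈ σ → a i + m ⬝ᵥ i.vec = 0

lemma cls_toricDivisor_toricPart (Δ : Fan n) (d : (toricVariety k Δ).RDiv) :
    Model.cls (toricDivisor k Δ (Δ.toricPart k d)) = Model.cls d :=
  Δ.cls_eq_iff.2 ⟨0, fun i => by simp⟩

open Classical in
/-- The invariant divisor with integral coefficients `b`. -/
def Fan.intDivisor (k : Type*) [Field k] (Δ : Fan n) (b : Δ.Ray → ℤ) : (toricVariety k Δ).ZDiv :=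
  ∑ i, Finsupp.single (Δ.primeDiv k i) (b i)

@[simp] lemma Fan.intDivisor_primeDiv (Δ : Fan n) (b : Δ.Ray → ℤ) (i : Δ.Ray) :
    Δ.intDivisor k b (Δ.primeDiv k i) = b i := by
  classical
  rw [intDivisor, Finsupp.finsetSum_apply]
  simp [Finsupp.single_apply, Δ.primeDiv_injective.eq_iff]

@[simp] lemma Fan.intDivisor_torusDiv (Δ : Fan n) (b : Δ.Ray → ℤ) {p : TorusRing k n}
    (hp : Prime p) : Δ.intDivisor k b (Δ.torusDiv p hp) = 0 := by
  classical
  rw [intDivisor, Finsupp.finsetSum_apply]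
  exact Finset.sum_eq_zero fun i _ => by
    rw [Finsupp.single_apply, if_neg (Δ.primeDiv_ne_torusDiv i hp)]

lemma Fan.toRDiv_intDivisor (Δ : Fan n) (b : Δ.Ray → ℤ) :
    Model.toRDiv (Δ.intDivisor k b) = toricDivisor k Δ fun i => (b i : ℝ) := by
  ext P
  rw [Model.toRDiv, Finsupp.mapRange_apply]
  obtain ⟨i, rfl⟩ | ⟨p, hp, rfl⟩ := Δ.primeDivisor_cases P <;> simp

lemma Fan.isLocalEquation_intDivisor (Δ : Fan n) {b : Δ.Ray → ℤ} {τ} (hτ : τ ∈ Δ.cones)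
    {m : Fin n → ℤ} (hm : ∀ i : Δ.Ray, i.vec ∈ τ → b i + m ⬝ᵥ i.1 = 0)
    {x : LocalSubring (ToricField k n)}
    (hx : IsLocalizationOf (coneAlgebra k τ).toSubring x.toSubring) :
    Model.IsLocalEquation (Δ.intDivisor k b) x (chi k (-m)) := by
  refine ⟨chi_ne_zero _, fun P hP => ?_⟩
  obtain ⟨i, rfl⟩ | ⟨p, hp, rfl⟩ := Δ.primeDivisor_cases P
  · have hi : i.vec ∈ τ := by
      refine (coneAlgebra_le_monRing_iff (k := k) (Δ.isRational hτ)).1 (hx.le.trans ?_)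
      rw [← Δ.primeDiv_toSubring]
      exact hP
    rw [intDivisor_primeDiv, Δ.ord_primeDiv i (chi_ne_zero _), monVal_chi, neg_dotProduct]
    linarith [hm i hi]
  · rw [intDivisor_torusDiv, Δ.ord_torusDiv_chi]

lemma Fan.isCartier_intDivisor (Δ : Fan n) {b : Δ.Ray → ℤ}
    (h : ∀ σ ∈ Δ.cones, ∃ m : Fin n → ℤ, ∀ i : Δ.Ray, i.vec ∈ σ → b i + m ⬝ᵥ i.1 = 0) :
    Model.IsCartier (Δ.intDivisor k b) := by
  intro x hx
  obtain ⟨τ, hτ, hτx⟩ := mem_toricVariety_iff.1 hx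
  obtain ⟨m, hm⟩ := h τ hτ
  exact ⟨_, Δ.isLocalEquation_intDivisor hτ hm hτx⟩

/-- The inequalities make `χ^m` a global section, and the equalities on the cone make it a generator
of the stalk. -/
lemma Fan.isGloballyGenerated_intDivisor (Δ : Fan n) {b : Δ.Ray → ℤ}
    (h : ∀ σ ∈ Δ.cones, ∃ m : Fin n → ℤ, (∀ i : Δ.Ray, 0 ≤ b i + m ⬝ᵥ i.1) ∧
      ∀ i : Δ.Ray, i.vec ∈ σ → b i + m ⬝ᵥ i.1 = 0) :
    Model.IsGloballyGenerated (Δ.intDivisor k b) := by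
  intro x hx f hf
  obtain ⟨τ, hτ, hτx⟩ := mem_toricVariety_iff.1 hx
  obtain ⟨m, hnn, hm⟩ := h τ hτ
  by_cases hf0 : f = 0
  · rw [hf0]; exact zero_mem _
  have hf := hf.resolve_left hf0
  have hsec : chi k m ∈ Model.globalSections (Δ.intDivisor k b) := by
    refine Or.inr fun P => ?_
    obtain ⟨i, rfl⟩ | ⟨p, hp, rfl⟩ := Δ.primeDivisor_cases P
    · rw [intDivisor_primeDiv, Δ.ord_primeDiv i (chi_ne_zero _), monVal_chi]
      linarith [hnn i]
    · rw [intDivisor_torusDiv, Δ.ord_torusDiv_chi]; rfl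
  have hreg : f * chi k (-m) ∈ x.toSubring := by
    refine Δ.mem_of_ord_nonneg hx (mul_ne_zero hf0 (chi_ne_zero _)) fun P hP => ?_
    rw [Fan.ord_mul P hf0 (chi_ne_zero _),
      ← (Δ.isLocalEquation_intDivisor hτ hm hτx).2 P hP]
    exact hf P hP
  have e : f = (⟨_, hreg⟩ : x.toSubring) • chi k m := by
    change f = f * chi k (-m) * chi k m
    rw [mul_assoc, ← chi_add, neg_add_cancel, chi_zero, mul_one]
  rw [e]
  exact Submodule.smul_mem _ _ (Submodule.subset_span hsec)

/-! ### Globally generated divisors -/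

/-- On every cone the coefficients `a` are given by a linear function bounded above by `a`. -/
def Fan.IsSupported (Δ : Fan n) (a : Δ.Ray → ℝ) : Prop :=
  ∀ σ ∈ Δ.cones, ∃ m : Fin n → ℝ, (∀ i : Δ.Ray, 0 ≤ a i + m ⬝ᵥ i.vec) ∧
    ∀ i : Δ.Ray, i.vec ∈ σ → a i + m ⬝ᵥ i.vec = 0

lemma Fan.IsSupported.add {Δ : Fan n} {a b : Δ.Ray → ℝ} (ha : Δ.IsSupported a)
    (hb : Δ.IsSupported b) : Δ.IsSupported (a + b) := fun σ hσ => by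
  obtain ⟨m, h, hm⟩ := ha σ hσ
  obtain ⟨m', h', hm'⟩ := hb σ hσ
  refine ⟨m + m', fun i => ?_, fun i hi => ?_⟩
  · have := h i
    have := h' i
    rw [Pi.add_apply, add_dotProduct]; linarith
  · have := hm i hi
    have := hm' i hi
    rw [Pi.add_apply, add_dotProduct]; linarith

lemma Fan.IsSupported.smul {Δ : Fan n} {a : Δ.Ray → ℝ} (ha : Δ.IsSupported a) {c : ℝ}
    (hc : 0 ≤ c) : Δ.IsSupported (c • a) := fun σ hσ => by
  obtain ⟨m, h, hm⟩ := ha σ hσ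
  refine ⟨c • m, fun i => ?_, fun i hi => ?_⟩
  · rw [Pi.smul_apply, smul_dotProduct, ← smul_add]; exact mul_nonneg hc (h i)
  · rw [Pi.smul_apply, smul_dotProduct, ← smul_add, hm i hi, smul_zero]

lemma Fan.isSupported_dotProduct (Δ : Fan n) (m : Fin n → ℝ) :
    Δ.IsSupported fun i => m ⬝ᵥ i.vec := fun σ _ =>
  ⟨-m, fun i => by rw [neg_dotProduct, add_neg_cancel],
    fun i _ => by rw [neg_dotProduct, add_neg_cancel]⟩

/-- Take a global section generating the stalk at the generic point of the orbit of `σ`. It need not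
be a character, but trivializing over the torus turns it into a Laurent polynomial, and an exponent
of minimal order at an interior point of `σ` serves as the required `m`. -/
lemma Fan.isSupported_of_isGloballyGenerated (Δ : Fan n) {D : (toricVariety k Δ).ZDiv}
    (hD : Model.IsCartier D) (hgg : Model.IsGloballyGenerated D) :
    Δ.IsSupported (Δ.toricPart k (Model.toRDiv D)) := by
  intro σ hσ
  set x := orbitRing k (Δ.isRational hσ) with hxdef
  have hx : x ∈ (toricVariety k Δ).points := orbitRing_mem hσ
  have hσx : IsOrbitCone σ x := isOrbitCone_orbitRing (k := k) (Δ.isRational hσ)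
  obtain ⟨h, h0, h1, h2⟩ := Δ.exists_torus_equation D
  obtain ⟨f, hf, hfP⟩ := hD x hx
  have hreg : ∀ s ∈ Model.globalSections D, f * s ∈ x.toSubring := by
    intro s hs
    by_cases hs0 : s = 0
    · rw [hs0, mul_zero]; exact zero_mem _
    have hs := hs.resolve_left hs0
    refine Δ.mem_of_ord_nonneg hx (mul_ne_zero hf hs0) fun P hP => ?_
    rw [Fan.ord_mul P hf hs0, ← hfP P hP]
    linarith [hs P]
  -- If every product `f * s` were a nonunit, `f` times the span of the global sections would lie in
  -- the maximal ideal, although `f⁻¹` belongs to the stalk.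
  have hunit : ∃ s ∈ Model.globalSections D, s ≠ 0 ∧ (f * s)⁻¹ ∈ x.toSubring := by
    by_contra! hcon
    have hst : f⁻¹ ∈ Model.stalk D x := Or.inr fun P hP => by
      rw [Fan.ord_inv P hf, hfP P hP, neg_add_cancel]
    have key : ∀ g ∈ Submodule.span x.toSubring (Model.globalSections D),
        ∃ r ∈ IsLocalRing.maximalIdeal x.toSubring, f * g = r := by
      intro g hg
      induction hg using Submodule.span_induction with
      | mem s hs =>
        by_cases hs0 : s = 0
        · exact ⟨0, zero_mem _, by rw [hs0, mul_zero]; rfl⟩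
        refine ⟨⟨f * s, hreg s hs⟩, ?_, rfl⟩
        rw [IsLocalRing.mem_maximalIdeal, mem_nonunits_iff,
          Subring.isUnit_iff_inv_mem _ (mul_ne_zero hf hs0)]
        exact hcon s hs hs0
      | zero => exact ⟨0, zero_mem _, by rw [mul_zero]; rfl⟩
      | add y z _ _ hy hz =>
        obtain ⟨r, hr, e⟩ := hy
        obtain ⟨r', hr', e'⟩ := hz
        exact ⟨r + r', add_mem hr hr', by rw [mul_add, e, e']; rfl⟩
      | smul c y _ hy =>
        obtain ⟨r, hr, e⟩ := hy
        refine ⟨c * r, Ideal.mul_mem_left _ _ hr, ?_⟩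
        change f * (c * y) = c * r
        rw [mul_left_comm, e]
    obtain ⟨r, hr, e⟩ := key _ (hgg x hx _ hst)
    rw [mul_inv_cancel₀ hf] at e
    have hr1 : r = 1 := Subtype.ext e.symm
    rw [hr1] at hr
    exact (Ideal.ne_top_iff_one _).1 (IsLocalRing.maximalIdeal.isMaximal _).ne_top hr
  obtain ⟨s, hs, hs0, hsx⟩ := hunit
  have hsP : ∀ P : (toricVariety k Δ).PrimeDivisor, P.Through x → P.ord s = -D P := by
    intro P hP
    have h3 := Fan.ord_nonneg_of_mem hP (inv_ne_zero (mul_ne_zero hf hs0)) hsx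
    have h4 := Fan.ord_nonneg_of_mem hP (mul_ne_zero hf hs0) (hreg s hs)
    rw [Fan.ord_inv P (mul_ne_zero hf hs0)] at h3
    rw [Fan.ord_mul P hf hs0, ← hfP P hP] at h3 h4
    linarith
  have hs' := hs.resolve_left hs0
  -- The factor `h` cancels the poles of `s` allowed by `D` inside the torus.
  obtain ⟨q, hq0, hq⟩ := Δ.exists_toField_of_ord_nonneg (mul_ne_zero hs0 h0) fun p hp => by
    rw [Fan.ord_mul _ hs0 h0, h1]; exact hs' _
  have hqi : ∀ i : Δ.Ray, monOrd i.1 q = (Δ.primeDiv k i).ord s + monVal i.1 h := fun i => by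
    rw [← monVal_toField i.1 hq0, ← hq, monVal_mul i.1 hs0 h0, Δ.ord_primeDiv i hs0]
  obtain ⟨m₀, hm₀⟩ := Δ.exists_linear_of_ord_eq_zero (Δ.isRational hσ) hσx
    (mul_ne_zero hs0 h0) fun p hp ht => by
      rw [Fan.ord_mul _ hs0 h0, h1, hsP _ ht, neg_add_cancel]
  obtain ⟨w, hw⟩ := (Δ.isRational hσ).exists_relint
  -- On `σ` the order of `q` is the linear function `m₀`. The exponent `u` dominates `m₀` there and
  -- agrees with it at the interior point `w`, hence agrees on all of `σ`.
  obtain ⟨u, hu, euw⟩ := monOrd_exists w hq0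
  rw [hq] at hm₀
  have hm₀' : ∀ v, latticeVec v ∈ σ → monOrd v q = m₀ ⬝ᵥ v := fun v hv => by
    rw [← hm₀ v hv, monVal_toField v hq0]
  have hd : u - m₀ ∈ dualSemigroup σ := (Δ.mem_dualSemigroup_iff hσ).2 fun i hi => by
    rw [sub_dotProduct, ← hm₀' i.1 hi]
    linarith [monOrd_le i.1 hu]
  have hd0 : pairing (u - m₀) (latticeVec w) = 0 := by
    rw [pairing_latticeVec, sub_dotProduct, euw, hm₀' w hw.1]; simp
  refine ⟨fun j => u j, fun i => ?_, fun i hi => ?_⟩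
  · rw [dotProduct_vec, h2, ← Int.cast_add]
    have h3 := monOrd_le i.1 hu
    rw [hqi] at h3
    have h4 := hs' (Δ.primeDiv k i)
    exact_mod_cast (by linarith : 0 ≤ D (Δ.primeDiv k i) - monVal i.1 h + u ⬝ᵥ i.1)
  · rw [dotProduct_vec, h2, ← Int.cast_add]
    have h3 := hw.2 _ hd hd0 _ hi
    rw [Fan.Ray.vec, pairing_latticeVec] at h3
    have h3' : (u - m₀) ⬝ᵥ i.1 = 0 := by exact_mod_cast h3
    rw [sub_dotProduct, ← hm₀' i.1 hi, hqi,
      hsP _ ((Δ.primeDiv_through_iff i (Δ.isRational hσ) hσx).2 hi)] at h3'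
    exact_mod_cast (by linarith : D (Δ.primeDiv k i) - monVal i.1 h + u ⬝ᵥ i.1 = 0)

/-- Supportedness is stable under sums, nonnegative multiples and addition of characters, so it
passes from the generators to the cone and does not depend on the representative of the class. -/
lemma Fan.isSupported_of_mem_ggCone (Δ : Fan n) {a : Δ.Ray → ℝ}
    (h : Model.cls (toricDivisor k Δ a) ∈ (toricVariety k Δ).ggCone) : Δ.IsSupported a := by
  have key : ∀ α ∈ (toricVariety k Δ).ggCone, ∃ d : (toricVariety k Δ).RDiv,
      Model.cls d = α ∧ Δ.IsSupported (Δ.toricPart k d) := by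
    intro α hα
    induction hα using Submodule.span_induction with
    | mem α hα =>
      obtain ⟨D, hD, hgg, rfl⟩ := hα
      exact ⟨_, rfl, Δ.isSupported_of_isGloballyGenerated hD hgg⟩
    | zero => exact ⟨0, map_zero _, fun σ _ => ⟨0, fun i => by simp, fun i _ => by simp⟩⟩
    | add x y _ _ hx hy =>
      obtain ⟨d, rfl, hd⟩ := hx
      obtain ⟨d', rfl, hd'⟩ := hy
      exact ⟨d + d', map_add _ _ _, by rw [map_add]; exact hd.add hd'⟩
    | smul c x _ hx =>
      obtain ⟨d, rfl, hd⟩ := hx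
      exact ⟨(c : ℝ) • d, map_smul _ _ _, by rw [map_smul]; exact hd.smul c.2⟩
  obtain ⟨d, hd, hl⟩ := key _ h
  obtain ⟨m, hm⟩ := Δ.cls_eq_iff.1 hd
  rw [toricPart_toricDivisor] at hm
  have e : a = Δ.toricPart k d + fun i => (-m) ⬝ᵥ i.vec := by
    ext i
    rw [Pi.add_apply, hm, neg_dotProduct]; ring
  rw [e]
  exact hl.add (Δ.isSupported_dotProduct _)

end ClassGroup

end

noncomputable section

open scoped BigOperators

/-! ### Global generation and position in the class group as linear inequalities -/

section Equivalences

variable {k : Type*} [Field k] {n : ℕ}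

lemma pairing_eq_dotProduct (m : Fin n → ℤ) (v : Fin n → ℝ) :
    pairing m v = (fun j => (m j : ℝ)) ⬝ᵥ v := rfl

/-- Real data on a fan are a nonnegative combination of integral data satisfying the same
linear conditions. -/
lemma Fan.exists_int_decomposition (Δ : Fan n) (a : Δ.Ray → ℝ) (m : Δ.cones → Fin n → ℝ) :
    ∃ (r : ℕ) (c : Fin (r + 1) → ℝ) (b : Fin (r + 1) → Δ.Ray → ℤ)
      (M : Fin (r + 1) → Δ.cones → Fin n → ℤ), (∀ s, 0 ≤ c s) ∧
      (∀ i, a i = ∑ s, c s * (b s i : ℝ)) ∧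
      ∀ s σ i, SignType.sign ((b s i + M s σ ⬝ᵥ i.1 : ℤ) : ℝ) =
        SignType.sign (a i + m σ ⬝ᵥ i.vec) := by
  classical
  have := Δ.finite.fintype
  let x : Δ.Ray ⊕ (Δ.cones × Fin n) → ℝ := Sum.elim a fun p => m p.1 p.2
  -- The form indexed by `(σ, i)` evaluates `a i + ⟨m σ, v_i⟩`, so the sign condition keeps each of
  -- these equalities and inequalities.
  let g : Δ.cones × Δ.Ray → Δ.Ray ⊕ (Δ.cones × Fin n) → ℤ := fun p =>
    Sum.elim (Pi.single p.2 1) fun q => if q.1 = p.1 then p.2.1 q.2 else 0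
  obtain ⟨r, c, z, hc, hx, hs⟩ := _root_.exists_int_decomposition (Finset.univ.image g) x
  have hg : ∀ (σ : Δ.cones) (i : Δ.Ray) (y : Δ.Ray ⊕ (Δ.cones × Fin n) → ℝ),
      ∑ j, (g (σ, i) j : ℝ) * y j = y (Sum.inl i) + ∑ j, y (Sum.inr (σ, j)) * (i.1 j : ℝ) := by
    intro σ i y
    rw [Fintype.sum_sum_type, Fintype.sum_prod_type]
    congr 1
    · simp [g, Pi.single_apply]
    · rw [Finset.sum_eq_single σ]
      · simp [g, mul_comm]
      · intro τ _ hτ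
        simp [g, hτ]
      · simp
  refine ⟨r, c, fun s i => z s (Sum.inl i), fun s σ j => z s (Sum.inr (σ, j)), hc,
    fun i => hx (Sum.inl i), fun s σ i => ?_⟩
  have h1 := hs s (g (σ, i)) (Finset.mem_image_of_mem _ (Finset.mem_univ _))
  rw [hg σ i (fun j => (z s j : ℝ)), hg σ i x] at h1
  rw [← show x (Sum.inl i) + ∑ j, x (Sum.inr (σ, j)) * (i.1 j : ℝ) = a i + m σ ⬝ᵥ i.vec from rfl,
    ← h1]
  congr 1
  push_cast [dotProduct]
  rfl

lemma Fan.toricDivisor_eq_sum (Δ : Fan n) (a : Δ.Ray → ℝ) :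
    toricDivisor k Δ a = ∑ i, a i • rayDivisor k Δ i := by
  classical
  ext P
  rw [Finsupp.finsetSum_apply]
  obtain ⟨j, rfl⟩ | ⟨p, hp, rfl⟩ := Δ.primeDivisor_cases P
  · simp [rayDivisor, Pi.single_apply]
  · simp [rayDivisor]

lemma Fan.toricDivisor_sum (Δ : Fan n) {ι : Type*} (s : Finset ι) (c : ι → ℝ)
    (b : ι → Δ.Ray → ℝ) :
    toricDivisor k Δ (fun i => ∑ t ∈ s, c t * b t i) = ∑ t ∈ s, c t • toricDivisor k Δ (b t) := by
  ext P
  rw [Finsupp.finsetSum_apply]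
  obtain ⟨j, rfl⟩ | ⟨p, hp, rfl⟩ := Δ.primeDivisor_cases P <;> simp

variable (k) in
-- Real supported coefficients are a nonnegative combination of integral ones satisfying the same
-- equalities and inequalities, and each of those gives a globally generated Cartier divisor.
lemma Fan.isSupported_iff_mem_ggCone (Δ : Fan n) {a : Δ.Ray → ℝ} :
    Δ.IsSupported a ↔ Model.cls (toricDivisor k Δ a) ∈ (toricVariety k Δ).ggCone := by
  refine ⟨fun h => ?_, Δ.isSupported_of_mem_ggCone⟩
  choose m hm hm0 using h
  obtain ⟨r, c, b, M, hc, ha, hs⟩ := Δ.exists_int_decomposition a fun σ => m σ σ.2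
  have hnn : ∀ s (σ : Δ.cones) (i : Δ.Ray), 0 ≤ b s i + M s σ ⬝ᵥ i.1 := fun s σ i => by
    have h1 : 0 ≤ SignType.sign ((b s i + M s σ ⬝ᵥ i.1 : ℤ) : ℝ) := by
      rw [hs]; exact sign_nonneg_iff.2 (hm σ σ.2 i)
    exact_mod_cast sign_nonneg_iff.1 h1
  have h0 : ∀ s (σ : Δ.cones) (i : Δ.Ray), i.vec ∈ σ.1 → b s i + M s σ ⬝ᵥ i.1 = 0 :=
    fun s σ i hi => by
      have h1 : SignType.sign ((b s i + M s σ ⬝ᵥ i.1 : ℤ) : ℝ) = 0 := by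
        rw [hs]; exact sign_eq_zero_iff.2 (hm0 σ σ.2 i hi)
      exact_mod_cast sign_eq_zero_iff.1 h1
  have e : toricDivisor k Δ a = ∑ s, c s • Model.toRDiv (Δ.intDivisor k (b s)) := by
    simp only [toRDiv_intDivisor]
    rw [← Δ.toricDivisor_sum Finset.univ c fun s i => (b s i : ℝ)]
    congr 1
    ext i
    exact ha i
  rw [e, Model.cls, map_sum]
  refine sum_mem fun s _ => ?_
  rw [map_smul]
  refine PointedCone.smul_mem _ (hc s) (Submodule.subset_span ⟨_, ?_, ?_, rfl⟩)
  · exact Δ.isCartier_intDivisor fun σ hσ => ⟨M s ⟨σ, hσ⟩, h0 s ⟨σ, hσ⟩⟩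
  · exact Δ.isGloballyGenerated_intDivisor fun σ hσ =>
      ⟨M s ⟨σ, hσ⟩, hnn s ⟨σ, hσ⟩, h0 s ⟨σ, hσ⟩⟩

variable (k) in
-- For a fixed `σ`, the functional `m` is the character whose divisor moves `∑ a_i D_i` to an
-- effective divisor without components among the rays of `σ`.
lemma Fan.isSupported_iff_mem_hull (Δ : Fan n) {a : Δ.Ray → ℝ} :
    Δ.IsSupported a ↔ ∀ σ ∈ Δ.cones, Model.cls (toricDivisor k Δ a) ∈
      PointedCone.hull ℝ {α | ∃ i : Δ.Ray, i.vec ∉ σ ∧ α = Model.cls (rayDivisor k Δ i)} := by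
  classical
  refine forall₂_congr fun σ hσ => ⟨?_, fun h => ?_⟩
  · rintro ⟨m, hm, hm0⟩
    have e : Model.cls (toricDivisor k Δ a) =
        ∑ i, (a i + m ⬝ᵥ i.vec) • Model.cls (rayDivisor k Δ i) := by
      have h1 : Model.cls (toricDivisor k Δ a) =
          Model.cls (toricDivisor k Δ fun i => a i + m ⬝ᵥ i.vec) :=
        Δ.cls_eq_iff.2 ⟨-m, fun i => by
          rw [toricPart_toricDivisor, toricPart_toricDivisor, neg_dotProduct]; ring⟩
      rw [h1, toricDivisor_eq_sum, Model.cls, map_sum]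
      simp only [map_smul, Model.cls]
    rw [e]
    refine sum_mem fun i _ => ?_
    by_cases hi : i.vec ∈ σ
    · rw [hm0 i hi, zero_smul]; exact zero_mem _
    · exact PointedCone.smul_mem _ (hm i) (Submodule.subset_span ⟨i, hi, rfl⟩)
  · have key : ∀ α ∈ PointedCone.hull ℝ
        {α | ∃ i : Δ.Ray, i.vec ∉ σ ∧ α = Model.cls (rayDivisor k Δ i)},
        ∃ d : (toricVariety k Δ).RDiv, Model.cls d = α ∧ (∀ i, 0 ≤ Δ.toricPart k d i) ∧
          ∀ i : Δ.Ray, i.vec ∈ σ → Δ.toricPart k d i = 0 := by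
      intro α hα
      induction hα using Submodule.span_induction with
      | mem α hα =>
        obtain ⟨i, hi, rfl⟩ := hα
        refine ⟨_, rfl, fun j => ?_, fun j hj => ?_⟩
        · rw [rayDivisor, toricPart_toricDivisor, Pi.single_apply]
          split_ifs <;> norm_num
        · rw [rayDivisor, toricPart_toricDivisor, Pi.single_apply, if_neg]
          rintro rfl
          exact hi hj
      | zero => exact ⟨0, map_zero _, fun i => by simp, fun i _ => by simp⟩
      | add x y _ _ hx hy =>
        obtain ⟨d, rfl, h1, h2⟩ := hx
        obtain ⟨d', rfl, h1', h2'⟩ := hy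
        exact ⟨d + d', map_add _ _ _,
          fun i => by rw [map_add]; exact add_nonneg (h1 i) (h1' i),
          fun i hi => by rw [map_add, Pi.add_apply, h2 i hi, h2' i hi, add_zero]⟩
      | smul c x _ hx =>
        obtain ⟨d, rfl, h1, h2⟩ := hx
        exact ⟨(c : ℝ) • d, map_smul _ _ _,
          fun i => by rw [map_smul]; exact mul_nonneg c.2 (h1 i),
          fun i hi => by rw [map_smul, Pi.smul_apply, h2 i hi, smul_zero]⟩
    obtain ⟨d, hd, h1, h2⟩ := key _ h
    obtain ⟨m, hm⟩ := Δ.cls_eq_iff.1 hd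
    rw [toricPart_toricDivisor] at hm
    have e : ∀ i, a i + m ⬝ᵥ i.vec = Δ.toricPart k d i := fun i => (hm i).symm
    exact ⟨m, fun i => by rw [e]; exact h1 i, fun i hi => by rw [e]; exact h2 i hi⟩

/-! ### Convex piecewise linear functions -/

/-- A convex piecewise linear function is sublinear. -/
lemma IsPiecewiseLinear.map_smul {ψ : (Fin n → ℝ) → ℝ} (h : IsPiecewiseLinear ψ) {c : ℝ}
    (hc : 0 ≤ c) (v : Fin n → ℝ) : ψ (c • v) = c * ψ v := by
  obtain ⟨S, -, -, hcov, hlin⟩ := h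
  obtain ⟨τ, hτ, hv⟩ := hcov v
  obtain ⟨l, hl⟩ := hlin τ hτ
  rw [hl v hv, hl _ (PointedCone.smul_mem _ hc hv), _root_.map_smul, smul_eq_mul]

lemma IsConvexFun.map_add_le {ψ : (Fin n → ℝ) → ℝ} (h : IsConvexFun ψ) (v w : Fin n → ℝ) :
    ψ (v + w) ≤ ψ v + ψ w := by
  simpa [Fin.sum_univ_two] using h 2 ![v, w]

/-- A supporting linear functional of a sublinear function. -/
lemma exists_supporting_functional {ψ : (Fin n → ℝ) → ℝ}
    (hsmul : ∀ c : ℝ, 0 ≤ c → ∀ v, ψ (c • v) = c * ψ v)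
    (hadd : ∀ v w, ψ (v + w) ≤ ψ v + ψ w) (w : Fin n → ℝ) :
    ∃ m : Fin n → ℝ, m ⬝ᵥ w = ψ w ∧ ∀ v, m ⬝ᵥ v ≤ ψ v := by
  have h0 : ψ 0 = 0 := by simpa using hsmul 0 le_rfl 0
  have hdot : ∀ g : (Fin n → ℝ) →ₗ[ℝ] ℝ, ∃ m : Fin n → ℝ, ∀ v, g v = m ⬝ᵥ v := fun g => by
    refine ⟨fun j => g (Pi.single j 1), fun v => ?_⟩
    conv_lhs => rw [pi_eq_sum_univ v]
    rw [map_sum]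
    refine Finset.sum_congr rfl fun j _ => ?_
    rw [_root_.map_smul, smul_eq_mul, mul_comm]
    congr 2
    ext i
    rw [Pi.single_apply]
    exact if_congr eq_comm rfl rfl
  -- Hahn-Banach is applied to the functional `t w ↦ t ψ(w)` on the line through `w`. For negative
  -- `t` the bound comes from `0 = ψ 0 ≤ ψ (t w) + ψ (-t w)`.
  obtain ⟨f, hfdom, hf⟩ : ∃ f : (Fin n → ℝ) →ₗ.[ℝ] ℝ, w ∈ f.domain ∧
      ((∀ (x : f.domain), (x : Fin n → ℝ) = w → f x = ψ w) ∧ ∀ x : f.domain, f x ≤ ψ x) := by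
    by_cases hw : w = 0
    · refine ⟨⊥, by rw [hw]; exact zero_mem _, fun x hx => ?_, fun x => ?_⟩
      · rw [hw, h0]
        have : x = 0 := Subtype.ext (by rw [hx, hw]; rfl)
        rw [this, LinearPMap.map_zero]
      · have hx : (x : Fin n → ℝ) = 0 := (Submodule.mem_bot ℝ).1 x.2
        have : x = 0 := Subtype.ext hx
        rw [this, LinearPMap.map_zero]
        exact h0.ge
    · refine ⟨LinearPMap.mkSpanSingleton w (ψ w) hw, Submodule.mem_span_singleton_self w,
        fun x hx => ?_, fun x => ?_⟩
      · obtain ⟨x, hx'⟩ := x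
        obtain rfl : x = w := hx
        exact LinearPMap.mkSpanSingleton_apply ℝ ℝ hw (ψ x)
      · obtain ⟨x, hx⟩ := x
        obtain ⟨t, rfl⟩ := Submodule.mem_span_singleton.1 hx
        rw [LinearPMap.mkSpanSingleton'_apply]
        change t * ψ w ≤ ψ (t • w)
        rcases le_total 0 t with ht | ht
        · exact (hsmul t ht w).ge
        · have h1 := hadd (t • w) ((-t) • w)
          rw [← add_smul, add_neg_cancel, zero_smul, h0, hsmul (-t) (by linarith)] at h1
          linarith
  obtain ⟨g, hg, hgle⟩ := exists_extension_of_le_sublinear f ψ (fun c hc x => hsmul c hc.le x)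
    hadd hf.2
  obtain ⟨m, hm⟩ := hdot g
  refine ⟨m, ?_, fun v => by rw [← hm]; exact hgle v⟩
  rw [← hm, ← hf.1 ⟨w, hfdom⟩ rfl]
  exact hg ⟨w, hfdom⟩

lemma isLinearOn_dotProduct {ψ : (Fin n → ℝ) → ℝ} {τ : PointedCone ℝ (Fin n → ℝ)}
    (m : Fin n → ℝ) (h : ∀ v ∈ τ, ψ v = m ⬝ᵥ v) : IsLinearOn ψ τ :=
  ⟨dotProductBilin ℝ ℝ m, h⟩

/-- The maximum of finitely many linear functions. -/
lemma isPiecewiseLinear_sup' {ι : Type*} [Fintype ι] [Nonempty ι] (m : ι → Fin n → ℝ) :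
    IsPiecewiseLinear (fun v => Finset.univ.sup' Finset.univ_nonempty fun s => m s ⬝ᵥ v) ∧
    IsConvexFun (fun v => Finset.univ.sup' Finset.univ_nonempty fun s => m s ⬝ᵥ v) := by
  classical
  constructor
  · have h : ∀ s, ∃ D : PointedCone ℝ (Fin n → ℝ), D.FG ∧
        ∀ v, v ∈ D ↔ ∀ t, 0 ≤ (dotProductBilin ℝ ℝ (m s) - dotProductBilin ℝ ℝ (m t)) v :=
      fun s => exists_fg_of_inequalities fun t =>
        dotProductBilin ℝ ℝ (m s) - dotProductBilin ℝ ℝ (m t)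
    choose D hfg hD using h
    have hD' : ∀ s v, v ∈ D s ↔ ∀ t, m t ⬝ᵥ v ≤ m s ⬝ᵥ v := fun s v => by
      rw [hD]
      exact forall_congr' fun t => sub_nonneg
    refine ⟨Set.range D, Set.finite_range D, ?_, fun v => ?_, ?_⟩
    · rintro _ ⟨s, rfl⟩; exact hfg s
    · obtain ⟨s, -, hs⟩ := Finset.exists_max_image Finset.univ (fun s => m s ⬝ᵥ v)
        Finset.univ_nonempty
      exact ⟨_, ⟨s, rfl⟩, (hD' s v).2 fun t => hs t (Finset.mem_univ t)⟩
    · rintro _ ⟨s, rfl⟩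
      refine isLinearOn_dotProduct (m s) fun v hv => le_antisymm ?_ ?_
      · exact Finset.sup'_le _ _ fun t _ => (hD' s v).1 hv t
      · exact Finset.le_sup' (fun s => m s ⬝ᵥ v) (Finset.mem_univ s)
  · intro l u
    refine Finset.sup'_le _ _ fun s _ => ?_
    rw [dotProduct_sum]
    exact Finset.sum_le_sum fun j _ => Finset.le_sup' (fun s => m s ⬝ᵥ u j) (Finset.mem_univ s)

lemma Fan.rayCone_vec_mem {Δ : Fan n} (i : Δ.Ray) : i.vec ∈ rayCone i.1 :=
  latticeVec_mem_rayCone i.1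

/-- The maximum of the functions `-m σ` is convex, equals `-m σ` on `σ`, and takes the value `a i`
at each ray. Conversely, a supporting functional at an interior point of `σ` touches `ψ` along all
of `σ`. -/
lemma Fan.isSupported_iff_exists_convex (Δ : Fan n) {a : Δ.Ray → ℝ} :
    Δ.IsSupported a ↔ ∃ ψ : (Fin n → ℝ) → ℝ, IsPiecewiseLinear ψ ∧ IsConvexFun ψ ∧
        (∀ σ ∈ Δ.cones, IsLinearOn ψ σ) ∧ ∀ i : Δ.Ray, ψ i.vec = a i := by
  classical
  constructor
  · intro h
    choose m hm hm0 using h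
    have := Δ.finite.fintype
    have : Nonempty Δ.cones := Δ.nonempty.to_subtype
    obtain ⟨h1, h2⟩ := isPiecewiseLinear_sup' fun σ : Δ.cones => -(m σ σ.2)
    refine ⟨_, h1, h2, fun σ hσ => isLinearOn_dotProduct (-(m σ hσ)) fun v hv =>
      le_antisymm (Finset.sup'_le _ _ fun τ _ => ?_)
        (Finset.le_sup' (fun σ : Δ.cones => -(m σ σ.2) ⬝ᵥ v) (Finset.mem_univ ⟨σ, hσ⟩)),
      fun i => le_antisymm (Finset.sup'_le _ _ fun τ _ => ?_) ?_⟩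
    · obtain ⟨c, hc, hc0, rfl⟩ := (Δ.mem_cone_iff hσ).1 hv
      rw [dotProduct_sum, dotProduct_sum]
      refine Finset.sum_le_sum fun i _ => ?_
      by_cases hi : i.vec ∈ σ
      · rw [dotProduct_smul, dotProduct_smul, neg_dotProduct, neg_dotProduct]
        have h3 := hm τ τ.2 i
        have h4 := hm0 σ hσ i hi
        exact mul_le_mul_of_nonneg_left (by linarith) (hc i)
      · rw [hc0 i hi]; simp
    · rw [neg_dotProduct]
      linarith [hm τ τ.2 i]
    · refine le_trans ?_ (Finset.le_sup' (fun σ : Δ.cones => -(m σ σ.2) ⬝ᵥ i.vec)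
        (Finset.mem_univ ⟨rayCone i.1, i.2.2⟩))
      rw [neg_dotProduct]
      linarith [hm0 _ i.2.2 i (Fan.rayCone_vec_mem i)]
  · rintro ⟨ψ, hpl, hconv, hlin, hψ⟩ σ hσ
    -- The sum of the rays of `σ`. The functional is at most `ψ` at each summand and `ψ` is linear
    -- on `σ`, so equality at the sum forces equality at every ray.
    let w : Fin n → ℝ := ∑ i : Δ.Ray, if i.vec ∈ σ then i.vec else 0
    obtain ⟨m, hmw, hm⟩ := exists_supporting_functional (fun c hc => hpl.map_smul hc)
      hconv.map_add_le w
    obtain ⟨l, hl⟩ := hlin σ hσ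
    have hwσ : w ∈ σ := sum_mem fun i _ => by
      split_ifs with hi
      · exact hi
      · exact zero_mem _
    have hle : ∀ i : Δ.Ray, m ⬝ᵥ i.vec ≤ a i := fun i => (hm i.vec).trans (hψ i).le
    refine ⟨-m, fun i => by rw [neg_dotProduct]; linarith [hle i], fun i hi => ?_⟩
    rw [hl w hwσ, dotProduct_sum, map_sum, ← sub_eq_zero, ← Finset.sum_sub_distrib] at hmw
    have hterm : ∀ j : Δ.Ray, m ⬝ᵥ (if j.vec ∈ σ then j.vec else 0) -
        l (if j.vec ∈ σ then j.vec else 0) ≤ 0 := fun j => by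
      split_ifs with hj
      · rw [← hl _ hj, hψ]; linarith [hle j]
      · simp
    have h0 := (Finset.sum_eq_zero_iff_of_nonpos fun j _ => hterm j).1 hmw i (Finset.mem_univ i)
    rw [if_pos hi, ← hl _ hi, hψ] at h0
    rw [neg_dotProduct]; linarith

end Equivalences

end

noncomputable section

open scoped BigOperators

/-! ### Rational points are dense -/

/-- Rational points are dense, and each is a positive multiple of an integral one. -/
lemma eq_univ_of_isClosed_of_intCast_mem {ι : Type*} [Fintype ι] {C : Set (ι → ℝ)}
    (hC : IsClosed C) (hsmul : ∀ c : ℝ, 0 < c → ∀ v ∈ C, c • v ∈ C)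
    (h : ∀ z : ι → ℤ, (fun i => (z i : ℝ)) ∈ C) : C = Set.univ := by
  have hd : Dense (Set.pi Set.univ fun _ : ι => Set.range ((↑) : ℚ → ℝ)) :=
    dense_pi _ fun _ _ => Rat.denseRange_cast
  refine Set.eq_univ_of_univ_subset ?_
  rw [← hd.closure_eq]
  refine hC.closure_subset_iff.2 fun v hv => ?_
  choose q hq using fun i => hv i (Set.mem_univ i)
  let N : ℕ := ∏ i, (q i).den
  have hN : 0 < N := Finset.prod_pos fun i _ => (q i).den_pos
  have hz : ∀ i, ∃ z : ℤ, (z : ℝ) = N * v i := fun i => by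
    obtain ⟨c, hc⟩ := Finset.dvd_prod_of_mem (fun i => (q i).den) (Finset.mem_univ i)
    refine ⟨c * (q i).num, ?_⟩
    have h1 : ((q i).num : ℚ) = q i * (q i).den := (Rat.mul_den_eq_num _).symm
    have h2 : (((q i).num : ℚ) : ℝ) = q i * (q i).den := by rw [h1]; push_cast; rfl
    rw [Rat.cast_intCast] at h2
    rw [← hq i, show N = (q i).den * c from hc]
    push_cast
    rw [h2]; ring
  choose z hz using hz
  have hN' : (0 : ℝ) < N := by exact_mod_cast hN
  have e : v = (N : ℝ)⁻¹ • fun i => (z i : ℝ) := by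
    ext i
    rw [Pi.smul_apply, hz, smul_eq_mul, inv_mul_cancel_left₀ hN'.ne']
  rw [e]
  exact hsmul _ (inv_pos.2 hN') _ (h z)

/-! ### Centers -/

/-- Localize `A` at the contraction of the maximal ideal of `R`. The last clause expresses
domination: elements of `A` invertible in `R` are invertible at the center. -/
lemma exists_center {F : Type*} [Field F] {A : Subring F} {R : LocalSubring F}
    (h : A ≤ R.toSubring) : ∃ x : LocalSubring F, IsLocalizationOf A x.toSubring ∧
      x.toSubring ≤ R.toSubring ∧ ∀ b ∈ A, b ≠ 0 → b⁻¹ ∈ R.toSubring → b⁻¹ ∈ x.toSubring := by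
  let P : Ideal A := (IsLocalRing.maximalIdeal R.toSubring).comap (Subring.inclusion h)
  have hP : P.IsPrime := Ideal.comap_isPrime _ _
  have key : ∀ b : A, (b : F) ≠ 0 → (b ∉ P ↔ (b : F)⁻¹ ∈ R.toSubring) := by
    intro b h0
    rw [show b ∈ P ↔ (⟨b, h b.2⟩ : R.toSubring) ∈ IsLocalRing.maximalIdeal R.toSubring from
      Iff.rfl, IsLocalRing.mem_maximalIdeal, mem_nonunits_iff, not_not,
      Subring.isUnit_iff_inv_mem _ h0]
  refine ⟨LocalSubring.ofPrime A P, LocalSubring.isLocalizationOf_ofPrime A P, fun f hf => ?_,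
    fun b hb h0 hbR => ((LocalSubring.inv_mem_ofPrime hb).1 ((key ⟨b, hb⟩ h0).2 hbR)).2⟩
  obtain ⟨a, b, hb, rfl⟩ := LocalSubring.mem_ofPrime.1 hf
  have h0 : (b : F) ≠ 0 := fun h0 => hb (by rw [show b = 0 from Subtype.ext h0]; exact zero_mem _)
  rw [div_eq_mul_inv]
  exact mul_mem (h a.2) ((key b h0).1 hb)

/-! ### The strictly convex function of a projective toric variety -/

section Projective

variable {k : Type*} [Field k] {n : ℕ}

lemma inv_mem_monRing {v : Fin n → ℤ} {f : ToricField k n} (hf : f ≠ 0) :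
    f⁻¹ ∈ monRing k v ↔ monVal v f ≤ 0 := by
  rw [mem_monRing, monVal_inv v hf]
  exact ⟨fun h => by linarith [h (inv_ne_zero hf)], fun h _ => by linarith⟩

variable (k) in
/-- The valuation ring of a monomial valuation, as a local ring. -/
def monPoint (v : Fin n → ℤ) : LocalSubring (ToricField k n) where
  toSubring := monRing k v
  isLocalRing := by
    have key : ∀ f : monRing k v, f ∈ nonunits (monRing k v) ↔
        ((f : ToricField k n) ≠ 0 → 0 < monVal v (f : ToricField k n)) := by
      rintro ⟨f, hf⟩
      by_cases h0 : f = 0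
      · have : (⟨f, hf⟩ : monRing k v) = 0 := Subtype.ext h0
        rw [this]
        exact ⟨fun _ h => absurd rfl h, fun _ => zero_mem_nonunits.2 zero_ne_one⟩
      · rw [mem_nonunits_iff, Subring.isUnit_iff_inv_mem _ h0, inv_mem_monRing h0, not_le]
        exact ⟨fun h _ => h, fun h => h h0⟩
    refine IsLocalRing.of_nonunits_add fun f g hf hg => ?_
    rw [key] at hf hg ⊢
    exact fun hne => Int.lt_iff_add_one_le.2 (monVal_add v hne
      (fun h => Int.lt_iff_add_one_le.1 (hf h)) (fun h => Int.lt_iff_add_one_le.1 (hg h)))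

/-- The affine chart of a projective variety with coordinates `F`. -/
def coordinateChart {m : ℕ} (F : Fin (m + 1) → TorusRing k n) (i : Fin (m + 1)) :
    Subalgebra k (ToricField k n) :=
  Algebra.adjoin k (Set.range fun j => toField (F j) / toField (F i))

/-- Coprime homogeneous coordinates of a projective toric variety. -/
structure IsCoordinates (Φ : Fan n) {m : ℕ} (F : Fin (m + 1) → TorusRing k n) : Prop where
  ne_zero : ∀ i, F i ≠ 0
  coprime : ∀ p, Prime p → ∃ i, ¬ p ∣ F i
  mem_iff : ∀ x : LocalSubring (ToricField k n), x ∈ (toricVariety k Φ).points ↔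
    ∃ i, IsLocalizationOf (coordinateChart F i).toSubring x.toSubring

/-- Clear denominators and divide by the greatest common divisor; the ratios of coordinates, and so
the charts, are unchanged. The coordinates need not be monomials. -/
lemma exists_isCoordinates {Φ : Fan n} (h : (toricVariety k Φ).IsProjective) :
    ∃ (m : ℕ) (F : Fin (m + 1) → TorusRing k n), IsCoordinates Φ F := by
  obtain ⟨m, f, hf, hX⟩ := h
  obtain ⟨b, hb⟩ := IsLocalization.exist_integer_multiples_of_finite
    (nonZeroDivisors (TorusRing k n)) f
  choose G hG using hb
  have hb0 : toField (b : TorusRing k n) ≠ 0 := toField_ne_zero (nonZeroDivisors.ne_zero b.2)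
  have hG' : ∀ i, toField (G i) = toField b * f i := fun i => by
    rw [toField, hG]; exact Algebra.smul_def _ _
  let _ : StrongNormalizationMonoid (TorusRing k n) :=
    UniqueFactorizationMonoid.strongNormalizationMonoid
  let _ : NormalizedGCDMonoid (TorusRing k n) :=
    UniqueFactorizationMonoid.toNormalizedGCDMonoid _
  obtain ⟨F, hF, hF1⟩ := Finset.extract_gcd (s := Finset.univ) G Finset.univ_nonempty
  set g := Finset.univ.gcd G
  have hG0 : ∀ i, G i ≠ 0 := fun i h0 => by
    have := hG' i
    rw [h0] at this
    exact mul_ne_zero hb0 (hf i) (this ▸ by simp [toField])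
  have hF0 : ∀ i, F i ≠ 0 := fun i h0 => hG0 i (by rw [hF i (Finset.mem_univ i), h0, mul_zero])
  have hg0 : g ≠ 0 := fun h0 => hG0 0 (by rw [hF 0 (Finset.mem_univ 0), h0, zero_mul])
  have hquot : ∀ i j, toField (F j) / toField (F i) = f j / f i := fun i j => by
    have h1 : ∀ i, toField g * toField (F i) = toField b * f i := fun i => by
      rw [← hG', hF i (Finset.mem_univ i)]; exact (map_mul _ _ _).symm
    rw [← mul_div_mul_left _ _ (toField_ne_zero hg0), h1, h1, mul_div_mul_left _ _ hb0]
  refine ⟨m, F, hF0, fun p hp => ?_, fun x => ?_⟩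
  · by_contra! hcon
    have : p ∣ Finset.univ.gcd F := Finset.dvd_gcd fun i _ => hcon i
    rw [hF1] at this
    exact hp.not_dvd_one this
  · rw [hX, Model.mem_ofCharts_iff, Set.exists_range_iff]
    simp only [coordinateChart, hquot]

namespace IsCoordinates

variable {Φ : Fan n} {m : ℕ} {F : Fin (m + 1) → TorusRing k n}

open Classical in
/-- The exponents occurring in the coordinates. -/
def exponents (F : Fin (m + 1) → TorusRing k n) : Finset (Fin n → ℤ) :=
  Finset.univ.biUnion fun i => (F i).coeff.support

/-- The minimal order of the coordinates for a monomial valuation. -/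
def minOrd (F : Fin (m + 1) → TorusRing k n) (v : Fin n → ℤ) : ℤ :=
  Finset.univ.inf' Finset.univ_nonempty fun i => monOrd v (F i)

lemma minOrd_le (F : Fin (m + 1) → TorusRing k n) (v : Fin n → ℤ) (i : Fin (m + 1)) :
    minOrd F v ≤ monOrd v (F i) := Finset.inf'_le _ (Finset.mem_univ i)

lemma exists_minOrd (F : Fin (m + 1) → TorusRing k n) (v : Fin n → ℤ) :
    ∃ i, minOrd F v = monOrd v (F i) := by
  obtain ⟨i, -, h⟩ := Finset.exists_mem_eq_inf' Finset.univ_nonempty fun i => monOrd v (F i)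
  exact ⟨i, h⟩

lemma mem_exponents {F : Fin (m + 1) → TorusRing k n} {s : Fin n → ℤ} :
    s ∈ exponents F ↔ ∃ i, s ∈ (F i).coeff.support := by
  simp [exponents]

lemma minOrd_le_dotProduct {F : Fin (m + 1) → TorusRing k n} {s : Fin n → ℤ}
    (hs : s ∈ exponents F) (v : Fin n → ℤ) : minOrd F v ≤ s ⬝ᵥ v := by
  obtain ⟨i, hi⟩ := mem_exponents.1 hs
  exact (minOrd_le F v i).trans (monOrd_le v hi)

/-- The ratios `F j / F i` are all integral for the valuation exactly when `F i` has the least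
order. -/
lemma coordinateChart_le_monRing (hF : IsCoordinates Φ F) {v : Fin n → ℤ} {i : Fin (m + 1)} :
    (coordinateChart F i).toSubring ≤ monRing k v ↔ monOrd v (F i) = minOrd F v := by
  constructor
  · intro h
    refine le_antisymm (Finset.le_inf' _ _ fun j _ => ?_) (minOrd_le F v i)
    have h1 : toField (F j) / toField (F i) ∈ coordinateChart F i :=
      Algebra.subset_adjoin ⟨j, rfl⟩
    have h2 := h h1 (div_ne_zero (toField_ne_zero (hF.ne_zero j)) (toField_ne_zero (hF.ne_zero i)))
    rw [monVal_div v (hF.ne_zero j) (hF.ne_zero i)] at h2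
    linarith
  · intro h
    suffices H : ∀ f ∈ coordinateChart F i, f ∈ monRing k v from H
    intro f hf
    induction hf using Algebra.adjoin_induction with
    | mem f hf =>
      obtain ⟨j, rfl⟩ := hf
      intro _
      rw [monVal_div v (hF.ne_zero j) (hF.ne_zero i), h]
      linarith [minOrd_le F v j]
    | algebraMap c =>
      exact monVal_nonneg_of_mem (σ := ⊤) Submodule.mem_top
        (Subalgebra.algebraMap_mem (coneAlgebra k ⊤) c)
    | add x y _ _ hx hy => exact add_mem hx hy
    | mul x y _ _ hx hy => exact mul_mem hx hy

/-- The valuative criterion: the monomial valuation of `v` has a center in a chart whose coordinate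
has least order. That center lies in some `U_σ`, and this forces `v ∈ σ`. -/
lemma latticeVec_mem_cone (hF : IsCoordinates Φ F) (v : Fin n → ℤ) :
    ∃ σ ∈ Φ.cones, latticeVec v ∈ σ := by
  obtain ⟨i, hi⟩ := exists_minOrd F v
  obtain ⟨x, hx, hxv, -⟩ := exists_center (R := monPoint k v)
    ((hF.coordinateChart_le_monRing (i := i)).2 hi.symm)
  obtain ⟨σ, hσ, hσx⟩ := mem_toricVariety_iff.1 ((hF.mem_iff x).2 ⟨i, hx⟩)
  exact ⟨σ, hσ, (coneAlgebra_le_monRing_iff (Φ.isRational hσ)).1 (hσx.le.trans hxv)⟩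

/-- Completeness: the support of the fan is a closed cone containing all lattice points. -/
lemma exists_cone (hF : IsCoordinates Φ F) (v : Fin n → ℝ) : ∃ σ ∈ Φ.cones, v ∈ σ := by
  have h : (⋃ σ ∈ Φ.cones, (σ : Set (Fin n → ℝ))) = Set.univ := by
    refine eq_univ_of_isClosed_of_intCast_mem
      (Φ.finite.isClosed_biUnion fun σ hσ => (Φ.isRational hσ).isClosed) (fun c hc v hv => ?_)
      fun z => ?_
    · obtain ⟨σ, hσ, hv⟩ := Set.mem_iUnion₂.1 hv
      exact Set.mem_biUnion hσ (PointedCone.smul_mem _ hc.le hv)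
    · obtain ⟨σ, hσ, hz⟩ := hF.latticeVec_mem_cone z
      exact Set.mem_biUnion hσ hz
  obtain ⟨σ, hσ, hv⟩ := Set.mem_iUnion₂.1 (h.symm ▸ Set.mem_univ v)
  exact ⟨σ, hσ, hv⟩

/-- On every cone the minimal order of the coordinates is linear. -/
lemma exists_linear_minOrd (hF : IsCoordinates Φ F) {σ} (hσ : σ ∈ Φ.cones) :
    ∃ i, IsLocalizationOf (coordinateChart F i).toSubring
      (orbitRing k (Φ.isRational hσ)).toSubring ∧
      ∃ l : Fin n → ℤ, ∀ v, latticeVec v ∈ σ → minOrd F v = l ⬝ᵥ v := by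
  have hx := isOrbitCone_orbitRing (k := k) (Φ.isRational hσ)
  obtain ⟨i, hi⟩ := (hF.mem_iff _).1 (orbitRing_mem (k := k) hσ)
  refine ⟨i, hi, ?_⟩
  -- A torus prime through the orbit point cannot divide `F i`: by coprimality it misses some `F j`,
  -- and then `F j / F i` would have a pole there.
  obtain ⟨l, hl⟩ := Φ.exists_linear_of_ord_eq_zero (Φ.isRational hσ) hx
    (toField_ne_zero (hF.ne_zero i)) fun p hp ht => by
      refine Φ.ord_torusDiv_eq_zero hp fun hpi => ?_
      obtain ⟨j, hj⟩ := hF.coprime p hp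
      have h1 : toField (F j) / toField (F i) ∈ coordinateChart F i :=
        Algebra.subset_adjoin ⟨j, rfl⟩
      have h2 : toField (F j) / toField (F i) ∈ primeRing p hp := ht (hi.le h1)
      have h3 := mul_mem ((inv_mem_primeRing hp (hF.ne_zero j)).2 hj) h2
      rw [← mul_div_assoc, inv_mul_cancel₀ (toField_ne_zero (hF.ne_zero j)), one_div] at h3
      exact (inv_mem_primeRing hp (hF.ne_zero i)).1 h3 hpi
  refine ⟨l, fun v hv => ?_⟩
  rw [← hl v hv, monVal_toField v (hF.ne_zero i)]
  exact ((hF.coordinateChart_le_monRing).1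
    (hi.le.trans ((hx.le_monRing_iff (Φ.isRational hσ)).2 hv))).symm

/-- A cone is determined by the exponents of minimal order at a point of its relative
interior. -/
lemma mem_of_forall_exponents_iff (hF : IsCoordinates Φ F) {σ} (hσ : σ ∈ Φ.cones)
    {w w' : Fin n → ℤ} (hw : IsRelint σ (latticeVec w))
    (h : ∀ s ∈ exponents F, s ⬝ᵥ w = minOrd F w ↔ s ⬝ᵥ w' = minOrd F w') :
    latticeVec w' ∈ σ := by
  classical
  have hx := isOrbitCone_orbitRing (k := k) (Φ.isRational hσ)
  obtain ⟨i, hi, -⟩ := hF.exists_linear_minOrd hσ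
  refine (hx.le_monRing_iff (Φ.isRational hσ)).1 ?_
  have hiw : monOrd w (F i) = minOrd F w := (hF.coordinateChart_le_monRing).1
    (hi.le.trans ((hx.le_monRing_iff (Φ.isRational hσ)).2 hw.1))
  obtain ⟨a, ha, haw⟩ := monOrd_exists w (hF.ne_zero i)
  have haS : a ∈ exponents F := mem_exponents.2 ⟨i, ha⟩
  have haw : a ⬝ᵥ w = minOrd F w := haw.trans hiw
  have haw' : a ⬝ᵥ w' = minOrd F w' := (h a haS).1 haw
  -- Exponents nonnegative on `w` and `w'` that vanish at both or at neither. By hypothesis every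
  -- exponent of a coordinate, shifted by the common minimal exponent `a`, lies in `Q`.
  let Q : AddSubmonoid (Fin n → ℤ) :=
    { carrier := {u | 0 ≤ u ⬝ᵥ w ∧ 0 ≤ u ⬝ᵥ w' ∧ (u ⬝ᵥ w = 0 ↔ u ⬝ᵥ w' = 0)}
      zero_mem' := by simp
      add_mem' := by
        rintro u v ⟨h1, h2, h3⟩ ⟨h1', h2', h3'⟩
        simp only [Set.mem_ofPred_eq, add_dotProduct]
        omega }
  let y : Fin (m + 1) → TorusRing k n := fun j => F j * AddMonoidAlgebra.single (-a) 1
  have hsingle : AddMonoidAlgebra.single (-a) (1 : k) ≠ 0 := by simp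
  have hyQ : ∀ j, ∀ u ∈ (y j).coeff.support, u ∈ Q := by
    intro j u hu
    obtain ⟨s, hs, t, ht, rfl⟩ := supp_mul hu
    rw [AddMonoidAlgebra.coeff_single, Finsupp.support_single _ one_ne_zero,
      Finset.mem_singleton] at ht
    subst ht
    have hsS : s ∈ exponents F := mem_exponents.2 ⟨j, hs⟩
    have h1 := minOrd_le_dotProduct hsS w
    have h2 := minOrd_le_dotProduct hsS w'
    have h3 := h s hsS
    change 0 ≤ (s + -a) ⬝ᵥ w ∧ 0 ≤ (s + -a) ⬝ᵥ w' ∧ ((s + -a) ⬝ᵥ w = 0 ↔ (s + -a) ⬝ᵥ w' = 0)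
    simp only [add_dotProduct, neg_dotProduct, haw, haw']
    omega
  have hyi : monOrd w (y i) = 0 ∧ monOrd w' (y i) = 0 := by
    have hiw' : monOrd w' (F i) = minOrd F w' :=
      le_antisymm ((monOrd_le w' ha).trans_eq haw') (minOrd_le F w' i)
    constructor
    · rw [monOrd_mul w (hF.ne_zero i) hsingle, monOrd_single _ _ one_ne_zero, neg_dotProduct, hiw,
        haw, add_neg_cancel]
    · rw [monOrd_mul w' (hF.ne_zero i) hsingle, monOrd_single _ _ one_ne_zero, neg_dotProduct, hiw',
        haw', add_neg_cancel]
  have hchart : ∀ b ∈ coordinateChart F i, ∃ p g : TorusRing k n,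
      (∀ u ∈ p.coeff.support, u ∈ Q) ∧ (∀ u ∈ g.coeff.support, u ∈ Q) ∧ g ≠ 0 ∧
      monOrd w g = 0 ∧ monOrd w' g = 0 ∧ b = toField p / toField g := by
    have hmulQ : ∀ p q : TorusRing k n, (∀ u ∈ p.coeff.support, u ∈ Q) →
        (∀ u ∈ q.coeff.support, u ∈ Q) → ∀ u ∈ (p * q).coeff.support, u ∈ Q := by
      intro p q hp hq u hu
      obtain ⟨s, hs, t, ht, rfl⟩ := supp_mul hu
      exact add_mem (hp s hs) (hq t ht)
    have hconstQ : ∀ c : k, ∀ u ∈ (AddMonoidAlgebra.single (0 : Fin n → ℤ) c).coeff.support,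
        u ∈ Q := by
      intro c u hu
      rw [AddMonoidAlgebra.coeff_single] at hu
      have := Finsupp.support_single_subset hu
      rw [Finset.mem_singleton] at this
      rw [this]; exact zero_mem _
    intro b hb
    induction hb using Algebra.adjoin_induction with
    | mem b hb =>
      obtain ⟨j, rfl⟩ := hb
      refine ⟨y j, y i, hyQ j, hyQ i, mul_ne_zero (hF.ne_zero i) hsingle, hyi.1, hyi.2, ?_⟩
      simp only [y, toField, map_mul]
      exact (mul_div_mul_right _ _ (toField_ne_zero hsingle)).symm
    | algebraMap c =>
      refine ⟨AddMonoidAlgebra.single 0 c, AddMonoidAlgebra.single 0 1, hconstQ c, hconstQ 1,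
        by simp, by rw [monOrd_single _ _ one_ne_zero, zero_dotProduct],
        by rw [monOrd_single _ _ one_ne_zero, zero_dotProduct], ?_⟩
      rw [toField_single, toField_single]; simp
    | add b b' _ _ hb hb' =>
      obtain ⟨p, g, h1, h2, h3, h4, h5, rfl⟩ := hb
      obtain ⟨p', g', h1', h2', h3', h4', h5', rfl⟩ := hb'
      refine ⟨p * g' + g * p', g * g', fun u hu => ?_, hmulQ _ _ h2 h2', mul_ne_zero h3 h3',
        by rw [monOrd_mul w h3 h3', h4, h4', add_zero],
        by rw [monOrd_mul w' h3 h3', h5, h5', add_zero], ?_⟩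
      · have : u ∈ (p * g').coeff.support ∪ (g * p').coeff.support := Finsupp.support_add hu
        rcases Finset.mem_union.1 this with hu | hu
        · exact hmulQ _ _ h1 h2' u hu
        · exact hmulQ _ _ h2 h1' u hu
      · have e1 := toField_ne_zero h3
        have e2 := toField_ne_zero h3'
        simp only [toField, map_mul, map_add] at e1 e2 ⊢
        exact div_add_div _ _ e1 e2
    | mul b b' _ _ hb hb' =>
      obtain ⟨p, g, h1, h2, h3, h4, h5, rfl⟩ := hb
      obtain ⟨p', g', h1', h2', h3', h4', h5', rfl⟩ := hb'
      refine ⟨p * p', g * g', hmulQ _ _ h1 h1', hmulQ _ _ h2 h2', mul_ne_zero h3 h3',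
        by rw [monOrd_mul w h3 h3', h4, h4', add_zero],
        by rw [monOrd_mul w' h3 h3', h5, h5', add_zero], ?_⟩
      simp only [toField, map_mul]
      exact div_mul_div_comm _ _ _ _
  -- Elements of the chart have order at least `0` at `w'`, and order `0` at `w'` whenever they have
  -- order `0` at `w`. So fractions whose denominator is a unit at the orbit point are integral for
  -- `w'`.
  have hcmp : ∀ b ∈ coordinateChart F i, b ≠ 0 →
      0 ≤ monVal w' b ∧ (monVal w b = 0 → monVal w' b = 0) := by
    intro b hb hb0
    obtain ⟨p, g, h1, h2, h3, h4, h5, rfl⟩ := hchart b hb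
    have hp0 : p ≠ 0 := by rintro rfl; simp [toField] at hb0
    rw [monVal_div w hp0 h3, monVal_div w' hp0 h3, h4, h5, sub_zero, sub_zero]
    obtain ⟨u, hu, e⟩ := monOrd_exists w hp0
    obtain ⟨u', hu', e'⟩ := monOrd_exists w' hp0
    refine ⟨e' ▸ (h1 u' hu').2.1, fun h0 => le_antisymm ?_ (e' ▸ (h1 u' hu').2.1)⟩
    rw [← (h1 u hu).2.2.1 (e.trans h0)]
    exact monOrd_le w' hu
  intro f hf hne
  obtain ⟨b, hb, c, hc, hc0, hcx, rfl⟩ := hi.frac f hf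
  have hb0 : b ≠ 0 := by rintro rfl; simp at hne
  have hcw : monVal w c = 0 := by
    have hle := (hx.le_monRing_iff (Φ.isRational hσ)).2 hw.1
    exact monVal_eq_zero_of_unit hc0 (hle (hi.le hc)) (hle hcx)
  rw [div_eq_mul_inv, monVal_mul w' hb0 (inv_ne_zero hc0), monVal_inv w' hc0,
    (hcmp c hc hc0).2 hcw]
  linarith [(hcmp b hb hb0).1]

/-- The support function of a projective embedding is strictly convex. -/
lemma exists_strictly_supporting (hF : IsCoordinates Φ F) {σ} (hσ : σ ∈ Φ.cones) :
    ∃ b : Fin n → ℝ, ∀ v, b ⬝ᵥ latticeVec v ≤ -(minOrd F v : ℝ) ∧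
      (b ⬝ᵥ latticeVec v = -(minOrd F v : ℝ) ↔ latticeVec v ∈ σ) := by
  classical
  obtain ⟨w, hw⟩ := (Φ.isRational hσ).exists_relint
  obtain ⟨i, -, l, hl⟩ := hF.exists_linear_minOrd hσ
  -- The exponents minimal at an interior point of `σ`; they are then minimal on all of `σ`.
  let A := (exponents F).filter fun s => s ⬝ᵥ w = minOrd F w
  have hA : A.Nonempty := by
    obtain ⟨j, hj⟩ := exists_minOrd F w
    obtain ⟨s, hs, e⟩ := monOrd_exists w (hF.ne_zero j)
    exact ⟨s, Finset.mem_filter.2 ⟨mem_exponents.2 ⟨j, hs⟩, e.trans hj.symm⟩⟩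
  have hA0 : (0 : ℝ) < A.card := by exact_mod_cast hA.card_pos
  have hlin : ∀ s ∈ A, ∀ v, latticeVec v ∈ σ → s ⬝ᵥ v = minOrd F v := by
    intro s hs v hv
    obtain ⟨hsS, hsw⟩ := Finset.mem_filter.1 hs
    have hd : s - l ∈ dualSemigroup σ := (Φ.mem_dualSemigroup_iff hσ).2 fun i hi => by
      rw [sub_dotProduct, ← hl i.1 hi]
      linarith [minOrd_le_dotProduct hsS i.1]
    have h0 : pairing (s - l) (latticeVec w) = 0 := by
      rw [pairing_latticeVec, sub_dotProduct, hsw, ← hl w hw.1, sub_self, Int.cast_zero]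
    have h1 := hw.2 _ hd h0 _ hv
    rw [pairing_latticeVec, Int.cast_eq_zero, sub_dotProduct] at h1
    rw [hl v hv]; linarith
  -- Under this assumption `w` and `w + N • v` have the same minimal exponents, so `w + N • v` lies
  -- in `σ` for every `N`. A supporting functional negative on `v` would be violated for large `N`.
  have hconv : ∀ v, (∀ s ∈ A, s ⬝ᵥ v = minOrd F v) → latticeVec v ∈ σ := by
    intro v hv
    have key : ∀ N : ℕ, latticeVec (w + N • v) ∈ σ := by
      intro N
      refine hF.mem_of_forall_exponents_iff hσ hw fun s hs => ?_
      obtain ⟨a, ha⟩ := hA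
      have hsum : ∀ s : Fin n → ℤ, s ⬝ᵥ (w + N • v) = s ⬝ᵥ w + N * (s ⬝ᵥ v) := fun s => by
        rw [dotProduct_add, dotProduct_smul, nsmul_eq_mul]
      have hge : ∀ s ∈ exponents F, minOrd F w + N * minOrd F v ≤ s ⬝ᵥ (w + N • v) :=
        fun s hs => by
          rw [hsum]
          exact add_le_add (minOrd_le_dotProduct hs w)
            (mul_le_mul_of_nonneg_left (minOrd_le_dotProduct hs v) (Int.natCast_nonneg N))
      have hmin : minOrd F (w + N • v) = minOrd F w + N * minOrd F v := by
        refine le_antisymm ?_ ?_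
        · refine (minOrd_le_dotProduct (Finset.mem_filter.1 ha).1 _).trans_eq ?_
          rw [hsum, (Finset.mem_filter.1 ha).2, hv a ha]
        · obtain ⟨j, hj⟩ := exists_minOrd F (w + N • v)
          obtain ⟨s, hs, e⟩ := monOrd_exists (w + N • v) (hF.ne_zero j)
          rw [hj, ← e]
          exact hge s (mem_exponents.2 ⟨j, hs⟩)
      constructor
      · intro h
        rw [hmin, hsum, h, hv s (Finset.mem_filter.2 ⟨hs, h⟩)]
      · intro h
        rw [hmin, hsum] at h
        have h1 := minOrd_le_dotProduct hs w
        have h2 := mul_le_mul_of_nonneg_left (minOrd_le_dotProduct hs v) (Int.natCast_nonneg N)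
        linarith
    refine (Φ.isRational hσ).mem_iff.2 fun u hu => ?_
    rw [pairing_latticeVec]
    by_contra! hneg
    have hneg' : u ⬝ᵥ v < 0 := by exact_mod_cast hneg
    have h1 := hu _ (key ((u ⬝ᵥ w).toNat + 1))
    rw [pairing_latticeVec, dotProduct_add, dotProduct_smul, nsmul_eq_mul] at h1
    have h2 : 0 ≤ u ⬝ᵥ w + (((u ⬝ᵥ w).toNat + 1 : ℕ) : ℤ) * (u ⬝ᵥ v) := by exact_mod_cast h1
    push_cast at h2
    have h3 := Int.self_le_toNat (u ⬝ᵥ w)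
    nlinarith
  -- The average of the functionals `-s`: it attains `-minOrd` only where every `s ∈ A` is minimal,
  -- which by `hconv` means on `σ`.
  refine ⟨(A.card : ℝ)⁻¹ • ∑ s ∈ A, fun j => -(s j : ℝ), fun v => ?_⟩
  have e : ((A.card : ℝ)⁻¹ • ∑ s ∈ A, fun j => -(s j : ℝ)) ⬝ᵥ latticeVec v =
      (A.card : ℝ)⁻¹ * ∑ s ∈ A, -((s ⬝ᵥ v : ℤ) : ℝ) := by
    rw [smul_dotProduct, sum_dotProduct, smul_eq_mul]
    congr 1
    refine Finset.sum_congr rfl fun s _ => ?_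
    simp [dotProduct, latticeVec]
  have hterm : ∀ s ∈ A, -((s ⬝ᵥ v : ℤ) : ℝ) ≤ -(minOrd F v : ℝ) := fun s hs =>
    neg_le_neg (by exact_mod_cast minOrd_le_dotProduct (Finset.mem_filter.1 hs).1 v)
  have hconst : ∑ s ∈ A, -(minOrd F v : ℝ) = A.card * -(minOrd F v : ℝ) := by
    rw [Finset.sum_const, nsmul_eq_mul]
  rw [e, inv_mul_le_iff₀ hA0, inv_mul_eq_iff_eq_mul₀ hA0.ne', ← hconst]
  refine ⟨Finset.sum_le_sum hterm, fun h => hconv v fun s hs => ?_, fun hv => ?_⟩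
  · have h1 := (Finset.sum_eq_sum_iff_of_le hterm).1 h s hs
    exact_mod_cast neg_injective h1
  · exact Finset.sum_congr rfl fun s hs => by rw [hlin s hs v hv]

end IsCoordinates

end Projective

end

noncomputable section

open scoped BigOperators

section NormalFan

variable {k : Type*} [Field k] {n : ℕ}

/-! ### Normal fans -/

/-- The cone of all `w` such that all elements of `A` are maximal on `S` in the direction `w`. -/
def normalCone (S A : Finset (Fin n → ℤ)) : PointedCone ℝ (Fin n → ℝ) where
  carrier := {w | ∀ a ∈ A, ∀ s ∈ S, 0 ≤ pairing (a - s) w}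
  zero_mem' a _ s _ := by rw [pairing_zero_right]
  add_mem' hv hw a ha s hs := by
    rw [pairing_add_right]; exact add_nonneg (hv a ha s hs) (hw a ha s hs)
  smul_mem' c w hw a ha s hs := by
    change 0 ≤ pairing (a - s) ((c : ℝ) • w)
    rw [pairing_smul_right]; exact mul_nonneg c.2 (hw a ha s hs)

lemma exists_nsmul_eq_of_mem_dualSemigroup_normalCone {S A : Finset (Fin n → ℤ)}
    {u : Fin n → ℤ} (hu : u ∈ dualSemigroup (normalCone S A)) :
    ∃ (q : ℕ) (c : A × S → ℕ), 0 < q ∧ q • u = ∑ j, c j • (j.1.1 - j.2.1) :=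
  farkas_int (fun j : A × S => j.1.1 - j.2.1) u fun w hw => hu w fun a ha s hs =>
    hw (⟨a, ha⟩, ⟨s, hs⟩)

open Classical in
/-- The normal fan of the convex hull of `S`. -/
def normalFan (S : Finset (Fin n → ℤ)) (hS : S.Nonempty)
    (hrat : ∀ A ⊆ S, A.Nonempty → IsRational (normalCone S A))
    (hlin : ∀ w, (∀ s ∈ S, ∀ t ∈ S, pairing (s - t) w = 0) → w = 0) : Fan n where
  cones := {σ | ∃ A ⊆ S, A.Nonempty ∧ σ = normalCone S A}
  finite := by
    refine (S.powerset.finite_toSet.image (normalCone S)).subset ?_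
    rintro _ ⟨A, hA, -, rfl⟩
    exact ⟨A, Finset.mem_coe.2 (Finset.mem_powerset.2 hA), rfl⟩
  nonempty := ⟨_, S, subset_rfl, hS, rfl⟩
  rational := by
    rintro _ ⟨A, hA, hne, rfl⟩
    exact hrat A hA hne
  strongly_convex := by
    rintro _ ⟨A, hA, ⟨a, ha⟩, rfl⟩ v hv hv'
    have h0 : ∀ s ∈ S, pairing (a - s) v = 0 := fun s hs => by
      have h1 := hv a ha s hs
      have h2 := hv' a ha s hs
      rw [pairing_neg_right] at h2
      linarith
    refine hlin v fun s hs t ht => ?_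
    have h1 := h0 s hs
    have h2 := h0 t ht
    rw [pairing_sub_left] at h1 h2 ⊢
    linarith
  face_mem := by
    rintro _ ⟨A, hA, ⟨a₀, ha₀⟩, rfl⟩ τ ⟨u, hu, hτ⟩
    obtain ⟨q, c, hq, e⟩ := exists_nsmul_eq_of_mem_dualSemigroup_normalCone hu
    -- A positive multiple of `u` is a combination of differences `a - s`. It vanishes at a point of
    -- the cone exactly when every `s` that occurs is maximal there too, so these `s` are added to
    -- `A`.
    let A' := A ∪ S.filter fun s => ∃ j : A × S, j.2.1 = s ∧ c j ≠ 0
    refine ⟨A', Finset.union_subset hA (Finset.filter_subset _ _),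
      ⟨a₀, Finset.mem_union_left _ ha₀⟩, ?_⟩
    have he : ∀ v, (q : ℝ) * pairing u v =
        ∑ j, (c j : ℝ) * pairing (j.1.1 - j.2.1) v := fun v => by
      rw [← pairing_nsmul_left, e, pairing_sum_left]
      simp only [pairing_nsmul_left]
    have hq' : (0 : ℝ) < q := by exact_mod_cast hq
    ext v
    rw [hτ]
    constructor
    · rintro ⟨hv, h0⟩
      have h1 := he v
      rw [h0, mul_zero, eq_comm, Finset.sum_eq_zero_iff_of_nonneg fun j _ =>
        mul_nonneg (Nat.cast_nonneg _) (hv _ j.1.2 _ j.2.2)] at h1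
      intro s hs t ht
      rcases Finset.mem_union.1 hs with hs | hs
      · exact hv s hs t ht
      · obtain ⟨-, j, rfl, hj⟩ := Finset.mem_filter.1 hs
        have h2 := (mul_eq_zero.1 (h1 j (Finset.mem_univ j))).resolve_left (by exact_mod_cast hj)
        have h3 := hv _ j.1.2 t ht
        rw [pairing_sub_left] at h2 h3 ⊢
        linarith
    · intro hv
      refine ⟨fun a ha s hs => hv a (Finset.mem_union_left _ ha) s hs, ?_⟩
      have h1 := he v
      rw [Finset.sum_eq_zero] at h1
      · exact (mul_eq_zero.1 h1).resolve_left hq'.ne'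
      intro j _
      by_cases hj : c j = 0
      · rw [hj]; simp
      have h2 := hv _ (Finset.mem_union_left _ j.1.2) _ j.2.2
      have h3 := hv j.2.1 (Finset.mem_union_right _ (Finset.mem_filter.2 ⟨j.2.2, j, rfl, hj⟩))
        j.1.1 (hA j.1.2)
      rw [pairing_sub_left] at h2 h3 ⊢
      rw [show pairing j.1.1 v - pairing j.2.1 v = 0 by linarith, mul_zero]
  inter_face := by
    rintro _ ⟨A, hA, ⟨a, ha⟩, rfl⟩ _ ⟨B, hB, -, rfl⟩
    have hp : ∀ v, pairing (∑ b ∈ B, (a - b)) v = ∑ b ∈ B, pairing (a - b) v := fun v =>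
      pairing_sum_left _ _ _
    -- Each `a - b` is nonnegative on the cone of `A`, and the sum vanishes exactly where all
    -- elements of `B` are maximal as well.
    refine ⟨∑ b ∈ B, (a - b), fun v hv => ?_, fun v => ?_⟩
    · rw [hp]
      exact Finset.sum_nonneg fun b hb => hv a ha b (hB hb)
    · rw [Submodule.mem_inf, hp]
      refine and_congr_right fun hv => ?_
      rw [Finset.sum_eq_zero_iff_of_nonneg fun b hb => hv a ha b (hB hb)]
      constructor
      · intro hv' b hb
        have h1 := hv a ha b (hB hb)
        have h2 := hv' b hb a (hA ha)
        rw [pairing_sub_left] at h1 h2 ⊢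
        linarith
      · intro h b hb s hs
        have h1 := h b hb
        have h2 := hv a ha s hs
        rw [pairing_sub_left] at h1 h2 ⊢
        linarith

/-! ### Projectivity of normal fans -/

/-- The coordinate ring of the chart where the monomial coordinate `χ^{-t}` does not vanish. -/
def monomialChart (k : Type*) [Field k] (T : Finset (Fin n → ℤ)) (t : Fin n → ℤ) :
    Subalgebra k (ToricField k n) :=
  Algebra.adjoin k {f | ∃ s ∈ T, f = chi k (t - s)}

lemma isProjective_of_monomialChart {X : Model k (ToricField k n)} {T : Finset (Fin n → ℤ)}
    (hT : T.Nonempty) (h : ∀ x, x ∈ X.points ↔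
      ∃ t ∈ T, IsLocalizationOf (monomialChart k T t).toSubring x.toSubring) :
    X.IsProjective := by
  obtain ⟨m, hm⟩ : ∃ m, T.card = m + 1 := ⟨T.card - 1, by have := hT.card_pos; omega⟩
  let e : Fin (m + 1) ≃ T := (T.equivFinOfCardEq hm).symm
  refine ⟨m, fun i => chi k (-(e i).1), fun i => chi_ne_zero _, ?_⟩
  have hchart : ∀ i, Algebra.adjoin k (Set.range fun j => chi k (-(e j).1) / chi k (-(e i).1)) =
      monomialChart k T (e i).1 := fun i => by
    refine congrArg _ (Set.ext fun f => ⟨?_, ?_⟩)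
    · rintro ⟨j, rfl⟩
      refine ⟨(e j).1, (e j).2, ?_⟩
      dsimp only
      rw [← chi_sub]; congr 1; abel
    · rintro ⟨s, hs, rfl⟩
      refine ⟨e.symm ⟨s, hs⟩, ?_⟩
      dsimp only
      rw [← chi_sub, Equiv.apply_symm_apply]; congr 1; abel
  ext x
  rw [h, Model.mem_ofCharts_iff, Set.exists_range_iff]
  simp only [hchart]
  constructor
  · rintro ⟨t, ht, hx⟩
    exact ⟨e.symm ⟨t, ht⟩, by rwa [Equiv.apply_symm_apply]⟩
  · rintro ⟨i, hx⟩
    exact ⟨_, (e i).2, hx⟩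

/-- The chart of a face is the locus in `U_σ` where `χ^u` does not vanish: multiplying numerator and
denominator by a power of `χ^u` brings both into the coordinate ring of `σ`. -/
lemma IsRational.isLocalizationOf_of_faceCone {σ : PointedCone ℝ (Fin n → ℝ)} (hσ : IsRational σ)
    {u : Fin n → ℤ} (hu : u ∈ dualSemigroup σ) {x : Subring (ToricField k n)}
    (hx : IsLocalizationOf (coneAlgebra k (_root_.faceCone σ u)).toSubring x) :
    IsLocalizationOf (coneAlgebra k σ).toSubring x := by
  have hle : coneAlgebra k σ ≤ coneAlgebra k (_root_.faceCone σ u) := coneAlgebra_mono inf_le_left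
  refine ⟨le_trans hle hx.le, fun f hf => ?_⟩
  obtain ⟨a, ha, b, hb, hb0, hbx, rfl⟩ := hx.frac f hf
  have hshift : ∀ a ∈ coneAlgebra k (_root_.faceCone σ u), ∃ m : ℕ, ∀ l ≥ m,
      chi k (l • u) * a ∈ coneAlgebra k σ := by
    intro a ha
    obtain ⟨p, hp, rfl⟩ := mem_coneAlgebra.1 ha
    have hex : ∀ v : Fin n → ℤ, ∃ m : ℕ, v ∈ dualSemigroup (_root_.faceCone σ u) →
        ∀ l ≥ m, v + l • u ∈ dualSemigroup σ := by
      intro v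
      by_cases hv : v ∈ dualSemigroup (_root_.faceCone σ u)
      · obtain ⟨m, hm⟩ := hσ.exists_add_nsmul_mem hu hv
        refine ⟨m, fun _ l hl => ?_⟩
        have : v + l • u = v + m • u + (l - m) • u := by
          rw [add_assoc, ← add_nsmul, Nat.add_sub_cancel' hl]
        rw [this]
        exact add_mem hm (AddSubmonoid.nsmul_mem _ hu _)
      · exact ⟨0, fun h => absurd h hv⟩
    choose m hm using hex
    refine ⟨p.coeff.support.sup m, fun l hl => ?_⟩
    rw [toField_eq_sum, Finset.mul_sum]
    refine sum_mem fun v hv => ?_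
    rw [mul_left_comm, ← chi_add, add_comm]
    exact mul_mem (Subalgebra.algebraMap_mem _ _)
      (chi_mem_coneAlgebra.2 (hm v (hp v hv) l ((Finset.le_sup hv).trans hl)))
  obtain ⟨m, hm⟩ := hshift a ha
  obtain ⟨m', hm'⟩ := hshift b hb
  refine ⟨_, hm (max m m') (le_max_left _ _), _, hm' (max m m') (le_max_right _ _),
    mul_ne_zero (chi_ne_zero _) hb0, ?_, (mul_div_mul_left _ _ (chi_ne_zero _)).symm⟩
  rw [mul_inv, ← chi_neg]
  refine mul_mem (hx.le (chi_mem_coneAlgebra.2 fun v hv => ?_)) hbx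
  have hv0 : pairing u v = 0 := hv.2
  rw [pairing_neg_left, pairing_nsmul_left, hv0]
  simp

/-- Let `P` be the convex hull of `S`. The coordinates are characters at lattice points `T` of a
dilate `N P`: all `N a`, and `N a - g` for generators `g` of the dual semigroup at `a`. The chart at
`N a` is exactly the affine toric variety of the cone of `a`, and every other chart lies inside one
of these. -/
lemma normalFan_isProjective {S : Finset (Fin n → ℤ)} (hS : S.Nonempty)
    (hrat : ∀ A ⊆ S, A.Nonempty → IsRational (normalCone S A))
    (hlin : ∀ w, (∀ s ∈ S, ∀ t ∈ S, pairing (s - t) w = 0) → w = 0) :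
    (toricVariety k (normalFan S hS hrat hlin)).IsProjective := by
  classical
  have hG : ∀ a : S, ∃ G : Finset (Fin n → ℤ),
      AddSubmonoid.closure (G : Set (Fin n → ℤ)) = dualSemigroup (normalCone S {a.1}) :=
    fun a => (hrat {a.1} (Finset.singleton_subset_iff.2 a.2)
      (Finset.singleton_nonempty _)).dualSemigroup_fg
  choose G hG using hG
  have hex : ∀ (a : S) (g : Fin n → ℤ), ∃ N : ℕ, g ∈ dualSemigroup (normalCone S {a.1}) →
      ∃ (q : ℕ) (c : S → ℕ), 0 < q ∧ q • g = ∑ b, c b • (a.1 - b.1) ∧ ∑ b, c b ≤ N := by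
    intro a g
    by_cases hg : g ∈ dualSemigroup (normalCone S {a.1})
    · obtain ⟨q, c, hq, e⟩ := farkas_int (fun b : S => a.1 - b.1) g fun w hw => hg w
        fun a' ha' s hs => by
          rw [Finset.mem_singleton.1 ha']; exact hw ⟨s, hs⟩
      exact ⟨_, fun _ => ⟨q, c, hq, e, le_rfl⟩⟩
    · exact ⟨0, fun h => absurd h hg⟩
  choose N₀ hN₀ using hex
  -- A dilation factor large enough that every `N a - g` stays in the dilated polytope.
  let N : ℕ := ∑ a, ∑ g ∈ G a, N₀ a g
  have hN : ∀ a, ∀ g ∈ G a, N₀ a g ≤ N := fun a g hg =>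
    (Finset.single_le_sum (f := fun g => N₀ a g) (fun _ _ => Nat.zero_le _) hg).trans
      (Finset.single_le_sum (f := fun a => ∑ g ∈ G a, N₀ a g) (fun _ _ => Nat.zero_le _)
        (Finset.mem_univ a))
  let T : Finset (Fin n → ℤ) := Finset.univ.biUnion fun a : S =>
    insert (N • a.1) ((G a).image fun g => N • a.1 - g)
  have hNT : ∀ a : S, N • a.1 ∈ T := fun a =>
    Finset.mem_biUnion.2 ⟨a, Finset.mem_univ a, Finset.mem_insert_self _ _⟩
  have hGT : ∀ a : S, ∀ g ∈ G a, N • a.1 - g ∈ T := fun a g hg =>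
    Finset.mem_biUnion.2 ⟨a, Finset.mem_univ a, Finset.mem_insert_of_mem
      (Finset.mem_image_of_mem _ hg)⟩
  -- Membership of `t` in `N P` with denominators cleared: `c / q` has total weight `N`.
  have hT : ∀ t ∈ T, ∃ (q : ℕ) (c : S → ℕ), 0 < q ∧ q • t = ∑ b, c b • b.1 ∧
      ∑ b, c b = q * N := by
    intro t ht
    obtain ⟨a, -, ht⟩ := Finset.mem_biUnion.1 ht
    rcases Finset.mem_insert.1 ht with rfl | ht
    · refine ⟨1, Pi.single a N, one_pos, ?_, by simp⟩
      rw [one_smul, Finset.sum_eq_single a]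
      · rw [Pi.single_eq_same]
      · intro b _ hb; rw [Pi.single_eq_of_ne hb, zero_smul]
      · simp
    · obtain ⟨g, hg, rfl⟩ := Finset.mem_image.1 ht
      have hgd : g ∈ dualSemigroup (normalCone S {a.1}) := by
        rw [← hG a]; exact AddSubmonoid.subset_closure hg
      obtain ⟨q, c, hq, e, hc⟩ := hN₀ a g hgd
      have hle : ∑ b, c b ≤ q * N :=
        (hc.trans (hN a g hg)).trans (Nat.le_mul_of_pos_left N hq)
      refine ⟨q, c + Pi.single a (q * N - ∑ b, c b), hq, ?_, ?_⟩
      · have h1 : ∑ b, (c + Pi.single a (q * N - ∑ b, c b) : S → ℕ) b • b.1 =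
            ∑ b, c b • b.1 + (q * N - ∑ b, c b) • a.1 := by
          simp only [Pi.add_apply, add_smul, Finset.sum_add_distrib]
          congr 1
          rw [Finset.sum_eq_single a]
          · rw [Pi.single_eq_same]
          · intro b _ hb; rw [Pi.single_eq_of_ne hb, zero_smul]
          · simp
        have h2 : ∑ b, c b • (a.1 - b.1) = (∑ b, c b) • a.1 - ∑ b, c b • b.1 := by
          simp only [smul_sub, Finset.sum_sub_distrib, Finset.sum_smul]
        have h3 : (q * N - ∑ b, c b) • a.1 = (q * N) • a.1 - (∑ b, c b) • a.1 := by
          rw [eq_sub_iff_add_eq, ← add_nsmul, Nat.sub_add_cancel hle]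
        rw [h1, h3, smul_sub, e, h2, smul_smul]
        abel
      · simp only [Pi.add_apply, Finset.sum_add_distrib, Finset.sum_pi_single', Finset.mem_univ,
          if_true]
        omega
  have hchart : ∀ a : S, monomialChart k T (N • a.1) = coneAlgebra k (normalCone S {a.1}) := by
    intro a
    apply le_antisymm
    · refine Algebra.adjoin_le ?_
      rintro _ ⟨t, ht, rfl⟩
      refine chi_mem_coneAlgebra.2 fun w hw => ?_
      obtain ⟨q, c, hq, e, hc⟩ := hT t ht
      have hq' : (0 : ℝ) < q := by exact_mod_cast hq
      have h1 : q • (N • a.1 - t) = ∑ b, c b • (a.1 - b.1) := by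
        simp only [smul_sub, Finset.sum_sub_distrib, ← Finset.sum_smul]
        rw [e, hc, smul_smul]
      have h2 : (q : ℝ) * pairing (N • a.1 - t) w = ∑ b, (c b : ℝ) * pairing (a.1 - b.1) w := by
        rw [← pairing_nsmul_left, h1, pairing_sum_left]
        simp only [pairing_nsmul_left]
      refine nonneg_of_mul_nonneg_right ?_ hq'
      rw [h2]
      exact Finset.sum_nonneg fun b _ => mul_nonneg (Nat.cast_nonneg _)
        (hw _ (Finset.mem_singleton_self _) _ b.2)
    · refine Algebra.adjoin_le ?_
      rintro _ ⟨u, hu, rfl⟩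
      have hu' : u ∈ AddSubmonoid.closure (G a : Set (Fin n → ℤ)) := by rw [hG a]; exact hu
      clear hu
      induction hu' using AddSubmonoid.closure_induction with
      | mem g hg => exact Algebra.subset_adjoin ⟨_, hGT a g hg, by rw [sub_sub_cancel]⟩
      | zero => rw [chi_zero]; exact one_mem _
      | add u v _ _ hu hv => rw [chi_add]; exact mul_mem hu hv
  obtain ⟨s₀, hs₀⟩ := hS
  refine isProjective_of_monomialChart ⟨_, hNT ⟨s₀, hs₀⟩⟩ fun x => ?_
  rw [mem_toricVariety_iff]
  constructor
  · rintro ⟨_, ⟨A, hA, ⟨a, ha⟩, rfl⟩, hx⟩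
    refine ⟨_, hNT ⟨a, hA ha⟩, ?_⟩
    rw [hchart]
    have hpair : ∀ w, pairing (∑ b ∈ A, (a - b)) w = ∑ b ∈ A, pairing (a - b) w :=
      fun w => pairing_sum_left _ _ _
    have hu : ∑ b ∈ A, (a - b) ∈ dualSemigroup (normalCone S {a}) := fun w hw => by
      rw [hpair]
      exact Finset.sum_nonneg fun b hb => hw a (Finset.mem_singleton_self a) b (hA hb)
    have hface : normalCone S A = faceCone (normalCone S {a}) (∑ b ∈ A, (a - b)) := by
      ext w
      rw [mem_faceCone, hpair]
      constructor
      · intro hw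
        refine ⟨fun a' ha' s hs => by rw [Finset.mem_singleton.1 ha']; exact hw a ha s hs, ?_⟩
        refine Finset.sum_eq_zero fun b hb => ?_
        have h1 := hw a ha b (hA hb)
        have h2 := hw b hb a (hA ha)
        rw [pairing_sub_left] at h1 h2 ⊢
        linarith
      · rintro ⟨hw, h0⟩ b hb s hs
        have h1 := (Finset.sum_eq_zero_iff_of_nonneg fun b hb =>
          hw a (Finset.mem_singleton_self a) b (hA hb)).1 h0 b hb
        have h2 := hw a (Finset.mem_singleton_self a) s hs
        rw [pairing_sub_left] at h1 h2 ⊢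
        linarith
    rw [hface] at hx
    exact (hrat {a} (Finset.singleton_subset_iff.2 (hA ha))
      (Finset.singleton_nonempty _)).isLocalizationOf_of_faceCone hu hx
  · rintro ⟨t, ht, hx⟩
    obtain ⟨q, c, hq, e, hc⟩ := hT t ht
    have hmem : ∀ s ∈ T, chi k (t - s) ∈ x.toSubring := fun s hs =>
      hx.le (Algebra.subset_adjoin ⟨s, hs, rfl⟩)
    -- From `∑ c b • (t - N • b) = 0` with `c a ≠ 0`, the vector `N • a - t` is a natural
    -- combination of the `t - N • b`. So `χ^(N a - t)` is invertible on the chart at `t`, which is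
    -- thus contained in the chart at `N a`. If `N = 0`, then `t = 0` and nothing is needed.
    have hunit : ∃ a : S, chi k (N • a.1 - t) ∈ monomialChart k T t := by
      by_cases hN0 : N = 0
      · refine ⟨⟨s₀, hs₀⟩, ?_⟩
        have hc0 : ∀ b, c b = 0 := fun b => by
          rw [hN0, mul_zero] at hc
          exact Finset.sum_eq_zero_iff.1 hc b (Finset.mem_univ b)
        have ht0 : t = 0 := by
          have h1 : q • t = 0 := by rw [e]; exact Finset.sum_eq_zero fun b _ => by rw [hc0, zero_smul]
          exact (smul_eq_zero.1 h1).resolve_left hq.ne'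
        rw [hN0, ht0, zero_smul, sub_zero, chi_zero]
        exact one_mem _
      obtain ⟨a, ha⟩ : ∃ a, c a ≠ 0 := by
        by_contra! hcon
        rw [Finset.sum_eq_zero fun b _ => hcon b] at hc
        exact (Nat.mul_ne_zero hq.ne' hN0) hc.symm
      refine ⟨a, ?_⟩
      have h1 : ∑ b, c b • (t - N • b.1) = 0 := by
        simp only [smul_sub, Finset.sum_sub_distrib, ← Finset.sum_smul, smul_comm _ N]
        rw [← Finset.smul_sum, ← e, hc, smul_smul, mul_comm, sub_self]
      rw [← Finset.add_sum_erase _ _ (Finset.mem_univ a)] at h1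
      obtain ⟨c', hc'⟩ := Nat.exists_eq_succ_of_ne_zero ha
      have h2 : N • a.1 - t = c' • (t - N • a.1) +
          ∑ b ∈ Finset.univ.erase a, c b • (t - N • b.1) := by
        rw [hc', Nat.succ_eq_add_one, add_nsmul, one_smul, add_right_comm] at h1
        rw [eq_neg_of_add_eq_zero_left h1]; abel
      have hmon : ∀ b : S, ∀ m : ℕ, chi k (m • (t - N • b.1)) ∈ monomialChart k T t :=
        fun b m => by
          have h3 : chi k (t - N • b.1) ∈ monomialChart k T t :=
            Algebra.subset_adjoin ⟨_, hNT b, rfl⟩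
          rw [chi_nsmul]; exact pow_mem h3 m
      have hsum : ∀ s : Finset S, chi k (∑ b ∈ s, c b • (t - N • b.1)) ∈ monomialChart k T t := by
        intro s
        induction s using Finset.induction_on with
        | empty => rw [Finset.sum_empty, chi_zero]; exact one_mem _
        | insert b s hb ih => rw [Finset.sum_insert hb, chi_add]; exact mul_mem (hmon b _) ih
      rw [h2, chi_add]
      exact mul_mem (hmon a _) (hsum _)
    obtain ⟨a, ha⟩ := hunit
    refine ⟨_, ⟨{a.1}, Finset.singleton_subset_iff.2 a.2, Finset.singleton_nonempty _, rfl⟩, ?_⟩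
    rw [← hchart a]
    have hgen : ∀ s ∈ T, chi k (t - s) ∈ monomialChart k T t := fun s hs =>
      Algebra.subset_adjoin ⟨s, hs, rfl⟩
    have hle : monomialChart k T (N • a.1) ≤ monomialChart k T t := Algebra.adjoin_le (by
      rintro _ ⟨s, hs, rfl⟩
      rw [show N • a.1 - s = (N • a.1 - t) + (t - s) by abel, chi_add]
      exact mul_mem ha (hgen s hs))
    refine ⟨le_trans hle hx.le, fun f hf => ?_⟩
    have hshift : ∀ p ∈ monomialChart k T t, ∃ m : ℕ, ∀ l ≥ m,
        chi k (N • a.1 - t) ^ l * p ∈ monomialChart k T (N • a.1) := by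
      have hv : chi k (N • a.1 - t) ∈ monomialChart k T (N • a.1) :=
        Algebra.subset_adjoin ⟨t, ht, rfl⟩
      intro p hp
      induction hp using Algebra.adjoin_induction with
      | mem p hp =>
        obtain ⟨s, hs, rfl⟩ := hp
        refine ⟨1, fun l hl => ?_⟩
        obtain ⟨l, rfl⟩ := Nat.exists_eq_add_of_le' hl
        rw [pow_succ, mul_assoc, ← chi_add, sub_add_sub_cancel]
        exact mul_mem (pow_mem hv l) (Algebra.subset_adjoin ⟨s, hs, rfl⟩)
      | algebraMap r => exact ⟨0, fun l _ => mul_mem (pow_mem hv l)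
          (Subalgebra.algebraMap_mem _ r)⟩
      | add p p' _ _ hp hp' =>
        obtain ⟨m, hm⟩ := hp
        obtain ⟨m', hm'⟩ := hp'
        exact ⟨max m m', fun l hl => by
          rw [mul_add]
          exact add_mem (hm l ((le_max_left _ _).trans hl)) (hm' l ((le_max_right _ _).trans hl))⟩
      | mul p p' _ _ hp hp' =>
        obtain ⟨m, hm⟩ := hp
        obtain ⟨m', hm'⟩ := hp'
        refine ⟨m + m', fun l hl => ?_⟩
        have h1 : chi k (N • a.1 - t) ^ l * (p * p') =
            (chi k (N • a.1 - t) ^ m * p) * (chi k (N • a.1 - t) ^ (l - m) * p') := by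
          rw [mul_mul_mul_comm, ← pow_add, Nat.add_sub_cancel' (by omega)]
        rw [h1]
        exact mul_mem (hm m le_rfl) (hm' _ (by omega))
    obtain ⟨p, hp, r, hr, hr0, hrx, rfl⟩ := hx.frac f hf
    obtain ⟨m, hm⟩ := hshift p hp
    obtain ⟨m', hm'⟩ := hshift r hr
    have hne : chi k (N • a.1 - t) ^ max m m' ≠ 0 := pow_ne_zero _ (chi_ne_zero _)
    refine ⟨_, hm (max m m') (le_max_left _ _), _, hm' (max m m') (le_max_right _ _),
      mul_ne_zero hne hr0, ?_, (mul_div_mul_left _ _ hne).symm⟩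
    rw [mul_inv, ← inv_pow, ← chi_neg, neg_sub]
    exact mul_mem (pow_mem (hmem _ (hNT a)) _) hrx

end NormalFan

end

noncomputable section

open scoped BigOperators

/-! ### Tight sets of inequalities and projective fans containing a given fan -/

section Polyhedra

variable {n : ℕ}

/-- `I` is the set of inequalities `l · v ≤ c v`, `v ∈ V`, which are equalities for some
solution `l` of this system. -/
def IsTightSet (V : Finset (Fin n → ℤ)) (c : (Fin n → ℤ) → ℝ) (I : Finset (Fin n → ℤ)) : Prop :=
  I ⊆ V ∧ ∃ l : Fin n → ℝ, ∀ v ∈ V, l ⬝ᵥ latticeVec v ≤ c v ∧ (l ⬝ᵥ latticeVec v = c v ↔ v ∈ I)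

lemma exists_separating_of_notMem_hull {I : Finset (Fin n → ℤ)} {w : Fin n → ℝ}
    (h : w ∉ PointedCone.hull ℝ (latticeVec '' (I : Set (Fin n → ℤ)))) :
    ∃ d : Fin n → ℝ, (∀ v ∈ I, d ⬝ᵥ latticeVec v ≤ 0) ∧ 0 < d ⬝ᵥ w := by
  by_contra! hcon
  obtain ⟨r, hr, e⟩ := farkas_vector (fun v : I => latticeVec v.1) w fun y hy => by
    have h1 := hcon (-y) fun v hv => by
      rw [neg_dotProduct]; linarith [show 0 ≤ y ⬝ᵥ latticeVec v from hy ⟨v, hv⟩]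
    rw [neg_dotProduct] at h1
    change 0 ≤ y ⬝ᵥ w
    linarith
  apply h
  rw [e]
  exact sum_mem fun v _ => PointedCone.smul_mem _ (hr v) (Submodule.subset_span ⟨v, v.2, rfl⟩)

/-- Linear programming: every vector is a nonnegative combination of a tight set. -/
lemma exists_isTightSet {V : Finset (Fin n → ℤ)}
    (hV : ∀ w, w ∈ PointedCone.hull ℝ (latticeVec '' (V : Set (Fin n → ℤ))))
    {c : (Fin n → ℤ) → ℝ} (hc : ∃ l : Fin n → ℝ, ∀ v ∈ V, l ⬝ᵥ latticeVec v ≤ c v)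
    (w : Fin n → ℝ) : ∃ I, IsTightSet V c I ∧
      w ∈ PointedCone.hull ℝ (latticeVec '' (I : Set (Fin n → ℤ))) := by
  classical
  let P : Set (Fin n → ℝ) := {l | ∀ v ∈ V, l ⬝ᵥ latticeVec v ≤ c v}
  have hcont : ∀ v : Fin n → ℝ, Continuous fun l : Fin n → ℝ => l ⬝ᵥ v := fun v =>
    continuous_finsetSum _ fun j _ => (continuous_apply j).mul continuous_const
  have hclosed : IsClosed P := by
    have : P = ⋂ v ∈ V, {l : Fin n → ℝ | l ⬝ᵥ latticeVec v ≤ c v} := by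
      ext l; simp [P]
    rw [this]
    exact isClosed_biInter fun v _ => isClosed_le (hcont _) continuous_const
  -- The set `V` spans positively, so the inequalities bound `l` in every direction.
  have hbound : ∀ u : Fin n → ℝ, ∃ M : ℝ, ∀ l ∈ P, l ⬝ᵥ u ≤ M := by
    intro u
    obtain ⟨r, hr, rfl⟩ := mem_hull_lattice.1 (hV u)
    refine ⟨∑ v ∈ V, r v * c v, fun l hl => ?_⟩
    rw [dotProduct_sum]
    refine Finset.sum_le_sum fun v hv => ?_
    rw [dotProduct_smul]
    exact mul_le_mul_of_nonneg_left (hl v hv) (hr v)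
  choose M hM using hbound
  have hcompact : IsCompact P := by
    refine (isCompact_Icc (a := fun j => -M (-Pi.single j 1)) (b := fun j => M (Pi.single j 1))
      ).of_isClosed_subset hclosed fun l hl => ⟨fun j => ?_, fun j => ?_⟩
    · have h1 := hM (-Pi.single j 1) l hl
      rw [dotProduct_neg, dotProduct_single_one] at h1
      linarith
    · have h1 := hM (Pi.single j 1) l hl
      rwa [dotProduct_single_one] at h1
  -- The inequalities tight at a maximum of `⟨l, w⟩` work: if `w` were outside their cone, a
  -- separating direction `d` would stay feasible for small steps and increase the objective.
  obtain ⟨l, hl, hmax⟩ := hcompact.exists_isMaxOn hc (hcont w).continuousOn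
  refine ⟨V.filter fun v => l ⬝ᵥ latticeVec v = c v, ⟨Finset.filter_subset _ _, l, fun v hv =>
    ⟨hl v hv, by simp [hv]⟩⟩, ?_⟩
  by_contra hw
  obtain ⟨d, hd, hdw⟩ := exists_separating_of_notMem_hull hw
  have hev : ∀ v ∈ V, ∀ᶠ t : ℝ in nhdsWithin 0 (Set.Ioi 0),
      (l + t • d) ⬝ᵥ latticeVec v ≤ c v := by
    intro v hv
    by_cases he : l ⬝ᵥ latticeVec v = c v
    · filter_upwards [self_mem_nhdsWithin] with t ht
      have h1 := hd v (Finset.mem_filter.2 ⟨hv, he⟩)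
      rw [add_dotProduct, smul_dotProduct, he, smul_eq_mul]
      have : t * d ⬝ᵥ latticeVec v ≤ 0 := mul_nonpos_of_nonneg_of_nonpos (le_of_lt ht) h1
      linarith
    · have hlt : l ⬝ᵥ latticeVec v < c v := lt_of_le_of_ne (hl v hv) he
      have hct : Filter.Tendsto (fun t : ℝ => (l + t • d) ⬝ᵥ latticeVec v)
          (nhdsWithin 0 (Set.Ioi 0)) (nhds (l ⬝ᵥ latticeVec v)) := by
        have h1 : Continuous fun t : ℝ => (l + t • d) ⬝ᵥ latticeVec v :=
          (hcont _).comp (continuous_const.add (continuous_id.smul continuous_const))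
        have h2 := h1.tendsto 0
        simp only [zero_smul, add_zero] at h2
        exact h2.mono_left nhdsWithin_le_nhds
      filter_upwards [hct.eventually (gt_mem_nhds hlt)] with t ht using le_of_lt ht
  obtain ⟨t, ht, ht0⟩ := (((Filter.eventually_all_finset V).2 hev).and self_mem_nhdsWithin).exists
  have h1 : (l + t • d) ⬝ᵥ w ≤ l ⬝ᵥ w := hmax (show l + t • d ∈ P from ht)
  rw [add_dotProduct, smul_dotProduct, smul_eq_mul] at h1
  have h2 : 0 < t * d ⬝ᵥ w := mul_pos ht0 hdw
  linarith

/-- Feasibility of a system of linear equations and inequalities follows from feasibility of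
arbitrarily small perturbations. -/
lemma exists_tight_of_frequently {V I : Finset (Fin n → ℤ)}
    {a h : (Fin n → ℤ) → ℝ}
    (H : ∀ δ : ℝ, 0 < δ → ∃ ε : ℝ, 0 < ε ∧ ε < δ ∧ IsTightSet V (fun v => a v + ε * h v) I) :
    ∃ l : Fin n → ℝ, ∀ v ∈ V, l ⬝ᵥ latticeVec v ≤ a v ∧ (v ∈ I → l ⬝ᵥ latticeVec v = a v) := by
  classical
  -- Solvability means that `a` is a linear function, given by the coordinates and their negatives,
  -- plus nonnegative slacks off `I`. By Farkas it suffices to rule out a `y` that annihilates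
  -- linear functions, is nonnegative off `I` and is negative on `a`.
  let g : (Fin n ⊕ Fin n) ⊕ {v : V // v.1 ∉ I} → V → ℝ :=
    Sum.elim (Sum.elim (fun j v => (v.1 j : ℝ)) (fun j v => -(v.1 j : ℝ)))
      (fun u => Pi.single u.1 1)
  obtain ⟨r, hr, e⟩ := farkas_vector g (fun v => a v.1) fun y hy => by
    have h1 : ∀ j : Fin n, ∑ v : V, y v * (v.1 j : ℝ) = 0 := fun j => by
      have h2 : 0 ≤ ∑ v : V, y v * (v.1 j : ℝ) := hy (Sum.inl (Sum.inl j))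
      have h3 : 0 ≤ ∑ v : V, y v * -(v.1 j : ℝ) := hy (Sum.inl (Sum.inr j))
      simp only [mul_neg, Finset.sum_neg_distrib] at h3
      linarith
    have h2 : ∀ v : V, v.1 ∉ I → 0 ≤ y v := fun v hv => by
      have h3 : 0 ≤ ∑ u : V, y u * (Pi.single v 1 : V → ℝ) u := hy (Sum.inr ⟨v, hv⟩)
      simpa [Pi.single_apply] using h3
    have h3 : ∀ l : Fin n → ℝ, ∑ v : V, y v * (l ⬝ᵥ latticeVec v.1) = 0 := fun l => by
      simp only [dotProduct, Finset.mul_sum, latticeVec]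
      rw [Finset.sum_comm]
      refine Finset.sum_eq_zero fun j _ => ?_
      have h4 := congrArg (l j * ·) (h1 j)
      simp only [mul_zero, Finset.mul_sum] at h4
      rw [← h4]
      exact Finset.sum_congr rfl fun v _ => by ring
    by_contra! hneg
    -- Such a `y` would remain negative on `a + ε h` for all small `ε`, contradicting solvability at
    -- some of them.
    have hsmall : ∃ δ : ℝ, 0 < δ ∧ ∀ ε, 0 < ε → ε < δ →
        ∑ v : V, y v * a v.1 + ε * ∑ v : V, y v * h v.1 < 0 := by
      have hct : Filter.Tendsto (fun ε : ℝ => ∑ v : V, y v * a v.1 + ε * ∑ v : V, y v * h v.1)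
          (nhdsWithin 0 (Set.Ioi 0)) (nhds (∑ v : V, y v * a v.1 + 0 * ∑ v : V, y v * h v.1)) :=
        (continuous_const.add (continuous_id.mul continuous_const)).tendsto 0 |>.mono_left
          nhdsWithin_le_nhds
      rw [zero_mul, add_zero] at hct
      obtain ⟨δ, hδ, hsub⟩ := mem_nhdsGT_iff_exists_Ioo_subset.1
        (hct.eventually (gt_mem_nhds hneg))
      exact ⟨δ, hδ, fun ε h1 h2 => hsub ⟨h1, h2⟩⟩
    obtain ⟨δ, hδ, hsmall⟩ := hsmall
    obtain ⟨ε, hε, hεδ, -, l, hl⟩ := H δ hδ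
    have h4 := hsmall ε hε hεδ
    have h5 : ∑ v : V, y v * a v.1 + ε * ∑ v : V, y v * h v.1 =
        ∑ v : V, y v * (a v.1 + ε * h v.1 - l ⬝ᵥ latticeVec v.1) := by
      simp only [mul_sub, Finset.sum_sub_distrib, h3, sub_zero, mul_add, Finset.sum_add_distrib,
        Finset.mul_sum]
      congr 1
      exact Finset.sum_congr rfl fun v _ => by ring
    have h6 : 0 ≤ ∑ v : V, y v * (a v.1 + ε * h v.1 - l ⬝ᵥ latticeVec v.1) :=
      Finset.sum_nonneg fun v _ => by
        by_cases hv : v.1 ∈ I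
        · rw [(hl v.1 v.2).2.2 hv]; simp
        · exact mul_nonneg (h2 v hv) (sub_nonneg.2 (hl v.1 v.2).1)
    linarith
  refine ⟨fun j => r (Sum.inl (Sum.inl j)) - r (Sum.inl (Sum.inr j)), fun v hv => ?_⟩
  have h1 : a v = (fun j => r (Sum.inl (Sum.inl j)) - r (Sum.inl (Sum.inr j))) ⬝ᵥ latticeVec v +
      ∑ u : {v : V // v.1 ∉ I}, r (Sum.inr u) * (Pi.single u.1 1 : V → ℝ) ⟨v, hv⟩ := by
    have h2 := congrFun e ⟨v, hv⟩
    rw [Finset.sum_apply, Fintype.sum_sum_type, Fintype.sum_sum_type] at h2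
    rw [h2, dotProduct, ← Finset.sum_add_distrib]
    congr 1
    refine Finset.sum_congr rfl fun j _ => ?_
    simp only [g, Sum.elim_inl, Sum.elim_inr, Pi.smul_apply, smul_eq_mul, latticeVec]
    ring
  constructor
  · rw [h1]
    refine le_add_of_nonneg_right (Finset.sum_nonneg fun u _ => mul_nonneg (hr _) ?_)
    rw [Pi.single_apply]
    split_ifs <;> norm_num
  · intro hvI
    rw [h1, Finset.sum_eq_zero, add_zero]
    intro u _
    rw [Pi.single_apply, if_neg, mul_zero]
    intro e'
    exact u.2 (by rw [← e']; exact hvI)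

/-- A refinement of the fan `Δ` to a projective fan with rays in `V`, on which the convex data
`a` are linear. -/
lemma exists_projective_fan (k : Type*) [Field k] {V : Finset (Fin n → ℤ)}
    (hprim : ∀ v ∈ V, IsPrimitive v)
    (hV : ∀ w, w ∈ PointedCone.hull ℝ (latticeVec '' (V : Set (Fin n → ℤ))))
    {a h : (Fin n → ℤ) → ℝ} {Δ : Fan n} (hΔV : ∀ v, Δ.IsRay v → v ∈ V)
    (ha : ∀ δ ∈ Δ.cones, ∃ l : Fin n → ℝ, ∀ v ∈ V, l ⬝ᵥ latticeVec v ≤ a v ∧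
      (latticeVec v ∈ δ → l ⬝ᵥ latticeVec v = a v))
    (hh : ∀ δ ∈ Δ.cones, ∃ b : Fin n → ℝ, ∀ v ∈ V, b ⬝ᵥ latticeVec v ≤ h v ∧
      (b ⬝ᵥ latticeVec v = h v ↔ latticeVec v ∈ δ)) :
    ∃ Φ : Fan n, Δ.cones ⊆ Φ.cones ∧ (toricVariety k Φ).IsProjective ∧
      (∀ u, Φ.IsRay u → u ∈ V) ∧
      ∀ σ ∈ Φ.cones, ∃ l : Fin n → ℝ, (∀ v ∈ V, l ⬝ᵥ latticeVec v ≤ a v) ∧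
        ∀ u, Φ.IsRay u → latticeVec u ∈ σ → l ⬝ᵥ latticeVec u = a u := by
  classical
  let c : ℝ → (Fin n → ℤ) → ℝ := fun ε v => a v + ε * h v
  -- The functional `l + ε b` touches the perturbed data at `v` exactly when `v ∈ δ`: strictness
  -- comes from `h`, and `a` contributes equality on `δ`.
  have hΔtight : ∀ δ ∈ Δ.cones, ∀ ε : ℝ, 0 < ε →
      IsTightSet V (c ε) (V.filter fun v => latticeVec v ∈ δ) := by
    intro δ hδ ε hε
    obtain ⟨l, hl⟩ := ha δ hδ
    obtain ⟨b, hb⟩ := hh δ hδ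
    refine ⟨Finset.filter_subset _ _, l + ε • b, fun v hv => ?_⟩
    obtain ⟨h1, h2⟩ := hl v hv
    obtain ⟨h3, h4⟩ := hb v hv
    have h5 := mul_le_mul_of_nonneg_left h3 hε.le
    rw [add_dotProduct, smul_dotProduct, smul_eq_mul]
    refine ⟨add_le_add h1 h5, ?_⟩
    rw [Finset.mem_filter, and_iff_right hv]
    constructor
    · intro h6
      refine h4.1 (mul_left_cancel₀ hε.ne' ?_)
      change l ⬝ᵥ latticeVec v + ε * b ⬝ᵥ latticeVec v = a v + ε * h v at h6
      linarith
    · intro h6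
      change _ = a v + ε * h v
      rw [h2 h6, h4.2 h6]
  have hcone : ∀ δ ∈ Δ.cones, PointedCone.hull ℝ
      (latticeVec '' ((V.filter fun v => latticeVec v ∈ δ : Finset _) : Set (Fin n → ℤ))) = δ := by
    intro δ hδ
    refine le_antisymm (Submodule.span_le.2 ?_) fun w hw => ?_
    · rintro _ ⟨v, hv, rfl⟩
      exact (Finset.mem_filter.1 hv).2
    · obtain ⟨r, hr, hr0, rfl⟩ := (Δ.mem_cone_iff hδ).1 hw
      refine sum_mem fun i _ => ?_
      by_cases hi : i.vec ∈ δ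
      · exact PointedCone.smul_mem _ (hr i) (Submodule.subset_span
          ⟨i.1, Finset.mem_coe.2 (Finset.mem_filter.2 ⟨hΔV _ i.2, hi⟩), rfl⟩)
      · rw [hr0 i hi, zero_smul]; exact zero_mem _
  -- There are finitely many families of subsets of `V`, so one family of tight sets occurs for
  -- infinitely many `ε = 1 / (N + 1)`. Fixing such an `ε₀` permits a passage to the limit at the
  -- end.
  obtain ⟨N₀, hN₀⟩ : ∃ N₀ : ℕ, ∀ δ : ℝ, 0 < δ → ∃ N : ℕ, 1 / ((N : ℝ) + 1) < δ ∧
      ∀ I, IsTightSet V (c (1 / ((N : ℝ) + 1))) I ↔ IsTightSet V (c (1 / ((N₀ : ℝ) + 1))) I := by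
    let T : ℕ → V.powerset.powerset := fun N =>
      ⟨V.powerset.filter fun I => IsTightSet V (c (1 / ((N : ℝ) + 1))) I,
        Finset.mem_powerset.2 (Finset.filter_subset _ _)⟩
    obtain ⟨t, ht⟩ := Finite.exists_infinite_fiber T
    have hinf : (T ⁻¹' {t}).Infinite := Set.infinite_coe_iff.1 ht
    obtain ⟨N₀, hN₀⟩ := hinf.nonempty
    refine ⟨N₀, fun δ hδ => ?_⟩
    obtain ⟨m, hm⟩ := exists_nat_one_div_lt hδ
    obtain ⟨N, hN, hmN⟩ := hinf.exists_gt m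
    refine ⟨N, lt_of_le_of_lt ?_ hm, fun I => ?_⟩
    · exact one_div_le_one_div_of_le (by positivity) (by
        have : (m : ℝ) < N := by exact_mod_cast hmN
        linarith)
    · have h1 : (T N).1 = (T N₀).1 := by rw [show T N = t from hN, show T N₀ = t from hN₀]
      have h2 : I ∈ (T N).1 ↔ I ∈ (T N₀).1 := by rw [h1]
      simp only [T, Finset.mem_filter, Finset.mem_powerset] at h2
      constructor
      · intro h3; exact (h2.1 ⟨h3.1, h3⟩).2
      · intro h3; exact (h2.2 ⟨h3.1, h3⟩).2
  set ε₀ : ℝ := 1 / ((N₀ : ℝ) + 1) with hε₀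
  have hε₀pos : 0 < ε₀ := by positivity
  -- The zero cone of `Δ` provides a point where all inequalities are strict, so the polytope is
  -- full dimensional.
  have hbot : IsTightSet V (c ε₀) ∅ := by
    have h1 := hΔtight ⊥ Δ.bot_mem ε₀ hε₀pos
    have h2 : (V.filter fun v => latticeVec v ∈ (⊥ : PointedCone ℝ (Fin n → ℝ))) = ∅ := by
      refine Finset.filter_eq_empty_iff.2 fun v hv h3 => (hprim v hv).ne_zero ?_
      exact latticeVec_injective (by rw [(Submodule.mem_bot _).1 h3, latticeVec_zero])
    rwa [h2] at h1
  let 𝓘 := {I : Finset (Fin n → ℤ) // IsTightSet V (c ε₀) I}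
  have : Finite 𝓘 := Set.Finite.to_subtype (V.powerset.finite_toSet.subset fun I hI =>
    Finset.mem_coe.2 (Finset.mem_powerset.2 hI.1))
  have := Fintype.ofFinite 𝓘
  choose l hl using fun I : 𝓘 => I.2.2
  -- The bounds and the chosen points become integral without changing which inequalities are tight;
  -- one summand of the integral decomposition suffices.
  obtain ⟨c', m, hm⟩ : ∃ (c' : (Fin n → ℤ) → ℤ) (m : 𝓘 → Fin n → ℤ), ∀ I : 𝓘, ∀ v ∈ V,
      m I ⬝ᵥ v ≤ c' v ∧ (m I ⬝ᵥ v = c' v ↔ v ∈ I.1) := by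
    let x : V ⊕ (𝓘 × Fin n) → ℝ := Sum.elim (fun v => c ε₀ v.1) fun p => l p.1 p.2
    let g : 𝓘 × V → V ⊕ (𝓘 × Fin n) → ℤ := fun p =>
      Sum.elim (Pi.single p.2 1) fun q => if q.1 = p.1 then -p.2.1 q.2 else 0
    obtain ⟨r, -, z, -, -, hs⟩ := exists_int_decomposition (Finset.univ.image g) x
    have hg : ∀ (I : 𝓘) (v : V) (y : V ⊕ (𝓘 × Fin n) → ℝ), ∑ j, (g (I, v) j : ℝ) * y j =
        y (Sum.inl v) - ∑ j, y (Sum.inr (I, j)) * (v.1 j : ℝ) := by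
      intro I v y
      rw [Fintype.sum_sum_type, Fintype.sum_prod_type, sub_eq_add_neg]
      congr 1
      · simp [g, Pi.single_apply]
      · rw [Finset.sum_eq_single I]
        · simp [g, mul_comm]
        · intro τ _ hτ
          simp [g, hτ]
        · simp
    refine ⟨fun v => if hv : v ∈ V then z 0 (Sum.inl ⟨v, hv⟩) else 0,
      fun I j => z 0 (Sum.inr (I, j)), fun I v hv => ?_⟩
    have h1 := hs 0 (g (I, ⟨v, hv⟩)) (Finset.mem_image_of_mem _ (Finset.mem_univ _))
    rw [hg I ⟨v, hv⟩ (fun j => (z 0 j : ℝ)), hg I ⟨v, hv⟩ x] at h1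
    have h2 : x (Sum.inl ⟨v, hv⟩) - ∑ j, x (Sum.inr (I, j)) * (v j : ℝ) =
      c ε₀ v - l I ⬝ᵥ latticeVec v := rfl
    have h3 : (z 0 (Sum.inl ⟨v, hv⟩) : ℝ) - ∑ j, (z 0 (Sum.inr (I, j)) : ℝ) * (v j : ℝ) =
        ((z 0 (Sum.inl ⟨v, hv⟩) - (fun j => z 0 (Sum.inr (I, j))) ⬝ᵥ v : ℤ) : ℝ) := by
      push_cast [dotProduct]; rfl
    rw [h2, h3] at h1
    obtain ⟨h4, h5⟩ := hl I v hv
    simp only [dif_pos hv]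
    constructor
    · have h6 : 0 ≤ SignType.sign (c ε₀ v - l I ⬝ᵥ latticeVec v) :=
        sign_nonneg_iff.2 (sub_nonneg.2 h4)
      rw [← h1, sign_nonneg_iff] at h6
      have h7 := Int.cast_nonneg_iff.1 h6
      linarith
    · rw [← h5, eq_comm, ← sub_eq_zero, ← Int.cast_eq_zero (α := ℝ), ← sign_eq_zero_iff, h1,
        sign_eq_zero_iff, sub_eq_zero, eq_comm]
  let S : Finset (Fin n → ℤ) := Finset.univ.image m
  have hmS : ∀ I, m I ∈ S := fun I => Finset.mem_image_of_mem _ (Finset.mem_univ I)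
  have hS : ∀ s ∈ S, ∃ I, s = m I := fun s hs => by
    obtain ⟨I, -, rfl⟩ := Finset.mem_image.1 hs
    exact ⟨I, rfl⟩
  have hle : ∀ s ∈ S, ∀ v ∈ V, s ⬝ᵥ v ≤ c' v := fun s hs v hv => by
    obtain ⟨I, rfl⟩ := hS s hs
    exact (hm I v hv).1
  have hcover : ∀ w : Fin n → ℝ, ∃ (I : 𝓘) (r : (Fin n → ℤ) → ℝ), (∀ v, 0 ≤ r v) ∧
      w = ∑ v ∈ I.1, r v • latticeVec v := fun w => by
    obtain ⟨l₀, hl₀⟩ := hbot.2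
    obtain ⟨I, hI, hw⟩ := exists_isTightSet hV ⟨l₀, fun v hv => (hl₀ v hv).1⟩ w
    obtain ⟨r, hr, e⟩ := mem_hull_lattice.1 hw
    exact ⟨⟨I, hI⟩, r, hr, e⟩
  have hpair : ∀ (s t : Fin n → ℤ) (K : Finset (Fin n → ℤ)) (r : (Fin n → ℤ) → ℝ),
      pairing (s - t) (∑ v ∈ K, r v • latticeVec v) =
        ∑ v ∈ K, r v * ((s ⬝ᵥ v - t ⬝ᵥ v : ℤ) : ℝ) := fun s t K r => by
    rw [pairing_sum_right]
    refine Finset.sum_congr rfl fun v _ => ?_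
    rw [pairing_smul_right, pairing_latticeVec, sub_dotProduct]
  let K : Finset (Fin n → ℤ) → Finset (Fin n → ℤ) := fun A =>
    V.filter fun v => ∀ s ∈ A, s ⬝ᵥ v = c' v
  -- By `hcover`, `w` is a nonnegative combination of the `v` in one tight set `I`. If the points of
  -- `A` maximize `⟨·, w⟩`, they must be tight at each `v` with nonzero coefficient, since `m I` is.
  have hnormal : ∀ A ⊆ S, A.Nonempty → normalCone S A =
      PointedCone.hull ℝ (latticeVec '' (K A : Set (Fin n → ℤ))) := by
    intro A hA _
    refine le_antisymm (fun w hw => ?_) (Submodule.span_le.2 ?_)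
    · obtain ⟨I, r, hr, rfl⟩ := hcover w
      refine sum_mem fun v hv => ?_
      by_cases hrv : r v = 0
      · rw [hrv, zero_smul]; exact zero_mem _
      have hvV := I.2.1 hv
      refine PointedCone.smul_mem _ (hr v) (Submodule.subset_span ⟨v, ?_, rfl⟩)
      refine Finset.mem_coe.2 (Finset.mem_filter.2 ⟨hvV, fun s hs => ?_⟩)
      have h1 := hw s hs (m I) (hmS I)
      rw [hpair] at h1
      have h2 : ∀ v ∈ I.1, r v * ((s ⬝ᵥ v - m I ⬝ᵥ v : ℤ) : ℝ) ≤ 0 := fun v hv => by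
        refine mul_nonpos_of_nonneg_of_nonpos (hr v) ?_
        rw [(hm I v (I.2.1 hv)).2.2 hv]
        exact_mod_cast sub_nonpos.2 (hle s (hA hs) v (I.2.1 hv))
      have h3 := (Finset.sum_eq_zero_iff_of_nonpos h2).1
        (le_antisymm (Finset.sum_nonpos h2) h1) v hv
      have h4 := (mul_eq_zero.1 h3).resolve_left hrv
      rw [(hm I v hvV).2.2 hv, Int.cast_eq_zero] at h4
      linarith
    · rintro _ ⟨v, hv, rfl⟩ s hs t ht
      obtain ⟨hvV, hvK⟩ := Finset.mem_filter.1 (Finset.mem_coe.1 hv)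
      rw [pairing_latticeVec, sub_dotProduct, hvK s hs]
      exact_mod_cast sub_nonneg.2 (hle t ht v hvV)
  have hne : S.Nonempty := ⟨_, hmS ⟨∅, hbot⟩⟩
  have hrat : ∀ A ⊆ S, A.Nonempty → IsRational (normalCone S A) := fun A hA hA0 =>
    ⟨_, hnormal A hA hA0⟩
  -- Compare with the interior point of `hbot`: strictness of its inequalities forces every
  -- coefficient of `w` to vanish.
  have hlin : ∀ w, (∀ s ∈ S, ∀ t ∈ S, pairing (s - t) w = 0) → w = 0 := by
    intro w hw
    obtain ⟨I, r, hr, rfl⟩ := hcover w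
    have h1 := hw _ (hmS I) _ (hmS ⟨∅, hbot⟩)
    have hlt : ∀ v ∈ I.1, (0 : ℝ) < ((m I ⬝ᵥ v - m ⟨∅, hbot⟩ ⬝ᵥ v : ℤ) : ℝ) := fun v hv => by
      obtain ⟨h2, h3⟩ := hm ⟨∅, hbot⟩ v (I.2.1 hv)
      have h4 : m ⟨∅, hbot⟩ ⬝ᵥ v < c' v :=
        lt_of_le_of_ne h2 fun h5 => absurd (h3.1 h5) (Finset.notMem_empty v)
      rw [(hm I v (I.2.1 hv)).2.2 hv]
      exact_mod_cast sub_pos.2 h4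
    rw [hpair, Finset.sum_eq_zero_iff_of_nonneg fun v hv => mul_nonneg (hr v) (hlt v hv).le] at h1
    exact Finset.sum_eq_zero fun v hv => by
      rw [(mul_eq_zero.1 (h1 v hv)).resolve_right (hlt v hv).ne', zero_smul]
  let Φ := normalFan S hne hrat hlin
  -- The ray of `u` is a face of the normal cone, so a generator from `K A` occurring in `u` lies on
  -- it; both vectors being primitive, they coincide.
  have hrayK : ∀ u, Φ.IsRay u → ∀ A ⊆ S, A.Nonempty → latticeVec u ∈ normalCone S A →
      u ∈ K A := by
    rintro u ⟨hu, hray⟩ A hA hA0 huA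
    obtain ⟨f, hf, hff⟩ := Φ.inter_face _ ⟨A, hA, hA0, rfl⟩ _ hray
    have hface : pairing f (latticeVec u) = 0 :=
      ((hff _).1 ⟨huA, latticeVec_mem_rayCone u⟩).2
    have huA' := huA
    rw [hnormal A hA hA0] at huA'
    obtain ⟨r, hr, e⟩ := mem_hull_lattice.1 huA'
    have hKmem : ∀ v ∈ K A, latticeVec v ∈ normalCone S A := fun v hv => by
      rw [hnormal A hA hA0]
      exact Submodule.subset_span ⟨v, hv, rfl⟩
    obtain ⟨v, hv, hrv⟩ : ∃ v ∈ K A, r v ≠ 0 := by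
      by_contra! hcon
      apply hu.ne_zero
      apply latticeVec_injective
      rw [e, latticeVec_zero]
      exact Finset.sum_eq_zero fun v hv => by rw [hcon v hv, zero_smul]
    rw [e, pairing_sum_right, Finset.sum_eq_zero_iff_of_nonneg fun v hv => by
      rw [pairing_smul_right]; exact mul_nonneg (hr v) (hf _ (hKmem v hv))] at hface
    have h1 := hface v hv
    rw [pairing_smul_right] at h1
    have h2 := ((hff (latticeVec v)).2 ⟨hKmem v hv, (mul_eq_zero.1 h1).resolve_left hrv⟩).2
    rwa [hu.eq_of_mem_rayCone (hprim v (Finset.mem_filter.1 hv).1) h2]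
  refine ⟨Φ, fun δ hδ => ?_, normalFan_isProjective hne hrat hlin, fun u hu => ?_, ?_⟩
  · have hI := hΔtight δ hδ ε₀ hε₀pos
    refine ⟨{m ⟨_, hI⟩}, Finset.singleton_subset_iff.2 (hmS _), Finset.singleton_nonempty _, ?_⟩
    rw [hnormal _ (Finset.singleton_subset_iff.2 (hmS _)) (Finset.singleton_nonempty _)]
    refine (hcone δ hδ).symm.trans ?_
    congr 2
    ext v
    simp only [K, Finset.mem_singleton, forall_eq, Finset.mem_coe, Finset.mem_filter]
    refine and_congr_right fun hv => ?_
    rw [(hm ⟨_, hI⟩ v hv).2]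
    simp [hv]
  · obtain ⟨A, hA, hA0, e⟩ := hu.2
    refine (Finset.mem_filter.1 (hrayK u hu A hA hA0 ?_)).1
    rw [← e]; exact latticeVec_mem_rayCone u
  · rintro _ ⟨A, hA, hA0, rfl⟩
    obtain ⟨s, hs⟩ := hA0
    obtain ⟨I, rfl⟩ := hS s (hA hs)
    obtain ⟨l', hl'⟩ := exists_tight_of_frequently (a := a) (h := h) fun δ hδ => by
      obtain ⟨N, hN, hiff⟩ := hN₀ δ hδ
      exact ⟨_, by positivity, hN, (hiff I.1).2 I.2⟩
    refine ⟨l', fun v hv => (hl' v hv).1, fun u hu huσ => ?_⟩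
    obtain ⟨huV, huK⟩ := Finset.mem_filter.1 (hrayK u hu A hA ⟨_, hs⟩ huσ)
    exact (hl' u huV).2 ((hm I u huV).2.1 (huK _ hs))

end Polyhedra

end

noncomputable section

section RationalFunctionField

open Polynomial

variable {k F : Type*} [Field k] [Field F] [Algebra k F]

/-! ### Places of a rational function field -/

/-- `t` is transcendental over `k` and generates the field `F` over `k`. -/
structure IsRationalGenerator (k : Type*) {F : Type*} [Field k] [Field F] [Algebra k F] (t : F) :
    Prop where
  transcendental : Transcendental k t
  exists_fraction : ∀ f : F, ∃ a b : k[X], b ≠ 0 ∧ f = aeval t a / aeval t b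

namespace IsRationalGenerator

variable {t : F} (h : IsRationalGenerator k t)
include h

lemma aeval_ne_zero {b : k[X]} (hb : b ≠ 0) : aeval t b ≠ 0 :=
  mt (transcendental_iff.1 h.transcendental b) hb

lemma ne_zero : t ≠ 0 := by
  simpa using h.aeval_ne_zero X_ne_zero

omit h in
lemma _root_.Polynomial.aeval_eq_pow_mul_aeval_inv_reverse {t : F} (ht : t ≠ 0) (a : k[X]) :
    aeval t a = t ^ a.natDegree * aeval t⁻¹ a.reverse := by
  let _ : Invertible t := invertibleOfNonzero ht
  have := eval₂_reverse_mul_pow (algebraMap k F) t a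
  rw [invOf_eq_inv] at this
  rw [aeval_def, ← this, aeval_def, mul_comm]

lemma inv : IsRationalGenerator k t⁻¹ where
  transcendental := fun hal => h.transcendental (by simpa using hal.inv)
  exists_fraction f := by
    obtain ⟨a, b, hb, rfl⟩ := h.exists_fraction f
    have ht := h.ne_zero
    refine ⟨X ^ b.natDegree * a.reverse, X ^ a.natDegree * b.reverse,
      mul_ne_zero (pow_ne_zero _ X_ne_zero) (by simpa using hb), ?_⟩
    rw [aeval_eq_pow_mul_aeval_inv_reverse ht a, aeval_eq_pow_mul_aeval_inv_reverse ht b]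
    simp only [map_mul, map_pow, aeval_X]
    have hb' : aeval t⁻¹ b.reverse ≠ 0 := by
      intro e
      apply h.aeval_ne_zero hb
      rw [aeval_eq_pow_mul_aeval_inv_reverse ht b, e, mul_zero]
    have htt : (t⁻¹) ^ b.natDegree * t ^ b.natDegree = 1 := by
      rw [← mul_pow, inv_mul_cancel₀ ht, one_pow]
    have htt' : (t⁻¹) ^ a.natDegree * t ^ a.natDegree = 1 := by
      rw [← mul_pow, inv_mul_cancel₀ ht, one_pow]
    rw [div_eq_div_iff (mul_ne_zero (pow_ne_zero _ ht) hb')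
      (mul_ne_zero (pow_ne_zero _ (inv_ne_zero ht)) hb')]
    linear_combination (aeval t⁻¹ a.reverse * aeval t⁻¹ b.reverse) * (htt' - htt)

omit h in
lemma ne_zero_of_not_dvd {p b : k[X]} (hb : ¬ p ∣ b) : b ≠ 0 := fun e => hb (e ▸ dvd_zero p)

/-- The local ring of the line at the point given by the prime polynomial `p`. -/
def localRing {p : k[X]} (hp : Prime p) : Subring F where
  carrier := {f | ∃ a b : k[X], ¬ p ∣ b ∧ f = aeval t a / aeval t b}
  mul_mem' := by
    rintro _ _ ⟨a, b, hb, rfl⟩ ⟨a', b', hb', rfl⟩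
    exact ⟨a * a', b * b', fun e => (hp.dvd_or_dvd e).elim hb hb', by
      rw [map_mul, map_mul, div_mul_div_comm]⟩
  one_mem' := ⟨1, 1, hp.not_dvd_one, by simp⟩
  add_mem' := by
    rintro _ _ ⟨a, b, hb, rfl⟩ ⟨a', b', hb', rfl⟩
    refine ⟨a * b' + b * a', b * b', fun e => (hp.dvd_or_dvd e).elim hb hb', ?_⟩
    rw [div_add_div _ _ (h.aeval_ne_zero (ne_zero_of_not_dvd hb))
      (h.aeval_ne_zero (ne_zero_of_not_dvd hb'))]
    simp only [map_mul, map_add]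
  zero_mem' := ⟨0, 1, hp.not_dvd_one, by simp⟩
  neg_mem' := by
    rintro _ ⟨a, b, hb, rfl⟩
    exact ⟨-a, b, hb, by rw [map_neg, neg_div]⟩

variable {p : k[X]} (hp : Prime p)

lemma aeval_mem (a : k[X]) : aeval t a ∈ h.localRing hp := ⟨a, 1, hp.not_dvd_one, by simp⟩

lemma inv_mem {b : k[X]} (hb : b ≠ 0) : (aeval t b)⁻¹ ∈ h.localRing hp ↔ ¬ p ∣ b := by
  constructor
  · rintro ⟨a, c, hc, e⟩ ⟨d, rfl⟩
    have hc0 : aeval t c ≠ 0 := h.aeval_ne_zero (ne_zero_of_not_dvd hc)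
    rw [inv_eq_iff_eq_inv, inv_div, eq_div_iff, ← map_mul] at e
    · exact hc ⟨d * a, (sub_eq_zero.1 (by_contra fun h0 => h.aeval_ne_zero h0 (by
        rw [map_sub, ← mul_assoc, e, sub_self]))).symm⟩
    · rintro h0
      rw [h0, div_zero] at e
      exact h.aeval_ne_zero hb e
  · exact fun hb => ⟨1, b, hb, by simp⟩

lemma isUniformizer : IsUniformizer (h.localRing hp) (aeval t p) where
  mem := h.aeval_mem hp p
  inv_notMem := fun e => (h.inv_mem hp hp.ne_zero).1 e dvd_rfl
  exists_pow f hf := by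
    obtain ⟨a, b, hb, rfl⟩ := h.exists_fraction f
    have ha : a ≠ 0 := by rintro rfl; simp at hf
    obtain ⟨i, a', ha', rfl⟩ : ∃ (i : ℕ) (c : k[X]), ¬ p ∣ c ∧ a = p ^ i * c :=
      have ⟨c, hc, hdvd⟩ := (FiniteMultiplicity.of_prime_left hp ha).exists_eq_pow_mul_and_not_dvd
      ⟨_, c, hdvd, hc⟩
    obtain ⟨j, b', hb', rfl⟩ : ∃ (i : ℕ) (c : k[X]), ¬ p ∣ c ∧ b = p ^ i * c :=
      have ⟨c, hc, hdvd⟩ := (FiniteMultiplicity.of_prime_left hp hb).exists_eq_pow_mul_and_not_dvd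
      ⟨_, c, hdvd, hc⟩
    have hp0 := h.aeval_ne_zero hp.ne_zero
    have e : aeval t (p ^ i * a') / aeval t (p ^ j * b') * aeval t p ^ (-((i : ℤ) - j)) =
        aeval t a' / aeval t b' := by
      rw [neg_sub, zpow_sub₀ hp0, zpow_natCast, zpow_natCast]
      simp only [map_mul, map_pow]
      field_simp
    refine ⟨i - j, ?_, ?_⟩
    · rw [e]; exact ⟨a', b', hb', rfl⟩
    · rw [e, inv_div]; exact ⟨b', a', ha', rfl⟩

lemma ordAlong_aeval_eq_zero {b : k[X]} (hb : ¬ p ∣ b) :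
    ordAlong (h.localRing hp) (aeval t b) = 0 := by
  have hb0 : b ≠ 0 := ne_zero_of_not_dvd hb
  refine (h.isUniformizer hp).ordAlong_eq (h.aeval_ne_zero hb0) ?_
  simpa using ⟨h.aeval_mem hp b, (h.inv_mem hp hb0).2 hb⟩

/-- The local ring at a closed point of the line, as a valuation ring. -/
def valuationRing : ValuationSubring F where
  toSubring := h.localRing hp
  mem_or_inv_mem' f := by
    by_cases hf : f = 0
    · exact Or.inl (by rw [hf]; exact (h.localRing hp).zero_mem)
    · have hu := h.isUniformizer hp
      change f ∈ h.localRing hp ∨ f⁻¹ ∈ h.localRing hp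
      rw [← hu.ordAlong_nonneg_iff hf, ← hu.ordAlong_nonneg_iff (inv_ne_zero hf),
        hu.ordAlong_inv hf]
      omega

lemma aeval_mem_valuationRing (a : k[X]) : aeval t a ∈ h.valuationRing hp := h.aeval_mem hp a

lemma valuationRing_ne_top : h.valuationRing hp ≠ ⊤ := fun e =>
  (h.isUniformizer hp).inv_notMem (show (aeval t p)⁻¹ ∈ h.valuationRing hp by
    rw [e]; exact ValuationSubring.mem_top _)

omit h in
lemma _root_.ValuationSubring.aeval_mem {V : ValuationSubring F}
    (hV : ∀ a : k, algebraMap k F a ∈ V) {t : F} (ht : t ∈ V) (b : k[X]) : aeval t b ∈ V := by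
  induction b using Polynomial.induction_on with
  | C a => simpa using hV a
  | add p q hp hq => rw [map_add]; exact add_mem hp hq
  | monomial n a _ => simpa using mul_mem (hV a) (pow_mem ht (n + 1))

/-- A denominator prime to `p` must be invertible in `V`, so `V` contains the local ring at `p`, a
maximal proper subring. -/
lemma eq_valuationRing {V : ValuationSubring F} (hV : ∀ a : k, algebraMap k F a ∈ V)
    (ht : t ∈ V) (hpV : (aeval t p)⁻¹ ∉ V) : V = h.valuationRing hp := by
  have hle : h.localRing hp ≤ V.toSubring := by
    rintro _ ⟨a, b, hb, rfl⟩
    rw [div_eq_mul_inv]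
    refine mul_mem (ValuationSubring.aeval_mem hV ht a) ?_
    by_contra hbV
    obtain ⟨u, w, huw⟩ := (hp.irreducible.coprime_iff_not_dvd.2 hb : IsCoprime p b)
    have hb0 : aeval t b ≠ 0 := h.aeval_ne_zero (ne_zero_of_not_dvd hb)
    have hp0 := h.aeval_ne_zero hp.ne_zero
    have e : aeval t u * aeval t p + aeval t w * aeval t b = 1 := by
      rw [← map_mul, ← map_mul, ← map_add, huw, map_one]
    -- Dividing the Bézout relation by `b` or by `p` puts the corresponding inverse into `V`; either
    -- outcome is excluded.
    rcases V.mem_or_inv_mem (aeval t p / aeval t b) with hm | hm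
    · apply hbV
      have : (aeval t b)⁻¹ = aeval t u * (aeval t p / aeval t b) + aeval t w := by
        field_simp; linear_combination -e
      rw [this]
      exact add_mem (mul_mem (ValuationSubring.aeval_mem hV ht u) hm)
        (ValuationSubring.aeval_mem hV ht w)
    · apply hpV
      have : (aeval t p)⁻¹ = aeval t u + aeval t w * (aeval t p / aeval t b)⁻¹ := by
        field_simp; linear_combination -e
      rw [this]
      exact add_mem (ValuationSubring.aeval_mem hV ht u)
        (mul_mem (ValuationSubring.aeval_mem hV ht w) hm)
  exact (ValuationSubring.toSubring_injective
    ((h.isUniformizer hp).eq_of_le hle ⟨_, hpV⟩)).symm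

/-- Every place of a rational function field which is not the one at infinity belongs to a prime
polynomial. -/
lemma exists_eq_valuationRing {V : ValuationSubring F} (hV : ∀ a : k, algebraMap k F a ∈ V)
    (hne : V ≠ ⊤) (ht : t ∈ V) : ∃ (p : k[X]) (hp : Prime p), V = h.valuationRing hp := by
  have hex : ∃ b : k[X], b ≠ 0 ∧ (aeval t b)⁻¹ ∉ V := by
    by_contra! hcon
    refine hne (eq_top_iff.2 fun f _ => ?_)
    obtain ⟨a, b, hb, rfl⟩ := h.exists_fraction f
    rw [div_eq_mul_inv]
    exact mul_mem (ValuationSubring.aeval_mem hV ht a) (hcon b hb)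
  obtain ⟨b, hb, hbV⟩ := hex
  have : ∃ p : k[X], Prime p ∧ (aeval t p)⁻¹ ∉ V := by
    by_contra! hcon
    apply hbV
    induction b using UniqueFactorizationMonoid.induction_on_prime with
    | h₁ => exact absurd rfl hb
    | h₂ x hx =>
      obtain ⟨c, hc, rfl⟩ := Polynomial.isUnit_iff.1 hx
      rw [aeval_C, ← map_inv₀]; exact hV _
    | h₃ a p ha hp ih =>
      rw [map_mul, mul_inv]
      refine mul_mem (hcon p hp) ?_
      by_contra hc
      exact hc (ih ha hc)
  obtain ⟨p, hp, hpV⟩ := this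
  exact ⟨p, hp, h.eq_valuationRing hp hV ht hpV⟩

/-- The residue field at a point of the line has the degree of the polynomial. -/
lemma finrank_residueField [Algebra k (IsLocalRing.ResidueField (h.valuationRing hp))]
    (hV : ∀ a : k, algebraMap k F a ∈ h.valuationRing hp)
    (halg : ∀ a : k, algebraMap k (IsLocalRing.ResidueField (h.valuationRing hp)) a =
      IsLocalRing.residue _ (⟨algebraMap k F a, hV a⟩ : h.valuationRing hp)) :
    Module.finrank k (IsLocalRing.ResidueField (h.valuationRing hp)) = p.natDegree := by
  have ht : t ∈ h.valuationRing hp := by simpa using h.aeval_mem_valuationRing hp X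
  let res := IsLocalRing.residue (h.valuationRing hp)
  let φ : k[X] →ₐ[k] IsLocalRing.ResidueField (h.valuationRing hp) := aeval (res ⟨t, ht⟩)
  have hφ : ∀ a : k[X], φ a = res ⟨aeval t a, h.aeval_mem_valuationRing hp a⟩ := by
    intro a
    induction a using Polynomial.induction_on with
    | C c =>
      change aeval _ (C c) = _
      rw [aeval_C, halg]
      congr 2
      simp
    | add a b ha hb =>
      rw [map_add, ha, hb, ← map_add]
      congr 1
      exact Subtype.ext (map_add (aeval t) a b).symm
    | monomial n c ih =>
      rw [pow_succ, ← mul_assoc, map_mul, ih, show φ X = res ⟨t, ht⟩ from aeval_X _, ← map_mul]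
      congr 1
      refine Subtype.ext ?_
      change aeval t (C c * X ^ n) * t = aeval t (C c * X ^ n * X)
      rw [map_mul _ _ X, aeval_X]
  have hzero : ∀ f (hf : f ∈ h.valuationRing hp),
      res ⟨f, hf⟩ = 0 ↔ f = 0 ∨ f⁻¹ ∉ h.localRing hp := by
    intro f hf
    change IsLocalRing.residue _ _ = 0 ↔ _
    rw [IsLocalRing.residue_eq_zero_iff, IsLocalRing.mem_maximalIdeal, mem_nonunits_iff]
    by_cases h0 : f = 0
    · subst h0
      simp only [true_or, iff_true]
      exact fun hu => hu.ne_zero rfl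
    · rw [← not_iff_not, not_not, not_or, not_not]
      exact (Subring.isUnit_iff_inv_mem (R := h.localRing hp) hf h0).trans
        ⟨fun e => ⟨h0, e⟩, fun e => e.2⟩
  have hker : RingHom.ker φ = Ideal.span {p} := by
    ext a
    rw [RingHom.mem_ker, hφ, hzero, Ideal.mem_span_singleton]
    by_cases ha : a = 0
    · simp [ha]
    · rw [h.inv_mem hp ha, not_not]
      simp [h.aeval_ne_zero ha]
  have hsurj : Function.Surjective φ := by
    intro y
    obtain ⟨⟨f, hf⟩, rfl⟩ := IsLocalRing.residue_surjective y
    obtain ⟨a, b, hb, hfab⟩ := hf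
    obtain ⟨u, w, huw⟩ := (hp.irreducible.coprime_iff_not_dvd.2 hb : IsCoprime p b)
    have hb0' : b ≠ 0 := ne_zero_of_not_dvd hb
    have hb0 : aeval t b ≠ 0 := h.aeval_ne_zero hb0'
    refine ⟨a * w, ?_⟩
    have hbV : (aeval t b)⁻¹ ∈ h.valuationRing hp := (h.inv_mem hp hb0').2 hb
    have hb1 : res ⟨(aeval t b)⁻¹, hbV⟩ = φ w := by
      have hpz : φ p = 0 := by
        have : p ∈ RingHom.ker φ := by rw [hker]; exact Ideal.mem_span_singleton_self p
        exact this
      have e1 : φ w * φ b = 1 := by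
        rw [← map_mul, eq_sub_of_add_eq' huw, map_sub, map_mul, hpz, mul_zero, sub_zero, map_one]
      refine mul_right_cancel₀ (right_ne_zero_of_mul_eq_one e1) ?_
      rw [e1, hφ b, ← map_mul, ← map_one res]
      congr 1
      exact Subtype.ext (inv_mul_cancel₀ hb0)
    rw [map_mul, ← hb1, hφ, ← map_mul]
    congr 1
    exact Subtype.ext ((div_eq_mul_inv _ _).symm.trans hfab.symm)
  rw [← finrank_quotient_span_eq_natDegree (f := p),
    ← (Ideal.quotientKerAlgEquivOfSurjective hsurj).toLinearEquiv.finrank_eq]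
  exact (Ideal.quotientEquivAlgOfEq k hker).toLinearEquiv.finrank_eq

end IsRationalGenerator

end RationalFunctionField

end

noncomputable section

namespace Model

open Polynomial

variable {k K : Type*} [Field k] [Field K] [Algebra k K] {Y : Model k K} {c : Y.points}

/-! ### Degrees of divisors on rational curves -/

lemma _root_.IsUniformizer.ordAlong_zpow {F : Type*} [Field F] {R : Subring F} {π f : F}
    (h : IsUniformizer R π) (hf : f ≠ 0) (j : ℤ) :
    ordAlong R (f ^ j) = j * ordAlong R f := by
  have hnat : ∀ m : ℕ, ordAlong R (f ^ m) = m * ordAlong R f := fun m => by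
    induction m with
    | zero => simp [h.ordAlong_one]
    | succ m ih =>
      rw [pow_succ, h.ordAlong_mul (pow_ne_zero _ hf) hf, ih]
      push_cast
      ring
  obtain ⟨m, rfl | rfl⟩ := j.eq_nat_or_neg
  · rw [zpow_natCast, hnat]
  · rw [zpow_neg, zpow_natCast, h.ordAlong_inv (pow_ne_zero _ hf), hnat, neg_mul]

lemma Place.ext {v w : Place c} (e : v.ring = w.ring) : v = w := by
  cases v; cases w; cases e; rfl

variable {t : residueField c} (h : IsRationalGenerator k t)

/-- The place of a rational curve given by a prime polynomial. -/
def primePlace {p : k[X]} (hp : Prime p) : Place c where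
  ring := h.valuationRing hp
  algebraMap_mem a := by simpa using h.aeval_mem_valuationRing hp (C a)
  ne_top := h.valuationRing_ne_top hp

/-- The place of a rational curve at which the coordinate vanishes. -/
def zeroPlace : Place c := primePlace h prime_X

/-- The place of a rational curve at which the coordinate has a pole. -/
def infPlace : Place c := primePlace h.inv prime_X

lemma degree_primePlace {p : k[X]} (hp : Prime p) : (primePlace h hp).degree = p.natDegree := by
  unfold Place.degree
  let _ : Algebra k (IsLocalRing.ResidueField (h.valuationRing hp)) :=
    ((IsLocalRing.residue (h.valuationRing hp)).comp
      ((algebraMap k (residueField c)).codRestrict (h.valuationRing hp).toSubring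
        (primePlace h hp).algebraMap_mem)).toAlgebra
  exact h.finrank_residueField hp (primePlace h hp).algebraMap_mem fun a => rfl

lemma degree_zeroPlace : (zeroPlace h).degree = 1 := by
  rw [zeroPlace, degree_primePlace, natDegree_X]

lemma degree_infPlace : (infPlace h).degree = 1 := by
  rw [infPlace, degree_primePlace, natDegree_X]

lemma notMem_infPlace : t ∉ (infPlace h).ring := by
  have := (h.inv.isUniformizer prime_X).inv_notMem
  rwa [aeval_X, inv_inv] at this

lemma eq_infPlace {v : Place c} (hv : t ∉ v.ring) : v = infPlace h := by
  refine Place.ext (h.inv.eq_valuationRing prime_X v.algebraMap_mem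
    ((v.ring.mem_or_inv_mem t).resolve_left hv) ?_)
  rwa [aeval_X, inv_inv]

lemma eq_primePlace {v : Place c} (hv : t ∈ v.ring) {p : k[X]} (hp : Prime p)
    (hpv : (aeval t p)⁻¹ ∉ v.ring) : v = primePlace h hp :=
  Place.ext (h.eq_valuationRing hp v.algebraMap_mem hv hpv)

include h in
lemma exists_isUniformizer_place (v : Place c) : ∃ π, IsUniformizer v.ring.toSubring π := by
  by_cases hv : t ∈ v.ring
  · obtain ⟨p, hp, e⟩ := h.exists_eq_valuationRing v.algebraMap_mem v.ne_top hv
    rw [e]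
    exact ⟨_, h.isUniformizer hp⟩
  · rw [eq_infPlace h hv]
    exact ⟨_, h.inv.isUniformizer prime_X⟩

/-- Write `a(t)` as `t ^ deg a` times the reversed polynomial at `t⁻¹`; the latter has nonzero
constant term, hence order `0` at infinity. -/
lemma ordAlong_infPlace {a : k[X]} (ha : a ≠ 0) :
    ordAlong (infPlace h).ring.toSubring (aeval t a) = -a.natDegree := by
  have hu := h.inv.isUniformizer prime_X
  have hr : ¬ X ∣ a.reverse := by
    rw [X_dvd_iff, coeff_zero_reverse]
    exact leadingCoeff_ne_zero.2 ha
  have h0 := h.inv.ordAlong_aeval_eq_zero prime_X hr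
  have hpow : ordAlong (h.inv.localRing prime_X) (t ^ a.natDegree) = -a.natDegree := by
    refine hu.ordAlong_eq (pow_ne_zero _ h.ne_zero) ?_
    have : t ^ a.natDegree * (aeval t⁻¹ (X : k[X])) ^ (-(-(a.natDegree : ℤ))) = 1 := by
      rw [neg_neg, aeval_X, zpow_natCast, ← mul_pow, mul_inv_cancel₀ h.ne_zero, one_pow]
    rw [this, inv_one]
    exact ⟨one_mem _, one_mem _⟩
  change ordAlong (h.inv.localRing prime_X) _ = _
  rw [Polynomial.aeval_eq_pow_mul_aeval_inv_reverse h.ne_zero a,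
    hu.ordAlong_mul (pow_ne_zero _ h.ne_zero)
      (h.inv.aeval_ne_zero (IsRationalGenerator.ne_zero_of_not_dvd hr)), h0, hpow, add_zero]

lemma ordAlong_primePlace_self {p : k[X]} (hp : Prime p) :
    ordAlong (primePlace h hp).ring.toSubring (aeval t p) = 1 :=
  (h.isUniformizer hp).ordAlong_self

lemma primePlace_ne_infPlace {p : k[X]} (hp : Prime p) : primePlace h hp ≠ infPlace h := by
  intro e
  apply notMem_infPlace h
  rw [← e]
  have := h.aeval_mem_valuationRing hp X
  rw [aeval_X] at this
  exact this

lemma ordAlong_aeval_prime_eq_zero {p : k[X]} (hp : Prime p) {v : Place c}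
    (h1 : v ≠ primePlace h hp) (h2 : v ≠ infPlace h) :
    ordAlong v.ring.toSubring (aeval t p) = 0 := by
  obtain ⟨π, hπ⟩ := exists_isUniformizer_place h v
  have ht : t ∈ v.ring := by_contra fun e => h2 (eq_infPlace h e)
  have hp' : (aeval t p)⁻¹ ∈ v.ring := by_contra fun e => h1 (eq_primePlace h ht hp e)
  refine hπ.ordAlong_eq (h.aeval_ne_zero hp.ne_zero) ?_
  simpa using ⟨ValuationSubring.aeval_mem v.algebraMap_mem ht p, hp'⟩

include h in
/-- The product formula for a rational curve. -/
lemma finsum_degree_mul_ord {f : residueField c} (hf : f ≠ 0) :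
    (Function.support fun v : Place c => (v.degree : ℤ) * ordAlong v.ring.toSubring f).Finite ∧
      ∑ᶠ v : Place c, (v.degree : ℤ) * ordAlong v.ring.toSubring f = 0 := by
  classical
  let P : residueField c → Prop := fun f =>
    (Function.support fun v : Place c => (v.degree : ℤ) * ordAlong v.ring.toSubring f).Finite ∧
      ∑ᶠ v : Place c, (v.degree : ℤ) * ordAlong v.ring.toSubring f = 0
  choose π hπ using exists_isUniformizer_place h
  have hmul : ∀ f g : residueField c, f ≠ 0 → g ≠ 0 → P f → P g → P (f * g) := by
    intro f g hf hg hPf hPg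
    have e : (fun v : Place c => (v.degree : ℤ) * ordAlong v.ring.toSubring (f * g)) = fun v =>
        (v.degree : ℤ) * ordAlong v.ring.toSubring f +
          (v.degree : ℤ) * ordAlong v.ring.toSubring g := by
      funext v
      rw [(hπ v).ordAlong_mul hf hg, mul_add]
    refine ⟨?_, ?_⟩
    · rw [e]
      exact (hPf.1.union hPg.1).subset (Function.support_add _ _)
    · rw [e, finsum_add_distrib hPf.1 hPg.1, hPf.2, hPg.2, add_zero]
  have hinv : ∀ f : residueField c, f ≠ 0 → P f → P f⁻¹ := by
    intro f hf hPf
    have e : (fun v : Place c => (v.degree : ℤ) * ordAlong v.ring.toSubring f⁻¹) = fun v =>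
        -((v.degree : ℤ) * ordAlong v.ring.toSubring f) := by
      funext v
      rw [(hπ v).ordAlong_inv hf, mul_neg]
    refine ⟨?_, ?_⟩
    · rw [e]
      exact hPf.1.subset fun v hv hv' => hv (by beta_reduce at hv' ⊢; rw [hv', neg_zero])
    · rw [e, finsum_neg_distrib, hPf.2, neg_zero]
  -- Only two places contribute: the one of `p`, with degree `deg p` and order `1`, and infinity,
  -- with degree `1` and order `-deg p`.
  have hprime : ∀ p : k[X], Prime p → P (aeval t p) := by
    intro p hp
    have hsub : (Function.support fun v : Place c =>
        (v.degree : ℤ) * ordAlong v.ring.toSubring (aeval t p)) ⊆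
        (({primePlace h hp, infPlace h} : Finset (Place c)) : Set (Place c)) := by
      intro v hv
      by_contra hcon
      simp only [Finset.coe_insert, Finset.coe_singleton, Set.mem_insert_iff,
        Set.mem_singleton_iff, not_or] at hcon
      exact hv (by beta_reduce; rw [ordAlong_aeval_prime_eq_zero h hp hcon.1 hcon.2, mul_zero])
    refine ⟨(Finset.finite_toSet _).subset hsub, ?_⟩
    rw [finsum_eq_sum_of_support_subset _ hsub, Finset.sum_pair (primePlace_ne_infPlace h hp),
      ordAlong_infPlace h hp.ne_zero, ordAlong_primePlace_self, degree_primePlace,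
      degree_infPlace]
    simp
  have hunit : ∀ a : k, a ≠ 0 → P (algebraMap k _ a) := by
    intro a ha
    have e : (fun v : Place c =>
        (v.degree : ℤ) * ordAlong v.ring.toSubring (algebraMap k (residueField c) a)) = 0 := by
      funext v
      rw [(hπ v).ordAlong_eq (m := 0) ((_root_.map_ne_zero _).2 ha) (by
        rw [neg_zero, zpow_zero, mul_one, ← map_inv₀]
        exact ⟨v.algebraMap_mem a, v.algebraMap_mem _⟩), mul_zero]
      rfl
    exact ⟨by rw [e]; simp, by rw [e]; exact finsum_zero⟩
  have hpoly : ∀ b : k[X], b ≠ 0 → P (aeval t b) := by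
    intro b hb
    induction b using UniqueFactorizationMonoid.induction_on_prime with
    | h₁ => exact absurd rfl hb
    | h₂ x hx =>
      obtain ⟨a, ha, rfl⟩ := Polynomial.isUnit_iff.1 hx
      rw [aeval_C]; exact hunit a ha.ne_zero
    | h₃ a p ha hp ih =>
      rw [map_mul]
      exact hmul _ _ (h.aeval_ne_zero hp.ne_zero) (h.aeval_ne_zero ha) (hprime p hp) (ih ha)
  obtain ⟨a, b, hb, rfl⟩ := h.exists_fraction f
  have ha : a ≠ 0 := by rintro rfl; simp at hf
  rw [div_eq_mul_inv]
  exact hmul _ _ (h.aeval_ne_zero ha) (inv_ne_zero (h.aeval_ne_zero hb)) (hpoly a ha)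
    (hinv _ (h.aeval_ne_zero hb) (hpoly b hb))

/-- The degree of a divisor on a rational curve which is principal away from the points `0` and
`∞`. -/
lemma finsum_degree_mul_ord_of_eq {q : Place c → residueField c} {f : residueField c} (hf : f ≠ 0)
    (m : Place c → ℤ)
    (hq : ∀ v : Place c, ordAlong v.ring.toSubring (q v) =
      m v * ordAlong v.ring.toSubring t + ordAlong v.ring.toSubring f) :
    ∑ᶠ v : Place c, (v.degree : ℤ) * ordAlong v.ring.toSubring (q v) =
      m (zeroPlace h) - m (infPlace h) := by
  classical
  have e : (fun v : Place c => (v.degree : ℤ) * ordAlong v.ring.toSubring (q v)) = fun v =>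
      m v * ((v.degree : ℤ) * ordAlong v.ring.toSubring t) +
        (v.degree : ℤ) * ordAlong v.ring.toSubring f := by
    funext v
    rw [hq v]; ring
  have hsub : (Function.support fun v : Place c =>
      m v * ((v.degree : ℤ) * ordAlong v.ring.toSubring t)) ⊆
      (({zeroPlace h, infPlace h} : Finset (Place c)) : Set (Place c)) := by
    intro v hv
    by_contra hcon
    simp only [Finset.coe_insert, Finset.coe_singleton, Set.mem_insert_iff,
      Set.mem_singleton_iff, not_or] at hcon
    have := ordAlong_aeval_prime_eq_zero h prime_X hcon.1 hcon.2
    rw [aeval_X] at this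
    exact hv (by beta_reduce; rw [this, mul_zero, mul_zero])
  have h1 := ordAlong_primePlace_self h prime_X
  have h2 := ordAlong_infPlace h (X_ne_zero (R := k))
  rw [aeval_X] at h1 h2
  obtain ⟨hfin, hsum⟩ := finsum_degree_mul_ord h hf
  rw [e, finsum_add_distrib ((Finset.finite_toSet _).subset hsub) hfin, hsum, add_zero,
    finsum_eq_sum_of_support_subset _ hsub,
    Finset.sum_pair (a := zeroPlace h) (primePlace_ne_infPlace h prime_X),
    h2, degree_infPlace, degree_zeroPlace, show ordAlong (zeroPlace h).ring.toSubring t = 1 from h1,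
    natDegree_X]
  push_cast
  ring

end Model

end

noncomputable section

open scoped BigOperators

namespace Model

variable {k K : Type*} [Field k] [Field K] [Algebra k K] {X : Model k K} {c : X.points}

/-! ### Values of rational functions -/

lemma valueAt_of_mem {f : K} (hf : f ∈ c.1.toSubring) :
    valueAt c f = IsLocalRing.residue c.1.toSubring ⟨f, hf⟩ := dif_pos hf

lemma valueAt_algebraMap (a : k) :
    valueAt c (algebraMap k K a) = algebraMap k (residueField c) a :=
  valueAt_of_mem (X.algebraMap_mem c.1 c.2 a)

lemma valueAt_mul {f g : K} (hf : f ∈ c.1.toSubring) (hg : g ∈ c.1.toSubring) :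
    valueAt c (f * g) = valueAt c f * valueAt c g := by
  rw [valueAt_of_mem hf, valueAt_of_mem hg, valueAt_of_mem (mul_mem hf hg), ← map_mul]
  rfl

lemma valueAt_add {f g : K} (hf : f ∈ c.1.toSubring) (hg : g ∈ c.1.toSubring) :
    valueAt c (f + g) = valueAt c f + valueAt c g := by
  rw [valueAt_of_mem hf, valueAt_of_mem hg, valueAt_of_mem (add_mem hf hg), ← map_add]
  rfl

lemma valueAt_sub {f g : K} (hf : f ∈ c.1.toSubring) (hg : g ∈ c.1.toSubring) :
    valueAt c (f - g) = valueAt c f - valueAt c g := by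
  rw [valueAt_of_mem hf, valueAt_of_mem hg, valueAt_of_mem (sub_mem hf hg), ← map_sub]
  rfl

@[simp] lemma valueAt_one : valueAt c (1 : K) = 1 := by
  rw [valueAt_of_mem (one_mem _)]
  exact map_one (IsLocalRing.residue c.1.toSubring)

lemma valueAt_neg {f : K} (hf : f ∈ c.1.toSubring) : valueAt c (-f) = -valueAt c f := by
  rw [valueAt_of_mem hf, valueAt_of_mem (neg_mem hf), ← map_neg]
  rfl

@[simp] lemma valueAt_zero : valueAt c (0 : K) = 0 := by
  rw [valueAt_of_mem (zero_mem _)]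
  exact map_zero (IsLocalRing.residue c.1.toSubring)

lemma valueAt_ne_zero {f : K} (hf : f ∈ c.1.toSubring) (h0 : f ≠ 0) :
    valueAt c f ≠ 0 ↔ f⁻¹ ∈ c.1.toSubring := by
  rw [valueAt_of_mem hf, Ne, IsLocalRing.residue_eq_zero_iff, IsLocalRing.mem_maximalIdeal,
    mem_nonunits_iff, not_not, Subring.isUnit_iff_inv_mem hf h0]

lemma valueAt_inv {f : K} (hf : f ∈ c.1.toSubring) (hf' : f⁻¹ ∈ c.1.toSubring) :
    valueAt c f⁻¹ = (valueAt c f)⁻¹ := by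
  by_cases h0 : f = 0
  · simp [h0]
  · refine eq_inv_of_mul_eq_one_left ?_
    rw [← valueAt_mul hf' hf, inv_mul_cancel₀ h0, valueAt_one]

lemma valueAt_pow {f : K} (hf : f ∈ c.1.toSubring) (m : ℕ) :
    valueAt c (f ^ m) = valueAt c f ^ m := by
  induction m with
  | zero => simp
  | succ m ih => rw [pow_succ, pow_succ, valueAt_mul (pow_mem hf m) hf, ih]

lemma valueAt_zpow {f : K} (hf : f ∈ c.1.toSubring) (hf' : f⁻¹ ∈ c.1.toSubring) (m : ℤ) :
    valueAt c (f ^ m) = valueAt c f ^ m := by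
  cases m with
  | ofNat m => simpa using valueAt_pow hf m
  | negSucc m =>
    rw [zpow_negSucc, zpow_negSucc, ← inv_pow, ← inv_pow, valueAt_pow hf', valueAt_inv hf hf']

lemma valueAt_aeval {f : K} (hf : f ∈ c.1.toSubring) (p : Polynomial k) :
    Polynomial.aeval f p ∈ c.1.toSubring ∧
      valueAt c (Polynomial.aeval f p) = Polynomial.aeval (valueAt c f) p := by
  induction p using Polynomial.induction_on with
  | C a =>
    rw [Polynomial.aeval_C, Polynomial.aeval_C]
    exact ⟨X.algebraMap_mem c.1 c.2 a, valueAt_algebraMap a⟩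
  | add p q hp hq =>
    rw [map_add, map_add, valueAt_add hp.1 hq.1, hp.2, hq.2]
    exact ⟨add_mem hp.1 hq.1, rfl⟩
  | monomial n a ih =>
    rw [pow_succ, ← mul_assoc, map_mul (Polynomial.aeval f) _ Polynomial.X,
      map_mul (Polynomial.aeval (valueAt c f)) _ Polynomial.X, Polynomial.aeval_X,
      Polynomial.aeval_X, valueAt_mul ih.1 hf, ih.2]
    exact ⟨mul_mem ih.1 hf, rfl⟩

lemma exists_valueAt_eq (y : residueField c) : ∃ f ∈ c.1.toSubring, valueAt c f = y := by
  obtain ⟨⟨f, hf⟩, rfl⟩ := IsLocalRing.residue_surjective y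
  exact ⟨f, hf, valueAt_of_mem hf⟩

/-- A nonzero element of a valuation ring has nonnegative order along it. -/
lemma _root_.ordAlong_nonneg_of_mem {F : Type*} [Field F] {R : Subring F} {f : F} (hf : f ∈ R) :
    0 ≤ ordAlong R f := by
  unfold ordAlong
  split_ifs with h
  · obtain ⟨π, hπ, u, e⟩ := h.choose_spec
    by_contra! hneg
    refine hπ.not_isUnit ?_
    set m := h.choose
    have hπ0 : (π : F) ≠ 0 := fun e => hπ.ne_zero (Subtype.ext e)
    obtain ⟨j, hj⟩ := Int.exists_eq_neg_ofNat hneg.le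
    have hj0 : j ≠ 0 := by rintro rfl; omega
    have e' : (⟨f, hf⟩ : R) * π ^ j = u := by
      refine Subtype.ext ?_
      change f * (π : F) ^ j = _
      rw [e, hj, mul_assoc, zpow_neg, zpow_natCast, inv_mul_cancel₀ (pow_ne_zero _ hπ0), mul_one]
    exact (isUnit_pow_iff hj0).1 (isUnit_of_mul_isUnit_right (e' ▸ u.isUnit))
  · exact le_rfl

lemma isCurve_of_isRationalGenerator {t : residueField c} (h : IsRationalGenerator k t) :
    IsCurve c := by
  have hind : AlgebraicIndependent k (Subtype.val : ({t} : Set (residueField c)) → _) :=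
    algebraicIndependent_unique_type_iff.2 h.transcendental
  have halg : Algebra.IsAlgebraic (Algebra.adjoin k {t}) (residueField c) := by
    refine ⟨fun f => ?_⟩
    obtain ⟨a, b, -, rfl⟩ := h.exists_fraction f
    have hm : ∀ p : Polynomial k,
        IsAlgebraic (Algebra.adjoin k {t}) (Polynomial.aeval t p) := fun p =>
      isAlgebraic_algebraMap (⟨_, Polynomial.aeval_mem_adjoin_singleton k t⟩ :
        Algebra.adjoin k {t})
    rw [div_eq_mul_inv]
    exact (hm a).mul (hm b).inv
  refine le_antisymm ?_ ?_
  · exact (Algebra.IsAlgebraic.trdeg_le_cardinalMk (R := k) (s := {t})).trans (by simp)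
  · simpa using hind.cardinalMk_le_trdeg

end Model

end

noncomputable section

open scoped BigOperators

section OrbitCurves

variable {k : Type*} [Field k] {n : ℕ}

/-! ### Curves in torus orbits -/

/-- The lattice vectors orthogonal to a cone. -/
def orthogonalLattice (σ : PointedCone ℝ (Fin n → ℝ)) : AddSubgroup (Fin n → ℤ) where
  carrier := {u | ∀ v ∈ σ, pairing u v = 0}
  zero_mem' v _ := by simp [pairing]
  add_mem' hu hu' v hv := by rw [pairing_add_left, hu v hv, hu' v hv, add_zero]
  neg_mem' hu v hv := by rw [pairing_neg_left, hu v hv, neg_zero]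

lemma orthogonalLattice_le_dual {σ : PointedCone ℝ (Fin n → ℝ)} {u : Fin n → ℤ}
    (hu : u ∈ orthogonalLattice σ) : u ∈ dualSemigroup σ := fun v hv => (hu v hv).ge

lemma add_mem_orthogonalLattice_iff {σ : PointedCone ℝ (Fin n → ℝ)} {u u' : Fin n → ℤ}
    (hu : u ∈ dualSemigroup σ) (hu' : u' ∈ dualSemigroup σ) :
    u + u' ∈ orthogonalLattice σ ↔ u ∈ orthogonalLattice σ ∧ u' ∈ orthogonalLattice σ := by
  refine ⟨fun h => ⟨fun v hv => ?_, fun v hv => ?_⟩, fun h => add_mem h.1 h.2⟩ <;>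
  · have h1 := h v hv
    rw [pairing_add_left] at h1
    have h2 := hu v hv
    have h3 := hu' v hv
    linarith

/-- The image of `H` under pairing with `v` is a nonzero cyclic subgroup of `ℤ`; `u₀` maps to its
positive generator. It is needed because `v` need not be primitive modulo the span of the cone. -/
lemma exists_generator_pairing {H : AddSubgroup (Fin n → ℤ)} {v : Fin n → ℤ}
    (hv : ∃ u ∈ H, u ⬝ᵥ v ≠ 0) :
    ∃ u₀ ∈ H, 0 < u₀ ⬝ᵥ v ∧ ∀ u ∈ H, u₀ ⬝ᵥ v ∣ u ⬝ᵥ v := by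
  let f : (Fin n → ℤ) →+ ℤ :=
    { toFun := fun u => u ⬝ᵥ v, map_zero' := zero_dotProduct v,
      map_add' := fun a b => add_dotProduct a b v }
  obtain ⟨g, hg⟩ := Int.subgroup_cyclic (H.map f)
  rw [← AddSubgroup.zmultiples_eq_closure] at hg
  have hdvd : ∀ u ∈ H, g ∣ u ⬝ᵥ v := fun u hu => by
    have : f u ∈ H.map f := ⟨u, hu, rfl⟩
    rw [hg] at this
    exact Int.mem_zmultiples_iff.1 this
  obtain ⟨u, hu, he⟩ : g ∈ H.map f := by rw [hg]; exact AddSubgroup.mem_zmultiples g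
  replace he : u ⬝ᵥ v = g := he
  have hg0 : g ≠ 0 := by
    rintro rfl
    obtain ⟨u', hu', h0⟩ := hv
    exact h0 (zero_dvd_iff.1 (hdvd u' hu'))
  rcases hg0.lt_or_gt with h | h
  · refine ⟨-u, neg_mem hu, by rw [neg_dotProduct, he]; omega, fun u' hu' => ?_⟩
    rw [neg_dotProduct, he, neg_dvd]; exact hdvd u' hu'
  · exact ⟨u, hu, by rwa [he], fun u' hu' => by rw [he]; exact hdvd u' hu'⟩

open LaurentPolynomial in
/-- The restriction of functions on an affine toric variety to the closure of a curve in its closed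
orbit. -/
lemma exists_restriction_curve (k : Type*) [Field k] (σ : PointedCone ℝ (Fin n → ℝ))
    {v : Fin n → ℤ} {d : ℤ} (hd : ∀ u ∈ orthogonalLattice σ, d ∣ u ⬝ᵥ v) :
    ∃ ρ : coneAlgebra k σ →ₐ[k] k[T;T⁻¹],
      (∀ (u : Fin n → ℤ) (hu : u ∈ orthogonalLattice σ),
        ρ ⟨chi k u, chi_mem_coneAlgebra.2 (orthogonalLattice_le_dual hu)⟩ = T (u ⬝ᵥ v / d)) ∧
      ∀ (u : Fin n → ℤ) (hu : u ∈ dualSemigroup σ), u ∉ orthogonalLattice σ →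
        ρ ⟨chi k u, chi_mem_coneAlgebra.2 hu⟩ = 0 := by
  classical
  -- Extension by zero off `σ^⊥` is multiplicative because a sum of two elements of `σ^∨` lies in
  -- `σ^⊥` only if both do.
  let θ₀ : Multiplicative (dualSemigroup σ) →* k[T;T⁻¹] :=
    { toFun := fun u => if u.toAdd.1 ∈ orthogonalLattice σ then T (u.toAdd.1 ⬝ᵥ v / d) else 0
      map_one' := by simp [zero_mem]
      map_mul' := fun a b => by
        simp only [toAdd_mul, AddSubmonoid.coe_add,
          add_mem_orthogonalLattice_iff a.toAdd.2 b.toAdd.2]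
        by_cases ha : a.toAdd.1 ∈ orthogonalLattice σ
        · by_cases hb : b.toAdd.1 ∈ orthogonalLattice σ
          · rw [if_pos ⟨ha, hb⟩, if_pos ha, if_pos hb, ← T_add, add_dotProduct,
              Int.add_ediv_of_dvd_left (hd _ ha)]
          · rw [if_neg fun h => hb h.2, if_neg hb, mul_zero]
        · rw [if_neg fun h => ha h.1, if_neg ha, zero_mul] }
  let θ : AddMonoidAlgebra k (dualSemigroup σ) →ₐ[k] k[T;T⁻¹] := AddMonoidAlgebra.lift k _ _ θ₀
  let ι : AddMonoidAlgebra k (dualSemigroup σ) →ₐ[k] ToricField k n :=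
    (IsScalarTower.toAlgHom k (TorusRing k n) (ToricField k n)).comp
      (AddMonoidAlgebra.mapDomainAlgHom k k (dualSemigroup σ).subtype)
  have hιs : ∀ u : dualSemigroup σ, ι (AddMonoidAlgebra.single u 1) = chi k u.1 := fun u => by
    change toField (AddMonoidAlgebra.mapDomain _ (AddMonoidAlgebra.single u 1)) = _
    rw [AddMonoidAlgebra.mapDomain_single]
    rfl
  have hinj : Function.Injective ι := (IsFractionRing.injective (TorusRing k n) _).comp
    (AddMonoidAlgebra.mapDomain_injective Subtype.val_injective)
  have hrange : ι.range = coneAlgebra k σ := by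
    refine le_antisymm ?_ (Algebra.adjoin_le ?_)
    · rintro _ ⟨p, rfl⟩
      induction p using AddMonoidAlgebra.induction_on with
      | of u =>
        change ι (AddMonoidAlgebra.single u 1) ∈ _
        rw [hιs]; exact chi_mem_coneAlgebra.2 u.2
      | add p q hp hq =>
        have e : ι (p + q) = ι p + ι q := map_add ι p q
        exact e ▸ add_mem hp hq
      | smul r p hp =>
        have e : ι (r • p) = r • ι p := map_smul ι r p
        exact e ▸ Subalgebra.smul_mem _ hp r
    · rintro _ ⟨u, hu, rfl⟩
      exact ⟨_, hιs ⟨u, hu⟩⟩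
  let e : AddMonoidAlgebra k (dualSemigroup σ) ≃ₐ[k] coneAlgebra k σ :=
    (AlgEquiv.ofInjective ι hinj).trans (Subalgebra.equivOfEq _ _ hrange)
  have he : ∀ u (hu : u ∈ dualSemigroup σ), e.symm ⟨chi k u, chi_mem_coneAlgebra.2 hu⟩ =
      AddMonoidAlgebra.single ⟨u, hu⟩ 1 := fun u hu => by
    rw [AlgEquiv.symm_apply_eq]
    exact Subtype.ext (hιs ⟨u, hu⟩).symm
  refine ⟨θ.comp e.symm.toAlgHom, fun u hu => ?_, fun u hu hu' => ?_⟩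
  · change θ (e.symm _) = _
    rw [he _ (orthogonalLattice_le_dual hu), AddMonoidAlgebra.lift_single, one_smul]
    exact if_pos hu
  · change θ (e.symm _) = _
    rw [he _ hu, AddMonoidAlgebra.lift_single, one_smul]
    exact if_neg hu'

open LaurentPolynomial in
/-- For a cone `σ` of a fan and a lattice direction `v` transversal to it, there is a rational
curve in the orbit of `σ` on which the characters restrict to powers of a coordinate. -/
lemma exists_orbit_curve (k : Type*) [Field k] {Φ : Fan n} {σ} (hσ : σ ∈ Φ.cones)
    {v : Fin n → ℤ} (hv : ∃ u ∈ orthogonalLattice σ, u ⬝ᵥ v ≠ 0) :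
    ∃ (c : (toricVariety k Φ).points) (t : Model.residueField c) (d : ℤ), 0 < d ∧
      IsRationalGenerator k t ∧ IsOrbitCone σ c.1 ∧ ∀ u ∈ orthogonalLattice σ,
        d ∣ u ⬝ᵥ v ∧ Model.valueAt c (chi k u) = t ^ (u ⬝ᵥ v / d) := by
  obtain ⟨u₀, hu₀, hd0, hd⟩ := exists_generator_pairing hv
  obtain ⟨ρ, hρ, hρ0⟩ := exists_restriction_curve k σ hd
  set d := u₀ ⬝ᵥ v
  let A := coneAlgebra k σ
  -- The kernel of restriction to the curve is prime because the target is a domain; it is the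
  -- generic point of the curve.
  let P : Ideal A.toSubring := RingHom.ker (ρ : A →+* k[T;T⁻¹])
  have hP : P.IsPrime := RingHom.ker_isPrime _
  have hmemP : ∀ f (hf : f ∈ A), (⟨f, hf⟩ : A.toSubring) ∈ P ↔ ρ ⟨f, hf⟩ = 0 := fun f hf => Iff.rfl
  obtain ⟨c, hloc, hval⟩ : ∃ c : (toricVariety k Φ).points,
      IsLocalizationOf A.toSubring c.1.toSubring ∧
      ∀ f (hf : f ∈ A), Model.valueAt c f = 0 ↔ ρ ⟨f, hf⟩ = 0 := by
    have hloc := LocalSubring.isLocalizationOf_ofPrime A.toSubring P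
    refine ⟨⟨_, mem_toricVariety_iff.2 ⟨σ, hσ, hloc⟩⟩, hloc, fun f hf => ?_⟩
    rw [Model.valueAt_of_mem (hloc.le hf), IsLocalRing.residue_eq_zero_iff, ← hmemP]
    exact LocalSubring.mem_maximalIdeal_ofPrime (⟨f, hf⟩ : A.toSubring)
  have hAc : ∀ f, f ∈ A → f ∈ c.1.toSubring := fun f hf => hloc.le hf
  have hvaleq : ∀ f g (hf : f ∈ A) (hg : g ∈ A), ρ ⟨f, hf⟩ = ρ ⟨g, hg⟩ →
      Model.valueAt c f = Model.valueAt c g := fun f g hf hg e => by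
    rw [← sub_eq_zero, ← Model.valueAt_sub (hAc f hf) (hAc g hg), hval _ (sub_mem hf hg),
      ← sub_eq_zero.2 e, ← map_sub]
    rfl
  have hchi : ∀ u, u ∈ orthogonalLattice σ → chi k u ∈ A := fun u hu =>
    chi_mem_coneAlgebra.2 (orthogonalLattice_le_dual hu)
  let χ : A := ⟨chi k u₀, hchi u₀ hu₀⟩
  have hρχ : ρ χ = T 1 := by
    rw [hρ u₀ hu₀, Int.ediv_self hd0.ne']
  have hρpoly : ∀ p : Polynomial k, ρ (Polynomial.aeval χ p) = Polynomial.toLaurent p := by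
    intro p
    rw [← Polynomial.aeval_algHom_apply, hρχ, ← Polynomial.toLaurent_X,
      ← Polynomial.toLaurentAlg_apply, Polynomial.aeval_algHom_apply, Polynomial.aeval_X_left_apply,
      Polynomial.toLaurentAlg_apply]
  have hcoe : ∀ p : Polynomial k, ((Polynomial.aeval χ p : A) : ToricField k n) =
      Polynomial.aeval (chi k u₀) p := fun p => (Polynomial.aeval_algHom_apply A.val χ p).symm
  let t := Model.valueAt c (chi k u₀)
  have hχc : chi k u₀ ∈ c.1.toSubring := hAc _ (hchi _ hu₀)
  have hpoly : ∀ p : Polynomial k, Polynomial.aeval t p =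
      Model.valueAt c ((Polynomial.aeval χ p : A) : ToricField k n) := fun p => by
    rw [hcoe, (Model.valueAt_aeval hχc p).2]
  have hzpow : ∀ u ∈ orthogonalLattice σ, Model.valueAt c (chi k u) = t ^ (u ⬝ᵥ v / d) := by
    intro u hu
    have hu₁ : (u ⬝ᵥ v / d) • u₀ ∈ orthogonalLattice σ := zsmul_mem hu₀ _
    have e : Model.valueAt c (chi k u) = Model.valueAt c (chi k ((u ⬝ᵥ v / d) • u₀)) := by
      refine hvaleq _ _ (hchi u hu) (hchi _ hu₁) ?_
      rw [hρ u hu, hρ _ hu₁, smul_dotProduct, smul_eq_mul, Int.mul_ediv_cancel _ hd0.ne']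
    rw [e, chi_zsmul, Model.valueAt_zpow hχc]
    rw [← chi_neg]
    exact hAc _ (hchi _ (neg_mem hu₀))
  have htrans : Transcendental k t := by
    rw [transcendental_iff]
    intro p hp
    rw [hpoly, hval _ (Polynomial.aeval χ p).2] at hp
    exact Polynomial.toLaurent_injective ((hρpoly p).symm.trans (hp.trans (map_zero _).symm))
  have ht0 : t ≠ 0 := fun e => Polynomial.X_ne_zero
    (transcendental_iff.1 htrans Polynomial.X (by rw [Polynomial.aeval_X, e]))
  -- Regular functions restrict to Laurent polynomials in `t`, so `t` generates the residue field.
  have hfrac : ∀ f, f ∈ A → ∃ (p : Polynomial k) (j : ℕ),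
      Model.valueAt c f * t ^ j = Polynomial.aeval t p := by
    intro f hf
    obtain ⟨j, p, hp⟩ := (ρ ⟨f, hf⟩).exists_T_pow
    refine ⟨p, j, ?_⟩
    have hχj : chi k u₀ ^ j ∈ A := pow_mem (hchi u₀ hu₀) j
    rw [hpoly, ← Model.valueAt_pow hχc, ← Model.valueAt_mul (hAc f hf) (hAc _ hχj)]
    refine hvaleq _ _ (mul_mem hf hχj) (Polynomial.aeval χ p).2 ?_
    have e1 : ρ (⟨f, hf⟩ * χ ^ j) = ρ (Polynomial.aeval χ p) := by
      rw [hρpoly, hp, map_mul, map_pow, hρχ, T_pow, mul_one]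
    exact e1
  refine ⟨c, t, d, hd0, ⟨htrans, fun y => ?_⟩, ⟨hloc, fun u hu hneg => ?_⟩, fun u hu =>
    ⟨hd u hu, hzpow u hu⟩⟩
  · obtain ⟨f, hf, rfl⟩ := Model.exists_valueAt_eq y
    obtain ⟨a, ha, b, hb, hb0, hbinv, rfl⟩ := hloc.frac f hf
    have hbv : Model.valueAt c b ≠ 0 := (Model.valueAt_ne_zero (hAc b hb) hb0).2 hbinv
    obtain ⟨p, i, hp⟩ := hfrac a ha
    obtain ⟨q, j, hq⟩ := hfrac b hb
    have hq0 : q ≠ 0 := by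
      rintro rfl
      rw [map_zero] at hq
      exact mul_ne_zero hbv (pow_ne_zero j ht0) hq
    refine ⟨p * Polynomial.X ^ j, q * Polynomial.X ^ i,
      mul_ne_zero hq0 (pow_ne_zero _ Polynomial.X_ne_zero), ?_⟩
    rw [div_eq_mul_inv, Model.valueAt_mul (hAc a ha) hbinv, Model.valueAt_inv (hAc b hb) hbinv,
      map_mul, map_mul, map_pow, map_pow, Polynomial.aeval_X, ← hp, ← hq]
    field_simp
  · by_contra hcon
    have h0 := (hval _ (chi_mem_coneAlgebra.2 hu)).2 (hρ0 u hu hcon)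
    refine (Model.valueAt_ne_zero (hAc _ (chi_mem_coneAlgebra.2 hu)) (chi_ne_zero u)).2 ?_ h0
    rwa [← chi_neg]

end OrbitCurves

end

noncomputable section

open scoped BigOperators

section IntersectionNumbers

variable {k : Type*} [Field k] {n : ℕ}

/-! ### Intersection numbers with curves in torus orbits -/

/-- The integral linear function `m` gives the toric part of the divisor `D` on the cone `τ`. -/
def Fan.IsCharacterOn (Φ : Fan n) (D : (toricVariety k Φ).ZDiv)
    (τ : PointedCone ℝ (Fin n → ℝ)) (m : Fin n → ℤ) : Prop :=
  ∀ i : Φ.Ray, i.vec ∈ τ → Φ.toricPart k (Model.toRDiv D) i + ((m ⬝ᵥ i.1 : ℤ) : ℝ) = 0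

/-- The function `h` has the right orders in the torus, and the character corrects those along the
invariant divisors through `x` without affecting the torus. -/
lemma Fan.isLocalEquation_mul_chi (Φ : Fan n) {D : (toricVariety k Φ).ZDiv} {h : ToricField k n}
    (h0 : h ≠ 0) (h1 : ∀ p hp, (Φ.torusDiv p hp).ord h = D (Φ.torusDiv p hp))
    (h2 : ∀ i, Φ.toricPart k (Model.toRDiv D) i = ((D (Φ.primeDiv k i) - monVal i.1 h : ℤ) : ℝ))
    {τ} (hτ : τ ∈ Φ.cones) {m : Fin n → ℤ} (hm : Φ.IsCharacterOn D τ m)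
    {x : LocalSubring (ToricField k n)} (hx : IsOrbitCone τ x) :
    Model.IsLocalEquation D x (h * chi k (-m)) := by
  refine ⟨mul_ne_zero h0 (chi_ne_zero _), fun P hP => ?_⟩
  rw [Fan.ord_mul P h0 (chi_ne_zero _)]
  rcases Φ.primeDivisor_cases P with ⟨i, rfl⟩ | ⟨p, hp, rfl⟩
  · have h3 := hm i ((Φ.primeDiv_through_iff i (Φ.isRational hτ) hx).1 hP)
    rw [h2] at h3
    have h4 : D (Φ.primeDiv k i) - monVal i.1 h + m ⬝ᵥ i.1 = 0 := by exact_mod_cast h3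
    rw [Φ.ord_primeDiv i h0, Φ.ord_primeDiv i (chi_ne_zero _), monVal_chi, neg_dotProduct]
    linarith
  · rw [h1, Φ.ord_torusDiv_chi, add_zero]

lemma Fan.div_mem_of_isLocalEquation (Φ : Fan n) {D : (toricVariety k Φ).ZDiv}
    {x : LocalSubring (ToricField k n)} (hx : x ∈ (toricVariety k Φ).points)
    {f g : ToricField k n} (hf : Model.IsLocalEquation D x f) (hg : Model.IsLocalEquation D x g) :
    f / g ∈ x.toSubring := by
  refine Φ.mem_of_ord_nonneg hx (div_ne_zero hf.1 hg.1) fun P hP => ?_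
  rw [div_eq_mul_inv, Fan.ord_mul P hf.1 (inv_ne_zero hg.1), Fan.ord_inv P hg.1, ← hf.2 P hP,
    ← hg.2 P hP, add_neg_cancel]

/-- A monomial valuation ring containing the ring at `y` contains the smaller ring at `x`, so every
generator of `σ` lies in `τ`. -/
lemma IsOrbitCone.le_of_le {Φ : Fan n} {σ τ} (hσ : σ ∈ Φ.cones) (hτ : τ ∈ Φ.cones)
    {x y : LocalSubring (ToricField k n)} (hx : IsOrbitCone τ x) (hy : IsOrbitCone σ y)
    (h : x.toSubring ≤ y.toSubring) : σ ≤ τ := by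
  obtain ⟨s, hs⟩ := Φ.isRational hσ
  have key : ∀ w ∈ s, latticeVec w ∈ τ := fun w hw =>
    (hx.le_monRing_iff (Φ.isRational hτ)).1 (h.trans ((hy.le_monRing_iff (Φ.isRational hσ)).2
      (by rw [hs]; exact Submodule.subset_span ⟨w, hw, rfl⟩)))
  rw [hs]
  refine Submodule.span_le.2 ?_
  rintro _ ⟨w, hw, rfl⟩
  exact key w hw

lemma Fan.sub_mem_orthogonalLattice {Φ : Fan n} {σ} (hσ : σ ∈ Φ.cones)
    {D : (toricVariety k Φ).ZDiv} {m m' : Fin n → ℤ} (hm : Φ.IsCharacterOn D σ m)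
    (hm' : Φ.IsCharacterOn D σ m') : m - m' ∈ orthogonalLattice σ := by
  intro v hv
  obtain ⟨c, -, hc0, rfl⟩ := (Φ.mem_cone_iff hσ).1 hv
  rw [pairing_sum_right]
  refine Finset.sum_eq_zero fun i _ => ?_
  by_cases hi : i.vec ∈ σ
  · rw [pairing_smul_right, Fan.Ray.vec, pairing_latticeVec, sub_dotProduct]
    have h1 := hm i hi
    have h2 := hm' i hi
    push_cast
    rw [show ((m ⬝ᵥ i.1 : ℤ) : ℝ) - ((m' ⬝ᵥ i.1 : ℤ) : ℝ) = 0 by linarith, mul_zero]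
  · rw [hc0 i hi, zero_smul, pairing_zero_right]

/-- The intersection numbers of Cartier divisors with a curve in the orbit of `σ` in the
direction `v`. -/
lemma Fan.exists_curve_intersection (k : Type*) [Field k] {Φ : Fan n} {σ} (hσ : σ ∈ Φ.cones)
    {v : Fin n → ℤ} (hv : ∃ u ∈ orthogonalLattice σ, u ⬝ᵥ v ≠ 0) :
    ∃ c : (toricVariety k Φ).points, Model.IsCurve c ∧ ∃ d : ℤ, 0 < d ∧
      ∀ (D : (toricVariety k Φ).ZDiv) (e : ℤ), Model.IsCartier D →
        Model.IsIntersectionNumber D c e →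
        ∃ τ₁ ∈ Φ.cones, ∃ τ₂ ∈ Φ.cones, σ ≤ τ₁ ∧ σ ≤ τ₂ ∧
          (∀ u ∈ dualSemigroup τ₁, u ∈ orthogonalLattice σ → 0 ≤ u ⬝ᵥ v) ∧
          (∀ u ∈ dualSemigroup τ₂, u ∈ orthogonalLattice σ → u ⬝ᵥ v ≤ 0) ∧
          ∃ m₁ m₂ : Fin n → ℤ, Φ.IsCharacterOn D τ₁ m₁ ∧ Φ.IsCharacterOn D τ₂ m₂ ∧
            d * e = (m₂ - m₁) ⬝ᵥ v := by
  obtain ⟨c, t, d, hd, ht, hc, hval⟩ := exists_orbit_curve k hσ hv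
  refine ⟨c, Model.isCurve_of_isRationalGenerator ht, d, hd, fun D e hD he => ?_⟩
  obtain ⟨g, q, hg, hq, rfl⟩ := he
  obtain ⟨h, h0, h1, h2⟩ := Φ.exists_torus_equation D
  choose x hxc hxq using hq
  choose τ hτ hxτ using fun w => Fan.exists_isOrbitCone_of_mem (hxc w).1
  choose m hm using fun w => Φ.toricPart_of_isCartier hD (hτ w)
  obtain ⟨m₀, hm₀⟩ := Φ.toricPart_of_isCartier hD hσ
  have hle : ∀ w, σ ≤ τ w := fun w => (hxτ w).le_of_le hσ (hτ w) hc (hxc w).2.1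
  have hsub : ∀ w, m₀ - m w ∈ orthogonalLattice σ := fun w =>
    Fan.sub_mem_orthogonalLattice hσ hm₀ fun i hi => hm w i (hle w hi)
  have hxring : ∀ w f, f ∈ (x w).toSubring → Model.valueAt c f ∈ w.ring := fun w f hf =>
    ((hxc w).2.2 ⟨f, hf⟩).1
  have hpow : ∀ w u, u ∈ dualSemigroup (τ w) → u ∈ orthogonalLattice σ →
      t ^ (u ⬝ᵥ v / d) ∈ w.ring := fun w u hu hu' => by
    rw [← (hval u hu').2]
    exact hxring w _ ((hxτ w).le (chi_mem_coneAlgebra.2 hu))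
  have hordt : ∀ (w : Model.Place c) (j : ℤ),
      ordAlong w.ring.toSubring (t ^ j) = j * ordAlong w.ring.toSubring t := fun w j => by
    obtain ⟨π, hπ⟩ := Model.exists_isUniformizer_place ht w
    exact hπ.ordAlong_zpow ht.ne_zero j
  -- The cones `τ₁` and `τ₂` belong to the centers of `t = 0` and `t = ∞`. Characters regular there
  -- restrict to powers of `t` with nonnegative, respectively nonpositive, exponent.
  refine ⟨τ (Model.zeroPlace ht), hτ _, τ (Model.infPlace ht), hτ _, hle _, hle _,
    fun u hu hu' => ?_, fun u hu hu' => ?_, m (Model.zeroPlace ht), m (Model.infPlace ht), hm _,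
    hm _, ?_⟩
  · have h3 := hpow _ u hu hu'
    have hX := ht.isUniformizer Polynomial.prime_X
    rw [Polynomial.aeval_X] at hX
    have h4 : 0 ≤ u ⬝ᵥ v / d := hX.zpow_mem.1 h3
    rw [← Int.ediv_mul_cancel (hval u hu').1]
    positivity
  · have h3 := hpow _ u hu hu'
    have hX := ht.inv.isUniformizer Polynomial.prime_X
    rw [Polynomial.aeval_X] at hX
    have ez : t ^ (u ⬝ᵥ v / d) = t⁻¹ ^ (-(u ⬝ᵥ v / d)) := by rw [inv_zpow', neg_neg]
    rw [ez] at h3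
    have h4 : 0 ≤ -(u ⬝ᵥ v / d) := hX.zpow_mem.1 h3
    rw [← Int.ediv_mul_cancel (hval u hu').1]
    nlinarith
  · have hG : Model.IsLocalEquation D c.1 (h * chi k (-m₀)) :=
      Φ.isLocalEquation_mul_chi h0 h1 h2 hσ hm₀ hc
    have hy : h * chi k (-m₀) / g ∈ c.1.toSubring := Φ.div_mem_of_isLocalEquation c.2 hG hg
    have hy' : (h * chi k (-m₀) / g)⁻¹ ∈ c.1.toSubring := by
      rw [inv_div]; exact Φ.div_mem_of_isLocalEquation c.2 hg hG
    have hy0 : Model.valueAt c (h * chi k (-m₀) / g) ≠ 0 :=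
      (Model.valueAt_ne_zero hy (div_ne_zero hG.1 hg.1)).2 hy'
    -- At every place the pulled back equation has the order of a power of `t` times a fixed
    -- function of total degree zero, so only the places `0` and `∞` contribute.
    rw [Model.finsum_degree_mul_ord_of_eq ht hy0 (fun w => (m₀ - m w) ⬝ᵥ v / d) fun w => ?_]
    · rw [mul_sub, Int.mul_ediv_cancel' (hval _ (hsub _)).1,
        Int.mul_ediv_cancel' (hval _ (hsub _)).1, ← sub_dotProduct]
      congr 1
      abel
    · obtain ⟨π, hπ⟩ := Model.exists_isUniformizer_place ht w
      have hE := Φ.isLocalEquation_mul_chi h0 h1 h2 (hτ w) (hm w) (hxτ w)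
      have hz : q w / (h * chi k (-m w)) ∈ (x w).toSubring :=
        Φ.div_mem_of_isLocalEquation (hxc w).1 (hxq w) hE
      have hz' : (q w / (h * chi k (-m w)))⁻¹ ∈ (x w).toSubring := by
        rw [inv_div]; exact Φ.div_mem_of_isLocalEquation (hxc w).1 hE (hxq w)
      have hzc := (hxc w).2.1 hz
      have hz0 : Model.valueAt c (q w / (h * chi k (-m w))) ≠ 0 :=
        (Model.valueAt_ne_zero hzc (div_ne_zero (hxq w).1 hE.1)).2 ((hxc w).2.1 hz')
      have hchi : chi k (m₀ - m w) ∈ c.1.toSubring :=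
        hc.le (chi_mem_coneAlgebra.2 (orthogonalLattice_le_dual (hsub w)))
      have e : q w / g = q w / (h * chi k (-m w)) * chi k (m₀ - m w) * (h * chi k (-m₀) / g) := by
        rw [chi_sub, chi_neg, chi_neg]
        have := chi_ne_zero (k := k) m₀
        have := chi_ne_zero (k := k) (m w)
        have := hg.1
        field_simp
      have hord : ordAlong w.ring.toSubring (Model.valueAt c (q w / (h * chi k (-m w)))) = 0 := by
        refine hπ.ordAlong_eq hz0 ?_
        rw [neg_zero, zpow_zero, mul_one, ← Model.valueAt_inv hzc ((hxc w).2.1 hz')]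
        exact ⟨hxring w _ hz, hxring w _ hz'⟩
      rw [e, Model.valueAt_mul (mul_mem hzc hchi) hy, Model.valueAt_mul hzc hchi,
        (hval _ (hsub w)).2, hπ.ordAlong_mul (mul_ne_zero hz0 (zpow_ne_zero _ ht.ne_zero)) hy0,
        hπ.ordAlong_mul hz0 (zpow_ne_zero _ ht.ne_zero), hord, zero_add, hordt]

end IntersectionNumbers

end

noncomputable section

open scoped BigOperators Topology

/-! ### Convexity is a local condition -/

/-- A maximum principle. If the inequality failed, subtracting the chord and adding a small `δ (t² -
1)` would give a function vanishing at `±1` and positive at `0`; at its interior maximum the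
quadratic term contradicts the local inequality. -/
lemma two_mul_le_of_eventually {f : ℝ → ℝ} (hf : Continuous f)
    (h : ∀ t, ∀ᶠ ε in 𝓝[>] (0 : ℝ), 2 * f t ≤ f (t + ε) + f (t - ε)) :
    2 * f 0 ≤ f 1 + f (-1) := by
  by_contra! hcon
  set δ := (2 * f 0 - (f 1 + f (-1))) / 4 with hδ
  have hδ0 : 0 < δ := by rw [hδ]; linarith
  let g : ℝ → ℝ := fun t => f t - ((f 1 + f (-1)) / 2 + t * ((f 1 - f (-1)) / 2)) + δ * (t ^ 2 - 1)
  have hg : Continuous g := by fun_prop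
  obtain ⟨t₀, ht₀, hmax⟩ := isCompact_Icc.exists_isMaxOn (Set.nonempty_Icc.2 (by norm_num))
    (hg.continuousOn (s := Set.Icc (-1 : ℝ) 1))
  have hpos : 0 < g t₀ := by
    refine lt_of_lt_of_le ?_ (hmax (⟨by norm_num, by norm_num⟩ : (0 : ℝ) ∈ Set.Icc (-1 : ℝ) 1))
    simp only [g]; rw [hδ] at *; linarith
  have h1 : t₀ ≠ 1 := by
    rintro rfl
    simp only [g] at hpos; linarith
  have h2 : t₀ ≠ -1 := by
    rintro rfl
    simp only [g] at hpos; linarith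
  have h3 : t₀ < 1 := lt_of_le_of_ne ht₀.2 h1
  have h4 : -1 < t₀ := lt_of_le_of_ne ht₀.1 h2.symm
  have hev : ∀ᶠ ε in 𝓝[>] (0 : ℝ), ε < min (1 - t₀) (t₀ + 1) :=
    (eventually_lt_nhds (lt_min (by linarith) (by linarith))).filter_mono nhdsWithin_le_nhds
  obtain ⟨ε, ⟨hε1, hε2⟩, hε0⟩ := ((h t₀).and hev |>.and self_mem_nhdsWithin).exists
  replace hε0 : 0 < ε := hε0
  have h5 := hmax (⟨by linarith, by linarith [min_le_left (1 - t₀) (t₀ + 1)]⟩ :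
    t₀ + ε ∈ Set.Icc (-1 : ℝ) 1)
  have h6 := hmax (⟨by linarith [min_le_right (1 - t₀) (t₀ + 1)], by linarith⟩ :
    t₀ - ε ∈ Set.Icc (-1 : ℝ) 1)
  have h7 : 0 < δ * ε ^ 2 := by positivity
  simp only [g, Set.mem_ofPred_eq] at h5 h6
  nlinarith

section NefCone

variable {k : Type*} [Field k] {n : ℕ}

/-! ### Nef classes -/

lemma Fan.dotProduct_eq_of_isLinear {Φ : Fan n} {σ τ} (hσ : σ ∈ Φ.cones) (hτ : τ ∈ Φ.cones)
    {a : Φ.Ray → ℝ} {m m' : Fin n → ℝ} (hm : ∀ i : Φ.Ray, i.vec ∈ σ → a i + m ⬝ᵥ i.vec = 0)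
    (hm' : ∀ i : Φ.Ray, i.vec ∈ τ → a i + m' ⬝ᵥ i.vec = 0) {w : Fin n → ℝ} (hw : w ∈ σ)
    (hw' : w ∈ τ) : m ⬝ᵥ w = m' ⬝ᵥ w := by
  have hστ := Φ.face_mem σ hσ _ (Φ.inter_face σ hσ τ hτ)
  obtain ⟨c, -, hc0, rfl⟩ := (Φ.mem_cone_iff hστ).1 (⟨hw, hw'⟩ : w ∈ σ ⊓ τ)
  rw [dotProduct_sum, dotProduct_sum]
  refine Finset.sum_congr rfl fun i _ => ?_
  by_cases hi : i.vec ∈ σ ⊓ τ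
  · rw [dotProduct_smul, dotProduct_smul]
    have h1 := hm i hi.1
    have h2 := hm' i hi.2
    congr 1
    linarith
  · rw [hc0 i hi, zero_smul, dotProduct_zero, dotProduct_zero]

/-- The piecewise linear function on a complete fan with given values on the rays. -/
lemma Fan.IsLocallyLinear.exists_function {Φ : Fan n} (hcomplete : ∀ w, ∃ σ ∈ Φ.cones, w ∈ σ)
    {a : Φ.Ray → ℝ} (ha : Φ.IsLocallyLinear a) :
    ∃ ψ : (Fin n → ℝ) → ℝ, ∀ τ ∈ Φ.cones, ∀ m : Fin n → ℝ,
      (∀ i : Φ.Ray, i.vec ∈ τ → a i + m ⬝ᵥ i.vec = 0) → ∀ w ∈ τ, ψ w = -(m ⬝ᵥ w) := by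
  choose σ hσ hw using hcomplete
  choose m hm using fun w => ha (σ w) (hσ w)
  refine ⟨fun w => -(m w ⬝ᵥ w), fun τ hτ m' hm' w hwτ => ?_⟩
  exact congrArg _ (Fan.dotProduct_eq_of_isLinear (hσ w) hτ (hm w) hm' (hw w) hwτ)

/-- Only finitely many generators of `τ^∨` matter. Those positive at `w` remain nonnegative nearby;
those vanishing at the interior point `w` of `σ` are orthogonal to `σ` and are handled by the
hypothesis on `v`. -/
lemma Fan.eventually_add_smul_mem {Φ : Fan n} {σ τ} (hτ : τ ∈ Φ.cones) {w : Fin n → ℝ}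
    (hw : IsRelint σ w) (hle : σ ≤ τ) {v : Fin n → ℤ}
    (h : ∀ u ∈ dualSemigroup τ, u ∈ orthogonalLattice σ → 0 ≤ u ⬝ᵥ v) :
    ∀ᶠ ε in 𝓝[>] (0 : ℝ), w + ε • latticeVec v ∈ τ := by
  obtain ⟨T, hT⟩ := (Φ.isRational hτ).dualSemigroup_fg
  have hev : ∀ u ∈ T, ∀ᶠ ε in 𝓝[>] (0 : ℝ), 0 ≤ pairing u (w + ε • latticeVec v) := by
    intro u hu
    have huτ : u ∈ dualSemigroup τ := hT ▸ AddSubmonoid.subset_closure hu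
    rcases (huτ w (hle hw.1)).eq_or_lt with h0 | hpos
    · have huσ : u ∈ orthogonalLattice σ :=
        hw.2 u (fun v hv => huτ v (hle hv)) h0.symm
      filter_upwards [self_mem_nhdsWithin] with ε hε
      rw [pairing_add_right, pairing_smul_right, ← h0, zero_add, pairing_latticeVec]
      exact mul_nonneg (le_of_lt hε) (by exact_mod_cast h u huτ huσ)
    · have hc : Continuous fun ε : ℝ => pairing u (w + ε • latticeVec v) :=
        (continuous_pairing u).comp (by fun_prop)
      have h1 : (0 : ℝ) < pairing u (w + (0 : ℝ) • latticeVec v) := by simpa using hpos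
      exact ((hc.tendsto 0).eventually (lt_mem_nhds h1)).filter_mono nhdsWithin_le_nhds |>.mono
        fun _ => le_of_lt
  filter_upwards [(Filter.eventually_all_finset T).2 hev] with ε hε
  rw [(Φ.isRational hτ).mem_iff]
  intro u hu
  rw [← hT] at hu
  induction hu using AddSubmonoid.closure_induction with
  | mem u hu => exact hε u hu
  | zero => simp [pairing]
  | add u u' _ _ hu hu' => rw [pairing_add_left]; exact add_nonneg hu hu'

lemma Fan.continuous_of_isLinearOn {Φ : Fan n} (hcomplete : ∀ w, ∃ σ ∈ Φ.cones, w ∈ σ)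
    {ψ : (Fin n → ℝ) → ℝ} (h : ∀ σ ∈ Φ.cones, ∃ m : Fin n → ℝ, ∀ w ∈ σ, ψ w = m ⬝ᵥ w) :
    Continuous ψ := by
  have := Φ.finite.to_subtype
  refine (locallyFinite_of_finite fun σ : Φ.cones => (σ.1 : Set (Fin n → ℝ))).continuous ?_ ?_ ?_
  · refine Set.eq_univ_of_forall fun w => ?_
    obtain ⟨σ, hσ, hw⟩ := hcomplete w
    exact Set.mem_iUnion.2 ⟨⟨σ, hσ⟩, hw⟩
  · exact fun σ => (Φ.isRational σ.2).isClosed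
  · intro σ
    obtain ⟨m, hm⟩ := h σ.1 σ.2
    have hc : Continuous fun w : Fin n → ℝ => m ⬝ᵥ w := by
      simp only [dotProduct]; fun_prop
    exact hc.continuousOn.congr fun w hw => hm w hw

/-- A locally linear function on a complete fan which is locally convex in all lattice directions
is convex. -/
lemma Fan.isSupported_of_eventually {Φ : Fan n} (hcomplete : ∀ w, ∃ σ ∈ Φ.cones, w ∈ σ)
    {a : Φ.Ray → ℝ} (ha : Φ.IsLocallyLinear a) {ψ : (Fin n → ℝ) → ℝ}
    (hψ : ∀ τ ∈ Φ.cones, ∀ m : Fin n → ℝ,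
      (∀ i : Φ.Ray, i.vec ∈ τ → a i + m ⬝ᵥ i.vec = 0) → ∀ w ∈ τ, ψ w = -(m ⬝ᵥ w))
    (hloc : ∀ (w : Fin n → ℝ) (v : Fin n → ℤ), ∀ᶠ ε in 𝓝[>] (0 : ℝ),
      2 * ψ w ≤ ψ (w + ε • latticeVec v) + ψ (w + ε • latticeVec (-v))) :
    Φ.IsSupported a := by
  have hlin : ∀ σ ∈ Φ.cones, ∃ m : Fin n → ℝ, ∀ w ∈ σ, ψ w = m ⬝ᵥ w := fun σ hσ => by
    obtain ⟨m, hm⟩ := ha σ hσ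
    exact ⟨-m, fun w hw => by rw [hψ σ hσ m hm w hw, neg_dotProduct]⟩
  have hcont : Continuous ψ := Fan.continuous_of_isLinearOn hcomplete hlin
  have hsmul : ∀ (c : ℝ), 0 ≤ c → ∀ w, ψ (c • w) = c * ψ w := fun c hc w => by
    obtain ⟨σ, hσ, hw⟩ := hcomplete w
    obtain ⟨m, hm⟩ := hlin σ hσ
    rw [hm w hw, hm _ (σ.smul_mem hc hw), dotProduct_smul, smul_eq_mul]
  have hint : ∀ x y : Fin n → ℤ, ψ (latticeVec x + latticeVec y) ≤
      ψ (latticeVec x) + ψ (latticeVec y) := by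
    intro x y
    -- The line runs in a lattice direction and passes through `2x` at `t = 1` and `2y` at `t = -1`,
    -- with midpoint `x + y`.
    let f : ℝ → ℝ := fun t => ψ (latticeVec x + latticeVec y + t • latticeVec (x - y))
    have hf : Continuous f := hcont.comp (by fun_prop)
    have key := two_mul_le_of_eventually hf fun t => by
      filter_upwards [hloc (latticeVec x + latticeVec y + t • latticeVec (x - y)) (x - y)] with ε hε
      refine hε.trans (le_of_eq ?_)
      simp only [f]
      congr 2
      · rw [add_smul, add_assoc]
      · rw [latticeVec_neg, sub_smul, smul_neg, ← sub_eq_add_neg, add_sub_assoc]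
    have e : ∀ x y : Fin n → ℤ, latticeVec (x - y) = latticeVec x - latticeVec y := fun x y => by
      rw [sub_eq_add_neg, latticeVec_add, latticeVec_neg, ← sub_eq_add_neg]
    have e1 : latticeVec x + latticeVec y + (1 : ℝ) • latticeVec (x - y) =
        (2 : ℝ) • latticeVec x := by rw [e]; module
    have e2 : latticeVec x + latticeVec y + (-1 : ℝ) • latticeVec (x - y) =
        (2 : ℝ) • latticeVec y := by rw [e]; module
    simp only [f, e1, e2, zero_smul, add_zero] at key
    rw [hsmul 2 (by norm_num), hsmul 2 (by norm_num)] at key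
    linarith
  have hadd : ∀ x y, ψ (x + y) ≤ ψ x + ψ y := by
    -- The pairs satisfying subadditivity form a closed set stable under positive scaling, so
    -- integral pairs suffice.
    let C : Set (Fin n ⊕ Fin n → ℝ) := {z | ψ ((fun i => z (Sum.inl i)) + fun i => z (Sum.inr i)) ≤
      ψ (fun i => z (Sum.inl i)) + ψ (fun i => z (Sum.inr i))}
    have hC : C = Set.univ := by
      refine eq_univ_of_isClosed_of_intCast_mem ?_ ?_ ?_
      · exact isClosed_le (hcont.comp (by fun_prop))
          ((hcont.comp (by fun_prop)).add (hcont.comp (by fun_prop)))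
      · intro c hc z hz
        have h1 := mul_le_mul_of_nonneg_left (show _ ≤ _ from hz) hc.le
        rw [mul_add, ← hsmul c hc.le, ← hsmul c hc.le, ← hsmul c hc.le, smul_add] at h1
        exact h1
      · exact fun z => hint (fun i => z (Sum.inl i)) fun i => z (Sum.inr i)
    intro x y
    have : Sum.elim x y ∈ C := hC ▸ Set.mem_univ _
    exact this
  refine Φ.isSupported_iff_exists_convex.2 ⟨ψ, ⟨Φ.cones, Φ.finite, fun τ hτ => ?_,
    hcomplete, fun τ hτ => ?_⟩, fun l u => ?_, fun σ hσ => ?_, fun i => ?_⟩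
  · obtain ⟨s, rfl⟩ := Φ.isRational hτ
    exact ⟨(s.finite_toSet.image _).toFinset, by rw [Set.Finite.coe_toFinset]⟩
  · obtain ⟨m, hm⟩ := hlin τ hτ
    exact isLinearOn_dotProduct m hm
  · induction l with
    | zero => simpa using (hsmul 0 le_rfl 0).le
    | succ l ih =>
      rw [Fin.sum_univ_succ, Fin.sum_univ_succ]
      exact (hadd _ _).trans (by gcongr; exact ih _)
  · obtain ⟨m, hm⟩ := hlin σ hσ
    exact isLinearOn_dotProduct m hm
  · obtain ⟨m, hm⟩ := ha _ i.2.2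
    rw [hψ _ i.2.2 m hm _ (Fan.rayCone_vec_mem i)]
    linarith [hm i (Fan.rayCone_vec_mem i)]

/-- A nef class on a complete toric variety is given by convex data. -/
lemma Fan.exists_isSupported_of_mem_nefCone {Φ : Fan n}
    (hcomplete : ∀ w, ∃ σ ∈ Φ.cones, w ∈ σ) {α : (toricVariety k Φ).ClR}
    (hα : α ∈ (toricVariety k Φ).nefCone) :
    ∃ a : Φ.Ray → ℝ, Φ.IsSupported a ∧ Model.cls (toricDivisor k Φ a) = α := by
  obtain ⟨N, r, D, hD, rfl, hnef⟩ := hα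
  let b : Fin N → Φ.Ray → ℝ := fun j => Φ.toricPart k (Model.toRDiv (D j))
  have hcast : ∀ j τ (m : Fin n → ℤ), Φ.IsCharacterOn (D j) τ m →
      ∀ i : Φ.Ray, i.vec ∈ τ → b j i + (fun l => (m l : ℝ)) ⬝ᵥ i.vec = 0 := fun j τ m hm i hi => by
    rw [dotProduct_vec]; exact hm i hi
  have hb : ∀ j, Φ.IsLocallyLinear (b j) := fun j σ hσ => by
    obtain ⟨m, hm⟩ := Φ.toricPart_of_isCartier (hD j) hσ
    exact ⟨_, hcast j σ m hm⟩
  choose ψ hψ using fun j => (hb j).exists_function hcomplete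
  refine ⟨∑ j, r j • b j, ?_, ?_⟩
  · have hsum : ∀ τ ∈ Φ.cones, ∀ M : Fin N → Fin n → ℝ,
        (∀ j, ∀ i : Φ.Ray, i.vec ∈ τ → b j i + M j ⬝ᵥ i.vec = 0) → ∀ i : Φ.Ray, i.vec ∈ τ →
        (∑ j, r j • b j) i + (∑ j, r j • M j) ⬝ᵥ i.vec = 0 := by
      intro τ _ M hM i hi
      rw [Finset.sum_apply, sum_dotProduct, ← Finset.sum_add_distrib]
      refine Finset.sum_eq_zero fun j _ => ?_
      rw [Pi.smul_apply, smul_dotProduct, ← smul_add, hM j i hi, smul_zero]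
    have hex : ∀ τ ∈ Φ.cones, ∃ M : Fin N → Fin n → ℝ,
        ∀ j, ∀ i : Φ.Ray, i.vec ∈ τ → b j i + M j ⬝ᵥ i.vec = 0 := fun τ hτ => by
      choose M hM using fun j => hb j τ hτ
      exact ⟨M, hM⟩
    refine Fan.isSupported_of_eventually hcomplete (ψ := fun w => ∑ j, r j * ψ j w)
      (fun τ hτ => ?_) (fun τ hτ m hm w hw => ?_) fun w v => ?_
    · obtain ⟨M, hM⟩ := hex τ hτ
      exact ⟨_, hsum τ hτ M hM⟩
    · obtain ⟨M, hM⟩ := hex τ hτ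
      rw [Fan.dotProduct_eq_of_isLinear hτ hτ hm (hsum τ hτ M hM) hw hw, sum_dotProduct,
        ← Finset.sum_neg_distrib]
      refine Finset.sum_congr rfl fun j _ => ?_
      rw [hψ j τ hτ (M j) (hM j) w hw, smul_dotProduct, smul_eq_mul, mul_neg]
    · obtain ⟨σ', hσ', hwσ'⟩ := hcomplete w
      obtain ⟨σ, hσ, -, hw⟩ := Φ.exists_relint_cone hσ' hwσ'
      by_cases hv : ∃ u ∈ orthogonalLattice σ, u ⬝ᵥ v ≠ 0
      · obtain ⟨c, hc, d, hd, hcD⟩ := Fan.exists_curve_intersection k hσ hv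
        obtain ⟨e, he, hpos⟩ := hnef c hc
        -- For small `ε` the points `w ± ε v` lie in `τ₁` and `τ₂`, where `ψ j` is linear; its
        -- second difference at `w` is `ε` times `d` times the intersection number.
        have hj : ∀ j, ∀ᶠ ε in 𝓝[>] (0 : ℝ), ψ j (w + ε • latticeVec v) +
            ψ j (w + ε • latticeVec (-v)) = 2 * ψ j w + ε * (d * e j) := by
          intro j
          obtain ⟨τ₁, hτ₁, τ₂, hτ₂, hle₁, hle₂, h1, h2, m₁, m₂, hm₁, hm₂, hde⟩ :=
            hcD (D j) (e j) (hD j) (he j)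
          filter_upwards [Fan.eventually_add_smul_mem hτ₁ hw hle₁ h1,
            Fan.eventually_add_smul_mem (v := -v) hτ₂ hw hle₂ fun u hu hu' => by
              rw [dotProduct_neg]; linarith [h2 u hu hu']] with ε hε₁ hε₂
          have e1 := hψ j τ₁ hτ₁ _ (hcast j τ₁ m₁ hm₁)
          have e2 := hψ j τ₂ hτ₂ _ (hcast j τ₂ m₂ hm₂)
          have e3 := (e1 w (hle₁ hw.1)).symm.trans (e2 w (hle₂ hw.1))
          have e4 : (d : ℝ) * e j = pairing m₂ (latticeVec v) - pairing m₁ (latticeVec v) := by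
            rw [pairing_latticeVec, pairing_latticeVec, ← Int.cast_sub, ← sub_dotProduct, ← hde]
            push_cast; rfl
          rw [e1 _ hε₁, e2 _ hε₂, e4, two_mul]
          nth_rw 1 [e1 w (hle₁ hw.1)]
          rw [e2 w (hle₂ hw.1), latticeVec_neg]
          simp only [← pairing_eq_dotProduct, pairing_add_right, pairing_smul_right,
            pairing_neg_right]
          ring
        filter_upwards [Filter.eventually_all.2 hj, self_mem_nhdsWithin] with ε hε hε0
        rw [← Finset.sum_add_distrib, Finset.mul_sum]
        have e5 : ∑ j, (r j * ψ j (w + ε • latticeVec v) + r j * ψ j (w + ε • latticeVec (-v))) =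
            ∑ j, 2 * (r j * ψ j w) + ε * d * ∑ j, r j * (e j : ℝ) := by
          rw [Finset.mul_sum, ← Finset.sum_add_distrib]
          refine Finset.sum_congr rfl fun j _ => ?_
          rw [← mul_add, hε j]; ring
        rw [e5]
        have : 0 ≤ ε * d * ∑ j, r j * (e j : ℝ) :=
          mul_nonneg (mul_nonneg (le_of_lt hε0) (by exact_mod_cast hd.le)) hpos
        linarith
      -- No character orthogonal to `σ` detects `v`, so `w ± ε v` stay in `σ`, where all the
      -- functions are linear.
      · push Not at hv
        filter_upwards [Fan.eventually_add_smul_mem (v := v) hσ hw le_rfl fun u _ hu =>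
            (hv u hu).ge, Fan.eventually_add_smul_mem (v := -v) hσ hw le_rfl fun u _ hu => by
              rw [dotProduct_neg, hv u hu, neg_zero]] with ε hε₁ hε₂
        rw [← Finset.sum_add_distrib, Finset.mul_sum]
        refine Finset.sum_le_sum fun j _ => ?_
        obtain ⟨m, hm⟩ := hb j σ hσ
        rw [hψ j σ hσ m hm _ hw.1, hψ j σ hσ m hm _ hε₁, hψ j σ hσ m hm _ hε₂, latticeVec_neg,
          dotProduct_add, dotProduct_add, smul_neg, dotProduct_neg]
        linarith
  · have e : ∑ j, r j • b j = Φ.toricPart k (∑ j, r j • Model.toRDiv (D j)) := by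
      simp only [map_sum, map_smul, b]
    rw [e, cls_toricDivisor_toricPart]
    simp only [Model.cls, map_sum, map_smul]

end NefCone

end

noncomputable section

open scoped BigOperators

namespace Model

variable {k K : Type*} [Field k] [Field K] [Algebra k K] {X : Model k K} {c : X.points}

/-! ### Centers of places on projective varieties -/

/-- The ring of the rational functions regular at the point `c` whose restriction to the closure
of `c` is regular at the place `v`. -/
def Place.compositeSubring (v : Place c) : Subring K where
  carrier := {f | f ∈ c.1.toSubring ∧ valueAt c f ∈ v.ring}
  mul_mem' hf hg := ⟨mul_mem hf.1 hg.1, by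
    rw [valueAt_mul hf.1 hg.1]; exact mul_mem hf.2 hg.2⟩
  one_mem' := ⟨one_mem _, by rw [valueAt_one]; exact one_mem _⟩
  add_mem' hf hg := ⟨add_mem hf.1 hg.1, by
    rw [valueAt_add hf.1 hg.1]; exact add_mem hf.2 hg.2⟩
  zero_mem' := ⟨zero_mem _, by rw [valueAt_zero]; exact zero_mem _⟩
  neg_mem' hf := ⟨neg_mem hf.1, by rw [valueAt_neg hf.1]; exact neg_mem hf.2⟩

/-- The local ring of the rational functions regular at the point `c` whose restriction to the
closure of `c` is regular at the place `v`. -/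
def Place.compositeRing (v : Place c) : LocalSubring K where
  toSubring := v.compositeSubring
  isLocalRing := by
    have key : ∀ f (hf : f ∈ c.1.toSubring) (hv : valueAt c f ∈ v.ring),
        IsUnit (⟨valueAt c f, hv⟩ : v.ring) → f⁻¹ ∈ c.1.toSubring ∧ valueAt c f⁻¹ ∈ v.ring := by
      intro f hf hv hu
      have h0 : valueAt c f ≠ 0 := fun e => hu.ne_zero (Subtype.ext e)
      have hf0 : f ≠ 0 := by rintro rfl; exact h0 valueAt_zero
      have hf' := (valueAt_ne_zero hf hf0).1 h0
      refine ⟨hf', ?_⟩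
      rw [valueAt_inv hf hf']
      exact (Subring.isUnit_iff_inv_mem (R := v.ring.toSubring) hv h0).1 hu
    have key' : ∀ f (hf : f ∈ c.1.toSubring) (hv : valueAt c f ∈ v.ring),
        IsUnit (⟨valueAt c f, hv⟩ : v.ring) → f ≠ 0 := by
      rintro f hf hv hu rfl
      exact hu.ne_zero (Subtype.ext valueAt_zero)
    refine IsLocalRing.of_isUnit_or_isUnit_one_sub_self fun a => ?_
    obtain ⟨f, hf⟩ := a
    rcases IsLocalRing.isUnit_or_isUnit_one_sub_self (⟨valueAt c f, hf.2⟩ : v.ring) with h | h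
    · left
      rw [Subring.isUnit_iff_inv_mem hf (key' f hf.1 hf.2 h)]
      exact key f hf.1 hf.2 h
    · right
      have e : valueAt c (1 - f) = 1 - valueAt c f := by
        rw [valueAt_sub (one_mem _) hf.1, valueAt_one]
      have hm : valueAt c (1 - f) ∈ v.ring := by rw [e]; exact sub_mem (one_mem _) hf.2
      have h' : IsUnit (⟨valueAt c (1 - f), hm⟩ : v.ring) := by
        convert h using 1; exact Subtype.ext e
      have hm1 : 1 - f ∈ c.1.toSubring := sub_mem (one_mem _) hf.1
      exact (Subring.isUnit_iff_inv_mem (R := v.compositeSubring) (f := 1 - f) ⟨hm1, hm⟩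
        (key' _ hm1 hm h')).2 (key _ hm1 hm h')

/-- The valuative criterion for the composite of the local ring at `c` with the place `v`: a chart
whose coordinate has the largest value at `v` has its coordinate ring inside the composite ring, and
the center is taken there. -/
lemma IsProjective.exists_isCenter (hX : X.IsProjective) (v : Place c) : ∃ x, v.IsCenter x := by
  obtain ⟨m, f, hf, hpts⟩ := hX
  obtain ⟨_, ⟨i₀, rfl⟩, hloc⟩ := Model.mem_ofCharts_iff.1 (hpts ▸ c.2 :
    c.1 ∈ (ofCharts (Set.range fun i => Algebra.adjoin k (Set.range fun j => f j / f i))).points)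
  have hmem : ∀ j, f j / f i₀ ∈ c.1.toSubring := fun j =>
    hloc.le (Algebra.subset_adjoin ⟨j, rfl⟩)
  obtain ⟨i, hi⟩ := Finite.exists_max fun j => v.ring.valuation (valueAt c (f j / f i₀))
  have hi0 : valueAt c (f i / f i₀) ≠ 0 := by
    intro e
    have h1 := hi i₀
    rw [e, div_self (hf i₀), valueAt_one, map_one, map_zero] at h1
    exact absurd h1 (not_le.2 zero_lt_one)
  have hinv : (f i / f i₀)⁻¹ ∈ c.1.toSubring :=
    (valueAt_ne_zero (hmem i) (div_ne_zero (hf i) (hf i₀))).1 hi0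
  have hmem' : ∀ j, f j / f i ∈ v.compositeRing.toSubring := by
    intro j
    have e : f j / f i = f j / f i₀ * (f i / f i₀)⁻¹ := by
      have := hf i₀
      field_simp
    rw [e]
    refine ⟨mul_mem (hmem j) hinv, ?_⟩
    rw [valueAt_mul (hmem j) hinv, valueAt_inv (hmem i) hinv, ← ValuationSubring.valuation_le_one_iff,
      map_mul, map_inv₀, ← div_eq_mul_inv]
    exact div_le_one_of_le₀ (hi j) zero_le
  have hle : (Algebra.adjoin k (Set.range fun j => f j / f i)).toSubring ≤
      v.compositeRing.toSubring := by
    intro g hg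
    replace hg : g ∈ Algebra.adjoin k (Set.range fun j => f j / f i) := hg
    induction hg using Algebra.adjoin_induction with
    | mem g hg => obtain ⟨j, rfl⟩ := hg; exact hmem' j
    | algebraMap a =>
      exact ⟨X.algebraMap_mem c.1 c.2 a, by rw [valueAt_algebraMap]; exact v.algebraMap_mem a⟩
    | add g g' _ _ hg hg' => exact add_mem hg hg'
    | mul g g' _ _ hg hg' => exact mul_mem hg hg'
  obtain ⟨x, hx, hxR, hxinv⟩ := exists_center hle
  refine ⟨x, ?_, fun g hg => (hxR hg).1, fun r => ⟨(hxR r.2).2, fun hr => ?_⟩⟩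
  · rw [hpts, Model.mem_ofCharts_iff]
    exact ⟨_, ⟨i, rfl⟩, hx⟩
  · obtain ⟨g, hg⟩ := r
    obtain ⟨a, ha, b, hb, hb0, hbx, rfl⟩ := hx.frac g hg
    have hax := hx.le ha
    rw [ValuationSubring.mem_nonunits_iff_or]
    by_contra! hcon
    obtain ⟨hv0, hvinv⟩ := hcon
    have hg0 : a / b ≠ 0 := fun e => hv0 ((congrArg (valueAt c) e).trans valueAt_zero)
    have ha0 : a ≠ 0 := by rintro rfl; simp at hg0
    have hbR' := hxR hbx
    have hginv := (valueAt_ne_zero (hxR hg).1 hg0).1 hv0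
    have hgR : (a / b)⁻¹ ∈ v.compositeRing.toSubring :=
      ⟨hginv, by rw [valueAt_inv (hxR hg).1 hginv]; exact hvinv⟩
    refine hr ?_
    have haR : a⁻¹ ∈ v.compositeRing.toSubring := by
      have e : a⁻¹ = (a / b)⁻¹ * b⁻¹ := by rw [inv_div]; field_simp
      rw [e]; exact mul_mem hgR hbR'
    have hax' := hxinv a ha ha0 haR
    rw [Subring.isUnit_iff_inv_mem hg hg0, inv_div]
    exact div_eq_mul_inv b a ▸ mul_mem (hx.le hb) hax'

end Model

/-! ### Nefness of supported data -/

section NefDivisors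

variable {k : Type*} [Field k] {n : ℕ}

/-- After decomposing into integral supported divisors, the local equations at the curve and at the
center of each place can be taken to be characters. Projectivity supplies the centers, and every
local contribution to the intersection number is nonnegative. -/
lemma Fan.IsSupported.mem_nefCone {Φ : Fan n} (hΦ : (toricVariety k Φ).IsProjective)
    {a : Φ.Ray → ℝ} (ha : Φ.IsSupported a) :
    Model.cls (toricDivisor k Φ a) ∈ (toricVariety k Φ).nefCone := by
  choose m hm using fun σ : Φ.cones => ha σ.1 σ.2
  obtain ⟨N, r, b, M, hr, hab, hsign⟩ := Φ.exists_int_decomposition a m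
  have hnonneg : ∀ s σ i, 0 ≤ b s i + M s σ ⬝ᵥ i.1 := fun s σ i => by
    have h1 := sign_nonneg_iff.2 ((hm σ).1 i)
    rw [← hsign s σ i, sign_nonneg_iff] at h1
    exact_mod_cast h1
  have hzero : ∀ s (σ : Φ.cones) (i : Φ.Ray), i.vec ∈ σ.1 → b s i + M s σ ⬝ᵥ i.1 = 0 :=
    fun s σ i hi => by
      have h1 := hsign s σ i
      rw [(hm σ).2 i hi, sign_zero, sign_eq_zero_iff] at h1
      exact_mod_cast h1
  refine ⟨N + 1, r, fun s => Φ.intDivisor k (b s), fun s =>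
    Φ.isCartier_intDivisor fun σ hσ => ⟨_, hzero s ⟨σ, hσ⟩⟩, ?_, fun c _ => ?_⟩
  · rw [show a = fun i => ∑ s, r s * (b s i : ℝ) from funext hab,
      Φ.toricDivisor_sum Finset.univ r fun s i => (b s i : ℝ)]
    simp only [Fan.toRDiv_intDivisor, Model.cls, map_sum, map_smul]
  · obtain ⟨σ, hσ, hcσ⟩ := mem_toricVariety_iff.1 c.2
    choose x hx using fun v : Model.Place c => hΦ.exists_isCenter v
    choose τ hτ hxτ using fun v => mem_toricVariety_iff.1 (hx v).1
    refine ⟨_, fun s => ⟨chi k (-M s ⟨σ, hσ⟩), fun v => chi k (-M s ⟨τ v, hτ v⟩),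
      Φ.isLocalEquation_intDivisor hσ (hzero s ⟨σ, hσ⟩) hcσ,
      fun v => ⟨x v, hx v, Φ.isLocalEquation_intDivisor (hτ v) (hzero s ⟨τ v, hτ v⟩) (hxτ v)⟩,
      rfl⟩, Finset.sum_nonneg fun s _ => mul_nonneg (hr s) (Int.cast_nonneg
        (finsum_nonneg fun v => mul_nonneg (Int.natCast_nonneg _) (ordAlong_nonneg_of_mem ?_)))⟩
    rw [← chi_sub]
    -- On the rays of `τ v` the functional of `τ v` gives equality and that of `σ` an inequality, so
    -- the difference lies in the dual semigroup of `τ v`.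
    have hmem : chi k (-M s ⟨τ v, hτ v⟩ - -M s ⟨σ, hσ⟩) ∈ (x v).toSubring := by
      refine (hxτ v).le (chi_mem_coneAlgebra.2 ((Φ.mem_dualSemigroup_iff (hτ v)).2 fun i hi => ?_))
      have h1 := hnonneg s ⟨σ, hσ⟩ i
      have h2 := hzero s ⟨τ v, hτ v⟩ i hi
      rw [sub_dotProduct, neg_dotProduct, neg_dotProduct]
      linarith
    exact ((hx v).2.2 ⟨_, hmem⟩).1

end NefDivisors

end

noncomputable section

open scoped BigOperators

section Extensions

variable {k : Type*} [Field k] {n : ℕ}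

/-! ### Restriction of divisors and extension of convex data -/

/-- A ray of a subfan as a ray of the fan. -/
def Fan.Ray.incl {Δ Φ : Fan n} (h : Δ.cones ⊆ Φ.cones) (i : Δ.Ray) : Φ.Ray :=
  ⟨i.1, i.2.1, h i.2.2⟩

lemma Fan.pullback_cls_toricDivisor {Δ Φ : Fan n} (h : Δ.cones ⊆ Φ.cones) (a : Φ.Ray → ℝ) :
    Model.pullback (toricVariety_mono k h) (Model.cls (toricDivisor k Φ a)) =
      Model.cls (toricDivisor k Δ fun i => a (i.incl h)) := by
  have e : Model.restrictDiv (toricVariety_mono k h) (toricDivisor k Φ a) =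
      toricDivisor k Δ fun i => a (i.incl h) := by
    refine Finsupp.ext fun P => ?_
    change toricDivisor k Φ a (Model.PrimeDivisor.incl _ P) = _
    rcases Δ.primeDivisor_cases P with ⟨i, rfl⟩ | ⟨p, hp, rfl⟩
    · have e1 : Model.PrimeDivisor.incl (toricVariety_mono k h) (Δ.primeDiv k i) =
          Φ.primeDiv k (i.incl h) := rfl
      rw [e1, Fan.toricDivisor_primeDiv, Fan.toricDivisor_primeDiv]
    · have e1 : Model.PrimeDivisor.incl (toricVariety_mono k h) (Δ.torusDiv p hp) =
          Φ.torusDiv p hp := rfl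
      rw [e1, Fan.toricDivisor_torusDiv, Fan.toricDivisor_torusDiv]
  rw [← e]
  rfl

lemma Fan.IsSupported.restrict {Δ Φ : Fan n} (h : Δ.cones ⊆ Φ.cones) {a : Φ.Ray → ℝ}
    (ha : Φ.IsSupported a) : Δ.IsSupported fun i => a (i.incl h) := fun σ hσ => by
  obtain ⟨m, h1, h2⟩ := ha σ (h hσ)
  exact ⟨m, fun i => h1 (i.incl h), fun i => h2 (i.incl h)⟩

/-- Projectivity makes `Φ` complete, so the nef class is given by supported coefficients; the
inequalities survive restriction to fewer rays and cones. -/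
lemma Fan.exists_isSupported_of_mem_pullback_nefCone {Δ Φ : Fan n}
    (hΦ : (toricVariety k Φ).IsProjective) (h : Δ.cones ⊆ Φ.cones) {α : (toricVariety k Δ).ClR}
    (hα : α ∈ Model.pullback (toricVariety_mono k h) '' (toricVariety k Φ).nefCone) :
    ∃ a : Δ.Ray → ℝ, Δ.IsSupported a ∧ Model.cls (toricDivisor k Δ a) = α := by
  obtain ⟨β, hβ, rfl⟩ := hα
  obtain ⟨m, F, hF⟩ := exists_isCoordinates hΦ
  obtain ⟨a, ha, rfl⟩ := Fan.exists_isSupported_of_mem_nefCone hF.exists_cone hβ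
  exact ⟨_, ha.restrict h, (Fan.pullback_cls_toricDivisor h a).symm⟩

/-- Convex data on a subfan of a projective fan extend to nef data on a projective fan whose rays
lie in a prescribed positively spanning set of primitive vectors. -/
lemma Fan.IsSupported.exists_mem_pullback_nefCone {Δ Φ₀ : Fan n}
    (hΦ₀ : (toricVariety k Φ₀).IsProjective) (h₀ : Δ.cones ⊆ Φ₀.cones) {a : Δ.Ray → ℝ}
    (ha : Δ.IsSupported a) {V : Finset (Fin n → ℤ)} (hprim : ∀ v ∈ V, IsPrimitive v)
    (hV : ∀ w, w ∈ PointedCone.hull ℝ (latticeVec '' (V : Set (Fin n → ℤ))))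
    (hΔV : ∀ v, Δ.IsRay v → v ∈ V)
    (hVΔ : ∀ v ∈ V, ∀ δ ∈ Δ.cones, latticeVec v ∈ δ → Δ.IsRay v) :
    ∃ (Φ : Fan n) (_ : (toricVariety k Φ).IsProjective) (h : Δ.cones ⊆ Φ.cones),
      (∀ v, Φ.IsRay v → v ∈ V) ∧ Model.cls (toricDivisor k Δ a) ∈
        Model.pullback (toricVariety_mono k h) '' (toricVariety k Φ).nefCone := by
  classical
  have := Δ.finite.fintype
  have : Nonempty Δ.cones := Δ.nonempty.to_subtype
  obtain ⟨N, F, hF⟩ := exists_isCoordinates hΦ₀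
  choose m hm hm0 using fun δ : Δ.cones => ha δ.1 δ.2
  -- The convex function attached to `a`, evaluated on all of `V`; it extends `a` from the rays of
  -- `Δ`.
  let a' : (Fin n → ℤ) → ℝ := fun v =>
    Finset.univ.sup' Finset.univ_nonempty fun δ : Δ.cones => -m δ ⬝ᵥ latticeVec v
  have hle : ∀ δ v, -m δ ⬝ᵥ latticeVec v ≤ a' v := fun δ v =>
    Finset.le_sup' (fun δ : Δ.cones => -m δ ⬝ᵥ latticeVec v) (Finset.mem_univ δ)
  have ha'le : ∀ i : Δ.Ray, a' i.1 ≤ a i := fun i => Finset.sup'_le _ _ fun δ _ => by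
    have h1 := hm δ i
    rw [neg_dotProduct, ← Fan.Ray.vec]
    linarith
  have heq : ∀ (δ : Δ.cones) (i : Δ.Ray), i.vec ∈ δ.1 → -m δ ⬝ᵥ latticeVec i.1 = a i :=
    fun δ i hi => by
      have h1 := hm0 δ i hi
      rw [neg_dotProduct, ← Fan.Ray.vec]
      linarith
  have ha' : ∀ i : Δ.Ray, a' i.1 = a i := fun i =>
    le_antisymm (ha'le i) ((heq ⟨_, i.2.2⟩ i (Fan.rayCone_vec_mem i)).symm.trans_le (hle _ _))
  -- The perturbing function is the strictly convex `-minOrd` of the given projective fan `Φ₀`.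
  -- Vectors of `V` in cones of `Δ` are rays of `Δ`, so `a'` is linear where required.
  obtain ⟨Φ, hΦ, hproj, hrays, hsupp⟩ := exists_projective_fan k hprim hV (a := a')
    (h := fun v => -(IsCoordinates.minOrd F v : ℝ)) hΔV
    (fun δ hδ => ⟨-m ⟨δ, hδ⟩, fun v hv => ⟨hle _ v, fun hvδ =>
      (heq ⟨δ, hδ⟩ ⟨v, hVΔ v hv δ hδ hvδ⟩ hvδ).trans (ha' ⟨v, hVΔ v hv δ hδ hvδ⟩).symm⟩⟩)
    fun δ hδ => by
      obtain ⟨b, hb⟩ := hF.exists_strictly_supporting (h₀ hδ)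
      exact ⟨b, fun v _ => hb v⟩
  refine ⟨Φ, hproj, hΦ, hrays, Model.cls (toricDivisor k Φ fun i => a' i.1), ?_, ?_⟩
  · refine Fan.IsSupported.mem_nefCone hproj fun σ hσ => ?_
    obtain ⟨l, hl, hl'⟩ := hsupp σ hσ
    refine ⟨-l, fun i => ?_, fun i hi => ?_⟩
    · rw [neg_dotProduct, ← sub_eq_add_neg]
      exact sub_nonneg.2 (hl i.1 (hrays i.1 i.2))
    · rw [neg_dotProduct, ← sub_eq_add_neg]
      exact sub_eq_zero.2 (hl' i.1 i.2 hi).symm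
  · exact (Fan.pullback_cls_toricDivisor hΦ _).trans
      (congrArg (fun b => Model.cls (toricDivisor k Δ b)) (funext ha'))

/-- A ray of `Φ` contained in a cone of `Δ` is its own intersection with that cone, hence a face of
it. -/
lemma Fan.isRay_of_mem_subfan {Δ Φ : Fan n} (h : Δ.cones ⊆ Φ.cones) {v : Fin n → ℤ}
    (hv : Φ.IsRay v) {δ} (hδ : δ ∈ Δ.cones) (hvδ : latticeVec v ∈ δ) : Δ.IsRay v := by
  refine ⟨hv.1, Δ.face_mem δ hδ _ ?_⟩
  have hle : rayCone v ≤ δ := Submodule.span_le.2 (Set.singleton_subset_iff.2 hvδ)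
  have := Φ.inter_face δ (h hδ) _ hv.2
  rwa [inf_eq_right.2 hle] at this

end Extensions

/-! ### The equivalences -/

theorem proposition2p3 (k : Type*) [Field k] {n : ℕ} (Δ : Fan n) (a : Δ.Ray → ℝ)
    (hD : Model.cls (toricDivisor k Δ a) ∈ (toricVariety k Δ).PicR) :
    List.TFAE [
      Model.cls (toricDivisor k Δ a) ∈ (toricVariety k Δ).ggCone,
      ∀ σ ∈ Δ.cones, Model.cls (toricDivisor k Δ a) ∈
        PointedCone.hull ℝ {α | ∃ i : Δ.Ray, i.vec ∉ σ ∧ α = Model.cls (rayDivisor k Δ i)},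
      ∃ ψ : (Fin n → ℝ) → ℝ, IsPiecewiseLinear ψ ∧ IsConvexFun ψ ∧
        (∀ σ ∈ Δ.cones, IsLinearOn ψ σ) ∧ ∀ i : Δ.Ray, ψ i.vec = a i] ∧
    ((∃ Φ : Fan n, Δ.cones ⊆ Φ.cones ∧ (toricVariety k Φ).IsProjective) →
      (Model.cls (toricDivisor k Δ a) ∈ (toricVariety k Δ).ggCone ↔
        Model.cls (toricDivisor k Δ a) ∈
          ⋃ (Φ : Fan n) (_ : (toricVariety k Φ).IsProjective) (h : Δ.cones ⊆ Φ.cones),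
            Model.pullback (toricVariety_mono k h) '' (toricVariety k Φ).nefCone) ∧
      (PointedCone.hull ℝ (Set.range (Fan.Ray.vec (Δ := Δ))) = ⊤ →
        (⋃ (Φ : Fan n) (_ : (toricVariety k Φ).IsProjective) (h : Δ.cones ⊆ Φ.cones),
            Model.pullback (toricVariety_mono k h) '' (toricVariety k Φ).nefCone) =
          ⋃ (Φ : Fan n) (_ : (toricVariety k Φ).IsProjective) (h : Δ.cones ⊆ Φ.cones)
              (_ : ∀ v, Φ.IsRay v ↔ Δ.IsRay v),
            Model.pullback (toricVariety_mono k h) '' (toricVariety k Φ).nefCone)) := by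

  have hiff : Model.cls (toricDivisor k Δ a) ∈ (toricVariety k Δ).ggCone ↔ Δ.IsSupported a :=
    (Δ.isSupported_iff_mem_ggCone k).symm
  refine ⟨?_, fun ⟨Φ₀, h₀, hΦ₀⟩ => ⟨?_, fun hspan => Set.Subset.antisymm ?_ ?_⟩⟩
  · tfae_have 1 ↔ 2 := hiff.trans (Δ.isSupported_iff_mem_hull k)
    tfae_have 1 ↔ 3 := hiff.trans (Δ.isSupported_iff_exists_convex)
    tfae_finish
  · simp only [Set.mem_iUnion]
    refine ⟨fun hgg => ?_, fun ⟨Φ, hΦ, h, hα⟩ => ?_⟩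
    · classical
      obtain ⟨N, F, hF⟩ := exists_isCoordinates hΦ₀
      -- Here `V` consists of the rays of the given projective fan, which span positively by
      -- completeness.
      obtain ⟨Φ, hΦ, h, -, hα⟩ := (hiff.1 hgg).exists_mem_pullback_nefCone hΦ₀ h₀
        (V := Finset.univ.image fun i : Φ₀.Ray => i.1)
        (fun v hv => by
          obtain ⟨i, -, rfl⟩ := Finset.mem_image.1 hv
          exact i.2.1)
        (fun w => by
          obtain ⟨σ, hσ, hw⟩ := hF.exists_cone w
          obtain ⟨c, hc, -, rfl⟩ := (Φ₀.mem_cone_iff hσ).1 hw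
          refine Submodule.sum_mem _ fun i _ => PointedCone.smul_mem _ (hc i)
            (Submodule.subset_span ⟨i.1, ?_, rfl⟩)
          exact Finset.mem_coe.2 (Finset.mem_image_of_mem _ (Finset.mem_univ i)))
        (fun v hv => Finset.mem_image.2 ⟨⟨v, hv.1, h₀ hv.2⟩, Finset.mem_univ _, rfl⟩)
        (fun v hv δ hδ hvδ => by
          obtain ⟨i, -, rfl⟩ := Finset.mem_image.1 hv
          exact Fan.isRay_of_mem_subfan h₀ i.2 hδ hvδ)
      exact ⟨Φ, hΦ, h, hα⟩
    · obtain ⟨b, hb, e⟩ := Fan.exists_isSupported_of_mem_pullback_nefCone hΦ h hα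
      rw [← e]
      exact (Δ.isSupported_iff_mem_ggCone k).1 hb
  · classical
    intro α hα
    simp only [Set.mem_iUnion] at hα ⊢
    obtain ⟨Φ, hΦ, h, hα⟩ := hα
    obtain ⟨b, hb, rfl⟩ := Fan.exists_isSupported_of_mem_pullback_nefCone hΦ h hα
    have hmem : ∀ v, v ∈ Finset.univ.image (fun i : Δ.Ray => i.1) ↔ Δ.IsRay v := fun v =>
      ⟨fun hv => by
        obtain ⟨i, -, rfl⟩ := Finset.mem_image.1 hv
        exact i.2, fun hv => Finset.mem_image.2 ⟨⟨v, hv⟩, Finset.mem_univ _, rfl⟩⟩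
    -- Since the rays of `Δ` already span positively, they can serve as `V`, and the new projective
    -- fan has no further rays.
    obtain ⟨Ψ, hΨ, h', hrays, hα'⟩ := hb.exists_mem_pullback_nefCone hΦ h
      (V := Finset.univ.image fun i : Δ.Ray => i.1) (fun v hv => ((hmem v).1 hv).1)
      (fun w => by
        have hw : w ∈ PointedCone.hull ℝ (Set.range (Fan.Ray.vec (Δ := Δ))) := by
          rw [hspan]; trivial
        refine Submodule.span_mono ?_ hw
        rintro _ ⟨i, rfl⟩
        exact ⟨i.1, Finset.mem_coe.2 ((hmem _).2 i.2), rfl⟩)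
      (fun v hv => (hmem v).2 hv) (fun v hv _ _ _ => (hmem v).1 hv)
    exact ⟨Ψ, hΨ, h', fun v => ⟨fun hv => (hmem v).1 (hrays v hv), fun hv => ⟨hv.1, h' hv.2⟩⟩, hα'⟩
  · intro α hα
    simp only [Set.mem_iUnion] at hα ⊢
    obtain ⟨Φ, hΦ, h, -, hα⟩ := hα
    exact ⟨Φ, hΦ, h, hα⟩

end
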